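/- **Notation.** Let $(W,S)$ be a Coxeter system with $S$ finite, and let $\bar S$ be the set of $W$-conjugacy classes of elements of $S$ (so $\omega\in\bar S$ is a class of simple reflections). Let $\Gamma$ be a totally ordered abelian group and $\varphi:\bar S\to\Gamma$ any map. Let $\mathcal H=\mathcal H(W,S,\varphi)$ be the Hecke algebra over $\mathbb Z[\Gamma]=\bigoplus_\gamma\mathbb Z e^\gamma$, with basis $(T_w)_{w\in W}$, $T_xT_y=T_{xy}$ if $\ell(xy)=\ell(x)+\ell(y)$, and $(T_s-e^{\varphi(s)})(T_s+e^{-\varphi(s)})=0$. Let $C_w$ be the unique element invariant under the bar involution ($e^\gamma\mapsto e^{-\gamma}$, $T_w\mapsto T_{w^{-1}}^{-1}$) with $C_w\equiv T_w$ modulo $\bigoplus_x\mathbb Z[\Gamma_{<0}]T_x$. For $?\in\{L,R,LR\}$, let $\leqslant_?^\varphi$ be the transitive closure of the relation "$C_x$ occurs with non-zero coefficient in some $hC_y$ ($?=L$), in some $C_yh$ ($?=R$), in some $hC_y$ or some $C_yh$ ($?=LR$), $h\in\mathcal H$". Let $\sim_?^\varphi$ be the associated equivalence relation; its classes are the left,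 right, two-sided cells. For a cell $C$, let $M_C^{?,\varphi}$ be the quotient of $\bigoplus_{w\leqslant C}\mathbb Z[\Gamma]C_w$ by $\bigoplus_{w<C}\mathbb Z[\Gamma]C_w$, and $\mathbb ZM_C^{?,\varphi}=\mathbb Z\otimes_{\mathbb Z[\Gamma]}M_C^{?,\varphi}$ (with $e^\gamma\mapsto1$), a left module, right module or bimodule over $\mathbb ZW$ according to $?$. A positive subset of an abelian group $\Lambda$ is a subset $X$ with $X\cup(-X)=\Lambda$, $X+X\subseteq X$ and $X\cap(-X)$ a subgroup. Then $\Gamma_X=\Lambda/(X\cap(-X))$ is totally ordered, its non-negative elements being the images of the elements of $X$. The set $\mathcal Pos(\Lambda)$ of positive subsets has the topology with basis the sets $\{X: X\cap E=\varnothing\}$, $E\subseteq\Lambda$ finite. For $\lambda\neq0$ put $\mathcal H_\lambda=\{X:\lambda\in X\cap(-X)\}$, a rational hyperplane; its two sides are the sets of $X$ not containing $\lambda$, resp. $-\lambda$. An arrangement is a finite set $\mathfrak A$ of rational hyperplanes; its facets are the classes of the relation "for every $H\in\mathfrak A$, $X$ and $Y$ both lie in $H$ or lie strictly on the same side of $H$",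 and its chambers are the facets meeting no $H\in\mathfrak A$. Take $\Lambda=\mathbb Z[\bar S]$, the free abelian group on $\bar S$. The arrangement is complete if it contains $\mathcal H_\omega$ for all $\omega\in\bar S$. For $X\in\mathcal Pos(\mathbb Z[\bar S])$ let $\varphi_X:\bar S\to\Gamma_X$ be the canonical map, and write $X$ in place of $\varphi_X$ in the notation above. For $\varphi:\bar S\to\Gamma$, let $\operatorname{Pos}(\varphi)$ be the set of elements of $\mathbb Z[\bar S]$ whose image under the linear extension of $\varphi$ is $\geqslant0$. For $\omega\in\bar S$ let $W_\omega=\langle\omega\rangle$, and for a facet $\mathcal F$ let $W_{\mathcal F}$ be the subgroup generated by the $\omega\in\bar S$ with $\mathcal F\subseteq\mathcal H_\omega$. *Conjecture A for $\mathfrak A$*: for every $?\in\{L,R,LR\}$ and every $\mathfrak A$-facet $\mathcal F$: (a) the relation $\sim_?^X$ is the same for all $X\in\mathcal F$ (call it $\sim_?^{\mathcal F}$); (b) the cells for $\sim_?^{\mathcal F}$ are the minimal non-empty subsets $C\subseteq W$ such that $C$ is a union of cells for $\sim_?^{\mathcal C}$ for every chamber $\mathcal C$ with $\mathcal F\subseteq\overline{\mathcal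 C}$, and $C$ is stable under translation by $W_{\mathcal F}$ (on the left if $?=L$, on the right if $?=R$, on both sides if $?=LR$). *Conjecture A* says that some complete arrangement has this property. The set of *essential hyperplanes* is the smallest (for inclusion) complete arrangement with this property. *Conjecture B*: let $\mathfrak A$ be the set of essential hyperplanes. For all $?$, all $X\in\mathcal Pos(\mathbb Z[\bar S])$, every cell $C$ for $\sim_?^X$, every $\mathfrak A$-chamber $\mathcal C$ with $X\in\overline{\mathcal C}$ and every $Y\in\mathcal C$, let $(C_i)_{i\in I}$ be the cells for $\sim_?^Y$ contained in $C$. Then there are $d$ and a partition $I=I_1\,\dot\cup\cdots\dot\cup\,I_d$ such that: (a) if $i\in I_k$, $j\in I_l$ and $C_i\leqslant_?^YC_j$, then $k\leqslant l$; (b) the module $\mathbb ZM_C^{?,X}$ has a filtration $0=M_0\subseteq M_1\subseteq\cdots\subseteq M_d=\mathbb ZM_C^{?,X}$ by submodules with $M_k/M_{k-1}\simeq\bigoplus_{i\in I_k}\mathbb ZM_{C_i}^{?,Y}$ for all $k$. *Conjecture A″ for $\bar S=\{\omega_1,\omega_2\}$, $\omega_1\ne\omega_2$, and rational numbers $0<r_1<\dots<r_n$*: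 put $r_0=0$, $r_{n+1}=\infty$. Let $\mathcal C_i$ be the set of $X$ with $a=\varphi_X(\omega_1)>0$ and $r_ia<b<r_{i+1}a$, where $b=\varphi_X(\omega_2)$. Let $X_q^+=\{\lambda\omega_1+\mu\omega_2:\lambda+q\mu\geqslant0\}$ for $q\in\mathbb Q$ and $X_\infty^+=\{\lambda\omega_1+\mu\omega_2:\mu\geqslant0\}$. Then for all $?$: (a) for $0\leqslant i\leqslant n$, the relation $\sim_?^\varphi$ is the same for all $\varphi$ with $\operatorname{Pos}(\varphi)\in\mathcal C_i$ (call it $\sim_?^{\mathcal C_i}$), for all totally ordered abelian groups $\Gamma$; (b) for $1\leqslant i\leqslant n$, $\sim_?^{X_{r_i}^+}$ is generated by $\sim_?^{\mathcal C_{i-1}}$ and $\sim_?^{\mathcal C_i}$; (c) $\sim_?^{X_0^+}$ is generated by $\sim_?^{\mathcal C_0}$ and (left, right or two-sided) translation by $W_{\omega_2}$; (d) $\sim_?^{X_\infty^+}$ is generated by $\sim_?^{\mathcal C_n}$ and translation by $W_{\omega_1}$. **Proposition.** Let $(W,S)$ be a Coxeter system with $S=\{s,t\}$, $s\neq t$,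 such that $st$ has finite even order $2m$ with $m\geqslant2$ (so that $\bar S$ is identified with $S$). Then: 1. Conjecture A holds for $(W,S)$; 2. the essential hyperplanes of $(W,S)$ are exactly $\mathcal H_s$, $\mathcal H_t$, $\mathcal H_{s-t}$ and $\mathcal H_{s+t}$; 3. Conjecture B holds for $(W,S)$; 4. Conjecture A″ holds for $\omega_1=s$, $\omega_2=t$ with $n=1$ and $r_1=1$. -/

import Mathlib

universe u v w

noncomputable section

namespace KLCell

set_option linter.unusedSectionVars false

variable {B : Type u} {W : Type v} [Group W] {M : CoxeterMatrix B} (cs : CoxeterSystem M W)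

/-! ### The exchange property -/

open Classical in
/-- The generator `i` acting on pairs (element of `W`, sign in `ZMod 2`). -/
def reflAct (i : B) : Function.End (W × ZMod 2) :=
  fun p => (cs.simple i * p.1 * cs.simple i, p.2 + if p.1 = cs.simple i then 1 else 0)

open Classical in
theorem reflAct_pow (i j : B) (n : ℕ) (t : W) (e : ZMod 2) :
    ((reflAct cs i * reflAct cs j) ^ n) (t, e) =
      ((cs.simple i * cs.simple j) ^ n * t * ((cs.simple i * cs.simple j) ^ n)⁻¹,
        e + ∑ r ∈ Finset.range (2 * n),
          if t = ((cs.simple i * cs.simple j) ^ r)⁻¹ * cs.simple j then 1 else 0) := by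
  induction n with
  | zero => simp only [pow_zero]; change (t, e) = _; simp
  | succ n ih =>
    set c := cs.simple i * cs.simple j with hc
    have hci : c⁻¹ = cs.simple j * cs.simple i := by simp [hc]
    have hjc : ∀ k : ℕ, cs.simple j * c ^ k = (c ^ k)⁻¹ * cs.simple j := by
      intro k
      induction k with
      | zero => simp
      | succ k ihk =>
        have : cs.simple j * c = c⁻¹ * cs.simple j := by rw [hci, hc]; simp [mul_assoc]
        rw [pow_succ, ← mul_assoc, ihk, mul_assoc, this, ← mul_assoc, ← mul_inv_rev,
          ← pow_succ', ← pow_succ]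
    have e1 : (c ^ n * t * (c ^ n)⁻¹ = cs.simple j) ↔ t = (c ^ (2 * n))⁻¹ * cs.simple j := by
      rw [mul_inv_eq_iff_eq_mul, hjc, ← eq_inv_mul_iff_mul_eq, two_mul, pow_add, mul_inv_rev,
        mul_assoc]
    have e2 : (cs.simple j * (c ^ n * t * (c ^ n)⁻¹) * cs.simple j = cs.simple i) ↔
        t = (c ^ (2 * n + 1))⁻¹ * cs.simple j := by
      have h1 : (cs.simple j * (c ^ n * t * (c ^ n)⁻¹) * cs.simple j = cs.simple i) ↔
          (c ^ n * t * (c ^ n)⁻¹ = c⁻¹ * cs.simple j) := by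
        rw [hci]
        constructor
        · intro h
          rw [← h]; simp [mul_assoc]
        · intro h
          rw [h]; simp [mul_assoc]
      rw [h1, mul_inv_eq_iff_eq_mul, mul_assoc, hjc, ← eq_inv_mul_iff_mul_eq]
      have : (c ^ (2 * n + 1))⁻¹ = (c ^ n)⁻¹ * (c⁻¹ * (c ^ n)⁻¹) := by
        rw [← mul_inv_rev, ← mul_inv_rev, ← pow_succ, ← pow_add]; congr 2; ring
      rw [this]; simp only [mul_assoc]
    rw [pow_succ']
    change (reflAct cs i) ((reflAct cs j) (((reflAct cs i * reflAct cs j) ^ n) (t, e))) = _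
    rw [ih]
    simp only [reflAct]
    rw [Prod.mk.injEq]
    constructor
    · rw [pow_succ', mul_inv_rev, hci, hc]; simp only [mul_assoc]
    · rw [show 2 * (n + 1) = 2 * n + 1 + 1 by ring, Finset.sum_range_succ, Finset.sum_range_succ]
      simp only [e1, e2, add_assoc]

open Classical in
theorem reflAct_liftable : M.IsLiftable (reflAct cs) := by
  intro i j
  funext ⟨t, e⟩
  rw [reflAct_pow]
  have hp := cs.simple_mul_simple_pow i j
  have : (∑ r ∈ Finset.range (2 * M i j),
      if t = ((cs.simple i * cs.simple j) ^ r)⁻¹ * cs.simple j then (1 : ZMod 2) else 0) = 0 := by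
    rw [two_mul, Finset.sum_range_add]
    simp only [pow_add, hp, one_mul]
    exact CharTwo.add_self_eq_zero _
  rw [hp, this]
  change _ = (t, e)
  simp

/-- The sign action of `W`. -/
def reflHom : W →* Function.End (W × ZMod 2) := cs.lift ⟨reflAct cs, reflAct_liftable cs⟩

theorem reflHom_simple (i : B) : reflHom cs (cs.simple i) = reflAct cs i :=
  cs.lift_apply_simple (reflAct_liftable cs) i

open Classical in
theorem reflHom_wordProd (ω : List B) (t : W) (e : ZMod 2) :
    reflHom cs (cs.wordProd ω) (t, e) =
      (cs.wordProd ω * t * (cs.wordProd ω)⁻¹, e + (cs.rightInvSeq ω).count t) := by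
  induction ω generalizing t e with
  | nil =>
    rw [cs.wordProd_nil, map_one]
    change (t, e) = _
    simp
  | cons i ω ih =>
    rw [cs.wordProd_cons, map_mul, reflHom_simple]
    change reflAct cs i (reflHom cs (cs.wordProd ω) (t, e)) = _
    rw [ih]
    simp only [reflAct, CoxeterSystem.rightInvSeq, List.count_cons, Prod.mk.injEq]
    constructor
    · simp [mul_assoc]
    · have : (cs.wordProd ω * t * (cs.wordProd ω)⁻¹ = cs.simple i) ↔
          ((cs.wordProd ω)⁻¹ * cs.simple i * cs.wordProd ω == t) = true := by
        rw [beq_iff_eq, mul_inv_eq_iff_eq_mul, mul_assoc, inv_mul_eq_iff_eq_mul, eq_comm]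
      rw [Nat.cast_add, add_assoc]
      by_cases h : cs.wordProd ω * t * (cs.wordProd ω)⁻¹ = cs.simple i
      · simp [h, this.1 h]
      · rw [if_neg h, if_neg (fun h' => h (this.2 h'))]; simp

theorem simple_mem_rightInvSeq {ω : List B} {i : B}
    (h : cs.length (cs.wordProd ω * cs.simple i) < cs.length (cs.wordProd ω)) :
    cs.simple i ∈ cs.rightInvSeq ω := by
  classical
  obtain ⟨ω', hω', hw⟩ := cs.exists_isReduced (cs.wordProd ω * cs.simple i)
  have hw' : cs.wordProd ω = cs.wordProd (ω'.concat i) := by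
    rw [cs.wordProd_concat, ← hw]; simp
  have key := congrArg Prod.snd ((reflHom_wordProd cs ω (cs.simple i) 0).symm.trans
    ((by rw [hw'] : reflHom cs (cs.wordProd ω) (cs.simple i, 0) =
      reflHom cs (cs.wordProd (ω'.concat i)) (cs.simple i, 0)).trans
      (reflHom_wordProd cs (ω'.concat i) (cs.simple i) 0)))
  have hnot : cs.simple i ∉ cs.rightInvSeq ω' := by
    intro hmem
    have h2 := (cs.isRightInversion_of_mem_rightInvSeq hω' hmem).2
    rw [← hw] at h2
    simp only [CoxeterSystem.simple_mul_simple_cancel_right] at h2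
    omega
  have hc : (cs.rightInvSeq (ω'.concat i)).count (cs.simple i) = 1 := by
    rw [cs.rightInvSeq_concat, List.concat_eq_append, List.count_append]
    have : List.count (cs.simple i)
        (List.map (⇑(MulAut.conj (cs.simple i))) (cs.rightInvSeq ω')) = 0 := by
      rw [List.count_eq_zero]
      intro hm
      obtain ⟨x, hx, hxe⟩ := List.mem_map.1 hm
      apply hnot
      have : x = cs.simple i := by
        rw [MulAut.conj_apply, mul_inv_eq_iff_eq_mul] at hxe
        exact mul_left_cancel hxe
      exact this ▸ hx
    rw [this]; simp
  rw [hc] at key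
  by_contra hn
  rw [List.count_eq_zero.2 hn] at key
  simp at key

/-- If `ℓ(s w t) = ℓ(w)` and `ℓ(s w) = ℓ(w t)` then `s w = w t`. -/
theorem simple_mul_eq_mul_simple (i j : B) (w : W)
    (h1 : cs.length (cs.simple i * w * cs.simple j) = cs.length w)
    (h2 : cs.length (cs.simple i * w) = cs.length (w * cs.simple j)) :
    cs.simple i * w = w * cs.simple j := by
  have main : ∀ w : W, cs.length (cs.simple i * w * cs.simple j) = cs.length w →
      cs.length (cs.simple i * w) = cs.length w + 1 →
      cs.length (w * cs.simple j) = cs.length w + 1 → cs.simple i * w = w * cs.simple j := by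
    intro w h1 h2 h7
    obtain ⟨ω, hω, rfl⟩ := cs.exists_isReduced w
    have hm : cs.simple j ∈ cs.rightInvSeq (i :: ω) := by
      apply simple_mem_rightInvSeq
      rw [cs.wordProd_cons, h1, h2]; omega
    rw [CoxeterSystem.rightInvSeq, List.mem_cons] at hm
    rcases hm with hm | hm
    · rw [hm]; simp [mul_assoc]
    · have h3 := (cs.isRightInversion_of_mem_rightInvSeq hω hm).2
      omega
  rcases cs.length_simple_mul w i with h | h
  · exact main w h1 h (h2 ▸ h)
  · have := main (w * cs.simple j) (by simp [← mul_assoc, h2])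
      (by rw [← mul_assoc, h1, ← h2]; omega) (by simp; omega)
    simp only [← mul_assoc, CoxeterSystem.simple_mul_simple_cancel_right] at this
    simpa using congrArg (· * cs.simple j) this


/-! ### Conjugacy classes of simple reflections and Hecke algebras -/

/-- Two generators are equivalent if they are conjugate in `W`. -/
def simpleConj : Setoid B where
  r i j := IsConj (cs.simple i) (cs.simple j)
  iseqv := ⟨fun _ => IsConj.refl _, fun h => h.symm, fun h h' => h.trans h'⟩

/-- The set `S̄` of conjugacy classes of simple reflections. -/
def SBar : Type u := Quotient (simpleConj cs)

/-- The class of a simple reflection. -/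
def cls (i : B) : SBar cs := Quotient.mk (simpleConj cs) i

theorem cls_eq {i j : B} (w : W) (h : cs.simple i * w = w * cs.simple j) : cls cs i = cls cs j := by
  refine Quotient.sound (s := simpleConj cs) (IsConj.symm (isConj_iff.2 ⟨w, ?_⟩))
  rw [← h]; simp

variable {Γ : Type w} [AddCommGroup Γ]

/-- The group ring `ℤ[Γ]`; `AddMonoidAlgebra.single γ 1` is the element `e^γ`. -/
abbrev GrpRing (Γ : Type w) [AddCommGroup Γ] : Type w := AddMonoidAlgebra ℤ Γ

/-- `e^γ`. -/
def expo (γ : Γ) : GrpRing Γ := AddMonoidAlgebra.single γ 1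

theorem expo_mul (γ δ : Γ) : expo γ * expo δ = expo (γ + δ) := by
  simp [expo, AddMonoidAlgebra.single_mul_single]

theorem expo_zero : expo (0 : Γ) = 1 := rfl

/-- The Hecke algebra with parameter `φ`: the free `ℤ[Γ]`-module with basis `(T_w)` indexed by `W`.
Its multiplication is constructed below; see `T_mul_T` and `T_simple_quadratic`. -/
@[nolint unusedArguments]
def Hecke (cs : CoxeterSystem M W) (_φ : SBar cs → Γ) : Type (max v w) := W →₀ GrpRing Γ

namespace Hecke

variable {cs} (φ : SBar cs → Γ)

instance : AddCommGroup (Hecke cs φ) := inferInstanceAs (AddCommGroup (W →₀ GrpRing Γ))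
instance : Module (GrpRing Γ) (Hecke cs φ) :=
  inferInstanceAs (Module (GrpRing Γ) (W →₀ GrpRing Γ))

/-- The standard basis `(T_w)`. -/
def Tbasis : Module.Basis W (GrpRing Γ) (Hecke cs φ) := Finsupp.basisSingleOne

/-- The standard basis element `T_w`. -/
def T (x : W) : Hecke cs φ := Tbasis φ x

/-- The element `e^{φ(s)} - e^{-φ(s)}`. -/
def qpar (i : B) : GrpRing Γ := expo (φ (cls cs i)) - expo (-φ (cls cs i))

/-- Left multiplication by `T_s`. -/
def lop (i : B) : Module.End (GrpRing Γ) (Hecke cs φ) :=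
  (Tbasis φ).constr (GrpRing Γ) fun x =>
    if cs.length x < cs.length (cs.simple i * x) then T φ (cs.simple i * x)
    else T φ (cs.simple i * x) + qpar φ i • T φ x

/-- Right multiplication by `T_s`. -/
def rop (i : B) : Module.End (GrpRing Γ) (Hecke cs φ) :=
  (Tbasis φ).constr (GrpRing Γ) fun x =>
    if cs.length x < cs.length (x * cs.simple i) then T φ (x * cs.simple i)
    else T φ (x * cs.simple i) + qpar φ i • T φ x

theorem lop_T (i : B) (x : W) : lop φ i (T φ x) =
    if cs.length x < cs.length (cs.simple i * x) then T φ (cs.simple i * x)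
    else T φ (cs.simple i * x) + qpar φ i • T φ x :=
  (Tbasis φ).constr_basis _ _ _

theorem rop_T (i : B) (x : W) : rop φ i (T φ x) =
    if cs.length x < cs.length (x * cs.simple i) then T φ (x * cs.simple i)
    else T φ (x * cs.simple i) + qpar φ i • T φ x :=
  (Tbasis φ).constr_basis _ _ _

theorem lop_rop (i j : B) : lop φ i * rop φ j = rop φ j * lop φ i := by
  refine (Tbasis φ).ext fun x => ?_
  change lop φ i (rop φ j (T φ x)) = rop φ j (lop φ i (T φ x))
  have hq : cs.length (cs.simple i * x * cs.simple j) = cs.length x →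
      cs.length (cs.simple i * x) = cs.length (x * cs.simple j) →
      cs.simple i * x = x * cs.simple j ∧ qpar φ i = qpar φ j ∧
        cs.simple i * x * cs.simple j = x := by
    intro h1 h2
    have h := simple_mul_eq_mul_simple cs i j x h1 h2
    exact ⟨h, by simp [qpar, cls_eq cs x h], by simp [h]⟩
  have hl := cs.length_simple_mul x i
  have hr := cs.length_mul_simple x j
  have hlr := cs.length_mul_simple (cs.simple i * x) j
  have hrl := cs.length_simple_mul (x * cs.simple j) i
  rw [← mul_assoc] at hrl
  rw [lop_T, rop_T]
  rcases hl with hl | hl <;> rcases hr with hr | hr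
  · rw [if_pos (by omega), if_pos (by omega), lop_T, rop_T, ← mul_assoc]
    rcases hlr with h | h
    · rw [if_pos (by omega), if_pos (by omega)]
    · obtain ⟨h1, h2, h3⟩ := hq (by omega) (by omega)
      rw [if_neg (by omega), if_neg (by omega), h1, h2]
  · rw [if_neg (by omega), if_pos (by omega), map_add, map_smul, lop_T, lop_T, rop_T, ← mul_assoc,
      if_pos (by omega), if_pos (by omega), if_neg (by omega)]
  · rw [if_pos (by omega), if_neg (by omega), map_add, map_smul, lop_T, rop_T, rop_T, ← mul_assoc,
      if_neg (by omega), if_pos (by omega), if_pos (by omega)]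
  · rw [if_neg (by omega), if_neg (by omega), map_add, map_add, map_smul, map_smul, lop_T, lop_T,
      rop_T, rop_T, ← mul_assoc, if_neg (c := cs.length x < cs.length (x * cs.simple j)) (by omega),
      if_neg (c := cs.length x < cs.length (cs.simple i * x)) (by omega)]
    rcases hlr with h | h
    · obtain ⟨h1, h2, h3⟩ := hq (by omega) (by omega)
      rw [if_pos (by omega), if_pos (by omega), h1, h2]
    · rw [if_neg (by omega), if_neg (by omega), smul_add, smul_add, smul_smul, smul_smul,
        mul_comm (qpar φ i)]
      abel

/-- The composite of the operators `lop` along a word. -/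
def lword (ω : List B) : Module.End (GrpRing Γ) (Hecke cs φ) := (ω.map (lop φ)).prod

theorem lword_T_one (ω : List B) (h : cs.IsReduced ω) :
    lword φ ω (T φ 1) = T φ (cs.wordProd ω) := by
  induction ω with
  | nil => simp [lword]
  | cons i ω ih =>
    have h' : cs.IsReduced ω := by simpa using h.drop 1
    have e : lword φ (i :: ω) = lop φ i * lword φ ω := by simp [lword]
    rw [e, Module.End.mul_apply, ih h', lop_T, cs.wordProd_cons, if_pos]
    rw [← cs.wordProd_cons, h, h']; simp

theorem eq_zero_of_comm (X : Module.End (GrpRing Γ) (Hecke cs φ))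
    (hX : ∀ i, X * rop φ i = rop φ i * X) (h1 : X (T φ 1) = 0) : X = 0 := by
  refine (Tbasis φ).ext fun x => ?_
  change X (T φ x) = 0
  obtain ⟨n, hn⟩ : ∃ n, cs.length x = n := ⟨_, rfl⟩
  induction n generalizing x with
  | zero => rwa [cs.length_eq_zero_iff.1 hn]
  | succ n ih =>
    have hx : x ≠ 1 := by rintro rfl; simp at hn
    obtain ⟨i, hi⟩ := cs.exists_rightDescent_of_ne_one hx
    have hi' := cs.isRightDescent_iff.1 hi
    have : T φ x = rop φ i (T φ (x * cs.simple i)) := by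
      rw [rop_T, if_pos] <;> simp; omega
    rw [this, ← Module.End.mul_apply, hX, Module.End.mul_apply, ih _ (by omega), map_zero]

/-- A reduced word for `x`. -/
def rword (cs : CoxeterSystem M W) (x : W) : List B := (cs.exists_isReduced x).choose

theorem rword_isReduced (x : W) : cs.IsReduced (rword cs x) := (cs.exists_isReduced x).choose_spec.1
theorem wordProd_rword (x : W) : cs.wordProd (rword cs x) = x :=
  (cs.exists_isReduced x).choose_spec.2.symm

/-- Left multiplication. -/
def lmul : Hecke cs φ →ₗ[GrpRing Γ] Module.End (GrpRing Γ) (Hecke cs φ) :=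
  (Tbasis φ).constr (GrpRing Γ) fun x => lword φ (rword cs x)

theorem lmul_T (x : W) : lmul φ (T φ x) = lword φ (rword cs x) := (Tbasis φ).constr_basis _ _ _

theorem lmul_T_one (h : Hecke cs φ) : lmul φ h (T φ 1) = h := by
  have : (lmul φ).flip (T φ 1) = LinearMap.id := by
    refine (Tbasis φ).ext fun x => ?_
    change lmul φ (T φ x) (T φ 1) = T φ x
    rw [lmul_T, lword_T_one φ _ (rword_isReduced x), wordProd_rword]
  exact LinearMap.congr_fun this h

theorem lword_rop (ω : List B) (i : B) : lword φ ω * rop φ i = rop φ i * lword φ ω := by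
  induction ω with
  | nil => simp [lword]
  | cons j ω ih =>
    have e : lword φ (j :: ω) = lop φ j * lword φ ω := by simp [lword]
    rw [e, mul_assoc, ih, ← mul_assoc, lop_rop, mul_assoc]

theorem lmul_rop (h : Hecke cs φ) (i : B) : lmul φ h * rop φ i = rop φ i * lmul φ h := by
  have : (LinearMap.mulRight (GrpRing Γ) (rop φ i)) ∘ₗ lmul φ =
      (LinearMap.mulLeft (GrpRing Γ) (rop φ i)) ∘ₗ lmul φ := by
    refine (Tbasis φ).ext fun x => ?_
    change lmul φ (T φ x) * rop φ i = rop φ i * lmul φ (T φ x)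
    rw [lmul_T, lword_rop]
  exact LinearMap.congr_fun this h

theorem end_ext {X Y : Module.End (GrpRing Γ) (Hecke cs φ)}
    (hX : ∀ i, X * rop φ i = rop φ i * X) (hY : ∀ i, Y * rop φ i = rop φ i * Y)
    (h : X (T φ 1) = Y (T φ 1)) : X = Y := by
  rw [← sub_eq_zero]
  exact eq_zero_of_comm φ _ (fun i => by rw [sub_mul, mul_sub, hX, hY]) (by simp [h])

instance : Mul (Hecke cs φ) := ⟨fun h h' => lmul φ h h'⟩
instance : One (Hecke cs φ) := ⟨T φ 1⟩

theorem mul_def (h h' : Hecke cs φ) : h * h' = lmul φ h h' := rfl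
theorem one_def : (1 : Hecke cs φ) = T φ 1 := rfl

theorem lmul_mul (h h' : Hecke cs φ) : lmul φ (h * h') = lmul φ h * lmul φ h' := by
  apply end_ext φ (lmul_rop φ _)
  · intro i
    rw [mul_assoc, lmul_rop, ← mul_assoc, lmul_rop, mul_assoc]
  · rw [Module.End.mul_apply, lmul_T_one, lmul_T_one, mul_def]

theorem lmul_one : lmul φ 1 = 1 :=
  end_ext φ (lmul_rop φ _) (fun i => by simp) (by rw [lmul_T_one]; rfl)

instance : Ring (Hecke cs φ) where
  __ := (inferInstance : AddCommGroup (Hecke cs φ))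
  mul_assoc a b c := by
    rw [mul_def, lmul_mul, mul_def φ b c, mul_def, Module.End.mul_apply]
  one_mul a := by rw [mul_def, lmul_one]; rfl
  mul_one a := by rw [mul_def, one_def, lmul_T_one]
  left_distrib a b c := by simp [mul_def]
  right_distrib a b c := by simp [mul_def]
  zero_mul a := by simp [mul_def]
  mul_zero a := by simp [mul_def]

instance : Algebra (GrpRing Γ) (Hecke cs φ) :=
  Algebra.ofModule (fun r x y => by simp [mul_def]) (fun r x y => by simp [mul_def])

theorem T_one : T φ 1 = 1 := rfl

theorem T_simple_mul (i : B) (h : Hecke cs φ) : T φ (cs.simple i) * h = lop φ i h := by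
  have : lmul φ (T φ (cs.simple i)) = lop φ i := by
    apply end_ext φ (lmul_rop φ _) (lop_rop φ i)
    rw [lmul_T_one, lop_T, if_pos] <;> simp
  rw [mul_def, this]

theorem T_simple_mul_T (i : B) (x : W) : T φ (cs.simple i) * T φ x =
    if cs.length x < cs.length (cs.simple i * x) then T φ (cs.simple i * x)
    else T φ (cs.simple i * x) + qpar φ i • T φ x := by
  rw [T_simple_mul, lop_T]

theorem T_mul_T (x y : W) (h : cs.length (x * y) = cs.length x + cs.length y) :
    T φ x * T φ y = T φ (x * y) := by
  obtain ⟨n, hn⟩ : ∃ n, cs.length x = n := ⟨_, rfl⟩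
  induction n generalizing x with
  | zero => rw [cs.length_eq_zero_iff.1 hn, T_one, one_mul, one_mul]
  | succ n ih =>
    have hx : x ≠ 1 := by rintro rfl; simp at hn
    obtain ⟨i, hi⟩ := cs.exists_leftDescent_of_ne_one hx
    have hi' := cs.isLeftDescent_iff.1 hi
    set z := cs.simple i * x with hz
    have hxz : x = cs.simple i * z := by simp [hz]
    have h1 := cs.length_mul_le z y
    have h2 := cs.length_mul_le (cs.simple i) (z * y)
    rw [← mul_assoc, ← hxz, cs.length_simple] at h2
    have e1 : T φ x = T φ (cs.simple i) * T φ z := by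
      rw [T_simple_mul_T, ← hxz, if_pos (by omega)]
    rw [e1, mul_assoc, ih z (by omega) (by omega), T_simple_mul_T, ← mul_assoc, ← hxz,
      if_pos (by omega)]

theorem T_simple_sq (i : B) :
    T φ (cs.simple i) * T φ (cs.simple i) = 1 + qpar φ i • T φ (cs.simple i) := by
  rw [T_simple_mul_T, if_neg (by simp)]; simp [T_one]

/-- The quadratic relation `(T_s - e^{φ(s)}) (T_s + e^{-φ(s)}) = 0`. -/
theorem T_simple_quadratic (i : B) :
    (T φ (cs.simple i) - algebraMap (GrpRing Γ) _ (expo (φ (cls cs i)))) *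
      (T φ (cs.simple i) + algebraMap (GrpRing Γ) _ (expo (-φ (cls cs i)))) = 0 := by
  rw [sub_mul, mul_add, mul_add, T_simple_sq, ← map_mul, expo_mul, ← Algebra.commutes,
    ← Algebra.smul_def, ← Algebra.smul_def, qpar, sub_smul]
  simp only [add_neg_cancel, expo_zero, map_one]
  abel

end Hecke


/-! ### The bar involution -/

/-- The involution `e^γ ↦ e^{-γ}` of `ℤ[Γ]`. -/
def barA : GrpRing Γ →+* GrpRing Γ := AddMonoidAlgebra.mapDomainRingHom ℤ (negAddMonoidHom (α := Γ))

theorem barA_expo (γ : Γ) : barA (expo γ) = expo (-γ) := by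
  simp [barA, expo]

theorem barA_coeff (a : GrpRing Γ) (γ : Γ) : (barA a).coeff γ = a.coeff (-γ) := by
  have := Finsupp.mapDomain_apply (f := fun γ : Γ => -γ) neg_injective a.coeff (-γ)
  rw [neg_neg] at this
  exact this

theorem barA_barA (a : GrpRing Γ) : barA (barA a) = a := by
  ext γ; simp [barA_coeff]

namespace Hecke

variable {cs} (φ : SBar cs → Γ)

/-- The inverse `T_s - (e^{φ(s)} - e^{-φ(s)})` of `T_s`. -/
def Tinv (i : B) : Hecke cs φ := T φ (cs.simple i) - qpar φ i • 1

theorem T_mul_Tinv (i : B) : T φ (cs.simple i) * Tinv φ i = 1 := by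
  simp [Tinv, mul_sub, T_simple_sq]

theorem Tinv_mul_T (i : B) : Tinv φ i * T φ (cs.simple i) = 1 := by
  simp [Tinv, sub_mul, T_simple_sq]

theorem isUnit_T (x : W) : IsUnit (T φ x) := by
  obtain ⟨n, hn⟩ : ∃ n, cs.length x = n := ⟨_, rfl⟩
  induction n generalizing x with
  | zero => rw [cs.length_eq_zero_iff.1 hn, T_one]; exact isUnit_one
  | succ n ih =>
    have hx : x ≠ 1 := by rintro rfl; simp at hn
    obtain ⟨i, hi⟩ := cs.exists_leftDescent_of_ne_one hx
    have hi' := cs.isLeftDescent_iff.1 hi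
    have e1 : T φ x = T φ (cs.simple i) * T φ (cs.simple i * x) := by
      rw [T_simple_mul_T, if_pos] <;> simp; omega
    rw [e1]
    exact IsUnit.mul ⟨⟨_, _, T_mul_Tinv φ i, Tinv_mul_T φ i⟩, rfl⟩ (ih _ (by omega))

/-- The bar involution: `e^γ ↦ e^{-γ}` on coefficients and `T_w ↦ (T_{w⁻¹})⁻¹`. -/
def bar : Hecke cs φ →+ Hecke cs φ :=
  Finsupp.liftAddHom (M := GrpRing Γ) (N := Hecke cs φ) fun x =>
    ((smulAddHom (GrpRing Γ) (Hecke cs φ)).flip (Ring.inverse (T φ x⁻¹))).comp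
      (barA (Γ := Γ)).toAddMonoidHom

theorem smul_T (a : GrpRing Γ) (x : W) : (Finsupp.single x a : W →₀ GrpRing Γ) = a • T φ x := by
  change _ = a • (Finsupp.single x (1 : GrpRing Γ) : W →₀ GrpRing Γ)
  rw [Finsupp.smul_single, smul_eq_mul, mul_one]

theorem addHom_ext {N : Type*} [AddCommGroup N] {f g : Hecke cs φ →+ N}
    (h : ∀ (a : GrpRing Γ) (x : W), f (a • T φ x) = g (a • T φ x)) : f = g := by
  refine Finsupp.addHom_ext (M := GrpRing Γ) (f := f) (g := g) fun x a => ?_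
  rw [smul_T φ a x]; exact h a x

theorem bar_smul_T (a : GrpRing Γ) (x : W) :
    bar φ (a • T φ x) = barA a • Ring.inverse (T φ x⁻¹) := by
  rw [← smul_T]
  exact Finsupp.liftAddHom_apply_single (M := GrpRing Γ) (N := Hecke cs φ) _ x a

theorem bar_T (x : W) : bar φ (T φ x) = Ring.inverse (T φ x⁻¹) := by
  simpa using bar_smul_T φ 1 x

theorem bar_smul (a : GrpRing Γ) (h : Hecke cs φ) : bar φ (a • h) = barA a • bar φ h := by
  have : (bar φ).comp (DistribSMul.toAddMonoidHom (Hecke cs φ) a) =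
      (DistribSMul.toAddMonoidHom (Hecke cs φ) (barA a)).comp (bar φ) := by
    refine addHom_ext φ fun b x => ?_
    simp [smul_smul, bar_smul_T]
  exact DFunLike.congr_fun this h

theorem bar_T_mul (x : W) : bar φ (T φ x) * T φ x⁻¹ = 1 := by
  rw [bar_T, Ring.inverse_mul_cancel _ (isUnit_T φ _)]

theorem T_mul_bar (x : W) : T φ x⁻¹ * bar φ (T φ x) = 1 := by
  rw [bar_T, Ring.mul_inverse_cancel _ (isUnit_T φ _)]

theorem bar_T_simple_mul_of_lt (i : B) (x : W) (h : cs.length x < cs.length (cs.simple i * x)) :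
    bar φ (T φ (cs.simple i * x)) = Tinv φ i * bar φ (T φ x) := by
  refine left_inv_eq_right_inv (bar_T_mul φ _) ?_
  have hl := cs.length_simple_mul x i
  have : T φ (cs.simple i * x)⁻¹ = T φ x⁻¹ * T φ (cs.simple i) := by
    rw [T_mul_T]
    · simp
    · rw [show x⁻¹ * cs.simple i = (cs.simple i * x)⁻¹ by simp, cs.length_inv, cs.length_inv,
        cs.length_simple]
      omega
  rw [this, mul_assoc, ← mul_assoc _ (Tinv φ i), T_mul_Tinv, one_mul, T_mul_bar]

theorem barA_qpar (i : B) : barA (qpar φ i) = -qpar φ i := by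
  simp [qpar, barA_expo]

theorem bar_T_simple_mul (i : B) (h : Hecke cs φ) :
    bar φ (T φ (cs.simple i) * h) = Tinv φ i * bar φ h := by
  have : (bar φ).comp (AddMonoidHom.mulLeft (T φ (cs.simple i))) =
      (AddMonoidHom.mulLeft (Tinv φ i)).comp (bar φ) := by
    refine addHom_ext φ fun b x => ?_
    simp only [AddMonoidHom.comp_apply, AddMonoidHom.coe_mulLeft, mul_smul_comm, bar_smul]
    congr 1
    rw [T_simple_mul_T]
    split_ifs with hx
    · exact bar_T_simple_mul_of_lt φ i x hx
    · have hl := cs.length_simple_mul x i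
      have h1 := bar_T_simple_mul_of_lt φ i (cs.simple i * x) (by simp; omega)
      simp only [CoxeterSystem.simple_mul_simple_cancel_left] at h1
      have h2 : bar φ (T φ (cs.simple i * x)) = T φ (cs.simple i) * bar φ (T φ x) := by
        rw [h1, ← mul_assoc, T_mul_Tinv, one_mul]
      rw [map_add, bar_smul, barA_qpar, h2, Tinv, sub_mul, smul_mul_assoc, one_mul, neg_smul,
        sub_eq_add_neg]
  exact DFunLike.congr_fun this h

theorem bar_Tinv_mul (i : B) (h : Hecke cs φ) :
    bar φ (Tinv φ i * h) = T φ (cs.simple i) * bar φ h := by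
  simp [Tinv, sub_mul, bar_T_simple_mul, bar_smul, barA_qpar]

theorem T_eq_of_isLeftDescent (i : B) (x : W) (hi : cs.IsLeftDescent x i) :
    T φ x = T φ (cs.simple i) * T φ (cs.simple i * x) := by
  have hi' := cs.isLeftDescent_iff.1 hi
  rw [T_simple_mul_T, if_pos] <;> simp; omega

theorem bar_one : bar φ 1 = 1 := by
  rw [← T_one, bar_T]; simp [T_one]

theorem bar_bar (h : Hecke cs φ) : bar φ (bar φ h) = h := by
  have key : ∀ x, bar φ (bar φ (T φ x)) = T φ x := by
    intro x
    obtain ⟨n, hn⟩ : ∃ n, cs.length x = n := ⟨_, rfl⟩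
    induction n generalizing x with
    | zero => rw [cs.length_eq_zero_iff.1 hn, T_one, bar_one, bar_one]
    | succ n ih =>
      have hx : x ≠ 1 := by rintro rfl; simp at hn
      obtain ⟨i, hi⟩ := cs.exists_leftDescent_of_ne_one hx
      have hi' := cs.isLeftDescent_iff.1 hi
      rw [T_eq_of_isLeftDescent φ i x hi, bar_T_simple_mul, bar_Tinv_mul, ih _ (by omega)]
  have : (bar φ).comp (bar φ) = AddMonoidHom.id _ := by
    refine addHom_ext φ fun b x => ?_
    simp only [AddMonoidHom.comp_apply, bar_smul, key, barA_barA, AddMonoidHom.id_apply]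
  exact DFunLike.congr_fun this h

/-- The span of the `T_x` with `ℓ(x) < n`. -/
def lenLT (n : ℕ) : Submodule (GrpRing Γ) (Hecke cs φ) :=
  Submodule.span _ (T φ '' {x | cs.length x < n})

theorem T_mem_lenLT {x : W} {n : ℕ} (h : cs.length x < n) : T φ x ∈ lenLT φ n :=
  Submodule.subset_span ⟨x, h, rfl⟩

theorem lenLT_mono {m n : ℕ} (h : m ≤ n) : lenLT φ m ≤ lenLT φ n :=
  Submodule.span_mono (Set.image_mono fun _ hx => lt_of_lt_of_le hx h)

theorem mem_lenLT {n : ℕ} {h : Hecke cs φ} :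
    h ∈ lenLT φ n ↔ ∀ x, (Tbasis φ).repr h x ≠ 0 → cs.length x < n := by
  have := (Tbasis φ).mem_span_image (m := h) (s := {x | cs.length x < n})
  change h ∈ Submodule.span _ (Tbasis φ '' _) ↔ _
  rw [this]
  simp [Set.subset_def]

theorem lenLT_zero : lenLT φ 0 = ⊥ := by
  simp [lenLT]

theorem exists_mem_lenLT (h : Hecke cs φ) : ∃ n, h ∈ lenLT φ n := by
  refine ⟨((Tbasis φ).repr h).support.sup cs.length + 1, (mem_lenLT φ).2 fun x hx => ?_⟩
  exact Nat.lt_succ_of_le (Finset.le_sup (f := cs.length) (Finsupp.mem_support_iff.2 hx))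

theorem T_simple_mul_mem_lenLT (i : B) {n : ℕ} {h : Hecke cs φ} (hh : h ∈ lenLT φ n) :
    T φ (cs.simple i) * h ∈ lenLT φ (n + 1) := by
  induction hh using Submodule.span_induction with
  | mem y hy =>
    obtain ⟨x, hx, rfl⟩ := hy
    simp only [Set.mem_ofPred_eq] at hx
    have hl := cs.length_simple_mul x i
    rw [T_simple_mul_T]
    split_ifs
    · exact T_mem_lenLT φ (by omega)
    · exact add_mem (T_mem_lenLT φ (by omega)) (Submodule.smul_mem _ _ (T_mem_lenLT φ (by omega)))
  | zero => simp
  | add a b _ _ ha hb => rw [mul_add]; exact add_mem ha hb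
  | smul a b _ hb => rw [mul_smul_comm]; exact Submodule.smul_mem _ _ hb

theorem bar_T_sub_mem (x : W) : bar φ (T φ x) - T φ x ∈ lenLT φ (cs.length x) := by
  obtain ⟨n, hn⟩ : ∃ n, cs.length x = n := ⟨_, rfl⟩
  induction n generalizing x with
  | zero => rw [cs.length_eq_zero_iff.1 hn, T_one, bar_one, sub_self]; exact zero_mem _
  | succ n ih =>
    have hx : x ≠ 1 := by rintro rfl; simp at hn
    obtain ⟨i, hi⟩ := cs.exists_leftDescent_of_ne_one hx
    have hi' := cs.isLeftDescent_iff.1 hi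
    have h1 := ih (cs.simple i * x) (by omega)
    have hl : cs.length (cs.simple i * x) = n := by omega
    rw [hl] at h1
    rw [T_eq_of_isLeftDescent φ i x hi, bar_T_simple_mul, hn]
    have : Tinv φ i * bar φ (T φ (cs.simple i * x)) - T φ (cs.simple i) * T φ (cs.simple i * x) =
        T φ (cs.simple i) * (bar φ (T φ (cs.simple i * x)) - T φ (cs.simple i * x)) -
          qpar φ i • ((bar φ (T φ (cs.simple i * x)) - T φ (cs.simple i * x)) +
            T φ (cs.simple i * x)) := by
      simp [Tinv, sub_mul, mul_sub]; abel
    rw [this]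
    refine sub_mem (T_simple_mul_mem_lenLT φ i h1) (Submodule.smul_mem _ _ (add_mem
      (lenLT_mono φ (Nat.le_succ n) h1) (T_mem_lenLT φ (by omega))))

/-- If `ℓ(x) = n` and `h` is supported in length at most `n`, the coefficient of `T_x` in `bar h` is
the image of that in `h`. -/
theorem repr_bar {n : ℕ} {h : Hecke cs φ} (hh : h ∈ lenLT φ (n + 1)) {x : W}
    (hx : n ≤ cs.length x) : (Tbasis φ).repr (bar φ h) x = barA ((Tbasis φ).repr h x) := by
  classical
  induction hh using Submodule.span_induction with
  | mem y hy =>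
    obtain ⟨z, hz, rfl⟩ := hy
    simp only [Set.mem_ofPred_eq] at hz
    have h1 := lenLT_mono φ (Nat.le_of_lt_succ hz) (bar_T_sub_mem φ z)
    rw [mem_lenLT] at h1
    have h2 : (Tbasis φ).repr (bar φ (T φ z) - T φ z) x = 0 := by
      by_contra hne
      have := h1 x hne
      omega
    rw [map_sub, Finsupp.sub_apply, sub_eq_zero] at h2
    rw [h2]
    change (Tbasis φ).repr (Tbasis φ z) x = barA ((Tbasis φ).repr (Tbasis φ z) x)
    rw [Module.Basis.repr_self, Finsupp.single_apply]
    split_ifs <;> simp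
  | zero => simp
  | add a b _ _ ha hb => simp [ha, hb]
  | smul a b _ hb => simp [bar_smul, hb]

end Hecke

section Operators

variable {cs} (φ : SBar cs → Γ)

/-- The operator `h ↦ T_u h T_{v⁻¹}` attached to `g = (u, v)`. -/
def actH (g : W × W) : Hecke cs φ →ₗ[GrpRing Γ] Hecke cs φ :=
  LinearMap.mulRight (GrpRing Γ) (Hecke.T φ g.2⁻¹) ∘ₗ LinearMap.mulLeft (GrpRing Γ) (Hecke.T φ g.1)

theorem actH_apply (g : W × W) (h : Hecke cs φ) :
    actH φ g h = Hecke.T φ g.1 * h * Hecke.T φ g.2⁻¹ := rfl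

/-- The augmentation `ℤ[Γ] → ℤ`, `e^γ ↦ 1`. -/
def aug (Γ : Type w) [AddCommGroup Γ] : GrpRing Γ →+* ℤ :=
  (AddMonoidAlgebra.lift ℤ ℤ Γ (1 : Multiplicative Γ →* ℤ)).toRingHom

theorem aug_expo (γ : Γ) : aug Γ (expo γ) = 1 := by
  simp [aug, expo]

/-- The ring `ℤ`, viewed as a `ℤ[Γ]`-module through the augmentation. -/
@[nolint unusedArguments]
def AugInt (_Γ : Type w) : Type := ℤ

instance : AddCommGroup (AugInt Γ) := inferInstanceAs (AddCommGroup ℤ)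
instance : Module (GrpRing Γ) (AugInt Γ) := Module.compHom ℤ (aug Γ)

theorem smul_augInt (a : GrpRing Γ) (n : AugInt Γ) :
    a • n = (show AugInt Γ from aug Γ a * (show ℤ from n)) := rfl

theorem mem_smul_top {φ : SBar cs → Γ} {N : Submodule (GrpRing Γ) (Hecke cs φ)} {I : Ideal (GrpRing Γ)} (x : N)
    (hx : x.1 ∈ I • N) : x ∈ I • (⊤ : Submodule (GrpRing Γ) N) := by
  have : Submodule.map N.subtype (I • (⊤ : Submodule (GrpRing Γ) N)) = I • N := by
    rw [Submodule.map_smul'', Submodule.map_subtype_top]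
  rw [← this] at hx
  obtain ⟨y, hy, hyx⟩ := hx
  rwa [← Subtype.ext hyx]

end Operators

/-! ### The Kazhdan–Lusztig basis -/

section Order

variable [LinearOrder Γ] [IsOrderedAddMonoid Γ]

/-- `ℤ[Γ_{<0}]`. -/
def negCoeffs (Γ : Type w) [AddCommGroup Γ] [LinearOrder Γ] : AddSubgroup (GrpRing Γ) where
  carrier := {a | ∀ γ, a.coeff γ ≠ 0 → γ < 0}
  zero_mem' := by simp
  add_mem' {a b} ha hb γ h := by
    by_contra hγ
    have h1 : a.coeff γ = 0 := by_contra fun h' => hγ (ha γ h')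
    have h2 : b.coeff γ = 0 := by_contra fun h' => hγ (hb γ h')
    simp [h1, h2] at h
  neg_mem' {a} ha γ h := ha γ (by simpa using h)

theorem eq_zero_of_mem_negCoeffs {a : GrpRing Γ} (ha : a ∈ negCoeffs Γ) (hb : barA a = a) :
    a = 0 := by
  ext γ
  by_contra h
  have h1 : a.coeff γ ≠ 0 := h
  have h2 : a.coeff (-γ) ≠ 0 := by rwa [← barA_coeff, hb]
  have h3 := ha _ h1
  have h4 := ha _ h2
  rw [neg_lt_zero] at h4
  exact lt_asymm h3 h4

theorem exists_negCoeffs {a : GrpRing Γ} (hb : barA a = -a) :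
    ∃ p ∈ negCoeffs Γ, p - barA p = a := by
  classical
  refine ⟨.ofCoeff (a.coeff.filter fun γ => γ < 0), fun γ h => ?_, ?_⟩
  · by_contra hγ
    exact h (Finsupp.filter_apply_neg _ _ hγ)
  · ext γ
    have hγ : a.coeff (-γ) = -a.coeff γ := by rw [← barA_coeff, hb]; simp
    simp only [AddMonoidAlgebra.coeff_sub, Finsupp.sub_apply, barA_coeff, Finsupp.filter_apply,
      neg_lt_zero, hγ]
    rcases lt_trichotomy γ 0 with h | h | h
    · simp [h, h.not_gt]
    · subst h
      have : a.coeff 0 = 0 := by simp only [neg_zero] at hγ; omega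
      simp [this]
    · simp [h, h.not_gt]

namespace Hecke

variable {cs} (φ : SBar cs → Γ)

/-- `H_{<0} = ⊕_w ℤ[Γ_{<0}] T_w`. -/
def negPart : AddSubgroup (Hecke cs φ) where
  carrier := {h | ∀ x, (Tbasis φ).repr h x ∈ negCoeffs Γ}
  zero_mem' x := by simp [zero_mem]
  add_mem' {a b} ha hb x := by simpa using add_mem (ha x) (hb x)
  neg_mem' {a} ha x := by simpa using ha x

theorem eq_zero_of_mem_negPart {h : Hecke cs φ} (hn : h ∈ negPart φ) (hb : bar φ h = h) :
    h = 0 := by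
  obtain ⟨n, hm⟩ := exists_mem_lenLT φ h
  induction n with
  | zero => simpa [lenLT_zero] using hm
  | succ n ih =>
    apply ih
    rw [mem_lenLT] at hm ⊢
    intro x hx
    by_contra hx'
    apply hx
    apply eq_zero_of_mem_negCoeffs (hn x)
    rw [← repr_bar φ ((mem_lenLT φ).2 hm) (not_lt.1 hx'), hb]

theorem exists_negPart (n : ℕ) (D : Hecke cs φ) (hD : D ∈ lenLT φ n) (hb : bar φ D = -D) :
    ∃ E ∈ negPart φ, E ∈ lenLT φ n ∧ E - bar φ E = D := by
  classical
  induction n generalizing D with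
  | zero =>
    have : D = 0 := by simpa [lenLT_zero] using hD
    exact ⟨0, zero_mem _, zero_mem _, by simp [this]⟩
  | succ n ih =>
    have hx : ∀ x, ∃ p ∈ negCoeffs Γ, (n ≤ cs.length x → p - barA p = (Tbasis φ).repr D x) ∧
        ((Tbasis φ).repr D x = 0 → p = 0) := by
      intro x
      by_cases h0 : (Tbasis φ).repr D x = 0
      · exact ⟨0, zero_mem _, by simp [h0], by simp⟩
      · by_cases hx : n ≤ cs.length x
        · obtain ⟨p, hp, hp'⟩ := exists_negCoeffs (a := (Tbasis φ).repr D x) (by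
            rw [← repr_bar φ hD hx, hb]; simp)
          exact ⟨p, hp, fun _ => hp', fun h => absurd h h0⟩
        · exact ⟨0, zero_mem _, fun h => absurd h hx, fun h => absurd h h0⟩
    choose p hp hp1 hp2 using hx
    let f : W →₀ GrpRing Γ := Finsupp.onFinset ((Tbasis φ).repr D).support p fun x h =>
      Finsupp.mem_support_iff.2 fun h' => h (hp2 x h')
    have hf : ∀ x, f x = p x := fun x => rfl
    let E₀ : Hecke cs φ := (Tbasis φ).repr.symm f
    have hE : ∀ x, (Tbasis φ).repr E₀ x = p x := fun x => by simp [E₀, hf]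
    have hEl : E₀ ∈ lenLT φ (n + 1) := by
      rw [mem_lenLT] at hD ⊢
      intro x hx
      exact hD x fun h => hx (by rw [hE, hp2 x h])
    obtain ⟨E, h1, h2, h3⟩ := ih (D - (E₀ - bar φ E₀)) (by
      rw [mem_lenLT]
      intro x
      contrapose!
      intro hx
      simp only [map_sub, Finsupp.sub_apply, repr_bar φ hEl hx, hE, hp1 x hx, sub_self]) (by
      simp only [map_sub, hb, bar_bar]; abel)
    refine ⟨E₀ + E, add_mem (fun x => by rw [hE]; exact hp x) h1,
      add_mem hEl (lenLT_mono φ (Nat.le_succ n) h2), ?_⟩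
    rw [map_add, ← sub_add_cancel D (E₀ - bar φ E₀), ← h3]; abel

theorem exists_C (x : W) : ∃ c : Hecke cs φ, (bar φ c = c ∧ c - T φ x ∈ negPart φ) ∧
    c - T φ x ∈ lenLT φ (cs.length x) := by
  obtain ⟨E, h1, h2, h3⟩ := exists_negPart φ (cs.length x) _ (bar_T_sub_mem φ x)
    (by rw [map_sub, bar_bar]; abel)
  refine ⟨T φ x + E, ⟨?_, by simpa using h1⟩, by simpa using h2⟩
  rw [map_add, ← sub_eq_zero]
  have : bar φ (T φ x) + bar φ E - (T φ x + E) = (bar φ (T φ x) - T φ x) - (E - bar φ E) := by abel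
  rw [this, h3, sub_self]

/-- Existence and uniqueness of the Kazhdan–Lusztig element attached to `x`. -/
theorem existsUnique_C (x : W) : ∃! c : Hecke cs φ, bar φ c = c ∧ c - T φ x ∈ negPart φ := by
  obtain ⟨c, hc, -⟩ := exists_C φ x
  refine ⟨c, hc, fun d hd => ?_⟩
  rw [← sub_eq_zero]
  refine eq_zero_of_mem_negPart φ ?_ (by rw [map_sub, hd.1, hc.1])
  simpa using sub_mem hd.2 hc.2

/-- The Kazhdan–Lusztig element `C_x`: the unique bar-invariant element congruent to `T_x` modulo
`H_{<0}`. -/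
def C (x : W) : Hecke cs φ := (existsUnique_C φ x).choose

theorem bar_C (x : W) : bar φ (C φ x) = C φ x := (existsUnique_C φ x).choose_spec.1.1
theorem C_sub_T_mem (x : W) : C φ x - T φ x ∈ negPart φ := (existsUnique_C φ x).choose_spec.1.2

theorem C_sub_T_mem_lenLT (x : W) : C φ x - T φ x ∈ lenLT φ (cs.length x) := by
  obtain ⟨c, hc, hl⟩ := exists_C φ x
  rwa [(existsUnique_C φ x).unique ⟨bar_C φ x, C_sub_T_mem φ x⟩ hc]

theorem linearIndependent_C : LinearIndependent (GrpRing Γ) (C φ) := by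
  let Ψ : Hecke cs φ →ₗ[GrpRing Γ] Hecke cs φ := (Tbasis φ).constr (GrpRing Γ) (C φ)
  have hΨ : ∀ x, Ψ (T φ x) = C φ x := fun x => (Tbasis φ).constr_basis _ _ _
  have hsub : ∀ n, ∀ h ∈ lenLT φ (n + 1), Ψ h - h ∈ lenLT φ n := by
    intro n h hh
    induction hh using Submodule.span_induction with
    | mem y hy =>
      obtain ⟨z, hz, rfl⟩ := hy
      rw [hΨ]
      exact lenLT_mono φ (Nat.le_of_lt_succ hz) (C_sub_T_mem_lenLT φ z)
    | zero => simp
    | add a b _ _ ha hb => rw [map_add, add_sub_add_comm]; exact add_mem ha hb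
    | smul a b _ hb => rw [map_smul, ← smul_sub]; exact Submodule.smul_mem _ _ hb
  have hker : LinearMap.ker Ψ = ⊥ := by
    rw [LinearMap.ker_eq_bot']
    intro h hh
    obtain ⟨n, hm⟩ := exists_mem_lenLT φ h
    induction n with
    | zero => simpa [lenLT_zero] using hm
    | succ n ih =>
      apply ih
      simpa [hh] using hsub n h hm
  have := (Tbasis φ).linearIndependent.map' Ψ hker
  rwa [show Ψ ∘ Tbasis φ = C φ from funext hΨ] at this

theorem span_C : ⊤ ≤ Submodule.span (GrpRing Γ) (Set.range (C φ)) := by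
  rw [← (Tbasis φ).span_eq, Submodule.span_le]
  rintro _ ⟨x, rfl⟩
  change T φ x ∈ Submodule.span (GrpRing Γ) (Set.range (C φ))
  obtain ⟨n, hn⟩ : ∃ n, cs.length x = n := ⟨_, rfl⟩
  induction n using Nat.strong_induction_on generalizing x with
  | _ n ih =>
    have h1 : lenLT φ n ≤ Submodule.span (GrpRing Γ) (Set.range (C φ)) := by
      rw [lenLT, Submodule.span_le]
      rintro _ ⟨y, hy, rfl⟩
      exact ih _ hy y rfl
    rw [← sub_sub_cancel (C φ x) (T φ x)]
    exact sub_mem (Submodule.subset_span ⟨x, rfl⟩) (h1 (hn ▸ C_sub_T_mem_lenLT φ x))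

/-- The Kazhdan–Lusztig basis `(C_w)`. -/
def Cbasis : Module.Basis W (GrpRing Γ) (Hecke cs φ) :=
  Module.Basis.mk (linearIndependent_C φ) (span_C φ)

theorem Cbasis_apply (x : W) : Cbasis φ x = C φ x := by simp [Cbasis]


end Hecke

/-! ### Cells -/

/-- The three types of cells: left, right, two-sided. -/
inductive Side : Type
  | L | R | LR

/-- The subgroup `H × 1`, `1 × H` or `H × H` of `W × W`. A pair `(u, v)` is thought of as acting on
`W` by `x ↦ u x v⁻¹`. -/
def sideSub : Side → Subgroup W → Subgroup (W × W)
  | .L, H => H.prod ⊥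
  | .R, H => (⊥ : Subgroup W).prod H
  | .LR, H => H.prod H

/-- The group acting on modules of the given type: a left (right, two-sided) `ℤW`-module is the same
as a module over the group ring of `W × 1` (of `1 × W`, of `W × W`), where `(u, v)` acts by
`x ↦ u x v⁻¹`. -/
abbrev SideGroup (W : Type v) [Group W] (side : Side) : Type v :=
  sideSub side (⊤ : Subgroup W)

/-- The equivalence relation on `W` of translation by `H` (on the left, right, or both). -/
def transRel (side : Side) (H : Subgroup W) : Setoid W where
  r x y := ∃ g ∈ sideSub side H, y = g.1 * x * g.2⁻¹
  iseqv := by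
    refine ⟨fun x => ⟨1, one_mem _, by simp⟩, ?_, ?_⟩
    · rintro x _ ⟨g, hg, rfl⟩
      exact ⟨g⁻¹, inv_mem hg, by simp [mul_assoc]⟩
    · rintro x _ _ ⟨g, hg, rfl⟩ ⟨k, hk, rfl⟩
      exact ⟨k * g, mul_mem hk hg, by simp [mul_assoc]⟩

/-- A subset of `W` is stable by translation by `H` (on the left, right, or both). -/
def IsTransStable (side : Side) (H : Subgroup W) (D : Set W) : Prop :=
  ∀ x ∈ D, ∀ g ∈ sideSub side H, g.1 * x * g.2⁻¹ ∈ D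

section Cells

variable {cs} (φ : SBar cs → Γ)

/-- The relation `x ← y`: the element `C_x` occurs in some `h C_y` (type `L`), in some `C_y h`
(type `R`), in some `h C_y` or some `C_y h` (type `LR`). -/
def arrow : Side → W → W → Prop
  | .L, x, y => ∃ h : Hecke cs φ, (Hecke.Cbasis φ).repr (h * Hecke.C φ y) x ≠ 0
  | .R, x, y => ∃ h : Hecke cs φ, (Hecke.Cbasis φ).repr (Hecke.C φ y * h) x ≠ 0
  | .LR, x, y => ∃ h : Hecke cs φ, (Hecke.Cbasis φ).repr (h * Hecke.C φ y) x ≠ 0 ∨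
      (Hecke.Cbasis φ).repr (Hecke.C φ y * h) x ≠ 0

/-- The Kazhdan–Lusztig preorder `x ≤ y`: the transitive closure of `x ← y`. -/
def cellLE (side : Side) : W → W → Prop := Relation.TransGen (arrow φ side)

theorem arrow_refl (side : Side) (x : W) : arrow φ side x x := by
  have h : (Hecke.Cbasis φ).repr (Hecke.C φ x) x ≠ 0 := by
    rw [← Hecke.Cbasis_apply, Module.Basis.repr_self, Finsupp.single_eq_same]
    exact one_ne_zero
  cases side
  · exact ⟨1, by rwa [one_mul]⟩
  · exact ⟨1, by rwa [mul_one]⟩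
  · exact ⟨1, Or.inl (by rwa [one_mul])⟩

/-- The equivalence relation associated with the preorder `cellLE`. -/
def cellRel (side : Side) : Setoid W where
  r x y := cellLE φ side x y ∧ cellLE φ side y x
  iseqv := ⟨fun x => ⟨.single (arrow_refl φ side x), .single (arrow_refl φ side x)⟩,
    fun h => ⟨h.2, h.1⟩, fun h h' => ⟨h.1.trans h'.1, h'.2.trans h.2⟩⟩

/-- Left, right or two-sided cells: the equivalence classes of `cellRel`. -/
def IsCell (side : Side) (D : Set W) : Prop := D ∈ (cellRel φ side).classes

/-! ### Cell modules -/

/-- The `ℤ[Γ]`-span of the `C_w` with `w ≤ D`. -/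
def leIdeal (side : Side) (D : Set W) : Submodule (GrpRing Γ) (Hecke cs φ) :=
  Submodule.span _ (Hecke.C φ '' {x | ∃ c ∈ D, cellLE φ side x c})

/-- The `ℤ[Γ]`-span of the `C_w` with `w < D`. -/
def ltIdeal (side : Side) (D : Set W) : Submodule (GrpRing Γ) (Hecke cs φ) :=
  Submodule.span _ (Hecke.C φ '' {x | ∃ c ∈ D, cellLE φ side x c ∧ ¬ cellLE φ side c x})

theorem mem_span_of_repr {P : Set W} {h : Hecke cs φ}
    (hP : ∀ x, (Hecke.Cbasis φ).repr h x ≠ 0 → x ∈ P) :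
    h ∈ Submodule.span (GrpRing Γ) (Hecke.C φ '' P) := by
  have := (Hecke.Cbasis φ).mem_span_image (m := h) (s := P)
  rw [show (⇑(Hecke.Cbasis φ) : W → Hecke cs φ) = Hecke.C φ from
    funext (Hecke.Cbasis_apply φ)] at this
  rw [this]
  exact fun x hx => hP x (Finsupp.mem_support_iff.1 hx)

theorem mul_mem_span {side : Side} (hs : side ≠ .R) {P : Set W}
    (hP : ∀ x y, arrow φ side x y → y ∈ P → x ∈ P) (k : Hecke cs φ) {h : Hecke cs φ}
    (hh : h ∈ Submodule.span (GrpRing Γ) (Hecke.C φ '' P)) :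
    k * h ∈ Submodule.span (GrpRing Γ) (Hecke.C φ '' P) := by
  induction hh using Submodule.span_induction with
  | mem z hz =>
    obtain ⟨y, hy, rfl⟩ := hz
    refine mem_span_of_repr φ fun x hx => hP x y ?_ hy
    cases side
    · exact ⟨k, hx⟩
    · exact absurd rfl hs
    · exact ⟨k, Or.inl hx⟩
  | zero => simp
  | add a b _ _ ha hb => rw [mul_add]; exact add_mem ha hb
  | smul a b _ hb => rw [mul_smul_comm]; exact Submodule.smul_mem _ _ hb

theorem mem_span_mul {side : Side} (hs : side ≠ .L) {P : Set W}
    (hP : ∀ x y, arrow φ side x y → y ∈ P → x ∈ P) (k : Hecke cs φ) {h : Hecke cs φ}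
    (hh : h ∈ Submodule.span (GrpRing Γ) (Hecke.C φ '' P)) :
    h * k ∈ Submodule.span (GrpRing Γ) (Hecke.C φ '' P) := by
  induction hh using Submodule.span_induction with
  | mem z hz =>
    obtain ⟨y, hy, rfl⟩ := hz
    refine mem_span_of_repr φ fun x hx => hP x y ?_ hy
    cases side
    · exact absurd rfl hs
    · exact ⟨k, hx⟩
    · exact ⟨k, Or.inr hx⟩
  | zero => simp
  | add a b _ _ ha hb => rw [add_mul]; exact add_mem ha hb
  | smul a b _ hb => rw [smul_mul_assoc]; exact Submodule.smul_mem _ _ hb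

theorem sideSub_fst {side : Side} (hs : side = .R) {H : Subgroup W} {g : W × W}
    (hg : g ∈ sideSub side H) : g.1 = 1 := by
  subst hs; exact Subgroup.mem_bot.1 (Subgroup.mem_prod.1 hg).1

theorem sideSub_snd {side : Side} (hs : side = .L) {H : Subgroup W} {g : W × W}
    (hg : g ∈ sideSub side H) : g.2 = 1 := by
  subst hs; exact Subgroup.mem_bot.1 (Subgroup.mem_prod.1 hg).2

theorem actH_mem_span {side : Side} {P : Set W}
    (hP : ∀ x y, arrow φ side x y → y ∈ P → x ∈ P) (g : SideGroup W side) {h : Hecke cs φ}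
    (hh : h ∈ Submodule.span (GrpRing Γ) (Hecke.C φ '' P)) :
    actH φ g.1 h ∈ Submodule.span (GrpRing Γ) (Hecke.C φ '' P) := by
  rw [actH_apply]
  have h1 : Hecke.T φ g.1.1 * h ∈ Submodule.span (GrpRing Γ) (Hecke.C φ '' P) := by
    by_cases hs : side = .R
    · rw [sideSub_fst hs g.2, Hecke.T_one, one_mul]; exact hh
    · exact mul_mem_span φ hs hP _ hh
  by_cases hs : side = .L
  · rw [sideSub_snd hs g.2, inv_one, Hecke.T_one, mul_one]; exact h1
  · exact mem_span_mul φ hs hP _ h1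

theorem le_closed (side : Side) (D : Set W) (x y : W) (h : arrow φ side x y)
    (hy : y ∈ {x | ∃ c ∈ D, cellLE φ side x c}) : x ∈ {x | ∃ c ∈ D, cellLE φ side x c} := by
  obtain ⟨c, hc, hyc⟩ := hy
  exact ⟨c, hc, .trans (.single h) hyc⟩

theorem lt_closed (side : Side) (D : Set W) (x y : W) (h : arrow φ side x y)
    (hy : y ∈ {x | ∃ c ∈ D, cellLE φ side x c ∧ ¬ cellLE φ side c x}) :
    x ∈ {x | ∃ c ∈ D, cellLE φ side x c ∧ ¬ cellLE φ side c x} := by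
  obtain ⟨c, hc, hyc, hn⟩ := hy
  exact ⟨c, hc, .trans (.single h) hyc, fun h' => hn (.trans h' (.single h))⟩

/-- The `ℤ[Γ]`-module `M_D`, the quotient of `leIdeal` by `ltIdeal`. -/
abbrev CellMod (side : Side) (D : Set W) : Type (max v w) :=
  leIdeal φ side D ⧸ (ltIdeal φ side D).submoduleOf (leIdeal φ side D)

theorem actH_mem_leIdeal (side : Side) (D : Set W) (g : SideGroup W side) {h : Hecke cs φ}
    (hh : h ∈ leIdeal φ side D) : actH φ g.1 h ∈ leIdeal φ side D :=
  actH_mem_span φ (le_closed φ side D) g hh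

theorem actH_mem_ltIdeal (side : Side) (D : Set W) (g : SideGroup W side) {h : Hecke cs φ}
    (hh : h ∈ ltIdeal φ side D) : actH φ g.1 h ∈ ltIdeal φ side D :=
  actH_mem_span φ (lt_closed φ side D) g hh

/-- The operator induced by `actH` on `leIdeal`. -/
def actLe (side : Side) (D : Set W) (g : SideGroup W side) :
    leIdeal φ side D →ₗ[GrpRing Γ] leIdeal φ side D :=
  (actH φ g.1).restrict fun _ hh => actH_mem_leIdeal φ side D g hh

theorem actLe_coe (side : Side) (D : Set W) (g : SideGroup W side) (x : leIdeal φ side D) :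
    (actLe φ side D g x).1 = actH φ g.1 x.1 := rfl

theorem actLe_mem_ltIdeal (side : Side) (D : Set W) (g : SideGroup W side) (x : leIdeal φ side D)
    (hx : x.1 ∈ ltIdeal φ side D) : (actLe φ side D g x).1 ∈ ltIdeal φ side D := by
  rw [actLe_coe]; exact actH_mem_ltIdeal φ side D g hx

theorem actLe_mem (side : Side) (D : Set W) (g : SideGroup W side) :
    (ltIdeal φ side D).submoduleOf (leIdeal φ side D) ≤
      ((ltIdeal φ side D).submoduleOf (leIdeal φ side D)).comap (actLe φ side D g) :=
  fun x hx => actLe_mem_ltIdeal φ side D g x hx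

/-- The operator induced by `actH` on `M_D`. -/
def actM (side : Side) (D : Set W) (g : SideGroup W side) :
    CellMod φ side D →ₗ[GrpRing Γ] CellMod φ side D :=
  Submodule.mapQ _ _ (actLe φ side D g) (actLe_mem φ side D g)

/-- The abelian group `ℤ M_D = ℤ ⊗_{ℤ[Γ]} M_D`. -/
def ZCell (side : Side) (D : Set W) : Type (max v w) :=
  TensorProduct (GrpRing Γ) (AugInt Γ) (CellMod φ side D)

instance (side : Side) (D : Set W) : AddCommGroup (ZCell φ side D) :=
  inferInstanceAs (AddCommGroup (TensorProduct (GrpRing Γ) (AugInt Γ) (CellMod φ side D)))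

/-- The operator on `ℤ M_D` induced by `h ↦ T_u h T_{v⁻¹}`. -/
def actZ (side : Side) (D : Set W) (g : SideGroup W side) : Module.End ℤ (ZCell φ side D) :=
  AddMonoidHom.toIntLinearMap
    (show ZCell φ side D →+ ZCell φ side D from
      ((actM φ side D g).lTensor (AugInt Γ)).toAddMonoidHom)

/-- The element `n ⊗ [h]` of `ℤ M_D`. -/
def ztmul (side : Side) (D : Set W) (n : ℤ) (h : leIdeal φ side D) : ZCell φ side D :=
  TensorProduct.tmul (GrpRing Γ) (show AugInt Γ from n) (Submodule.Quotient.mk h)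

theorem zcell_ext (side : Side) (D : Set W) {f g : Module.End ℤ (ZCell φ side D)}
    (h : ∀ n x, f (ztmul φ side D n x) = g (ztmul φ side D n x)) : f = g := by
  ext z
  refine TensorProduct.induction_on (R := GrpRing Γ) (M := AugInt Γ) (N := CellMod φ side D)
    (motive := fun z => f z = g z) z ?_ ?_ ?_
  · exact (map_zero f).trans (map_zero g).symm
  · intro n x
    obtain ⟨x, rfl⟩ := Submodule.Quotient.mk_surjective _ x
    exact h n x
  · intro a b ha hb
    exact (map_add f a b).trans ((congrArg₂ _ ha hb).trans (map_add g a b).symm)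

theorem actZ_ztmul (side : Side) (D : Set W) (g : SideGroup W side) (n : ℤ)
    (h : leIdeal φ side D) : actZ φ side D g (ztmul φ side D n h) =
      ztmul φ side D n ⟨actH φ g.1 h.1, actH_mem_leIdeal φ side D g h.2⟩ := rfl

theorem ztmul_sub (side : Side) (D : Set W) (n : ℤ) (x y : leIdeal φ side D) :
    ztmul φ side D n (x - y) = ztmul φ side D n x - ztmul φ side D n y :=
  TensorProduct.tmul_sub (R := GrpRing Γ) (M := AugInt Γ) _ (Submodule.Quotient.mk x)
    (Submodule.Quotient.mk y)

theorem ztmul_eq_zero (side : Side) (D : Set W) (n : ℤ) (x : leIdeal φ side D)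
    (hx : x ∈ RingHom.ker (aug Γ) • (⊤ : Submodule (GrpRing Γ) (leIdeal φ side D))) :
    ztmul φ side D n x = 0 := by
  refine Submodule.smul_induction_on hx ?_ ?_
  · intro a ha y _
    change TensorProduct.tmul (GrpRing Γ) (show AugInt Γ from n)
      (a • (Submodule.Quotient.mk y : CellMod φ side D)) = 0
    rw [← TensorProduct.smul_tmul, smul_augInt, (RingHom.mem_ker).1 ha, zero_mul]
    exact TensorProduct.zero_tmul _ _
  · intro a b ha hb
    have := ztmul_sub φ side D n (a + b) b
    rw [add_sub_cancel_right, ha, hb, sub_zero] at this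
    exact this.symm

theorem T_mul_T_sub_mem (x y : W) : Hecke.T φ x * Hecke.T φ y - Hecke.T φ (x * y) ∈
    RingHom.ker (aug Γ) • (⊤ : Submodule (GrpRing Γ) (Hecke cs φ)) := by
  obtain ⟨n, hn⟩ : ∃ n, cs.length x = n := ⟨_, rfl⟩
  induction n generalizing x with
  | zero => rw [cs.length_eq_zero_iff.1 hn, Hecke.T_one, one_mul, one_mul, sub_self]
            exact zero_mem _
  | succ n ih =>
    have hx : x ≠ 1 := by rintro rfl; simp at hn
    obtain ⟨i, hi⟩ := cs.exists_leftDescent_of_ne_one hx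
    have hi' := cs.isLeftDescent_iff.1 hi
    have e : Hecke.T φ x * Hecke.T φ y - Hecke.T φ (x * y) =
        Hecke.T φ (cs.simple i) * (Hecke.T φ (cs.simple i * x) * Hecke.T φ y -
          Hecke.T φ (cs.simple i * x * y)) +
        (Hecke.T φ (cs.simple i) * Hecke.T φ (cs.simple i * x * y) - Hecke.T φ (x * y)) := by
      rw [Hecke.T_eq_of_isLeftDescent φ i x hi, mul_sub, ← mul_assoc]; abel
    rw [e]
    refine add_mem ?_ ?_
    · refine Submodule.smul_induction_on (ih (cs.simple i * x) (by omega)) ?_ ?_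
      · intro a ha z _
        rw [mul_smul_comm]
        exact Submodule.smul_mem_smul ha trivial
      · intro a b ha hb
        rw [mul_add]; exact add_mem ha hb
    · rw [Hecke.T_simple_mul_T]
      have : cs.simple i * (cs.simple i * x * y) = x * y := by simp [← mul_assoc]
      rw [this]
      split_ifs
      · rw [sub_self]; exact zero_mem _
      · rw [add_sub_cancel_left]
        refine Submodule.smul_mem_smul ?_ trivial
        rw [RingHom.mem_ker, Hecke.qpar, map_sub, aug_expo, aug_expo, sub_self]

theorem mul_mem_smul {side : Side} (D : Set W) (hs : side ≠ .R) {z : Hecke cs φ}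
    (hz : z ∈ RingHom.ker (aug Γ) • (⊤ : Submodule (GrpRing Γ) (Hecke cs φ)))
    {x : Hecke cs φ} (hx : x ∈ leIdeal φ side D) :
    z * x ∈ RingHom.ker (aug Γ) • leIdeal φ side D := by
  refine Submodule.smul_induction_on hz ?_ ?_
  · intro a ha y _
    rw [smul_mul_assoc]
    exact Submodule.smul_mem_smul ha (mul_mem_span φ hs (le_closed φ side D) _ hx)
  · intro a b ha hb
    rw [add_mul]; exact add_mem ha hb

theorem mem_smul_mul {side : Side} (D : Set W) (hs : side ≠ .L) {z : Hecke cs φ}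
    (hz : z ∈ RingHom.ker (aug Γ) • (⊤ : Submodule (GrpRing Γ) (Hecke cs φ)))
    {x : Hecke cs φ} (hx : x ∈ leIdeal φ side D) :
    x * z ∈ RingHom.ker (aug Γ) • leIdeal φ side D := by
  refine Submodule.smul_induction_on hz ?_ ?_
  · intro a ha y _
    rw [mul_smul_comm]
    exact Submodule.smul_mem_smul ha (mem_span_mul φ hs (le_closed φ side D) _ hx)
  · intro a b ha hb
    rw [mul_add]; exact add_mem ha hb

theorem actH_mul_sub_mem (side : Side) (D : Set W) (g k : SideGroup W side) {x : Hecke cs φ}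
    (hx : x ∈ leIdeal φ side D) : actH φ g.1 (actH φ k.1 x) - actH φ (g.1 * k.1) x ∈
      RingHom.ker (aug Γ) • leIdeal φ side D := by
  have e : actH φ g.1 (actH φ k.1 x) - actH φ (g.1 * k.1) x =
      (Hecke.T φ g.1.1 * Hecke.T φ k.1.1 - Hecke.T φ (g.1.1 * k.1.1)) *
        (x * (Hecke.T φ k.1.2⁻¹ * Hecke.T φ g.1.2⁻¹)) +
      (Hecke.T φ (g.1.1 * k.1.1) * x) *
        (Hecke.T φ k.1.2⁻¹ * Hecke.T φ g.1.2⁻¹ - Hecke.T φ (k.1.2⁻¹ * g.1.2⁻¹)) := by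
    simp only [actH_apply, Prod.fst_mul, Prod.snd_mul, mul_inv_rev, mul_sub, sub_mul, mul_assoc]
    abel
  rw [e]
  refine add_mem ?_ ?_
  · by_cases hs : side = .R
    · rw [sideSub_fst hs g.2, sideSub_fst hs k.2]
      simp [Hecke.T_one]
    · refine mul_mem_smul φ D hs (T_mul_T_sub_mem φ _ _) ?_
      by_cases hs' : side = .L
      · rw [sideSub_snd hs' g.2, sideSub_snd hs' k.2]
        simpa [Hecke.T_one] using hx
      · exact mem_span_mul φ hs' (le_closed φ side D) _ hx
  · by_cases hs : side = .L
    · rw [sideSub_snd hs g.2, sideSub_snd hs k.2]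
      simp [Hecke.T_one]
    · refine mem_smul_mul φ D hs (T_mul_T_sub_mem φ _ _) ?_
      by_cases hs' : side = .R
      · rw [sideSub_fst hs' g.2, sideSub_fst hs' k.2]
        simpa [Hecke.T_one] using hx
      · exact mul_mem_span φ hs' (le_closed φ side D) _ hx

/-- The module `ℤ M_D` as a representation of `SideGroup W side`. -/
def cellRep (side : Side) (D : Set W) :
    Representation ℤ (SideGroup W side) (ZCell φ side D) where
  toFun g := actZ φ side D g
  map_one' := by
    refine zcell_ext φ side D fun n x => ?_
    rw [actZ_ztmul]
    congr 1
    apply Subtype.ext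
    simp [actH_apply, Hecke.T_one]
  map_mul' g k := by
    refine zcell_ext φ side D fun n x => ?_
    rw [Module.End.mul_apply, actZ_ztmul, actZ_ztmul, actZ_ztmul, eq_comm, ← sub_eq_zero,
      ← ztmul_sub]
    refine ztmul_eq_zero φ side D n _ (mem_smul_top _ ?_)
    exact actH_mul_sub_mem φ side D g k x.2

/-- The cell module `ℤ M_D`, as a module over the group ring of `SideGroup W side`. -/
abbrev CellModule (side : Side) (D : Set W) : Type (max v w) := (cellRep φ side D).asModule

end Cells
end Order


/-! ### Positive subsets of an abelian group -/

section Positive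

open scoped Pointwise

/-- Positive subsets of an abelian group. -/
@[ext]
structure PosSubset (Λ : Type u) [AddCommGroup Λ] where
  carrier : Set Λ
  union_neg : carrier ∪ -carrier = Set.univ
  add_subset : carrier + carrier ⊆ carrier
  exists_addSubgroup : ∃ K : AddSubgroup Λ, (K : Set Λ) = carrier ∩ -carrier

variable {Λ : Type u} [AddCommGroup Λ]

namespace PosSubset

variable (X : PosSubset Λ)

theorem mem_or_neg_mem (l : Λ) : l ∈ X.carrier ∨ -l ∈ X.carrier := by
  have : l ∈ X.carrier ∪ -X.carrier := by rw [X.union_neg]; trivial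
  simpa using this

theorem add_mem {a b : Λ} (ha : a ∈ X.carrier) (hb : b ∈ X.carrier) : a + b ∈ X.carrier :=
  X.add_subset (Set.add_mem_add ha hb)

/-- The subgroup `X ∩ (-X)`. -/
def lin : AddSubgroup Λ where
  carrier := X.carrier ∩ -X.carrier
  zero_mem' := by
    obtain ⟨K, hK⟩ := X.exists_addSubgroup
    rw [← hK]; exact K.zero_mem
  add_mem' {a b} ha hb := by
    obtain ⟨K, hK⟩ := X.exists_addSubgroup
    have ha' : a ∈ (K : Set Λ) := hK ▸ ha
    have hb' : b ∈ (K : Set Λ) := hK ▸ hb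
    rw [← hK]
    exact K.add_mem ha' hb'
  neg_mem' {a} ha := by
    obtain ⟨K, hK⟩ := X.exists_addSubgroup
    have ha' : a ∈ (K : Set Λ) := hK ▸ ha
    rw [← hK]
    exact K.neg_mem ha'

/-- The quotient `Γ_X = Λ / (X ∩ (-X))`. -/
def GammaQuot : Type u := Λ ⧸ X.lin

instance : AddCommGroup X.GammaQuot := inferInstanceAs (AddCommGroup (Λ ⧸ X.lin))

/-- The canonical morphism `Λ → Γ_X`. -/
def can : Λ →+ X.GammaQuot := QuotientAddGroup.mk' X.lin

theorem can_surjective (a : X.GammaQuot) : ∃ l, X.can l = a := QuotientAddGroup.mk'_surjective X.lin a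

theorem can_eq_iff {l l' : Λ} : X.can l = X.can l' ↔ -l + l' ∈ X.lin := QuotientAddGroup.eq

theorem mem_of_can_eq {l l' : Λ} (h : X.can l = X.can l') (hl : l ∈ X.carrier) :
    l' ∈ X.carrier := by
  have := X.add_mem hl (X.can_eq_iff.1 h).1
  simpa using this

/-- The total order on `Γ_X`: `a ≤ b` if some representative of `b - a` belongs to `X`. -/
instance : LinearOrder X.GammaQuot where
  le a b := ∃ l ∈ X.carrier, X.can l = b - a
  le_refl a := ⟨0, X.lin.zero_mem.1, by simp⟩
  le_trans a b c := by
    rintro ⟨l, hl, h1⟩ ⟨l', hl', h2⟩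
    exact ⟨l + l', X.add_mem hl hl', by rw [map_add, h1, h2]; abel⟩
  le_antisymm a b := by
    rintro ⟨l, hl, h1⟩ ⟨l', hl', h2⟩
    have h3 : X.can l' = X.can (-l) := by rw [map_neg, h1, h2]; abel
    have h4 : l ∈ X.lin := ⟨hl, X.mem_of_can_eq h3 hl'⟩
    have h5 : X.can l = 0 := (QuotientAddGroup.eq_zero_iff l).2 h4
    rw [h5] at h1
    exact (sub_eq_zero.1 h1.symm).symm
  le_total a b := by
    obtain ⟨l, hl⟩ := X.can_surjective (b - a)
    rcases X.mem_or_neg_mem l with h | h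
    · exact Or.inl ⟨l, h, hl⟩
    · exact Or.inr ⟨-l, h, by rw [map_neg, hl]; abel⟩
  toDecidableLE := Classical.decRel _

theorem le_def (a b : X.GammaQuot) : a ≤ b ↔ ∃ l ∈ X.carrier, X.can l = b - a := Iff.rfl

instance : IsOrderedAddMonoid X.GammaQuot where
  add_le_add_left a b h c := by
    obtain ⟨l, hl, h⟩ := h
    exact ⟨l, hl, by rw [h]; abel⟩

/-- The positive subset `Pos(f) = {l | f(l) ≥ 0}` attached to a morphism into a totally ordered
abelian group. -/
def ofHom {Γ : Type w} [AddCommGroup Γ] [LinearOrder Γ] [IsOrderedAddMonoid Γ] (f : Λ →+ Γ) :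
    PosSubset Λ where
  carrier := {l | 0 ≤ f l}
  union_neg := by
    ext l
    simpa using le_total 0 (f l)
  add_subset := by
    rintro _ ⟨a, ha, b, hb, rfl⟩
    simpa using add_nonneg (show 0 ≤ f a from ha) (show 0 ≤ f b from hb)
  exists_addSubgroup := by
    refine ⟨f.ker, ?_⟩
    ext l
    simp [le_antisymm_iff, and_comm]

/-- The open set `U(E) = {X | X ∩ E = ∅}`. -/
def avoid (E : Set Λ) : Set (PosSubset Λ) := {X | X.carrier ∩ E = ∅}

/-- The topology on the set of positive subsets: `U` is open if for every `X ∈ U` there is a finite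
`E` with `X ∈ U(E) ⊆ U`. -/
instance : TopologicalSpace (PosSubset Λ) where
  IsOpen U := ∀ X ∈ U, ∃ E : Set Λ, E.Finite ∧ X ∈ avoid E ∧ avoid E ⊆ U
  isOpen_univ X _ := ⟨∅, Set.finite_empty, by simp [avoid], Set.subset_univ _⟩
  isOpen_inter U V hU hV X hX := by
    obtain ⟨E, hE, h1, h2⟩ := hU X hX.1
    obtain ⟨F, hF, h3, h4⟩ := hV X hX.2
    refine ⟨E ∪ F, hE.union hF, ?_, fun Y hY => ?_⟩
    · simp only [avoid, Set.mem_ofPred_eq, Set.inter_union_distrib_left, Set.union_empty_iff]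
      exact ⟨h1, h3⟩
    · simp only [avoid, Set.mem_ofPred_eq, Set.inter_union_distrib_left,
        Set.union_empty_iff] at hY
      exact ⟨h2 hY.1, h4 hY.2⟩
  isOpen_sUnion S hS X hX := by
    obtain ⟨U, hU, hXU⟩ := hX
    obtain ⟨E, hE, h1, h2⟩ := hS U hU X hXU
    exact ⟨E, hE, h1, h2.trans (Set.subset_sUnion_of_mem hU)⟩

/-- The rational hyperplane `H_l = {X | l ∈ X ∩ (-X)}` (for `l ≠ 0`). -/
def hyp (l : Λ) : Set (PosSubset Λ) := {X | l ∈ X.carrier ∩ -X.carrier}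

/-- `X` and `Y` lie on the same side of the rational hyperplane `H`: they belong to the same one
among `U(l)`, `H_l`, `U(-l)`, where `H = H_l`. -/
def SameSide (H : Set (PosSubset Λ)) (X Y : PosSubset Λ) : Prop :=
  ∀ l : Λ, l ≠ 0 → H = hyp l → (X ∈ avoid {l} ↔ Y ∈ avoid {l}) ∧ (X ∈ hyp l ↔ Y ∈ hyp l) ∧
    (X ∈ avoid {-l} ↔ Y ∈ avoid {-l})

/-- A finite set of rational hyperplanes. -/
def IsArrangement (𝔄 : Set (Set (PosSubset Λ))) : Prop :=
  𝔄.Finite ∧ ∀ H ∈ 𝔄, ∃ l : Λ, l ≠ 0 ∧ H = hyp l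

/-- The facets of an arrangement: the classes of the relation of being on the same side of all its
hyperplanes. -/
def IsFacet (𝔄 : Set (Set (PosSubset Λ))) (F : Set (PosSubset Λ)) : Prop :=
  ∃ X, F = {Y | ∀ H ∈ 𝔄, SameSide H X Y}

/-- The chambers of an arrangement: the facets which meet none of its hyperplanes. -/
def IsChamber (𝔄 : Set (Set (PosSubset Λ))) (F : Set (PosSubset Λ)) : Prop :=
  IsFacet 𝔄 F ∧ ∀ H ∈ 𝔄, F ∩ H = ∅

end PosSubset

end Positive

/-! ### The conjectures -/

open PosSubset

/-- The free abelian group `ℤ[S̄]`. -/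
abbrev Lam (cs : CoxeterSystem M W) : Type u := SBar cs →₀ ℤ

variable {cs}

/-- The basis element of `ℤ[S̄]` attached to a class. -/
def bas (ω : SBar cs) : Lam cs := Finsupp.single ω 1

/-- The morphism `ℤ[S̄] → Γ` extending a map `S̄ → Γ`. -/
def extHom (φ : SBar cs → Γ) : Lam cs →+ Γ := (Finsupp.linearCombination ℤ φ).toAddMonoidHom

/-- The positive subset `Pos(φ)` of `ℤ[S̄]`. -/
def PosOf [LinearOrder Γ] [IsOrderedAddMonoid Γ] (φ : SBar cs → Γ) : PosSubset (Lam cs) :=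
  ofHom (extHom φ)

/-- The canonical map `φ_X : S̄ → Γ_X`. -/
def phi (X : PosSubset (Lam cs)) : SBar cs → X.GammaQuot := fun ω => X.can (bas ω)

variable (cs)

/-- The standard parabolic subgroup generated by the `ω ∈ S̄` with `F ⊆ H_ω`. -/
def facetParabolic (F : Set (PosSubset (Lam cs))) : Subgroup W :=
  Subgroup.closure {x | ∃ i, x = cs.simple i ∧ F ⊆ hyp (bas (cls cs i))}

/-- An arrangement is complete if it contains all the hyperplanes `H_ω`, `ω ∈ S̄`. -/
def IsComplete (𝔄 : Set (Set (PosSubset (Lam cs)))) : Prop :=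
  ∀ ω : SBar cs, hyp (bas ω) ∈ 𝔄

variable {cs} in
/-- `D` is a union of cells. -/
def IsUnionOfCells [LinearOrder Γ] [IsOrderedAddMonoid Γ] (φ : SBar cs → Γ) (side : Side)
    (D : Set W) : Prop :=
  ∃ S : Set (Set W), (∀ E ∈ S, IsCell φ side E) ∧ D = ⋃₀ S

/-- The statements (a) and (b) of Conjecture A, for all three types of cells, for a given
arrangement. -/
def CondA (𝔄 : Set (Set (PosSubset (Lam cs)))) : Prop :=
  ∀ (side : Side) (F : Set (PosSubset (Lam cs))), IsFacet 𝔄 F →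
    (∀ X ∈ F, ∀ Y ∈ F, cellRel (phi X) side = cellRel (phi Y) side) ∧
    (∀ X ∈ F, ∀ D : Set W, IsCell (phi X) side D ↔
      Minimal (fun E : Set W => E.Nonempty ∧
        (∀ K, IsChamber 𝔄 K → F ⊆ closure K → ∀ Y ∈ K, IsUnionOfCells (phi Y) side E) ∧
        IsTransStable side (facetParabolic cs F) E) D)

/-- The finite complete rational hyperplane arrangements satisfying Conjecture A. -/
def arrangementsA : Set (Set (Set (PosSubset (Lam cs)))) :=
  {𝔄 | IsArrangement 𝔄 ∧ IsComplete cs 𝔄 ∧ CondA cs 𝔄}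

/-- Conjecture A. -/
def ConjectureA : Prop := ∃ 𝔄, 𝔄 ∈ arrangementsA cs

/-- `𝔄` is the set of essential hyperplanes: the smallest arrangement satisfying Conjecture A. -/
def IsEssential (𝔄 : Set (Set (PosSubset (Lam cs)))) : Prop := IsLeast (arrangementsA cs) 𝔄

variable {cs} in
/-- The cells for `Y` contained in `D`. -/
abbrev Subcells (side : Side) (Y : PosSubset (Lam cs)) (D : Set W) : Type v :=
  {E : Set W // IsCell (phi Y) side E ∧ E ⊆ D}

/-- Conjecture B. The blocks of the partition of the cells contained in `D` are the fibres of `κ`. -/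
def ConjectureB : Prop :=
  ∃ 𝔄, IsEssential cs 𝔄 ∧
    ∀ (side : Side) (X : PosSubset (Lam cs)) (D : Set W), IsCell (phi X) side D →
      ∀ K, IsChamber 𝔄 K → X ∈ closure K → ∀ Y ∈ K,
        ∃ (d : ℕ) (κ : Subcells side Y D → Fin d), Function.Surjective κ ∧
          (∀ i j, (∃ x ∈ i.1, ∃ y ∈ j.1, cellLE (phi Y) side x y) → κ i ≤ κ j) ∧
          ∃ N : Fin (d + 1) →
              Submodule (MonoidAlgebra ℤ (SideGroup W side)) (CellModule (phi X) side D),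
            Monotone N ∧ N 0 = ⊥ ∧ N (Fin.last d) = ⊤ ∧
            ∀ k : Fin d, Nonempty
              ((N k.succ ⧸ (N k.castSucc).submoduleOf (N k.succ))
                ≃ₗ[MonoidAlgebra ℤ (SideGroup W side)]
                (DirectSum {i : Subcells side Y D // κ i = k}
                  fun i => CellModule (phi Y) side i.1.1))

/-! ### The concrete form of Conjecture A when `|S̄| = 2` -/

section Two

variable {cs}

/-- The sequence `r₀ = 0 < r₁ < ⋯ < r_m < r_{m+1} = ∞`, where `r i` stands for `r_{i+1}`. -/
def ratio {m : ℕ} (r : Fin m → ℚ) (i : ℕ) : WithTop ℚ :=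
  if i = 0 then 0 else if h : i - 1 < m then ((r ⟨i - 1, h⟩ : ℚ) : WithTop ℚ) else ⊤

/-- The chamber `𝒞_i`: the `X` such that `r_i a < b < r_{i+1} a` and `a > 0`, where `a = φ_X(ω₁)`
and `b = φ_X(ω₂)`. -/
def chamberC (ω₁ ω₂ : SBar cs) {m : ℕ} (r : Fin m → ℚ) (i : ℕ) : Set (PosSubset (Lam cs)) :=
  {X | 0 < phi X ω₁ ∧
    (∀ q : ℚ, ratio r i = q → q.num • phi X ω₁ < q.den • phi X ω₂) ∧
    (∀ q : ℚ, ratio r (i + 1) = q → q.den • phi X ω₂ < q.num • phi X ω₁)}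

/-- `X_q⁺ = {λ ω₁ + μ ω₂ | λ + q μ ≥ 0}`. -/
def Xplus (ω₁ ω₂ : SBar cs) (q : ℚ) : PosSubset (Lam cs) :=
  ofHom
    { toFun := fun l => (l ω₁ : ℚ) + q * (l ω₂ : ℚ)
      map_zero' := by simp
      map_add' := fun l l' => by simp only [Finsupp.add_apply, Int.cast_add]; ring }

/-- `X_∞⁺ = {λ ω₁ + μ ω₂ | μ ≥ 0}`. -/
def XplusTop (ω₂ : SBar cs) : PosSubset (Lam cs) := ofHom (Finsupp.applyAddHom ω₂)

variable (cs) in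
/-- The standard parabolic subgroup generated by the simple reflections in `ω`. -/
def classParabolic (ω : SBar cs) : Subgroup W :=
  Subgroup.closure {x | ∃ i, x = cs.simple i ∧ cls cs i = ω}

variable (cs) in
/-- Conjecture A'' for `S̄ = {ω₁, ω₂}` and the rational numbers `0 < r₁ < ⋯ < r_m`. -/
def ConjectureA'' (ω₁ ω₂ : SBar cs) (m : ℕ) (r : Fin m → ℚ) : Prop :=
  (ω₁ ≠ ω₂ ∧ ∀ ω, ω = ω₁ ∨ ω = ω₂) ∧ StrictMono r ∧ (∀ i, 0 < r i) ∧
  ∀ (side : Side)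
    (Γ : Type w) [AddCommGroup Γ] [LinearOrder Γ] [IsOrderedAddMonoid Γ]
    (Γ' : Type w) [AddCommGroup Γ'] [LinearOrder Γ'] [IsOrderedAddMonoid Γ']
    (φ : SBar cs → Γ) (φ' : SBar cs → Γ'),
    (∀ i ≤ m, PosOf φ ∈ chamberC ω₁ ω₂ r i → PosOf φ' ∈ chamberC ω₁ ω₂ r i →
      cellRel φ side = cellRel φ' side) ∧
    (∀ i : Fin m, PosOf φ ∈ chamberC ω₁ ω₂ r i → PosOf φ' ∈ chamberC ω₁ ω₂ r (i + 1) →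
      cellRel (phi (Xplus ω₁ ω₂ (r i))) side = cellRel φ side ⊔ cellRel φ' side) ∧
    (PosOf φ ∈ chamberC ω₁ ω₂ r 0 →
      cellRel (phi (Xplus ω₁ ω₂ 0)) side =
        cellRel φ side ⊔ transRel side (classParabolic cs ω₂)) ∧
    (PosOf φ ∈ chamberC ω₁ ω₂ r m →
      cellRel (phi (XplusTop ω₂)) side =
        cellRel φ side ⊔ transRel side (classParabolic cs ω₁))

end Two

end KLCell
end

open KLCell KLCell.PosSubset

noncomputable section
namespace KLCell
set_option linter.unusedSectionVars false

/-! ### Alternating words in dihedral groups -/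

/-! Write a, b for the parameters of s and t, w₀ for the longest element (of length 2m), and w₁ =
w₀t = tw₀. Elements of W are alternating words. Since st has even order, any choice of signs on s
and t extends to a character of W (`exists_sign`). Twisting T_w by it identifies Hecke algebras
whose parameters differ by signs and sends C_w to ±C_w. So the preorders depend only on |a| and |b|,
and after exchanging s and t one may assume 0 ≤ b ≤ a.

Explicit multiplication. If 0 ≤ b < a, or a = b > 0, then C_w is an eigenvector of T_s whenever w
starts with s. Such an eigenvector is determined by its coefficients on the words starting with s,
and checking these alone gives the products of C_s and C_t with the basis: `Cgen_mul_C_of_lt`,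
`Cgen_mul_C_of_gt`, `Cgen_mul_C_of_eq`. The left preorder is generated by these products. It is
`RelA` for 0 < b < a, `RelZ` for 0 = b < a, `RelE` for 0 < a = b, and everything is comparable when
a = b = 0. The right preorder follows by inversion, and a two-sided comparison is a right one
followed by a left one. For 0 < b < a the sets {1}, {t}, {w₁}, {w₀} are cells and the remaining
"core" is cut up by descents. At b = 0, t joins 1 and w₁ joins w₀; at a = b, t and w₁ join the core.

Conjecture A. The comparison of |a| with |b| is read from the signs of s - t and s + t, so the
facets of the four hyperplanes separate exactly these cases. On a diagonal the relation is the join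
of those of the two adjacent chambers (`cellRel_eq_sup_of_eq`). On an axis it is the join of one
adjacent chamber with a translation relation (`cellRel_eq_sup_of_zero`). Lexicographic perturbation
provides the adjacent chambers. The axes are forced by completeness and the diagonals by the fact
that {t} is a two-sided cell beside such a wall but not on it (`cellRel_ne_of_eq_of_lt`). Conjecture
A″ consists of the same join formulas at explicit points.

Conjecture B. Setting e^γ = 1 turns the Hecke algebra into the group ring and C_w into a basis c_w
(`cel`), so that cell modules become subquotients spanned by some of the c_w. If an equivariant map
compares the spans for X with those for Y (`IsComparable`), adding the Y-cells inside D one at a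
time along a linear extension of their order yields the filtration (`exists_filtration`). The
identity is such a comparison except for one kind of one-sided cell at b = 0, namely the core left
cell whose elements end with t and its inverse. There multiplication by 1 + t is used
(`isComparable_left_of_zero_of_isCore`). -/

/-- `M` is the Coxeter matrix of a dihedral group of order `4 m`, with generators `s` and `t`. -/
structure IsDihedral {B : Type u} (M : CoxeterMatrix B) (s t : B) (m : ℕ) : Prop where
  ne : s ≠ t
  all : ∀ i, i = s ∨ i = t
  two_le : 2 ≤ m
  eq : M s t = 2 * m

theorem IsDihedral.symm {B : Type u} {M : CoxeterMatrix B} {s t : B} {m : ℕ}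
    (H : IsDihedral M s t m) : IsDihedral M t s m :=
  ⟨H.ne.symm, fun i => (H.all i).symm, H.two_le, by rw [M.symmetric]; exact H.eq⟩

section Alt

variable {B : Type u} {W : Type v} [Group W] {M : CoxeterMatrix B} (cs : CoxeterSystem M W)

/-- The alternating product `s t s ⋯` with `k` factors. -/
def alt : B → B → ℕ → W
  | _, _, 0 => 1
  | s, t, k + 1 => cs.simple s * alt t s k

variable (s t : B)

@[simp] theorem alt_zero : alt cs s t 0 = 1 := by rw [alt]

theorem alt_succ (k : ℕ) : alt cs s t (k + 1) = cs.simple s * alt cs t s k := by rw [alt]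

@[simp] theorem alt_one : alt cs s t 1 = cs.simple s := by simp [alt]

@[simp] theorem simple_mul_alt (k : ℕ) : cs.simple s * alt cs t s k = alt cs s t (k + 1) :=
  (alt_succ cs s t k).symm

@[simp] theorem simple_mul_alt_succ (k : ℕ) :
    cs.simple s * alt cs s t (k + 1) = alt cs t s k := by
  rw [alt_succ, cs.simple_mul_simple_cancel_left]

theorem alt_even (k : ℕ) : alt cs s t (2 * k) = (cs.simple s * cs.simple t) ^ k := by
  induction k with
  | zero => simp
  | succ k ih =>
    rw [show 2 * (k + 1) = 2 * k + 1 + 1 by ring, alt_succ, alt_succ, ih, pow_succ', mul_assoc]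

theorem alt_odd (k : ℕ) :
    alt cs s t (2 * k + 1) = (cs.simple s * cs.simple t) ^ k * cs.simple s := by
  induction k with
  | zero => simp
  | succ k ih =>
    rw [show 2 * (k + 1) + 1 = 2 * k + 1 + 1 + 1 by ring, alt_succ, alt_succ, ih, pow_succ']
    simp only [mul_assoc]

/-- Inversion reverses a word. An alternating word of even length then starts with the other letter,
while one of odd length is a palindrome. -/
theorem alt_even_inv (k : ℕ) : (alt cs s t (2 * k))⁻¹ = alt cs t s (2 * k) := by
  rw [alt_even, alt_even, ← inv_pow]; simp

theorem alt_odd_inv (k : ℕ) : (alt cs s t (2 * k + 1))⁻¹ = alt cs s t (2 * k + 1) := by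
  rw [inv_eq_iff_mul_eq_one]
  induction k with
  | zero => simp
  | succ k ih =>
    rw [alt_odd] at *
    rw [pow_succ]
    nth_rewrite 2 [← pow_succ]
    rw [pow_succ']
    have : ∀ x : W, x * (cs.simple s * cs.simple t) * cs.simple s *
      ((cs.simple s * cs.simple t) * x * cs.simple s) = x * cs.simple s * (x * cs.simple s) := by
      intro x; simp [mul_assoc]
    rw [this, ih]

theorem alt_inv_of_even {k : ℕ} (h : Even k) : (alt cs s t k)⁻¹ = alt cs t s k := by
  obtain ⟨j, rfl⟩ := h.exists_two_nsmul
  exact alt_even_inv cs s t j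

theorem alt_inv_of_odd {k : ℕ} (h : Odd k) : (alt cs s t k)⁻¹ = alt cs s t k := by
  obtain ⟨j, rfl⟩ := h
  exact alt_odd_inv cs s t j

variable {s t} {m : ℕ} (H : IsDihedral M s t m)
include H

/-- The braid relation: both words of length 2m give the longest element w₀. -/
theorem alt_top : alt cs s t (2 * m) = alt cs t s (2 * m) := by
  rw [← alt_even_inv cs s t, eq_inv_iff_mul_eq_one, alt_even, ← pow_add, ← two_mul, ← H.eq,
    cs.simple_mul_simple_pow]

/-- A concrete model of the group, needed only to see that alternating words of length at most 2m do
not collapse. -/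
theorem exists_dihedralHom : ∃ f : W →* DihedralGroup (2 * m),
    f (cs.simple s) = .sr 0 ∧ f (cs.simple t) = .sr 1 := by
  classical
  let g : B → DihedralGroup (2 * m) := fun i => if i = s then .sr 0 else .sr 1
  have hg : M.IsLiftable g := by
    have hs : g s = .sr 0 := if_pos rfl
    have ht : g t = .sr 1 := if_neg H.ne.symm
    have key : ∀ i, (g i * g i) ^ M i i = 1 := fun i => by
      rcases H.all i with rfl | rfl <;> simp [hs, ht]
    intro i j
    rcases H.all i with rfl | rfl <;> rcases H.all j with rfl | rfl
    · exact key _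
    · rw [hs, ht, H.eq]
      simp
    · rw [hs, ht, H.symm.eq]
      simp
    · exact key _
  refine ⟨cs.lift ⟨g, hg⟩, ?_, ?_⟩
  · rw [cs.lift_apply_simple hg]; exact if_pos rfl
  · rw [cs.lift_apply_simple hg]; exact if_neg H.ne.symm

omit H in
theorem dihedralHom_alt {f : W →* DihedralGroup (2 * m)} (hs : f (cs.simple s) = .sr 0)
    (ht : f (cs.simple t) = .sr 1) (k : ℕ) :
    f (alt cs s t (2 * k)) = .r k ∧ f (alt cs s t (2 * k + 1)) = .sr (-k) ∧
    f (alt cs t s (2 * k)) = .r (-k) ∧ f (alt cs t s (2 * k + 1)) = .sr (1 + k) := by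
  simp only [alt_even, alt_odd, map_mul, map_pow, hs, ht]
  have h1 : (DihedralGroup.sr (0 : ZMod (2 * m)) * .sr 1) ^ k = .r (k : ZMod (2 * m)) := by simp
  have h2 : (DihedralGroup.sr (1 : ZMod (2 * m)) * .sr 0) ^ k = .r (-k : ZMod (2 * m)) := by
    simp
  rw [h1, h2]
  simp

/-- In the model, even words are rotations and odd words are reflections. Within one parity the
exponent is at most m, hence determined modulo 2m. -/
theorem alt_injective {j k : ℕ} (hj : j ≤ 2 * m) (hk : k ≤ 2 * m)
    (h : alt cs s t j = alt cs s t k) : j = k := by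
  obtain ⟨f, hs, ht⟩ := exists_dihedralHom cs H
  have hm := H.two_le
  have h' := congrArg f h
  have key : ∀ a b : ℕ, a < 2 * m → b < 2 * m → (a : ZMod (2 * m)) = b → a = b := by
    intro a b ha hb hab
    rw [ZMod.natCast_eq_natCast_iff] at hab
    exact Nat.ModEq.eq_of_lt_of_lt hab ha hb
  rcases Nat.even_or_odd' j with ⟨a, rfl | rfl⟩ <;> rcases Nat.even_or_odd' k with ⟨b, rfl | rfl⟩
  · rw [(dihedralHom_alt cs hs ht a).1, (dihedralHom_alt cs hs ht b).1] at h'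
    rw [key a b (by omega) (by omega) (by simpa using h')]
  · rw [(dihedralHom_alt cs hs ht a).1, (dihedralHom_alt cs hs ht b).2.1] at h'
    simp at h'
  · rw [(dihedralHom_alt cs hs ht a).2.1, (dihedralHom_alt cs hs ht b).1] at h'
    simp at h'
  · rw [(dihedralHom_alt cs hs ht a).2.1, (dihedralHom_alt cs hs ht b).2.1] at h'
    rw [key a b (by omega) (by omega) (by simpa using h')]

theorem alt_eq_alt {j k : ℕ} (hj : j ≤ 2 * m) (hk : k ≤ 2 * m)
    (h : alt cs s t j = alt cs t s k) : j = k ∧ (j = 0 ∨ j = 2 * m) := by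
  obtain ⟨f, hs, ht⟩ := exists_dihedralHom cs H
  have hm := H.two_le
  have h' := congrArg f h
  have key : ∀ a : ℕ, (a : ZMod (2 * m)) = 0 → 2 * m ∣ a := fun a ha =>
    (ZMod.natCast_eq_zero_iff a (2 * m)).1 ha
  rcases Nat.even_or_odd' j with ⟨a, rfl | rfl⟩ <;> rcases Nat.even_or_odd' k with ⟨b, rfl | rfl⟩
  · rw [(dihedralHom_alt cs hs ht a).1, (dihedralHom_alt cs hs ht b).2.2.1] at h'
    -- Here a + b is a multiple of 2m with a, b ≤ m, so either both vanish or both equal m: the word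
    -- is 1 or w₀.
    have : ((a + b : ℕ) : ZMod (2 * m)) = 0 := by
      push_cast; rw [DihedralGroup.r.injEq] at h'; rw [h']; simp
    obtain ⟨c, hc⟩ := key _ this
    have : c < 2 := by by_contra hc'; nlinarith
    interval_cases c <;> omega
  · rw [(dihedralHom_alt cs hs ht a).1, (dihedralHom_alt cs hs ht b).2.2.2] at h'
    simp at h'
  · rw [(dihedralHom_alt cs hs ht a).2.1, (dihedralHom_alt cs hs ht b).2.2.1] at h'
    simp at h'
  · rw [(dihedralHom_alt cs hs ht a).2.1, (dihedralHom_alt cs hs ht b).2.2.2] at h'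
    -- For odd lengths a + b + 1 lies strictly between 0 and 2m, so the congruence is impossible.
    have : ((a + b + 1 : ℕ) : ZMod (2 * m)) = 0 := by
      push_cast; rw [DihedralGroup.sr.injEq] at h'
      rw [add_assoc, add_comm (b : ZMod (2 * m)), ← h']; simp
    obtain ⟨c, hc⟩ := key _ this
    have : c < 1 := by
      by_contra hc'
      have := Nat.mul_le_mul_left (2 * m) (not_lt.1 hc')
      omega
    interval_cases c; omega

/-- The bound by the length of the given word is kept because, applied to a reduced word, it shows
in `length_alt` that alternating words are reduced. -/
theorem exists_alt_wordProd (ω : List B) : ∃ k ≤ 2 * m, k ≤ ω.length ∧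
    (cs.wordProd ω = alt cs s t k ∨ cs.wordProd ω = alt cs t s k) := by
  have hm := H.two_le
  induction ω with
  | nil => exact ⟨0, by omega, le_rfl, by simp⟩
  | cons i ω ih =>
    have key : ∀ s t : B, IsDihedral M s t m → ∀ k ≤ 2 * m, k ≤ ω.length →
        cs.wordProd ω = alt cs s t k → ∃ k ≤ 2 * m, k ≤ (i :: ω).length ∧
        (cs.wordProd (i :: ω) = alt cs s t k ∨ cs.wordProd (i :: ω) = alt cs t s k) := by
      intro s t H k hk hkω h
      rw [cs.wordProd_cons, h, List.length_cons]
      rcases H.all i with rfl | rfl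
      · cases k with
        | zero => exact ⟨1, by omega, by omega, Or.inl (by simp)⟩
        | succ k => exact ⟨k, by omega, by omega, Or.inr (by simp)⟩
      · rcases hk.lt_or_eq with hk' | rfl
        · exact ⟨k + 1, by omega, by omega, Or.inr (by simp)⟩
        -- At w₀ a further letter cannot lengthen the word. The other expression of w₀ starts with
        -- that letter, which cancels.
        · rw [alt_top cs H]
          obtain ⟨l, hl⟩ : ∃ l, 2 * m = l + 1 := ⟨2 * m - 1, by omega⟩
          rw [hl, simple_mul_alt_succ]
          exact ⟨l, by omega, by omega, Or.inl rfl⟩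
    obtain ⟨k, hk, hkω, h | h⟩ := ih
    · exact key s t H k hk hkω h
    · obtain ⟨k', h1, h2, h3⟩ := key t s H.symm k hk hkω h
      exact ⟨k', h1, h2, h3.symm⟩

theorem exists_alt (x : W) : ∃ k ≤ 2 * m, x = alt cs s t k ∨ x = alt cs t s k := by
  obtain ⟨ω, -, rfl⟩ := cs.exists_isReduced x
  obtain ⟨k, hk, -, h⟩ := exists_alt_wordProd cs H ω
  exact ⟨k, hk, h⟩

/-- Case distinction along the elements of a dihedral group. -/
theorem alt_cases {P : W → Prop} (h0 : P 1) (h1 : ∀ k, 1 ≤ k → k ≤ 2 * m → P (alt cs s t k))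
    (h2 : ∀ k, 1 ≤ k → k < 2 * m → P (alt cs t s k)) (x : W) : P x := by
  obtain ⟨k, hk, hx⟩ := exists_alt cs H x
  have hm := H.two_le
  rcases Nat.eq_zero_or_pos k with rfl | h
  · have : x = 1 := by simpa using hx
    rwa [this]
  · rcases hx with rfl | rfl
    · exact h1 k h hk
    · rcases hk.lt_or_eq with hk | rfl
      · exact h2 k h hk
      · rw [← alt_top cs H]; exact h1 _ h le_rfl

omit H in
theorem length_alt_le (k : ℕ) : cs.length (alt cs s t k) ≤ k := by
  induction k generalizing s t with
  | zero => simp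
  | succ k ih =>
    rw [alt_succ]
    have h1 := cs.length_mul_le (cs.simple s) (alt cs t s k)
    have h2 := ih (s := t) (t := s)
    rw [cs.length_simple] at h1
    omega

theorem length_alt {k : ℕ} (hk : k ≤ 2 * m) : cs.length (alt cs s t k) = k := by
  refine le_antisymm (length_alt_le cs k) ?_
  obtain ⟨ω, hω, h⟩ := cs.exists_isReduced (alt cs s t k)
  obtain ⟨j, hj, hjω, h'⟩ := exists_alt_wordProd cs H ω
  rw [h, hω]
  rw [← h] at h'
  rcases h' with h' | h'
  · rw [alt_injective cs H hk hj h']; exact hjω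
  · rw [(alt_eq_alt cs H hk hj h').1]; exact hjω

theorem alt_inj {j k : ℕ} (hj : j ≤ 2 * m) (hk : k ≤ 2 * m) :
    alt cs s t j = alt cs s t k ↔ j = k :=
  ⟨alt_injective cs H hj hk, fun h => h ▸ rfl⟩

theorem alt_eq_alt_iff {j k : ℕ} (hj : j ≤ 2 * m) (hk : k ≤ 2 * m) :
    alt cs s t j = alt cs t s k ↔ j = k ∧ (j = 0 ∨ j = 2 * m) := by
  refine ⟨alt_eq_alt cs H hj hk, ?_⟩
  rintro ⟨rfl, rfl | rfl⟩
  · simp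
  · exact alt_top cs H

theorem alt_eq_one_iff {k : ℕ} (hk : k ≤ 2 * m) : alt cs s t k = 1 ↔ k = 0 := by
  rw [← alt_zero cs s t, alt_inj cs H hk (by omega)]

include cs in
theorem finite_of_isDihedral : Finite W := by
  refine Set.finite_univ_iff.1 (Set.Finite.subset
    (((Finset.range (2 * m + 1)).finite_toSet.image (alt cs s t)).union
      ((Finset.range (2 * m + 1)).finite_toSet.image (alt cs t s))) ?_)
  intro x _
  obtain ⟨k, hk, h | h⟩ := exists_alt cs H x
  · exact Or.inl ⟨k, by simp; omega, h.symm⟩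
  · exact Or.inr ⟨k, by simp; omega, h.symm⟩

/-- The braid relation has even exponent 2m, so the signs of s and t are independent. This separates
the two conjugacy classes and allows the reduction to non-negative parameters. -/
theorem exists_sign (e : B → ℤˣ) : ∃ ε : W →* ℤˣ, ∀ i, ε (cs.simple i) = e i := by
  have he : M.IsLiftable e := by
    intro i j
    rcases H.all i with rfl | rfl <;> rcases H.all j with rfl | rfl
    · rw [Int.units_mul_self, one_pow]
    · rw [H.eq, pow_mul, Int.units_sq, one_pow]
    · rw [H.symm.eq, pow_mul, Int.units_sq, one_pow]
    · rw [Int.units_mul_self, one_pow]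
  exact ⟨cs.lift ⟨e, he⟩, fun i => cs.lift_apply_simple he i⟩

theorem cls_ne : cls cs s ≠ cls cs t := by
  classical
  intro h
  obtain ⟨ε, hε⟩ := exists_sign cs H (fun i => if i = s then -1 else 1)
  have h1 : IsConj (cs.simple s) (cs.simple t) := Quotient.exact (s := simpleConj cs) h
  have h2 := ε.map_isConj h1
  rw [isConj_iff_eq, hε, hε, if_pos rfl, if_neg H.ne.symm] at h2
  exact absurd h2 (by decide)

theorem cls_cases (ω : SBar cs) : ω = cls cs s ∨ ω = cls cs t := by
  obtain ⟨i, rfl⟩ := Quotient.exists_rep ω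
  rcases H.all i with rfl | rfl
  · exact Or.inl rfl
  · exact Or.inr rfl

end Alt
end KLCell
end

noncomputable section
namespace KLCell
set_option linter.unusedSectionVars false

/-! ### Tools for Hecke algebras: induction, inversion, change of signs -/

namespace Hecke

variable {B : Type u} {W : Type v} [Group W] {M : CoxeterMatrix B} {cs : CoxeterSystem M W}
variable {Γ : Type w} [AddCommGroup Γ] (φ : SBar cs → Γ)

/-- T_x is a product of generators along a reduced word. Identities between additive or semilinear
maps thus reduce to the effect of one left factor T_s. -/
theorem induction {P : Hecke cs φ → Prop} (one : P 1) (add : ∀ a b, P a → P b → P (a + b))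
    (smul : ∀ (r : GrpRing Γ) a, P a → P (r • a))
    (T_mul : ∀ i a, P a → P (T φ (cs.simple i) * a)) (h : Hecke cs φ) : P h := by
  have key : ∀ x, P (T φ x) := by
    intro x
    obtain ⟨n, hn⟩ : ∃ n, cs.length x = n := ⟨_, rfl⟩
    induction n generalizing x with
    | zero => rw [cs.length_eq_zero_iff.1 hn, T_one]; exact one
    | succ n ih =>
      have hx : x ≠ 1 := by rintro rfl; simp at hn
      obtain ⟨i, hi⟩ := cs.exists_leftDescent_of_ne_one hx
      have hi' := cs.isLeftDescent_iff.1 hi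
      rw [T_eq_of_isLeftDescent φ i x hi]
      exact T_mul _ _ (ih _ (by omega))
  have h1 : h ∈ Submodule.span (GrpRing Γ) (Set.range (Tbasis φ)) := by
    rw [(Tbasis φ).span_eq]; trivial
  induction h1 using Submodule.span_induction with
  | mem y hy => obtain ⟨x, rfl⟩ := hy; exact key x
  | zero => simpa using smul 0 1 one
  | add a b _ _ ha hb => exact add a b ha hb
  | smul a b _ hb => exact smul a b hb

theorem repr_T (x y : W) [Decidable (x = y)] :
    (Tbasis φ).repr (T φ x) y = if x = y then 1 else 0 := by
  change (Tbasis φ).repr (Tbasis φ x) y = _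
  rw [Module.Basis.repr_self, Finsupp.single_apply]

theorem hecke_ext {a b : Hecke cs φ} (h : ∀ x, (Tbasis φ).repr a x = (Tbasis φ).repr b x) :
    a = b := (Tbasis φ).repr.injective (Finsupp.ext h)

/-- Multiplication by T_s read on coefficients: the form used when elements are known only through
their coefficients, as for eigenvectors and twists. -/
theorem repr_T_simple_mul (i : B) (h : Hecke cs φ) (y : W) :
    (Tbasis φ).repr (T φ (cs.simple i) * h) y = (Tbasis φ).repr h (cs.simple i * y) +
      if cs.length (cs.simple i * y) < cs.length y then qpar φ i * (Tbasis φ).repr h y else 0 := by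
  classical
  rw [T_simple_mul]
  let f : Hecke cs φ →ₗ[GrpRing Γ] GrpRing Γ :=
    Finsupp.lapply y ∘ₗ (Tbasis φ).repr.toLinearMap ∘ₗ lop φ i
  let g : Hecke cs φ →ₗ[GrpRing Γ] GrpRing Γ :=
    Finsupp.lapply (cs.simple i * y) ∘ₗ (Tbasis φ).repr.toLinearMap +
    (if cs.length (cs.simple i * y) < cs.length y then qpar φ i else 0) •
      (Finsupp.lapply y ∘ₗ (Tbasis φ).repr.toLinearMap)
  have hfg : f = g := by
    refine (Tbasis φ).ext fun x => ?_
    change (Tbasis φ).repr (lop φ i (T φ x)) y = (Tbasis φ).repr (T φ x) (cs.simple i * y) +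
      (if cs.length (cs.simple i * y) < cs.length y then qpar φ i else 0) •
        (Tbasis φ).repr (T φ x) y
    rw [lop_T, repr_T, repr_T]
    have e : cs.simple i * x = y ↔ x = cs.simple i * y := by
      constructor <;> rintro rfl <;> simp
    have hne : cs.simple i * y ≠ y := fun h0 => by
      rcases cs.length_simple_mul y i with h | h <;> rw [h0] at h <;> omega
    have hl := cs.length_simple_mul x i
    by_cases h1 : cs.length x < cs.length (cs.simple i * x)
    · rw [if_pos h1, repr_T]
      simp only [e]
      by_cases h2 : x = y
      · subst h2
        rw [if_neg (c := cs.length (cs.simple i * x) < cs.length x) (by omega), zero_smul, add_zero]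
      · rw [if_neg h2, smul_zero, add_zero]
    · rw [if_neg h1, map_add, map_smul, Finsupp.add_apply, Finsupp.smul_apply, repr_T, repr_T]
      simp only [e]
      by_cases h2 : x = y
      · subst h2
        rw [if_pos (c := cs.length (cs.simple i * x) < cs.length x) (by omega)]
      · rw [if_neg h2, smul_zero, smul_zero]
  have := LinearMap.congr_fun hfg h
  refine this.trans ?_
  change (Tbasis φ).repr h (cs.simple i * y) +
    (if cs.length (cs.simple i * y) < cs.length y then qpar φ i else 0) • (Tbasis φ).repr h y = _
  rw [smul_eq_mul, ite_mul, zero_mul]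

theorem mul_T_simple (i : B) (h : Hecke cs φ) : h * T φ (cs.simple i) = rop φ i h := by
  have h1 : rop φ i (T φ 1) = T φ (cs.simple i) := by rw [rop_T, if_pos] <;> simp
  have h2 := LinearMap.congr_fun (lmul_rop φ h i) (T φ 1)
  rw [Module.End.mul_apply, Module.End.mul_apply, h1, lmul_T_one] at h2
  exact h2

/-- The linear map `T_w ↦ T_{w⁻¹}`. -/
def flip : Hecke cs φ →ₗ[GrpRing Γ] Hecke cs φ :=
  (Tbasis φ).constr (GrpRing Γ) fun x => T φ x⁻¹

theorem flip_T (x : W) : flip φ (T φ x) = T φ x⁻¹ := (Tbasis φ).constr_basis _ _ _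

theorem flip_one : flip φ 1 = 1 := by
  rw [← T_one, flip_T, inv_one]

theorem flip_flip (h : Hecke cs φ) : flip φ (flip φ h) = h := by
  have : flip φ ∘ₗ flip φ = LinearMap.id := (Tbasis φ).ext fun x => by
    change flip φ (flip φ (T φ x)) = T φ x
    rw [flip_T, flip_T, inv_inv]
  exact LinearMap.congr_fun this h

theorem repr_flip (h : Hecke cs φ) (y : W) :
    (Tbasis φ).repr (flip φ h) y = (Tbasis φ).repr h y⁻¹ := by
  classical
  have : Finsupp.lapply y ∘ₗ (Tbasis φ).repr.toLinearMap ∘ₗ flip φ =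
      Finsupp.lapply y⁻¹ ∘ₗ (Tbasis φ).repr.toLinearMap := (Tbasis φ).ext fun x => by
    change (Tbasis φ).repr (flip φ (T φ x)) y = (Tbasis φ).repr (T φ x) y⁻¹
    rw [flip_T, repr_T, repr_T]
    simp only [inv_eq_iff_eq_inv]
  exact LinearMap.congr_fun this h

theorem flip_T_simple_mul (i : B) (h : Hecke cs φ) :
    flip φ (T φ (cs.simple i) * h) = flip φ h * T φ (cs.simple i) := by
  rw [T_simple_mul, mul_T_simple]
  have : flip φ ∘ₗ lop φ i = rop φ i ∘ₗ flip φ := (Tbasis φ).ext fun x => by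
    change flip φ (lop φ i (T φ x)) = rop φ i (flip φ (T φ x))
    rw [lop_T, flip_T, rop_T]
    have e1 : cs.length (x⁻¹ * cs.simple i) = cs.length (cs.simple i * x) := by
      rw [← cs.length_inv]; simp
    rw [e1, cs.length_inv]
    split_ifs <;> simp [flip_T]
  exact LinearMap.congr_fun this h

/-- An anti-automorphism commuting with `bar`: it exchanges left and right and sends C_x to the
basis element of the inverse of x, so right cells are inverses of left cells. -/
theorem flip_mul (h k : Hecke cs φ) : flip φ (h * k) = flip φ k * flip φ h := by
  refine induction φ (P := fun h => flip φ (h * k) = flip φ k * flip φ h) ?_ ?_ ?_ ?_ h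
  · rw [one_mul, flip_one, mul_one]
  · intro a b ha hb
    rw [add_mul, map_add, map_add, mul_add, ha, hb]
  · intro r a ha
    rw [smul_mul_assoc, map_smul, map_smul, mul_smul_comm, ha]
  · intro i a ha
    rw [mul_assoc, flip_T_simple_mul, ha, flip_T_simple_mul, mul_assoc]

theorem bar_flip (h : Hecke cs φ) : bar φ (flip φ h) = flip φ (bar φ h) := by
  have : (bar φ).comp (flip φ).toAddMonoidHom = (flip φ).toAddMonoidHom.comp (bar φ) := by
    refine addHom_ext φ fun a x => ?_
    simp only [AddMonoidHom.comp_apply, LinearMap.toAddMonoidHom_coe, map_smul, bar_smul, flip_T]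
    congr 1
    -- The two sides are a left and a right inverse of T_x, hence equal.
    refine left_inv_eq_right_inv (a := T φ x) ?_ ?_
    · have := bar_T_mul φ x⁻¹
      rwa [inv_inv] at this
    · have := congrArg (flip φ) (bar_T_mul φ x)
      rwa [flip_mul, flip_T, inv_inv, flip_one] at this
  exact DFunLike.congr_fun this h

/-! ### Changing the signs of the parameters by a character of W -/

section Twist

variable (φ' : SBar cs → Γ) (ε : W →* ℤˣ)

/-- The linear map `T_w ↦ ε(w) T_w` between the Hecke algebras with parameters `φ` and `φ'`. -/
def twist : Hecke cs φ →ₗ[GrpRing Γ] Hecke cs φ' :=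
  (Tbasis φ).constr (GrpRing Γ) fun x => ((ε x : ℤˣ) : ℤ) • T φ' x

theorem twist_T (x : W) : twist φ φ' ε (T φ x) = ((ε x : ℤˣ) : ℤ) • T φ' x :=
  (Tbasis φ).constr_basis _ _ _

theorem repr_twist (h : Hecke cs φ) (y : W) :
    (Tbasis φ').repr (twist φ φ' ε h) y = ((ε y : ℤˣ) : ℤ) • (Tbasis φ).repr h y := by
  classical
  have : Finsupp.lapply y ∘ₗ (Tbasis φ').repr.toLinearMap ∘ₗ twist φ φ' ε =
      ((ε y : ℤˣ) : ℤ) • Finsupp.lapply y ∘ₗ (Tbasis φ).repr.toLinearMap :=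
    (Tbasis φ).ext fun x => by
    change (Tbasis φ').repr (twist φ φ' ε (T φ x)) y =
      ((ε y : ℤˣ) : ℤ) • (Tbasis φ).repr (T φ x) y
    rw [twist_T, repr_T, map_zsmul, Finsupp.smul_apply, repr_T]
    split_ifs with h
    · rw [h]
    · simp
  exact LinearMap.congr_fun this h

variable {φ φ' ε} (hε : ∀ i, φ' (cls cs i) = ((ε (cs.simple i) : ℤˣ) : ℤ) • φ (cls cs i))
include hε

/-- Replacing T_s by -T_s turns the quadratic relation for the parameter φ(s) into the one for
-φ(s), and the scalar e^{φ(s)} - e^{-φ(s)} changes sign accordingly. -/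
theorem qpar_twist (i : B) : qpar φ' i = ((ε (cs.simple i) : ℤˣ) : ℤ) • qpar φ i := by
  rw [qpar, qpar, hε]
  rcases Int.units_eq_one_or (ε (cs.simple i)) with h | h <;> simp [h]

theorem twist_T_simple_mul (i : B) (h : Hecke cs φ) : twist φ φ' ε (T φ (cs.simple i) * h) =
    ((ε (cs.simple i) : ℤˣ) : ℤ) • (T φ' (cs.simple i) * twist φ φ' ε h) := by
  refine hecke_ext φ' fun y => ?_
  rw [repr_twist, repr_T_simple_mul, map_zsmul, Finsupp.smul_apply, repr_T_simple_mul,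
    repr_twist, repr_twist, qpar_twist hε, map_mul ε]
  rcases Int.units_eq_one_or (ε (cs.simple i)) with h | h <;>
    rcases Int.units_eq_one_or (ε y) with h' | h' <;> simp [h, h']

theorem bar_twist (h : Hecke cs φ) : bar φ' (twist φ φ' ε h) = twist φ φ' ε (bar φ h) := by
  refine induction φ (P := fun h => bar φ' (twist φ φ' ε h) = twist φ φ' ε (bar φ h)) ?_ ?_ ?_ ?_ h
  · have h1 : twist φ φ' ε 1 = 1 := by rw [← T_one, twist_T, map_one, T_one]; simp
    rw [bar_one, h1, bar_one]
  · intro a b ha hb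
    simp only [map_add, ha, hb]
  · intro r a ha
    rw [map_smul, bar_smul, bar_smul, map_smul, ha]
  · intro i a ha
    rw [twist_T_simple_mul hε, map_zsmul, bar_T_simple_mul, bar_T_simple_mul, ha, Tinv, Tinv,
      sub_mul, sub_mul, map_sub, twist_T_simple_mul hε, smul_mul_assoc, smul_mul_assoc, one_mul,
      one_mul, map_smul, qpar_twist hε]
    rcases Int.units_eq_one_or (ε (cs.simple i)) with h | h <;> simp [h, sub_eq_add_neg]

end Twist

section Ordered

variable [LinearOrder Γ] [IsOrderedAddMonoid Γ]

theorem C_unique {x : W} {c : Hecke cs φ} (hb : bar φ c = c) (hc : c - T φ x ∈ negPart φ) :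
    c = C φ x :=
  (existsUnique_C φ x).unique ⟨hb, hc⟩ ⟨bar_C φ x, C_sub_T_mem φ x⟩

theorem C_one : C φ (1 : W) = 1 := by
  refine (C_unique φ (bar_one φ) ?_).symm
  rw [T_one, sub_self]; exact zero_mem _

theorem flip_C (x : W) : flip φ (C φ x) = C φ x⁻¹ := by
  refine C_unique φ (by rw [bar_flip, bar_C]) fun y => ?_
  rw [← flip_T, ← map_sub, repr_flip]
  exact C_sub_T_mem φ x _

theorem repr_flip_C (h : Hecke cs φ) (x : W) :
    (Cbasis φ).repr (flip φ h) x = (Cbasis φ).repr h x⁻¹ := by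
  classical
  have : Finsupp.lapply x ∘ₗ (Cbasis φ).repr.toLinearMap ∘ₗ flip φ =
      Finsupp.lapply x⁻¹ ∘ₗ (Cbasis φ).repr.toLinearMap := (Cbasis φ).ext fun y => by
    change (Cbasis φ).repr (flip φ (Cbasis φ y)) x = (Cbasis φ).repr (Cbasis φ y) x⁻¹
    rw [Cbasis_apply, flip_C, ← Cbasis_apply, ← Cbasis_apply, Module.Basis.repr_self,
      Module.Basis.repr_self, Finsupp.single_apply, Finsupp.single_apply]
    simp only [inv_eq_iff_eq_inv]
  exact LinearMap.congr_fun this h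

/-- The twist commutes with `bar`, and signs do not affect membership in ℤ[Γ_{<0}], so uniqueness of
the Kazhdan–Lusztig element applies. -/
theorem twist_C {φ φ' : SBar cs → Γ} {ε : W →* ℤˣ}
    (hε : ∀ i, φ' (cls cs i) = ((ε (cs.simple i) : ℤˣ) : ℤ) • φ (cls cs i)) (x : W) :
    twist φ φ' ε (C φ x) = ((ε x : ℤˣ) : ℤ) • C φ' x := by
  have h2 : ((ε x : ℤˣ) : ℤ) • twist φ φ' ε (C φ x) = C φ' x := by
    refine C_unique φ' (by rw [map_zsmul, bar_twist hε, bar_C]) fun y => ?_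
    have h1 := C_sub_T_mem φ x y
    have e : ((ε x : ℤˣ) : ℤ) • twist φ φ' ε (C φ x) - T φ' x =
        ((ε x : ℤˣ) : ℤ) • twist φ φ' ε (C φ x - T φ x) := by
      rw [map_sub, twist_T, smul_sub, smul_smul, ← Units.val_mul, Int.units_mul_self]; simp
    rw [e, map_zsmul, Finsupp.smul_apply, repr_twist]
    exact zsmul_mem (zsmul_mem h1 _) _
  rw [← h2, smul_smul, ← Units.val_mul, Int.units_mul_self]; simp

theorem repr_twist_C {φ φ' : SBar cs → Γ} {ε : W →* ℤˣ}
    (hε : ∀ i, φ' (cls cs i) = ((ε (cs.simple i) : ℤˣ) : ℤ) • φ (cls cs i)) (h : Hecke cs φ)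
    (x : W) : (Cbasis φ').repr (twist φ φ' ε h) x = ((ε x : ℤˣ) : ℤ) • (Cbasis φ).repr h x := by
  classical
  have : Finsupp.lapply x ∘ₗ (Cbasis φ').repr.toLinearMap ∘ₗ twist φ φ' ε =
      ((ε x : ℤˣ) : ℤ) • Finsupp.lapply x ∘ₗ (Cbasis φ).repr.toLinearMap :=
    (Cbasis φ).ext fun y => by
    change (Cbasis φ').repr (twist φ φ' ε (Cbasis φ y)) x =
      ((ε x : ℤˣ) : ℤ) • (Cbasis φ).repr (Cbasis φ y) x
    rw [Cbasis_apply, twist_C hε, ← Cbasis_apply, map_zsmul, Finsupp.smul_apply, ← Cbasis_apply,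
      Module.Basis.repr_self, Module.Basis.repr_self, Finsupp.single_apply]
    split_ifs with h
    · rw [h]
    · simp
  exact LinearMap.congr_fun this h

/-! ### Generating arrows -/

/-- `cellLE` for left cells is generated by the multiplications by the `T_s`. -/
theorem _root_.KLCell.cellLE_left_of {r : W → W → Prop} (hrefl : ∀ x, r x x)
    (htrans : ∀ x y z, r x y → r y z → r x z)
    (hr : ∀ i x y, (Cbasis φ).repr (T φ (cs.simple i) * C φ y) x ≠ 0 → r x y) {x y : W}
    (h : cellLE φ .L x y) : r x y := by
  have key : ∀ x y, arrow φ .L x y → r x y := by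
    rintro x y ⟨k, hk⟩
    -- The span N contains C_y and, by transitivity of `r`, is stable under each T_i. Hence it
    -- contains the whole left ideal generated by C_y.
    set N := Submodule.span (GrpRing Γ) (C φ '' {x | r x y}) with hN
    have hmem : ∀ k, k * C φ y ∈ N := by
      intro k
      refine induction φ (P := fun k => k * C φ y ∈ N) ?_ ?_ ?_ ?_ k
      · rw [one_mul]; exact Submodule.subset_span ⟨y, hrefl y, rfl⟩
      · intro a b ha hb; rw [add_mul]; exact add_mem ha hb
      · intro a b hb; rw [smul_mul_assoc]; exact N.smul_mem _ hb
      · intro i a ha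
        rw [mul_assoc]
        have : N ≤ N.comap (lop φ i) := by
          rw [hN, Submodule.span_le]
          rintro _ ⟨z, hz, rfl⟩
          refine mem_span_of_repr φ fun x hx => htrans _ _ _ (hr i x z ?_) hz
          rwa [T_simple_mul]
        rw [T_simple_mul]
        exact this ha
    have h1 := hmem k
    have h2 := (Cbasis φ).mem_span_image (m := k * C φ y) (s := {x | r x y})
    rw [show (⇑(Cbasis φ) : W → Hecke cs φ) = C φ from funext (Cbasis_apply φ)] at h2
    exact h2.1 h1 (Finsupp.mem_support_iff.2 hk)
  induction h with
  | single h => exact key _ _ h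
  | tail _ h ih => exact htrans _ _ _ ih (key _ _ h)

theorem _root_.KLCell.arrow_right_iff (x y : W) : arrow φ .R x y ↔ arrow φ .L x⁻¹ y⁻¹ := by
  constructor
  · rintro ⟨h, hh⟩
    refine ⟨flip φ h, ?_⟩
    rwa [← flip_C, ← flip_mul, repr_flip_C, inv_inv]
  · rintro ⟨h, hh⟩
    refine ⟨flip φ h, ?_⟩
    rwa [← inv_inv x, ← repr_flip_C, flip_mul, flip_flip, flip_C]

theorem _root_.KLCell.cellLE_right_iff (x y : W) :
    cellLE φ .R x y ↔ cellLE φ .L x⁻¹ y⁻¹ := by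
  constructor
  · intro h
    induction h with
    | single h => exact .single ((arrow_right_iff φ _ _).1 h)
    | tail _ h ih => exact .tail ih ((arrow_right_iff φ _ _).1 h)
  · intro h
    generalize hx : x⁻¹ = x' at h
    generalize hy : y⁻¹ = y' at h
    induction h generalizing y with
    | single h =>
      subst hx hy
      exact .single ((arrow_right_iff φ _ _).2 h)
    | @tail b c _ h ih =>
      subst hy
      exact .tail (ih b⁻¹ (inv_inv b)) ((arrow_right_iff φ _ _).2 (by rwa [inv_inv]))

theorem _root_.KLCell.cellLE_two_sided_of_left {x y : W} (h : cellLE φ .L x y) :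
    cellLE φ .LR x y :=
  Relation.TransGen.mono (fun _ _ ⟨k, hk⟩ => ⟨k, Or.inl hk⟩) _ _ h

theorem _root_.KLCell.cellLE_two_sided_of_right {x y : W} (h : cellLE φ .R x y) :
    cellLE φ .LR x y :=
  Relation.TransGen.mono (fun _ _ ⟨k, hk⟩ => ⟨k, Or.inr hk⟩) _ _ h

theorem _root_.KLCell.cellLE_two_sided_of {r : W → W → Prop}
    (htrans : ∀ x y z, r x y → r y z → r x z) (hL : ∀ x y, cellLE φ .L x y → r x y)
    (hR : ∀ x y, cellLE φ .R x y → r x y) {x y : W} (h : cellLE φ .LR x y) : r x y := by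
  have key : ∀ x y, arrow φ .LR x y → r x y := by
    rintro x y ⟨k, hk | hk⟩
    · exact hL x y (.single ⟨k, hk⟩)
    · exact hR x y (.single ⟨k, hk⟩)
  induction h with
  | single h => exact key _ _ h
  | tail _ h ih => exact htrans _ _ _ ih (key _ _ h)

/-- The Kazhdan-Lusztig preorders are unaffected by a change of signs of the parameters. -/
theorem _root_.KLCell.cellLE_twist {φ φ' : SBar cs → Γ} {ε : W →* ℤˣ}
    (hε : ∀ i, φ' (cls cs i) = ((ε (cs.simple i) : ℤˣ) : ℤ) • φ (cls cs i)) (side : Side)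
    {x y : W} (h : cellLE φ side x y) : cellLE φ' side x y := by
  have hL : ∀ x y, cellLE φ .L x y → cellLE φ' .L x y := by
    intro x y
    refine cellLE_left_of φ (fun x => .single (arrow_refl φ' _ x)) (fun x y z => .trans)
      fun i x y hxy => .single ⟨T φ' (cs.simple i), ?_⟩
    intro h0
    have h1 := repr_twist_C hε (T φ (cs.simple i) * C φ y) x
    rw [twist_T_simple_mul hε, twist_C hε, mul_smul_comm, map_zsmul, map_zsmul,
      Finsupp.smul_apply, Finsupp.smul_apply, h0, smul_zero, smul_zero] at h1
    rcases Int.units_eq_one_or (ε x) with h | h <;> simp only [h, Units.val_one, Units.val_neg, one_smul, neg_smul, neg_eq_zero,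
      eq_comm (a := (0 : GrpRing Γ))] at h1 <;> exact hxy h1
  have hR : ∀ x y, cellLE φ .R x y → cellLE φ' .R x y := by
    intro x y h
    rw [cellLE_right_iff] at *
    exact hL _ _ h
  cases side
  · exact hL x y h
  · exact hR x y h
  · exact cellLE_two_sided_of φ (fun _ _ _ => .trans)
      (fun x y h => cellLE_two_sided_of_left φ' (hL x y h))
      (fun x y h => cellLE_two_sided_of_right φ' (hR x y h)) h

theorem _root_.KLCell.cellLE_twist_iff {φ φ' : SBar cs → Γ} {ε : W →* ℤˣ}
    (hε : ∀ i, φ' (cls cs i) = ((ε (cs.simple i) : ℤˣ) : ℤ) • φ (cls cs i)) (side : Side)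
    (x y : W) : cellLE φ' side x y ↔ cellLE φ side x y := by
  refine ⟨cellLE_twist (ε := ε) (fun i => ?_) side, cellLE_twist hε side⟩
  rw [hε, smul_smul, ← Units.val_mul, Int.units_mul_self]; simp

end Ordered
end Hecke
end KLCell
end

noncomputable section
namespace KLCell
set_option linter.unusedSectionVars false

/-! ### Non-positive coefficients -/

section Coeffs

variable {Γ : Type w} [AddCommGroup Γ] [LinearOrder Γ] [IsOrderedAddMonoid Γ]

/-- All exponents of `p` are non-positive. -/
def IsNonpos (p : GrpRing Γ) : Prop := ∀ γ, p.coeff γ ≠ 0 → γ ≤ 0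

theorem isNonpos_of_mem {p : GrpRing Γ} (h : p ∈ negCoeffs Γ) : IsNonpos p :=
  fun γ hγ => (h γ hγ).le

theorem coeff_expo (γ δ : Γ) [Decidable (γ = δ)] :
    (expo γ).coeff δ = if γ = δ then 1 else 0 := by
  rw [expo, AddMonoidAlgebra.coeff_single, Finsupp.single_apply]

theorem isNonpos_expo {γ : Γ} (h : γ ≤ 0) : IsNonpos (expo γ) := by
  classical
  intro δ hδ
  rw [coeff_expo] at hδ
  by_contra h'
  refine hδ (if_neg ?_)
  rintro rfl
  exact h' h

theorem expo_mem_negCoeffs {γ : Γ} (h : γ < 0) : expo γ ∈ negCoeffs Γ := by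
  classical
  intro δ hδ
  rw [coeff_expo] at hδ
  by_contra h'
  refine hδ (if_neg ?_)
  rintro rfl
  exact h' h

theorem isNonpos_one : IsNonpos (1 : GrpRing Γ) := by
  rw [← expo_zero]; exact isNonpos_expo le_rfl

theorem IsNonpos.add {p q : GrpRing Γ} (hp : IsNonpos p) (hq : IsNonpos q) :
    IsNonpos (p + q) := by
  intro γ hγ
  by_contra h
  have h1 : p.coeff γ = 0 := by_contra fun h' => h (hp γ h')
  have h2 : q.coeff γ = 0 := by_contra fun h' => h (hq γ h')
  simp [h1, h2] at hγ

theorem mul_mem_negCoeffs {p q : GrpRing Γ} (hp : IsNonpos p) (hq : q ∈ negCoeffs Γ) :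
    p * q ∈ negCoeffs Γ := by
  classical
  intro γ hγ
  rw [AddMonoidAlgebra.coeff_mul] at hγ
  obtain ⟨a, ha, h1⟩ := Finset.exists_ne_zero_of_sum_ne_zero hγ
  obtain ⟨b, hb, h2⟩ := Finset.exists_ne_zero_of_sum_ne_zero h1
  have e : a + b = γ := by
    by_contra hne
    simp [hne] at h2
  rw [← e]
  exact add_neg_of_nonpos_of_neg (hp a (Finsupp.mem_support_iff.1 ha))
    (hq b (Finsupp.mem_support_iff.1 hb))

theorem mul_mem_negCoeffs' {p q : GrpRing Γ} (hp : p ∈ negCoeffs Γ) (hq : IsNonpos q) :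
    p * q ∈ negCoeffs Γ := by
  rw [mul_comm]; exact mul_mem_negCoeffs hq hp

theorem isNonpos_of_sub {p : GrpRing Γ} (c : Prop) [Decidable c]
    (h : p - (if c then 1 else 0) ∈ negCoeffs Γ) : IsNonpos p := by
  rw [← sub_add_cancel p (if c then 1 else 0)]
  refine (isNonpos_of_mem h).add ?_
  split_ifs
  · exact isNonpos_one
  · exact isNonpos_of_mem (zero_mem _)

end Coeffs

/-! ### Products of C_s and C_t with the Kazhdan–Lusztig basis -/

namespace Hecke

variable {B : Type u} {W : Type v} [Group W] {M : CoxeterMatrix B} {cs : CoxeterSystem M W}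
variable {Γ : Type w} [AddCommGroup Γ] [LinearOrder Γ] [IsOrderedAddMonoid Γ] (φ : SBar cs → Γ)

/-- The scalar `C_s - T_s`, when the parameter of `s` is non-negative. -/
def dpar (i : B) : GrpRing Γ := if φ (cls cs i) = 0 then 0 else expo (-φ (cls cs i))

/-- The element `C_s`, when the parameter of `s` is non-negative. -/
def Cgen (i : B) : Hecke cs φ := T φ (cs.simple i) + dpar φ i • 1

/-- Compatibility of `bar` with left multiplication by C_s suffices for the recursions: it makes
their right-hand sides bar-invariant. When the parameter vanishes, C_s is T_s and `qpar` is zero. -/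
theorem bar_Cgen_mul (i : B) (h : Hecke cs φ) : bar φ (Cgen φ i * h) = Cgen φ i * bar φ h := by
  rw [Cgen, add_mul, map_add, bar_T_simple_mul, smul_mul_assoc, one_mul, bar_smul, Tinv, add_mul,
    sub_mul, smul_mul_assoc, smul_mul_assoc, one_mul, sub_add_eq_add_sub, add_sub_assoc, ← sub_smul]
  congr 2
  rw [dpar, qpar]
  split_ifs with h0
  · simp [h0]
  · rw [barA_expo, neg_neg]; ring

theorem bar_Cgen (i : B) : bar φ (Cgen φ i) = Cgen φ i := by
  have := bar_Cgen_mul φ i 1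
  rwa [bar_one, mul_one] at this

variable {φ}

theorem dpar_mem {i : B} (h : 0 ≤ φ (cls cs i)) : dpar φ i ∈ negCoeffs Γ := by
  rw [dpar]
  split_ifs with h0
  · exact zero_mem _
  · exact expo_mem_negCoeffs (neg_neg_of_pos (lt_of_le_of_ne h (Ne.symm h0)))

theorem smul_mem_negPart {p : GrpRing Γ} (hp : p ∈ negCoeffs Γ) {h : Hecke cs φ}
    (hh : ∀ x, IsNonpos ((Tbasis φ).repr h x)) : p • h ∈ negPart φ := by
  intro x
  rw [map_smul, Finsupp.smul_apply, smul_eq_mul]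
  exact mul_mem_negCoeffs' hp (hh x)

theorem isNonpos_repr_T (x y : W) : IsNonpos ((Tbasis φ).repr (T φ x) y) := by
  classical
  rw [repr_T]
  split_ifs
  · exact isNonpos_one
  · exact isNonpos_of_mem (zero_mem _)

theorem isNonpos_repr_C (x y : W) : IsNonpos ((Tbasis φ).repr (C φ x) y) := by
  have h1 := C_sub_T_mem φ x y
  rw [← sub_add_cancel (C φ x) (T φ x), map_add, Finsupp.add_apply]
  exact (isNonpos_of_mem h1).add (isNonpos_repr_T x y)

theorem C_simple {i : B} (h : 0 ≤ φ (cls cs i)) : C φ (cs.simple i) = Cgen φ i := by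
  refine (C_unique φ (bar_Cgen φ i) ?_).symm
  rw [Cgen, add_sub_cancel_left]
  exact smul_mem_negPart (dpar_mem h) fun x => by rw [← T_one]; exact isNonpos_repr_T _ _

/-- `h` is an eigenvector of `T_i` for the eigenvalue `e^{φ(i)}`. -/
def IsEig (i : B) (h : Hecke cs φ) : Prop :=
  T φ (cs.simple i) * h = expo (φ (cls cs i)) • h

theorem IsEig.sub {i : B} {h k : Hecke cs φ} (hh : IsEig i h) (hk : IsEig i k) :
    IsEig i (h - k) := by
  rw [IsEig, mul_sub, hh, hk, smul_sub]

theorem IsEig.smul {i : B} {h : Hecke cs φ} (hh : IsEig i h) (p : GrpRing Γ) :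
    IsEig i (p • h) := by
  rw [IsEig, mul_smul_comm, hh, smul_comm]

theorem isEig_zero (i : B) : IsEig i (0 : Hecke cs φ) := by
  rw [IsEig, mul_zero, smul_zero]

/-- The quadratic relation gives T_s C_s = e^{φ(s)} C_s. This needs a non-zero parameter, since
otherwise the added scalar e^{-φ(s)} is absent from C_s. -/
theorem isEig_Cgen_mul {i : B} (hi : φ (cls cs i) ≠ 0) (h : Hecke cs φ) :
    IsEig i (Cgen φ i * h) := by
  rw [IsEig, ← mul_assoc, ← smul_mul_assoc]
  congr 1
  rw [Cgen, dpar, if_neg hi, mul_add, T_simple_sq, mul_smul_comm, mul_one, smul_add, smul_smul,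
    expo_mul, add_neg_cancel, expo_zero, one_smul, add_assoc, ← add_smul, qpar, sub_add_cancel,
    add_comm]

theorem IsEig.Cgen_mul {i : B} (hi : φ (cls cs i) ≠ 0) {h : Hecke cs φ} (hh : IsEig i h) :
    Cgen φ i * h = (expo (φ (cls cs i)) + expo (-φ (cls cs i))) • h := by
  rw [Cgen, dpar, if_neg hi, add_mul, hh, smul_mul_assoc, one_mul, add_smul]

section Dihedral

variable {s t : B} {m : ℕ} (H : IsDihedral M s t m)
include H

theorem repr_T_mul_alt (h : Hecke cs φ) {j : ℕ} (hj : j < 2 * m) :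
    (Tbasis φ).repr (T φ (cs.simple s) * h) (alt cs s t (j + 1)) =
      (Tbasis φ).repr h (alt cs t s j) + qpar φ s * (Tbasis φ).repr h (alt cs s t (j + 1)) := by
  rw [repr_T_simple_mul, simple_mul_alt_succ, if_pos]
  rw [length_alt cs H.symm (by omega), length_alt cs H (by omega)]
  omega

theorem repr_T_mul_alt' (h : Hecke cs φ) {j : ℕ} (hj : j < 2 * m) :
    (Tbasis φ).repr (T φ (cs.simple s) * h) (alt cs t s j) =
      (Tbasis φ).repr h (alt cs s t (j + 1)) := by
  rw [repr_T_simple_mul, simple_mul_alt, if_neg, add_zero]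
  rw [length_alt cs H.symm (by omega), length_alt cs H (by omega)]
  omega

/-- The coefficients of an eigenvector on the words not starting with s are determined by those on
the words starting with s, with an extra factor e^{-φ(s)}. -/
theorem IsEig.repr_alt {h : Hecke cs φ} (hh : IsEig s h) {j : ℕ} (hj : j < 2 * m) :
    (Tbasis φ).repr h (alt cs t s j) =
      expo (-φ (cls cs s)) * (Tbasis φ).repr h (alt cs s t (j + 1)) := by
  rw [← repr_T_mul_alt' H h hj, hh, map_smul, Finsupp.smul_apply, smul_eq_mul, ← mul_assoc,
    expo_mul, neg_add_cancel, expo_zero, one_mul]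

theorem repr_Cgen_mul_alt (hs : φ (cls cs s) ≠ 0) (h : Hecke cs φ) {j : ℕ} (hj : j < 2 * m) :
    (Tbasis φ).repr (Cgen φ s * h) (alt cs s t (j + 1)) =
      (Tbasis φ).repr h (alt cs t s j) +
        expo (φ (cls cs s)) * (Tbasis φ).repr h (alt cs s t (j + 1)) := by
  rw [Cgen, add_mul, smul_mul_assoc, one_mul, map_add, Finsupp.add_apply, repr_T_mul_alt H h hj,
    map_smul, Finsupp.smul_apply, smul_eq_mul, add_assoc, ← add_mul, qpar, dpar, if_neg hs,
    sub_add_cancel]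

/-- The criterion behind both recursions. For an eigenvector with φ(s) > 0 and non-positive
exponents on the words starting with s, the remaining coefficients are automatically strictly
negative, so half of the conditions characterizing C_w suffice. -/
theorem sub_T_mem_negPart (hs : 0 < φ (cls cs s)) {h : Hecke cs φ} (hh : IsEig s h) {k : ℕ}
    (hk1 : 1 ≤ k) (hk2 : k ≤ 2 * m)
    (hc : ∀ j < 2 * m, (Tbasis φ).repr h (alt cs s t (j + 1)) - (if j + 1 = k then 1 else 0) ∈
      negCoeffs Γ) : h - T φ (alt cs s t k) ∈ negPart φ := by
  classical
  have hm := H.two_le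
  have h2 : ∀ j < 2 * m, (Tbasis φ).repr (h - T φ (alt cs s t k)) (alt cs t s j) ∈
      negCoeffs Γ := by
    intro j hj
    rw [map_sub, Finsupp.sub_apply, repr_T, if_neg, sub_zero, hh.repr_alt H hj]
    · exact mul_mem_negCoeffs' (expo_mem_negCoeffs (neg_neg_of_pos hs)) (isNonpos_of_sub _ (hc j hj))
    · rw [alt_eq_alt_iff cs H hk2 (by omega)]; omega
  refine alt_cases cs H ?_ ?_ ?_
  · simpa using h2 0 (by omega)
  · intro j hj1 hj2
    obtain ⟨j, rfl⟩ : ∃ i, j = i + 1 := ⟨j - 1, by omega⟩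
    rw [map_sub, Finsupp.sub_apply, repr_T]
    simp only [alt_inj cs H hk2 hj2, eq_comm (a := k)]
    exact hc j hj2
  · intro j _ hj
    exact h2 j hj

/-- The coefficients of `C_w`, for `w` an alternating product, on alternating products with the
same first letter. -/
theorem repr_C_alt {k j : ℕ} (hk : k ≤ 2 * m) (hj : j ≤ 2 * m) :
    (Tbasis φ).repr (C φ (alt cs s t k)) (alt cs s t j) - (if j = k then 1 else 0) ∈
      negCoeffs Γ := by
  classical
  have := C_sub_T_mem φ (alt cs s t k) (alt cs s t j)
  rw [map_sub, Finsupp.sub_apply, repr_T] at this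
  simpa only [alt_inj cs H hk hj, eq_comm (a := k)] using this

theorem repr_C_alt_of_lt {k j : ℕ} (hk : k < j) (hj : j ≤ 2 * m) :
    (Tbasis φ).repr (C φ (alt cs s t k)) (alt cs s t j) = 0 := by
  classical
  have h1 := (mem_lenLT φ).1 (C_sub_T_mem_lenLT φ (alt cs s t k)) (alt cs s t j)
  rw [length_alt cs H hj, length_alt cs H (by omega), map_sub, Finsupp.sub_apply, repr_T, if_neg,
    sub_zero] at h1
  · by_contra h2
    have := h1 h2
    omega
  · rw [alt_inj cs H (by omega) hj]; omega

omit H in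
variable (φ s t) in
/-- `C_w` for `w` the alternating product with `k` factors if `k > 0`, and `0` if `k = 0`. -/
def Calt (k : ℕ) : Hecke cs φ := if k = 0 then 0 else C φ (alt cs s t k)

omit H in
@[simp] theorem Calt_zero : Calt φ s t 0 = 0 := if_pos rfl

omit H in
theorem Calt_of_pos {k : ℕ} (hk : 1 ≤ k) : Calt φ s t k = C φ (alt cs s t k) :=
  if_neg (by omega)

omit H in
theorem bar_Calt (k : ℕ) : bar φ (Calt φ s t k) = Calt φ s t k := by
  rw [Calt]
  split_ifs
  · exact map_zero _
  · exact bar_C φ _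

theorem repr_Calt {k j : ℕ} (hk : k ≤ 2 * m) (hj : 1 ≤ j) (hj' : j ≤ 2 * m) :
    (Tbasis φ).repr (Calt φ s t k) (alt cs s t j) - (if j = k then 1 else 0) ∈ negCoeffs Γ := by
  rw [Calt]
  split_ifs with h1 h2 h2
  · omega
  · simp [zero_mem]
  · simpa [h2] using repr_C_alt H hk hj'
  · simpa [h2] using repr_C_alt (φ := φ) H hk hj'

omit H in
variable (φ s t) in
/-- The structure constant of the Kazhdan-Lusztig basis in the case `φ(t) < φ(s)`. -/
def zeta : GrpRing Γ :=
  if φ (cls cs t) = 0 then 0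
  else expo (φ (cls cs s) - φ (cls cs t)) + expo (φ (cls cs t) - φ (cls cs s))

omit H in
theorem barA_zeta : barA (zeta φ s t) = zeta φ s t := by
  rw [zeta]
  split_ifs
  · exact map_zero _
  · rw [map_add, barA_expo, barA_expo, neg_sub, neg_sub, add_comm]

omit H in
-- This explains the choice of `zeta`: it is the bar-invariant correction after which only a
-- multiple of (e^{φ(t)} - e^{-φ(t)})e^{-φ(s)} is left, and that has strictly negative exponents
-- when 0 ≤ φ(t) < φ(s).
theorem dpar_mul_sub_zeta : dpar φ t * (expo (φ (cls cs s)) + expo (-φ (cls cs s))) - zeta φ s t =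
    -(qpar φ t * expo (-φ (cls cs s))) := by
  rw [dpar, zeta, qpar]
  split_ifs with h
  · simp [h]
  · rw [mul_add, sub_mul, expo_mul, expo_mul, expo_mul]
    have e1 : -φ (cls cs t) + φ (cls cs s) = φ (cls cs s) - φ (cls cs t) := by abel
    have e2 : φ (cls cs t) + -φ (cls cs s) = φ (cls cs t) - φ (cls cs s) := by abel
    rw [e1, e2]
    ring

/-- `T_t C_w` modulo `H_{<0}` in the case `φ(t) < φ(s)`. -/
theorem Cgen_mul_C_sub_T_mem (hs : φ (cls cs t) < φ (cls cs s)) (ht : 0 ≤ φ (cls cs t)) {k : ℕ}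
    (hk : 1 ≤ k) (hk' : k < 2 * m) (he : IsEig s (C φ (alt cs s t k))) :
    Cgen φ t * C φ (alt cs s t k) - T φ (alt cs t s (k + 1)) ∈ negPart φ := by
  classical
  have hm := H.two_le
  have hs0 : 0 < φ (cls cs s) := ht.trans_lt hs
  set g := C φ (alt cs s t k) with hg
  have hG : ∀ j, j ≤ 2 * m → (Tbasis φ).repr g (alt cs s t j) - (if j = k then 1 else 0) ∈
    negCoeffs Γ := fun j hj => repr_C_alt H hk'.le hj
  have hE := expo_mem_negCoeffs (neg_neg_of_pos hs0)
  -- Eigenvector symmetry moves to the next word starting with s. At length 2m there is no such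
  -- word, but the coefficient at w₀ is zero because k < 2m.
  have hT : ∀ j < 2 * m, (Tbasis φ).repr g (alt cs t s (j + 1)) =
      expo (-φ (cls cs s)) * (if j + 1 < 2 * m then (Tbasis φ).repr g (alt cs s t (j + 2))
        else 0) := by
    intro j hj
    split_ifs with h
    · exact he.repr_alt H h
    · have : j + 1 = 2 * m := by omega
      rw [this, ← alt_top cs H, repr_C_alt_of_lt H hk' le_rfl, mul_zero]
  have hT' : ∀ j < 2 * m, IsNonpos (if j + 1 < 2 * m then (Tbasis φ).repr g (alt cs s t (j + 2))
        else 0) := by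
    intro j hj
    split_ifs with h
    · exact isNonpos_repr_C _ _
    · exact isNonpos_of_mem (zero_mem _)
  have hq : IsNonpos (qpar φ t * expo (-φ (cls cs s))) := by
    rw [qpar, sub_eq_add_neg, add_mul, neg_mul, expo_mul, expo_mul]
    refine (isNonpos_expo ?_).add (isNonpos_of_mem (neg_mem (expo_mem_negCoeffs ?_)))
    · rw [← sub_eq_add_neg, sub_nonpos]; exact hs.le
    · exact add_neg_of_nonpos_of_neg (neg_nonpos.2 ht) (neg_neg_of_pos hs0)
  -- The strict inequality φ(t) < φ(s) is what makes the leading exponent φ(t) - φ(s) negative.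
  have hq' : qpar φ t * expo (-φ (cls cs s)) ∈ negCoeffs Γ := by
    rw [qpar, sub_mul, expo_mul, expo_mul]
    refine sub_mem (expo_mem_negCoeffs ?_) (expo_mem_negCoeffs ?_)
    · rw [← sub_eq_add_neg, sub_neg]; exact hs
    · exact add_neg_of_nonpos_of_neg (neg_nonpos.2 ht) (neg_neg_of_pos hs0)
  rw [Cgen, add_mul, smul_mul_assoc, one_mul, add_sub_right_comm]
  refine add_mem ?_ (smul_mem_negPart (dpar_mem ht) fun x => isNonpos_repr_C _ _)
  have h1 : ∀ j < 2 * m, (Tbasis φ).repr (T φ (cs.simple t) * g - T φ (alt cs t s (k + 1)))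
      (alt cs s t j) ∈ negCoeffs Γ := by
    intro j hj
    rw [map_sub, Finsupp.sub_apply, repr_T, if_neg, sub_zero, repr_T_mul_alt' H.symm g hj, hT j hj]
    · exact mul_mem_negCoeffs' hE (hT' j hj)
    · rw [alt_eq_alt_iff cs H.symm (by omega) (by omega)]; omega
  refine alt_cases cs H.symm ?_ ?_ ?_
  · simpa using h1 0 (by omega)
  · intro j hj1 hj2
    obtain ⟨j, rfl⟩ : ∃ i, j = i + 1 := ⟨j - 1, by omega⟩
    rw [map_sub, Finsupp.sub_apply, repr_T, repr_T_mul_alt H.symm g (by omega), hT j (by omega),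
      add_sub_right_comm, ← mul_assoc]
    simp only [alt_inj cs H.symm (show k + 1 ≤ 2 * m by omega) hj2, Nat.add_right_cancel_iff,
      eq_comm (a := k)]
    exact add_mem (hG j (by omega)) (mul_mem_negCoeffs' hq' (hT' j (by omega)))
  · intro j _ hj
    exact h1 j hj

/-- The right-hand side is bar-invariant and an s-eigenvector, so only the words starting with s
have to be tested. If G(j) is the coefficient of C_{k-2} on the word of length j, the coefficient on
length j + 1 becomes G(j - 1) + G(j + 3) minus that of C_{k-4}, because the terms in e^{φ(t)}
cancel. The constant term of G(j - 1) sits at j + 1 = k, and that of G(j + 3), at j + 1 = k - 4, is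
removed by the last summand. Missing terms of index 0 vanish by the convention in `Calt`, with
truncated subtraction. -/
theorem C_alt_recursion (hs : φ (cls cs t) < φ (cls cs s)) (ht : 0 ≤ φ (cls cs t)) {k : ℕ}
    (hk : 3 ≤ k) (hk' : k ≤ 2 * m) (he : IsEig s (Calt φ s t (k - 2)))
    (he' : IsEig s (Calt φ s t (k - 4))) :
    C φ (alt cs s t k) = Cgen φ s * (Cgen φ t * Calt φ s t (k - 2)) -
      zeta φ s t • Calt φ s t (k - 2) - Calt φ s t (k - 4) := by
  have hm := H.two_le
  have hs0 : 0 < φ (cls cs s) := ht.trans_lt hs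
  refine (C_unique φ ?_ ?_).symm
  · rw [map_sub, map_sub, bar_Cgen_mul, bar_Cgen_mul, bar_smul, bar_Calt, bar_Calt, barA_zeta]
  set g := Calt φ s t (k - 2) with hg
  -- As g is an eigenvector, C_s multiplies the scalar part of C_t by e^{φ(s)} + e^{-φ(s)}. This
  -- combines with `zeta` into a single strictly negative scalar.
  have e1 : Cgen φ s * (Cgen φ t * g) - zeta φ s t • g = Cgen φ s * (T φ (cs.simple t) * g) -
      (qpar φ t * expo (-φ (cls cs s))) • g := by
    rw [sub_eq_add_neg _ ((qpar φ t * expo (-φ (cls cs s))) • g), ← neg_smul,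
      ← dpar_mul_sub_zeta, sub_smul, mul_smul, ← he.Cgen_mul hs0.ne']
    conv_lhs => rw [show Cgen φ t = T φ (cs.simple t) + dpar φ t • 1 from rfl]
    rw [add_mul, smul_mul_assoc, one_mul, mul_add, mul_smul_comm]
    abel
  rw [e1]
  have hE := expo_mem_negCoeffs (neg_neg_of_pos hs0)
  -- G is extended by zero from length 2m on, so the shifted indices j + 2 and j + 3 need no range
  -- conditions. The value at 2m itself is zero because k - 2 < 2m.
  set G : ℕ → GrpRing Γ := fun j => if j < 2 * m then (Tbasis φ).repr g (alt cs s t j) else 0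
    with hGdef
  have hg' : g = C φ (alt cs s t (k - 2)) := Calt_of_pos (by omega)
  have hGt : ∀ j < 2 * m, (Tbasis φ).repr g (alt cs t s j) =
      expo (-φ (cls cs s)) * G (j + 1) := by
    intro j hj
    rw [he.repr_alt H hj]
    simp only [hGdef]
    split_ifs with h
    · rfl
    · have : j + 1 = 2 * m := by omega
      rw [this, hg', repr_C_alt_of_lt H (by omega) le_rfl]
  have hG2 : ∀ j ≤ 2 * m, (Tbasis φ).repr g (alt cs s t j) = G j := by
    intro j hj
    simp only [hGdef]
    split_ifs with h
    · rfl
    · have : j = 2 * m := by omega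
      rw [this, hg', repr_C_alt_of_lt H (by omega) le_rfl]
  have hG1 : ∀ j, G j - (if j = k - 2 then 1 else 0) ∈ negCoeffs Γ := by
    intro j
    simp only [hGdef]
    split_ifs with h1 h2 h2
    · simpa [h2, hg'] using repr_C_alt (φ := φ) (k := k - 2) (j := j) H (by omega) (by omega)
    · simpa [h2, hg'] using repr_C_alt (φ := φ) (k := k - 2) (j := j) H (by omega) (by omega)
    · omega
    · simp [zero_mem]
  have hq' : qpar φ t * expo (-φ (cls cs s)) ∈ negCoeffs Γ := by
    rw [qpar, sub_mul, expo_mul, expo_mul]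
    refine sub_mem (expo_mem_negCoeffs ?_) (expo_mem_negCoeffs ?_)
    · rw [← sub_eq_add_neg, sub_neg]; exact hs
    · exact add_neg_of_nonpos_of_neg (neg_nonpos.2 ht) (neg_neg_of_pos hs0)
  refine sub_T_mem_negPart H hs0 ?_ (by omega) hk' ?_
  · exact ((isEig_Cgen_mul hs0.ne' _).sub (he.smul _)).sub he'
  intro j hj
  -- The factor e^{φ(s)} coming from C_s cancels exactly the e^{-φ(s)} coming from eigenvector
  -- symmetry, which shifts the length by three in total.
  have hv : expo (φ (cls cs s)) *
      (Tbasis φ).repr (T φ (cs.simple t) * g) (alt cs s t (j + 1)) = G (j + 3) := by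
    by_cases h : j + 1 < 2 * m
    · rw [repr_T_mul_alt' H.symm g h]
      by_cases h' : j + 2 < 2 * m
      · rw [hGt _ h', ← mul_assoc, expo_mul, add_neg_cancel, expo_zero, one_mul]
      · have e : j + 2 = 2 * m := by omega
        rw [show j + 1 + 1 = j + 2 from rfl, e, ← alt_top cs H, hG2 _ le_rfl]
        simp only [hGdef]
        rw [if_neg (by omega), if_neg (by omega), mul_zero]
    · have e : j + 1 = 2 * m := by omega
      have hz : (Tbasis φ).repr g (alt cs s t j) = 0 := by
        rw [hg', repr_C_alt_of_lt H (by omega) (by omega)]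
      have hz' : (Tbasis φ).repr g (alt cs s t (2 * m)) = 0 := by
        rw [hg', repr_C_alt_of_lt H (by omega) le_rfl]
      rw [e, alt_top cs H, ← e, repr_T_mul_alt H.symm g (by omega), e, ← alt_top cs H, hz, hz']
      simp only [hGdef]
      rw [if_neg (by omega)]; simp
  have hg4 := repr_Calt (φ := φ) (k := k - 4) (j := j + 1) H (by omega) (by omega) (by omega)
  rw [map_sub, map_sub, Finsupp.sub_apply, Finsupp.sub_apply, repr_Cgen_mul_alt H hs0.ne' _ hj, hv,
    map_smul, Finsupp.smul_apply, smul_eq_mul, hG2 (j + 1) (by omega)]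
  -- Both conditions also fail together for k = 3 and k = 4, where the subtraction on the right
  -- gives 0.
  have hcond : (j + 3 = k - 2) ↔ (j + 1 = k - 4) := by omega
  have h3 := hG1 (j + 3)
  simp only [hcond] at h3
  cases j with
  | zero =>
    -- At length one there is no G(j - 1). The two leftover terms carry e^{-φ(s)} or the negative
    -- scalar, so they do no harm.
    rw [show alt cs t s 0 = alt cs s t 0 by simp, repr_T_mul_alt' H.symm g (by omega),
      hGt _ (by omega), if_neg (c := 0 + 1 = k) (by omega), sub_zero]
    have h4 := sub_mem h3 hg4
    have h5 := mul_mem_negCoeffs' hE (isNonpos_of_sub _ (hG1 (0 + 1 + 1)))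
    have h6 := mul_mem_negCoeffs' hq' (isNonpos_of_sub _ (hG1 (0 + 1)))
    convert add_mem (sub_mem h5 h6) h4 using 1
    ring
  | succ j =>
    rw [repr_T_mul_alt H.symm g (by omega), hGt _ (by omega), hG2 j (by omega)]
    have h4 := sub_mem h3 hg4
    have h5 := hG1 j
    have hcond' : (j = k - 2) ↔ (j + 1 + 1 = k) := by omega
    simp only [hcond'] at h5
    convert add_mem h5 h4 using 1
    ring

theorem Cgen_mul_Cgen (hs : 0 < φ (cls cs s)) (ht : 0 ≤ φ (cls cs t)) :
    C φ (alt cs s t 2) = Cgen φ s * Cgen φ t := by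
  have hm := H.two_le
  refine (C_unique φ (by rw [bar_Cgen_mul, bar_Cgen]) ?_).symm
  have e : T φ (alt cs s t 2) = T φ (cs.simple s) * T φ (cs.simple t) := by
    rw [T_simple_mul_T, if_pos]
    · simp [alt_succ]
    · have h1 := length_alt cs H.symm (k := 1) (by omega)
      have h2 := length_alt cs H (k := 2) (by omega)
      rw [alt_one] at h1
      rw [alt_succ, alt_one] at h2
      rw [h1, h2]; omega
  have e2 : Cgen φ s * Cgen φ t - T φ (alt cs s t 2) = dpar φ t • T φ (cs.simple s) +
      dpar φ s • (T φ (cs.simple t) + dpar φ t • T φ 1) := by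
    rw [e, Cgen, Cgen, T_one]
    simp only [add_mul, mul_add, smul_mul_assoc, one_mul, mul_smul_comm, mul_one]
    module
  rw [e2]
  refine add_mem (smul_mem_negPart (dpar_mem ht) (isNonpos_repr_T _))
    (smul_mem_negPart (dpar_mem hs.le) fun x => ?_)
  rw [map_add, Finsupp.add_apply]
  exact (isNonpos_repr_T _ _).add
    (isNonpos_of_mem (smul_mem_negPart (dpar_mem ht) (isNonpos_repr_T _) x))

/-- The recursion assumes the eigenvector property for shorter words and returns it for the new one,
so both are obtained by one strong induction. The words s and st start it. -/
theorem isEig_C_alt (hs : φ (cls cs t) < φ (cls cs s)) (ht : 0 ≤ φ (cls cs t)) {k : ℕ}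
    (hk : 1 ≤ k) (hk' : k ≤ 2 * m) : IsEig s (C φ (alt cs s t k)) := by
  have hs0 : 0 < φ (cls cs s) := ht.trans_lt hs
  induction k using Nat.strong_induction_on with
  | _ k ih =>
    rcases (by omega : k = 1 ∨ k = 2 ∨ 3 ≤ k) with rfl | rfl | h3
    · rw [alt_one, C_simple hs0.le, ← mul_one (Cgen φ s)]
      exact isEig_Cgen_mul hs0.ne' _
    · rw [Cgen_mul_Cgen H hs0 ht]
      exact isEig_Cgen_mul hs0.ne' _
    · have h1 : ∀ j < k, IsEig s (Calt φ s t j) := by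
        intro j hj
        rw [Calt]
        split_ifs with h
        · exact isEig_zero _
        · exact ih j hj (by omega) (by omega)
      rw [C_alt_recursion H hs ht h3 hk' (h1 _ (by omega)) (h1 _ (by omega))]
      exact ((isEig_Cgen_mul hs0.ne' _).sub ((h1 _ (by omega)).smul _)).sub (h1 _ (by omega))

/-- Left multiplication by `C_t` in the case `φ(t) < φ(s)`. -/
theorem Cgen_mul_C_of_lt (hs : φ (cls cs t) < φ (cls cs s)) (ht : 0 ≤ φ (cls cs t)) {k : ℕ}
    (hk : 1 ≤ k) (hk' : k < 2 * m) :
    Cgen φ t * C φ (alt cs s t k) = C φ (alt cs t s (k + 1)) :=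
  C_unique φ (by rw [bar_Cgen_mul, bar_C])
    (Cgen_mul_C_sub_T_mem H hs ht hk hk' (isEig_C_alt H hs ht hk hk'.le))

/-- Left multiplication by `C_s` in the case `φ(t) < φ(s)`. -/
theorem Cgen_mul_C_of_gt (hs : φ (cls cs t) < φ (cls cs s)) (ht : 0 ≤ φ (cls cs t)) {k : ℕ}
    (hk : 1 ≤ k) (hk' : k < 2 * m) :
    Cgen φ s * C φ (alt cs t s k) = C φ (alt cs s t (k + 1)) +
      zeta φ s t • Calt φ s t (k - 1) + Calt φ s t (k - 3) := by
  have hs0 : 0 < φ (cls cs s) := ht.trans_lt hs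
  rcases hk.eq_or_lt with rfl | hk1
  · rw [alt_one, C_simple ht, ← Cgen_mul_Cgen H hs0 ht]; simp
  · have h1 : ∀ j ≤ 2 * m, IsEig s (Calt φ s t j) := by
      intro j hj
      rw [Calt]
      split_ifs with h
      · exact isEig_zero _
      · exact isEig_C_alt H hs ht (by omega) hj
    have h2 := C_alt_recursion H hs ht (k := k + 1) (by omega) (by omega) (h1 _ (by omega))
      (h1 _ (by omega))
    -- Since C_t times the shorter element is exactly C of the word starting with t, the recursion
    -- at k + 1 is the desired product formula.
    obtain ⟨j, rfl⟩ : ∃ j, k = j + 2 := ⟨k - 2, by omega⟩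
    rw [← Cgen_mul_C_of_lt H hs ht (by omega) (by omega), h2,
      show j + 2 + 1 - 2 = j + 1 by omega, show j + 2 - 1 = j + 1 by omega,
      show j + 2 + 1 - 4 = j + 2 - 3 by omega, Calt_of_pos (k := j + 1) (by omega)]
    abel

/-- With equal parameters the factor e^{φ(s)} of C_s cancels the e^{-φ(t)} given by the
t-eigenvector property. The coefficient at length j + 1 is therefore the sum of those of the
previous element at lengths j and j + 2. The second has constant term 1 when j + 1 = k - 2, which
the subtracted element removes. -/
theorem C_alt_recursion_eq (hs : 0 < φ (cls cs s)) (hst : φ (cls cs s) = φ (cls cs t)) {k : ℕ}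
    (hk : 2 ≤ k) (hk' : k ≤ 2 * m) (he : IsEig t (C φ (alt cs t s (k - 1))))
    (he' : IsEig s (Calt φ s t (k - 2))) :
    C φ (alt cs s t k) = Cgen φ s * C φ (alt cs t s (k - 1)) - Calt φ s t (k - 2) := by
  have hm := H.two_le
  refine (C_unique φ ?_ ?_).symm
  · rw [map_sub, bar_Cgen_mul, bar_C, bar_Calt]
  refine sub_T_mem_negPart H hs ((isEig_Cgen_mul hs.ne' _).sub he') (by omega) hk' ?_
  intro j hj
  set g := C φ (alt cs t s (k - 1)) with hg
  have h2 := repr_Calt (φ := φ) (k := k - 2) (j := j + 1) H (by omega) (by omega) (by omega)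
  have h3 := repr_C_alt (φ := φ) (k := k - 1) (j := j) H.symm (by omega) (by omega)
  have h4 : expo (φ (cls cs s)) * (Tbasis φ).repr g (alt cs s t (j + 1)) -
      (if j + 1 = k - 2 then 1 else 0) ∈ negCoeffs Γ := by
    by_cases h : j + 1 < 2 * m
    · rw [he.repr_alt H.symm h, ← mul_assoc, ← hst, expo_mul, add_neg_cancel, expo_zero, one_mul]
      have h5 := repr_C_alt (φ := φ) (k := k - 1) (j := j + 2) H.symm (by omega) (by omega)
      have hcond : (j + 2 = k - 1) ↔ (j + 1 = k - 2) := by omega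
      simpa only [hcond] using h5
    · have e : j + 1 = 2 * m := by omega
      rw [if_neg (by omega), e, alt_top cs H, hg, repr_C_alt_of_lt H.symm (by omega) le_rfl,
        mul_zero, sub_zero]
      exact zero_mem _
  rw [map_sub, Finsupp.sub_apply, repr_Cgen_mul_alt H hs.ne' _ hj]
  have hcond : (j = k - 1) ↔ (j + 1 = k) := by omega
  simp only [hcond] at h3
  convert add_mem h3 (sub_mem h4 h2) using 1
  ring

omit H in
-- The roles of s and t alternate along the recursion, so the induction runs over both orderings of
-- the generators at once.
theorem isEig_C_alt_eq (H : IsDihedral M s t m) (hs : 0 < φ (cls cs s))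
    (hst : φ (cls cs s) = φ (cls cs t)) {k : ℕ} (hk : 1 ≤ k) (hk' : k ≤ 2 * m) :
    IsEig s (C φ (alt cs s t k)) := by
  induction k using Nat.strong_induction_on generalizing s t with
  | _ k ih =>
    rcases hk.eq_or_lt with rfl | h2
    · rw [alt_one, C_simple hs.le, ← mul_one (Cgen φ s)]
      exact isEig_Cgen_mul hs.ne' _
    · have h1 : IsEig s (Calt φ s t (k - 2)) := by
        rw [Calt]
        split_ifs with h
        · exact isEig_zero _
        · exact ih _ (by omega) H hs hst (by omega) (by omega)
      have h3 := ih (k - 1) (by omega) H.symm (hst ▸ hs) hst.symm (by omega) (by omega)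
      rw [C_alt_recursion_eq H hs hst h2 hk' h3 h1]
      exact (isEig_Cgen_mul hs.ne' _).sub h1

/-- Left multiplication by `C_s` in the case `φ(s) = φ(t)`. -/
theorem Cgen_mul_C_of_eq (hs : 0 < φ (cls cs s)) (hst : φ (cls cs s) = φ (cls cs t)) {k : ℕ}
    (hk : 1 ≤ k) (hk' : k < 2 * m) :
    Cgen φ s * C φ (alt cs t s k) = C φ (alt cs s t (k + 1)) + Calt φ s t (k - 1) := by
  have h1 : IsEig s (Calt φ s t (k + 1 - 2)) := by
    rw [Calt]
    split_ifs with h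
    · exact isEig_zero _
    · exact isEig_C_alt_eq H hs hst (by omega) (by omega)
  have := C_alt_recursion_eq H hs hst (k := k + 1) (by omega) (by omega)
    (isEig_C_alt_eq H.symm (hst ▸ hs) hst.symm (by omega) (by omega)) h1
  rw [this, Nat.add_sub_cancel, show k + 1 - 2 = k - 1 by omega, sub_add_cancel]

end Dihedral
end Hecke
end KLCell
end

noncomputable section
namespace KLCell
set_option linter.unusedSectionVars false

/-! ### Explicit preorders on dihedral groups -/

section Combinatorics

variable {B : Type u} {W : Type v} [Group W] {M : CoxeterMatrix B} (cs : CoxeterSystem M W)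

/-- `x` and `y` agree on whether `s` is a right descent (type `L`) or a left descent (type `R`). -/
def SameDescent (s : B) : Side → W → W → Prop
  | .L, x, y => cs.IsRightDescent x s ↔ cs.IsRightDescent y s
  | .R, x, y => cs.IsLeftDescent x s ↔ cs.IsLeftDescent y s
  | .LR, _, _ => True

variable {cs} in
theorem SameDescent.refl (s : B) (side : Side) (x : W) : SameDescent cs s side x x := by
  cases side
  · exact Iff.rfl
  · exact Iff.rfl
  · trivial

variable {cs} in
theorem SameDescent.symm {s : B} {side : Side} {x y : W} (h : SameDescent cs s side x y) :
    SameDescent cs s side y x := by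
  cases side
  · exact Iff.symm h
  · exact Iff.symm h
  · trivial

variable {cs} in
theorem SameDescent.trans {s : B} {side : Side} {x y z : W} (h : SameDescent cs s side x y)
    (h' : SameDescent cs s side y z) : SameDescent cs s side x z := by
  cases side
  · exact Iff.trans h h'
  · exact Iff.trans h h'
  · trivial

theorem sameDescent_inv (s : B) (x y : W) :
    SameDescent cs s .L x⁻¹ y⁻¹ ↔ SameDescent cs s .R x y := by
  simp only [SameDescent, cs.isRightDescent_inv_iff]

variable (s t : B) (m : ℕ)

/-- The Kazhdan-Lusztig preorder in the case `0 < φ(t) < φ(s)`. -/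
def RelA (side : Side) (x y : W) : Prop :=
  y = 1 ∨ x = alt cs s t (2 * m) ∨ (x ≠ 1 ∧ y ≠ alt cs s t (2 * m) ∧ SameDescent cs s side x y ∧
    (y = cs.simple t ∨ x = alt cs s t (2 * m - 1) ∨
      (x ≠ cs.simple t ∧ y ≠ alt cs s t (2 * m - 1))))

/-- The Kazhdan-Lusztig preorder in the case `0 < φ(t) = φ(s)`. -/
def RelE (side : Side) (x y : W) : Prop :=
  y = 1 ∨ x = alt cs s t (2 * m) ∨ (x ≠ 1 ∧ y ≠ alt cs s t (2 * m) ∧ SameDescent cs s side x y)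

/-- The Kazhdan-Lusztig preorder in the case `0 = φ(t) < φ(s)`. -/
def RelZ (side : Side) (x y : W) : Prop :=
  (y = 1 ∨ y = cs.simple t) ∨ (x = alt cs s t (2 * m) ∨ x = alt cs s t (2 * m - 1)) ∨
    ((x ≠ 1 ∧ x ≠ cs.simple t) ∧ (y ≠ alt cs s t (2 * m) ∧ y ≠ alt cs s t (2 * m - 1)) ∧
      SameDescent cs s side x y)

variable {s t m} (H : IsDihedral M s t m)
include H

theorem isLeftDescent_alt {j : ℕ} (h1 : 1 ≤ j) (h2 : j ≤ 2 * m) :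
    cs.IsLeftDescent (alt cs s t j) s := by
  obtain ⟨j, rfl⟩ : ∃ i, j = i + 1 := ⟨j - 1, by omega⟩
  rw [CoxeterSystem.IsLeftDescent, simple_mul_alt_succ, length_alt cs H h2,
    length_alt cs H.symm (by omega)]
  omega

theorem not_isLeftDescent_alt {j : ℕ} (h2 : j < 2 * m) :
    ¬ cs.IsLeftDescent (alt cs t s j) s := by
  rw [CoxeterSystem.IsLeftDescent, simple_mul_alt, length_alt cs H h2,
    length_alt cs H.symm (by omega)]
  omega

theorem alt_top_inv : (alt cs s t (2 * m))⁻¹ = alt cs s t (2 * m) := by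
  rw [alt_inv_of_even cs s t (by simp), alt_top cs H]

omit H in
theorem alt_pred_top_inv (hm : 1 ≤ m) : (alt cs s t (2 * m - 1))⁻¹ = alt cs s t (2 * m - 1) :=
  alt_inv_of_odd cs s t ⟨m - 1, by omega⟩

/-- A table translating everything the three explicit preorders depend on into arithmetic of the
length j. With it, each inclusion of a generating arrow in a preorder becomes linear arithmetic. -/
theorem alt_facts {j : ℕ} (h1 : 1 ≤ j) (h2 : j ≤ 2 * m) :
    alt cs s t j ≠ 1 ∧ (alt cs s t j = alt cs s t (2 * m) ↔ j = 2 * m) ∧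
    (alt cs s t j = alt cs s t (2 * m - 1) ↔ j = 2 * m - 1) ∧ alt cs s t j ≠ cs.simple t ∧
    cs.IsLeftDescent (alt cs s t j) s ∧
    (cs.IsRightDescent (alt cs s t j) s ↔ j % 2 = 1 ∨ j = 2 * m) := by
  have hm := H.two_le
  refine ⟨?_, alt_inj cs H h2 le_rfl, alt_inj cs H h2 (by omega), ?_,
    isLeftDescent_alt cs H h1 h2, ?_⟩
  · rw [Ne, alt_eq_one_iff cs H h2]; omega
  · rw [← alt_one cs t s, Ne, alt_eq_alt_iff cs H h2 (by omega)]; omega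
  · rw [← inv_inv (alt cs s t j), cs.isRightDescent_inv_iff]
    rcases Nat.even_or_odd j with h | h
    · rw [alt_inv_of_even cs s t h]
      have h' := Nat.even_iff.1 h
      rcases h2.lt_or_eq with h3 | rfl
      · have := not_isLeftDescent_alt cs H h3
        constructor
        · intro h; exact absurd h this
        · omega
      · rw [← alt_top cs H]
        simp [isLeftDescent_alt cs H h1 le_rfl]
    · rw [alt_inv_of_odd cs s t h]
      simp [isLeftDescent_alt cs H h1 h2, Nat.odd_iff.1 h]

theorem alt_facts' {j : ℕ} (h1 : 1 ≤ j) (h2 : j < 2 * m) :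
    alt cs t s j ≠ 1 ∧ alt cs t s j ≠ alt cs s t (2 * m) ∧
    alt cs t s j ≠ alt cs s t (2 * m - 1) ∧ (alt cs t s j = cs.simple t ↔ j = 1) ∧
    ¬ cs.IsLeftDescent (alt cs t s j) s ∧
    (cs.IsRightDescent (alt cs t s j) s ↔ j % 2 = 0) := by
  have hm := H.two_le
  refine ⟨?_, ?_, ?_, ?_, not_isLeftDescent_alt cs H h2, ?_⟩
  · rw [Ne, alt_eq_one_iff cs H.symm h2.le]; omega
  · rw [Ne, alt_eq_alt_iff cs H.symm h2.le le_rfl]; omega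
  · rw [Ne, alt_eq_alt_iff cs H.symm h2.le (by omega)]; omega
  · rw [← alt_one cs t s, alt_inj cs H.symm h2.le (by omega)]
  · rw [← inv_inv (alt cs t s j), cs.isRightDescent_inv_iff]
    rcases Nat.even_or_odd j with h | h
    · rw [alt_inv_of_even cs t s h]
      simp [isLeftDescent_alt cs H h1 h2.le, Nat.even_iff.1 h]
    · rw [alt_inv_of_odd cs t s h]
      simp [not_isLeftDescent_alt cs H h2, Nat.odd_iff.1 h]

theorem special_ne : (1 : W) ≠ alt cs s t (2 * m) ∧ (1 : W) ≠ alt cs s t (2 * m - 1) ∧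
    cs.simple t ≠ 1 ∧ cs.simple t ≠ alt cs s t (2 * m) ∧ cs.simple t ≠ alt cs s t (2 * m - 1) ∧
    alt cs s t (2 * m) ≠ alt cs s t (2 * m - 1) := by
  have hm := H.two_le
  have h1 := alt_facts cs H (j := 2 * m) (by omega) le_rfl
  have h2 := alt_facts cs H (j := 2 * m - 1) (by omega) (by omega)
  exact ⟨h1.1.symm, h2.1.symm, by simpa using (alt_facts' cs H (j := 1) le_rfl (by omega)).1,
    h1.2.2.2.1.symm, h2.2.2.2.1.symm, fun h => by have := h1.2.2.1.1 h; omega⟩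

omit H in
theorem RelA.refl (side : Side) (x : W) : RelA cs s t m side x x := by
  have := SameDescent.refl (cs := cs) s side x
  unfold RelA; tauto

omit H in
theorem RelE.refl (side : Side) (x : W) : RelE cs s t m side x x := by
  have := SameDescent.refl (cs := cs) s side x
  unfold RelE; tauto

omit H in
theorem RelZ.refl (side : Side) (x : W) : RelZ cs s t m side x x := by
  have := SameDescent.refl (cs := cs) s side x
  unfold RelZ; tauto

theorem RelA.trans (side : Side) (x y z : W) (h1 : RelA cs s t m side x y)
    (h2 : RelA cs s t m side y z) : RelA cs s t m side x z := by
  have hne := special_ne cs H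
  have ht := fun a b => SameDescent.trans (cs := cs) (s := s) (side := side) (x := x) (y := y)
    (z := z) a b
  unfold RelA at *
  grind

theorem RelE.trans (side : Side) (x y z : W) (h1 : RelE cs s t m side x y)
    (h2 : RelE cs s t m side y z) : RelE cs s t m side x z := by
  have hne := special_ne cs H
  have ht := fun a b => SameDescent.trans (cs := cs) (s := s) (side := side) (x := x) (y := y)
    (z := z) a b
  unfold RelE at *
  grind

theorem RelZ.trans (side : Side) (x y z : W) (h1 : RelZ cs s t m side x y)
    (h2 : RelZ cs s t m side y z) : RelZ cs s t m side x z := by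
  have hne := special_ne cs H
  have ht := fun a b => SameDescent.trans (cs := cs) (s := s) (side := side) (x := x) (y := y)
    (z := z) a b
  unfold RelZ at *
  grind

theorem special_inv (x : W) : (x⁻¹ = 1 ↔ x = 1) ∧ (x⁻¹ = cs.simple t ↔ x = cs.simple t) ∧
    (x⁻¹ = alt cs s t (2 * m) ↔ x = alt cs s t (2 * m)) ∧
    (x⁻¹ = alt cs s t (2 * m - 1) ↔ x = alt cs s t (2 * m - 1)) := by
  have hm := H.two_le
  refine ⟨inv_eq_one, ?_, ?_, ?_⟩ <;> rw [inv_eq_iff_eq_inv]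
  · rw [cs.inv_simple]
  · rw [alt_top_inv cs H]
  · rw [alt_pred_top_inv cs (by omega)]

theorem RelA.inv_iff (x y : W) : RelA cs s t m .L x⁻¹ y⁻¹ ↔ RelA cs s t m .R x y := by
  simp only [RelA, Ne, special_inv cs H, sameDescent_inv]

theorem RelE.inv_iff (x y : W) : RelE cs s t m .L x⁻¹ y⁻¹ ↔ RelE cs s t m .R x y := by
  simp only [RelE, Ne, special_inv cs H, sameDescent_inv]

theorem RelZ.inv_iff (x y : W) : RelZ cs s t m .L x⁻¹ y⁻¹ ↔ RelZ cs s t m .R x y := by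
  simp only [RelZ, Ne, special_inv cs H, sameDescent_inv]

/-- There are elements away from the extreme ones with prescribed descents. -/
theorem exists_core (x y : W) : ∃ z, z ≠ 1 ∧ z ≠ cs.simple t ∧ z ≠ alt cs s t (2 * m) ∧
    z ≠ alt cs s t (2 * m - 1) ∧ SameDescent cs s .L z x ∧ SameDescent cs s .R z y := by
  have hm := H.two_le
  -- The four patterns are realized by s, ts, st and tst. As m ≥ 2, these words stay away from w₁
  -- and w₀.
  by_cases hx : cs.IsRightDescent x s <;> by_cases hy : cs.IsLeftDescent y s
  · have h := alt_facts cs H (j := 1) le_rfl (by omega)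
    refine ⟨alt cs s t 1, h.1, h.2.2.2.1, ?_, ?_, ?_, ?_⟩
    · rw [Ne, h.2.1]; omega
    · rw [Ne, h.2.2.1]; omega
    · simp only [SameDescent, hx, iff_true]; rw [h.2.2.2.2.2]; omega
    · simp only [SameDescent, hy, iff_true]; exact h.2.2.2.2.1
  · have h := alt_facts' cs H (j := 2) (by omega) (by omega)
    refine ⟨alt cs t s 2, h.1, ?_, h.2.1, h.2.2.1, ?_, ?_⟩
    · rw [Ne, h.2.2.2.1]; omega
    · simp only [SameDescent, hx, iff_true]; rw [h.2.2.2.2.2]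
    · simp only [SameDescent, hy, iff_false]; exact h.2.2.2.2.1
  · have h := alt_facts cs H (j := 2) (by omega) (by omega)
    refine ⟨alt cs s t 2, h.1, h.2.2.2.1, ?_, ?_, ?_, ?_⟩
    · rw [Ne, h.2.1]; omega
    · rw [Ne, h.2.2.1]; omega
    · simp only [SameDescent, hx, iff_false]; rw [h.2.2.2.2.2]; omega
    · simp only [SameDescent, hy, iff_true]; exact h.2.2.2.2.1
  · have h := alt_facts' cs H (j := 3) (by omega) (by omega)
    refine ⟨alt cs t s 3, h.1, ?_, h.2.1, h.2.2.1, ?_, ?_⟩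
    · rw [Ne, h.2.2.2.1]; omega
    · simp only [SameDescent, hx, iff_false]; rw [h.2.2.2.2.2]; omega
    · simp only [SameDescent, hy, iff_false]; exact h.2.2.2.2.1

/-- An intermediate core element z shares its first letter with x and its last letter with y. This
is how the two-sided preorder is recovered from the one-sided ones; the extreme elements are handled
separately. -/
theorem RelA.factor {x y : W} (h : RelA cs s t m .LR x y) :
    ∃ z, RelA cs s t m .R x z ∧ RelA cs s t m .L z y := by
  obtain ⟨z, h1, h2, h3, h4, h5, h6⟩ := exists_core cs H y x
  have hne := special_ne cs H
  have hr := RelA.refl cs (s := s) (t := t) (m := m) .R x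
  have hr' := RelA.refl cs (s := s) (t := t) (m := m) .L x
  have h7 := h6.symm
  by_cases e : x = y
  · exact ⟨x, hr, e ▸ hr'⟩
  by_cases e1 : y = 1
  · exact ⟨x, hr, Or.inl e1⟩
  by_cases e2 : x = alt cs s t (2 * m)
  · exact ⟨y, Or.inr (Or.inl e2), RelA.refl cs .L y⟩
  refine ⟨z, ?_, ?_⟩ <;> unfold RelA at * <;> grind

theorem RelE.factor {x y : W} (h : RelE cs s t m .LR x y) :
    ∃ z, RelE cs s t m .R x z ∧ RelE cs s t m .L z y := by
  obtain ⟨z, h1, h2, h3, h4, h5, h6⟩ := exists_core cs H y x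
  have hr := RelE.refl cs (s := s) (t := t) (m := m) .R x
  have h7 := h6.symm
  by_cases e1 : y = 1
  · exact ⟨x, hr, Or.inl e1⟩
  by_cases e2 : x = alt cs s t (2 * m)
  · exact ⟨y, Or.inr (Or.inl e2), RelE.refl cs .L y⟩
  refine ⟨z, ?_, ?_⟩ <;> unfold RelE at * <;> grind

theorem RelZ.factor {x y : W} (h : RelZ cs s t m .LR x y) :
    ∃ z, RelZ cs s t m .R x z ∧ RelZ cs s t m .L z y := by
  obtain ⟨z, h1, h2, h3, h4, h5, h6⟩ := exists_core cs H y x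
  have hr := RelZ.refl cs (s := s) (t := t) (m := m) .R x
  have h7 := h6.symm
  by_cases e1 : y = 1 ∨ y = cs.simple t
  · exact ⟨x, hr, Or.inl e1⟩
  by_cases e2 : x = alt cs s t (2 * m) ∨ x = alt cs s t (2 * m - 1)
  · exact ⟨y, Or.inr (Or.inl e2), RelZ.refl cs .L y⟩
  refine ⟨z, ?_, ?_⟩ <;> unfold RelZ at * <;> grind

omit H in
theorem RelA.two_sided {side : Side} {x y : W} (h : RelA cs s t m side x y) :
    RelA cs s t m .LR x y := by
  have : SameDescent cs s .LR x y := trivial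
  unfold RelA at *; tauto

omit H in
theorem RelE.two_sided {side : Side} {x y : W} (h : RelE cs s t m side x y) :
    RelE cs s t m .LR x y := by
  have : SameDescent cs s .LR x y := trivial
  unfold RelE at *; tauto

omit H in
theorem RelZ.two_sided {side : Side} {x y : W} (h : RelZ cs s t m side x y) :
    RelZ cs s t m .LR x y := by
  have : SameDescent cs s .LR x y := trivial
  unfold RelZ at *; tauto

/-- The elements with a given last letter, as inverses of alternating products. -/
theorem alt_inv_facts {j : ℕ} (h1 : 1 ≤ j) (h2 : j ≤ 2 * m) :
    (alt cs s t j)⁻¹ ≠ 1 ∧ ((alt cs s t j)⁻¹ = alt cs s t (2 * m) ↔ j = 2 * m) ∧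
    ((alt cs s t j)⁻¹ = alt cs s t (2 * m - 1) ↔ j = 2 * m - 1) ∧ (alt cs s t j)⁻¹ ≠ cs.simple t ∧
    cs.IsRightDescent (alt cs s t j)⁻¹ s := by
  have h := alt_facts cs H h1 h2
  simp only [Ne, special_inv cs H, cs.isRightDescent_inv_iff]
  exact ⟨h.1, h.2.1, h.2.2.1, h.2.2.2.1, h.2.2.2.2.1⟩

theorem alt_inv_facts' {j : ℕ} (h1 : 1 ≤ j) (h2 : j < 2 * m) :
    (alt cs t s j)⁻¹ ≠ 1 ∧ (alt cs t s j)⁻¹ ≠ alt cs s t (2 * m) ∧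
    (alt cs t s j)⁻¹ ≠ alt cs s t (2 * m - 1) ∧ ((alt cs t s j)⁻¹ = cs.simple t ↔ j = 1) ∧
    ¬ cs.IsRightDescent (alt cs t s j)⁻¹ s := by
  have h := alt_facts' cs H h1 h2
  simp only [Ne, special_inv cs H, cs.isRightDescent_inv_iff]
  exact ⟨h.1, h.2.1, h.2.2.1, h.2.2.2.1, h.2.2.2.2.1⟩

theorem alt_inv_cases {P : W → Prop} (h0 : P 1)
    (h1 : ∀ k, 1 ≤ k → k ≤ 2 * m → P (alt cs s t k)⁻¹)
    (h2 : ∀ k, 1 ≤ k → k < 2 * m → P (alt cs t s k)⁻¹) (x : W) : P x := by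
  rw [← inv_inv x]
  exact alt_cases cs H (P := fun x => P x⁻¹) (by rwa [inv_one]) h1 h2 x⁻¹

/-- Going up in a family of elements with a given last letter. -/
theorem le_alt_inv_of_ge {r : W → W → Prop} (hrefl : ∀ x, r x x)
    (htrans : ∀ x y z, r x y → r y z → r x z)
    (hst : ∀ k, 1 ≤ k → k < 2 * m → r (alt cs s t (k + 1)) (alt cs t s k))
    (hts : ∀ k, 1 ≤ k → k < 2 * m → r (alt cs t s (k + 1)) (alt cs s t k))
    {j k : ℕ} (hk : 1 ≤ k) (hkj : k ≤ j) (hj : j ≤ 2 * m) :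
    r (alt cs s t j)⁻¹ (alt cs s t k)⁻¹ := by
  induction hkj with
  | refl => exact hrefl _
  | @step j hkj ih =>
    have hkj' : k ≤ j := hkj
    refine htrans _ _ _ ?_ (ih (by omega))
    change r (alt cs s t (j + 1))⁻¹ _
    rcases Nat.even_or_odd j with h | h
    · rw [alt_inv_of_even cs s t h, alt_inv_of_odd cs s t h.add_one]
      exact hst j (by omega) (by omega)
    · rw [alt_inv_of_odd cs s t h, alt_inv_of_even cs s t h.add_one]
      exact hts j (by omega) (by omega)

omit H in
/-- Going down in a family of elements with a given last letter. -/
theorem le_alt_inv_of_le {r : W → W → Prop} (hrefl : ∀ x, r x x)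
    (htrans : ∀ x y z, r x y → r y z → r x z) {a b : ℕ}
    (hr : ∀ k, a < k → k ≤ b → r (alt cs s t (k - 1))⁻¹ (alt cs s t k)⁻¹)
    {j k : ℕ} (hj : a ≤ j) (hkj : j ≤ k) (hk : k ≤ b) :
    r (alt cs s t j)⁻¹ (alt cs s t k)⁻¹ := by
  induction hkj with
  | refl => exact hrefl _
  | @step k hkj ih =>
    have hkj' : j ≤ k := hkj
    exact htrans _ _ _ (ih (by omega)) (hr (k + 1) (by omega) (by omega))

end Combinatorics
end KLCell
end

noncomputable section
namespace KLCell
set_option linter.unusedSectionVars false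
set_option linter.unusedSimpArgs false

/-! ### The Kazhdan-Lusztig preorders of dihedral groups -/

open Hecke

variable {B : Type u} {W : Type v} [Group W] {M : CoxeterMatrix B} {cs : CoxeterSystem M W}
variable {Γ : Type w} [AddCommGroup Γ] [LinearOrder Γ] [IsOrderedAddMonoid Γ] {φ : SBar cs → Γ}

theorem repr_C_C (x y : W) [Decidable (y = x)] :
    (Cbasis φ).repr (C φ y) x = if y = x then 1 else 0 := by
  rw [← Cbasis_apply, Module.Basis.repr_self, Finsupp.single_apply]

/-- The relation `r x y` contains `cellLE` for left cells if, for all `i` and `y`, the product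
`C_i C_y` is a combination of the `C_x` with `r x y`. -/
theorem cellLE_left_of_Cgen {r : W → W → Prop} (hrefl : ∀ x, r x x)
    (htrans : ∀ x y z, r x y → r y z → r x z)
    (hr : ∀ i y, Cgen φ i * C φ y ∈ Submodule.span (GrpRing Γ) (C φ '' {x | r x y})) {x y : W}
    (h : cellLE φ .L x y) : r x y := by
  refine cellLE_left_of φ hrefl htrans (fun i x y hxy => ?_) h
  have h1 : T φ (cs.simple i) * C φ y ∈ Submodule.span (GrpRing Γ) (C φ '' {x | r x y}) := by
    have e : T φ (cs.simple i) * C φ y = Cgen φ i * C φ y - dpar φ i • C φ y := by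
      rw [Cgen, add_mul, smul_mul_assoc, one_mul, add_sub_cancel_right]
    rw [e]
    exact sub_mem (hr i y) (Submodule.smul_mem _ _ (Submodule.subset_span ⟨y, hrefl y, rfl⟩))
  have h2 := (Cbasis φ).mem_span_image (m := T φ (cs.simple i) * C φ y) (s := {x | r x y})
  rw [show (⇑(Cbasis φ) : W → Hecke cs φ) = C φ from funext (Cbasis_apply φ)] at h2
  exact h2.1 h1 (Finsupp.mem_support_iff.2 hxy)

theorem cellLE_left_one (x : W) : cellLE φ .L x 1 := by
  classical
  refine .single ⟨C φ x, ?_⟩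
  rw [C_one, mul_one, repr_C_C, if_pos rfl]
  exact one_ne_zero

section Dihedral

variable {s t : B} {m : ℕ} (H : IsDihedral M s t m)
include H

theorem repr_C_Calt {j k : ℕ} (hj : j ≤ 2 * m) (hk : k ≤ 2 * m) (hk' : 1 ≤ k) :
    (Cbasis φ).repr (Calt φ s t j) (alt cs s t k) = if j = k then 1 else 0 := by
  classical
  rw [Calt]
  split_ifs with h1 h2 h2
  · omega
  · simp
  · rw [h2, repr_C_C, if_pos rfl]
  · rw [repr_C_C, if_neg]
    rwa [alt_inj cs H hj hk]

omit H in
theorem zeta_ne_zero (ht : φ (cls cs t) ≠ 0) : zeta φ s t ≠ 0 := by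
  intro h
  have h1 := congrArg (aug Γ) h
  rw [zeta, if_neg ht, map_add, aug_expo, aug_expo, map_zero] at h1
  omega

/-! ### The left preorder for 0 ≤ φ(t) < φ(s) -/

section Unequal

variable (hs : φ (cls cs t) < φ (cls cs s)) (ht : 0 ≤ φ (cls cs t))
include hs ht

theorem repr_Cgen_mul_of_gt {k j : ℕ} (hk : 1 ≤ k) (hk' : k < 2 * m) (hj : 1 ≤ j)
    (hj' : j ≤ 2 * m) : (Cbasis φ).repr (Cgen φ s * C φ (alt cs t s k)) (alt cs s t j) =
      (if k + 1 = j then 1 else 0) + zeta φ s t * (if k - 1 = j then 1 else 0) +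
        (if k - 3 = j then 1 else 0) := by
  rw [Cgen_mul_C_of_gt H hs ht hk hk', map_add, map_add, map_smul, Finsupp.add_apply,
    Finsupp.add_apply, Finsupp.smul_apply, smul_eq_mul, repr_C_Calt H (by omega) hj' hj,
    repr_C_Calt H (by omega) hj' hj, ← Calt_of_pos (by omega), repr_C_Calt H (by omega) hj' hj]

theorem le_up_s {k : ℕ} (hk : 1 ≤ k) (hk' : k < 2 * m) :
    cellLE φ .L (alt cs s t (k + 1)) (alt cs t s k) := by
  refine .single ⟨Cgen φ s, ?_⟩
  rw [repr_Cgen_mul_of_gt H hs ht hk hk' (by omega) (by omega), if_pos rfl, if_neg (by omega),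
    if_neg (by omega)]
  simp

theorem le_up_t {k : ℕ} (hk : 1 ≤ k) (hk' : k < 2 * m) :
    cellLE φ .L (alt cs t s (k + 1)) (alt cs s t k) := by
  classical
  refine .single ⟨Cgen φ t, ?_⟩
  rw [Cgen_mul_C_of_lt H hs ht hk hk', repr_C_C, if_pos rfl]
  exact one_ne_zero

omit H hs ht in
theorem Cgen_eq_T (h0 : φ (cls cs t) = 0) : Cgen φ t = T φ (cs.simple t) := by
  rw [Cgen, dpar, if_pos h0, zero_smul, add_zero]

omit H hs ht in
theorem T_mul_T_of_eq_zero (h0 : φ (cls cs t) = 0) :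
    T φ (cs.simple t) * T φ (cs.simple t) = 1 := by
  rw [T_simple_sq, qpar, h0]; simp

theorem Cgen_mul_C_of_zero (h0 : φ (cls cs t) = 0) {k : ℕ} (hk : k < 2 * m) :
    Cgen φ t * C φ (alt cs t s (k + 1)) = C φ (alt cs s t k) := by
  have e : Cgen φ t * Cgen φ t = 1 := by rw [Cgen_eq_T h0, T_mul_T_of_eq_zero h0]
  rcases Nat.eq_zero_or_pos k with rfl | h
  · rw [zero_add, alt_one, C_simple ht, alt_zero, C_one, e]
  · rw [← Cgen_mul_C_of_lt H hs ht h hk, ← mul_assoc, e, one_mul]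

theorem Cgen_mul_C_of_pos (h0 : φ (cls cs t) ≠ 0) {k : ℕ} (hk : k < 2 * m) :
    Cgen φ t * C φ (alt cs t s (k + 1)) =
      (expo (φ (cls cs t)) + expo (-φ (cls cs t))) • C φ (alt cs t s (k + 1)) := by
  refine IsEig.Cgen_mul h0 ?_
  rcases Nat.eq_zero_or_pos k with rfl | h
  · rw [zero_add, alt_one, C_simple ht, ← mul_one (Cgen φ t)]
    exact isEig_Cgen_mul h0 _
  · rw [← Cgen_mul_C_of_lt H hs ht h hk]
    exact isEig_Cgen_mul h0 _

theorem le_down_of_zero (h0 : φ (cls cs t) = 0) {k : ℕ} (hk : k < 2 * m) :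
    cellLE φ .L (alt cs s t k) (alt cs t s (k + 1)) := by
  classical
  refine .single ⟨Cgen φ t, ?_⟩
  rw [Cgen_mul_C_of_zero H hs ht h0 hk, repr_C_C, if_pos rfl]
  exact one_ne_zero

/-- The coefficient giving this step is `zeta`, which specializes to 2 when φ(t) ≠ 0 but is zero
when φ(t) = 0. In the latter case T_t, being an involution that permutes the basis, provides the
step instead. -/
theorem le_down_one {k : ℕ} (hk : 2 ≤ k) (hk' : k < 2 * m) :
    cellLE φ .L (alt cs s t (k - 1)) (alt cs t s k) := by
  by_cases h0 : φ (cls cs t) = 0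
  · obtain ⟨k, rfl⟩ : ∃ j, k = j + 1 := ⟨k - 1, by omega⟩
    exact le_down_of_zero H hs ht h0 (by omega)
  · refine .single ⟨Cgen φ s, ?_⟩
    rw [repr_Cgen_mul_of_gt H hs ht (by omega) hk' (by omega) (by omega), if_pos rfl,
      if_neg (by omega), if_neg (by omega)]
    simpa using zeta_ne_zero h0

theorem le_down_three {k : ℕ} (hk : 4 ≤ k) (hk' : k < 2 * m) :
    cellLE φ .L (alt cs s t (k - 3)) (alt cs t s k) := by
  refine .single ⟨Cgen φ s, ?_⟩
  rw [repr_Cgen_mul_of_gt H hs ht (by omega) hk' (by omega) (by omega), if_pos rfl,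
    if_neg (by omega), if_neg (by omega)]
  simp

/-- Upper bound for the left preorder in the case `φ(t) < φ(s)`. -/
theorem cellLE_left_upper {r : W → W → Prop} (hrefl : ∀ x, r x x)
    (htrans : ∀ x y z, r x y → r y z → r x z) (h1 : ∀ x, r x 1)
    (hst : ∀ k, 1 ≤ k → k < 2 * m → r (alt cs s t (k + 1)) (alt cs t s k))
    (hts : ∀ k, 1 ≤ k → k < 2 * m → r (alt cs t s (k + 1)) (alt cs s t k))
    (hd1 : ∀ k, 2 ≤ k → k < 2 * m → r (alt cs s t (k - 1)) (alt cs t s k))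
    (hd3 : ∀ k, 4 ≤ k → k < 2 * m → r (alt cs s t (k - 3)) (alt cs t s k))
    (hz : φ (cls cs t) = 0 → r 1 (cs.simple t) ∧
      r (alt cs s t (2 * m - 1)) (alt cs s t (2 * m))) {x y : W}
    (h : cellLE φ .L x y) : r x y := by
  classical
  have hm := H.two_le
  have hs0 := ht.trans_lt hs
  have hself : ∀ (p : GrpRing Γ) y, p • C φ y ∈
      Submodule.span (GrpRing Γ) (C φ '' {x | r x y}) := fun p y =>
    Submodule.smul_mem _ _ (Submodule.subset_span ⟨y, hrefl y, rfl⟩)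
  have hC : ∀ x y, r x y → C φ x ∈ Submodule.span (GrpRing Γ) (C φ '' {x | r x y}) :=
    fun x y h => Submodule.subset_span ⟨x, h, rfl⟩
  have hss : ∀ k, 1 ≤ k → k ≤ 2 * m → Cgen φ s * C φ (alt cs s t k) ∈
      Submodule.span (GrpRing Γ) (C φ '' {x | r x (alt cs s t k)}) := by
    intro k hk hk'
    rw [(isEig_C_alt H hs ht hk hk').Cgen_mul hs0.ne']
    exact hself _ _
  have htt : ∀ k, k < 2 * m → Cgen φ t * C φ (alt cs t s (k + 1)) ∈
      Submodule.span (GrpRing Γ) (C φ '' {x | r x (alt cs t s (k + 1))}) := by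
    intro k hk
    by_cases h0 : φ (cls cs t) = 0
    · rw [Cgen_mul_C_of_zero H hs ht h0 hk]
      refine hC _ _ ?_
      rcases Nat.eq_zero_or_pos k with rfl | h
      · simpa using (hz h0).1
      · by_cases h2 : k + 1 < 2 * m
        · simpa using hd1 (k + 1) (by omega) h2
        · have e : k + 1 = 2 * m := by omega
          rw [e, ← alt_top cs H, show k = 2 * m - 1 by omega]
          exact (hz h0).2
    · rw [Cgen_mul_C_of_pos H hs ht h0 hk]
      exact hself _ _
  refine cellLE_left_of_Cgen hrefl htrans (fun i y => ?_) h
  revert y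
  refine alt_cases cs H ?_ ?_ ?_
  · have e : {x | r x 1} = Set.univ := Set.eq_univ_of_forall h1
    rw [e, Set.image_univ]
    exact span_C φ trivial
  · intro k hk hk'
    rcases H.all i with rfl | rfl
    · exact hss k hk hk'
    · rcases hk'.lt_or_eq with h2 | rfl
      · rw [Cgen_mul_C_of_lt H hs ht hk h2]
        exact hC _ _ (hts k hk h2)
      · have := htt (2 * m - 1) (by omega)
        rwa [Nat.sub_add_cancel (by omega), ← alt_top cs H] at this
  · intro k hk hk'
    have hCalt : ∀ j, (1 ≤ j → r (alt cs s t j) (alt cs t s k)) → Calt φ s t j ∈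
        Submodule.span (GrpRing Γ) (C φ '' {x | r x (alt cs t s k)}) := by
      intro j hj
      rw [Calt]
      split_ifs with h
      · exact zero_mem _
      · exact hC _ _ (hj (by omega))
    rcases H.all i with rfl | rfl
    · rw [Cgen_mul_C_of_gt H hs ht hk hk']
      refine add_mem (add_mem (hC _ _ (hst k hk hk')) (Submodule.smul_mem _ _ (hCalt _ fun h => ?_)))
        (hCalt _ fun h => ?_)
      · exact hd1 k (by omega) hk'
      · exact hd3 k (by omega) hk'
    · obtain ⟨k, rfl⟩ : ∃ j, k = j + 1 := ⟨k - 1, by omega⟩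
      exact htt k (by omega)

/-- Descending chains in the case `φ(t) < φ(s)`. -/
theorem le_down_alt_inv_s {k : ℕ} (hk : 1 < k) (hk' : k ≤ 2 * m - 2) :
    cellLE φ .L (alt cs s t (k - 1))⁻¹ (alt cs s t k)⁻¹ := by
  have hm := H.two_le
  rcases Nat.even_or_odd k with h | h
  · rw [alt_inv_of_even cs s t h, alt_inv_of_odd cs s t (Nat.Even.sub_odd (by omega) h odd_one)]
    exact le_down_one H hs ht hk (by omega)
  · have h2 := Nat.odd_iff.1 h
    rw [alt_inv_of_odd cs s t h, alt_inv_of_even cs s t (Nat.Odd.sub_odd h odd_one)]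
    -- A word starting with s cannot be shortened directly: C_s acts on it as a scalar and C_t
    -- lengthens it. So go up by one with C_t, down by three with C_s, and up by one again. The
    -- detour passes through length k + 1 < 2m.
    refine .trans (.trans ?_ (le_down_three H hs ht (k := k + 1) (by omega) (by omega)))
      (le_up_t H hs ht (k := k) (by omega) (by omega))
    have := le_up_t H hs ht (k := k - 2) (by omega) (by omega)
    rwa [show k - 2 + 1 = k - 1 by omega, show k - 2 = k + 1 - 3 by omega] at this

/-- The same detour, for the words ending with t. The chain stops at length two, as the element t
itself is not claimed to be reached from longer words. -/
theorem le_down_alt_inv_t {k : ℕ} (hk : 2 < k) (hk' : k ≤ 2 * m - 1) :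
    cellLE φ .L (alt cs t s (k - 1))⁻¹ (alt cs t s k)⁻¹ := by
  have hm := H.two_le
  rcases Nat.even_or_odd k with h | h
  · have h2 := Nat.even_iff.1 h
    rw [alt_inv_of_even cs t s h, alt_inv_of_odd cs t s (Nat.Even.sub_odd (by omega) h odd_one)]
    refine .trans (.trans ?_ (le_down_three H hs ht (k := k + 1) (by omega) (by omega)))
      (le_up_t H hs ht (k := k) (by omega) (by omega))
    have := le_up_t H hs ht (k := k - 2) (by omega) (by omega)
    rwa [show k - 2 + 1 = k - 1 by omega, show k - 2 = k + 1 - 3 by omega] at this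
  · have h2 := Nat.odd_iff.1 h
    rw [alt_inv_of_odd cs t s h, alt_inv_of_even cs t s (Nat.Odd.sub_odd h odd_one)]
    exact le_down_one H hs ht (by omega) (by omega)

theorem le_alt_inv_s_of_ge {j k : ℕ} (hk : 1 ≤ k) (hkj : k ≤ j) (hj : j ≤ 2 * m) :
    cellLE φ .L (alt cs s t j)⁻¹ (alt cs s t k)⁻¹ :=
  le_alt_inv_of_ge cs H (fun x => .single (arrow_refl φ _ x)) (fun _ _ _ => .trans)
    (fun _ h h' => le_up_s H hs ht h h') (fun _ h h' => le_up_t H hs ht h h') hk hkj hj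

theorem le_alt_inv_t_of_ge {j k : ℕ} (hk : 1 ≤ k) (hkj : k ≤ j) (hj : j ≤ 2 * m) :
    cellLE φ .L (alt cs t s j)⁻¹ (alt cs t s k)⁻¹ :=
  le_alt_inv_of_ge cs H.symm (fun x => .single (arrow_refl φ _ x)) (fun _ _ _ => .trans)
    (fun _ h h' => le_up_t H hs ht h h') (fun _ h h' => le_up_s H hs ht h h') hk hkj hj

theorem alt_top_le (y : W) : cellLE φ .L (alt cs s t (2 * m)) y := by
  have hm := H.two_le
  revert y
  refine alt_inv_cases cs H (cellLE_left_one _) ?_ ?_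
  · intro k hk hk'
    rw [← alt_top_inv cs H]
    exact le_alt_inv_s_of_ge H hs ht hk hk' le_rfl
  · intro k hk hk'
    rw [alt_top cs H, ← alt_top_inv cs H.symm]
    exact le_alt_inv_t_of_ge H hs ht hk hk'.le le_rfl

theorem le_alt_inv_s {j k : ℕ} (hj : 1 ≤ j) (hj' : j ≤ 2 * m) (hk : 1 ≤ k) (hk' : k ≤ 2 * m - 2) :
    cellLE φ .L (alt cs s t j)⁻¹ (alt cs s t k)⁻¹ := by
  rcases le_total k j with h | h
  · exact le_alt_inv_s_of_ge H hs ht hk h hj'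
  · exact le_alt_inv_of_le cs (fun x => .single (arrow_refl φ _ x)) (fun _ _ _ => .trans)
      (fun _ h h' => le_down_alt_inv_s H hs ht h h') hj h hk'

theorem le_alt_inv_t {j k : ℕ} (hj : 2 ≤ j) (hj' : j ≤ 2 * m) (hk : 1 ≤ k) (hk' : k < 2 * m) :
    cellLE φ .L (alt cs t s j)⁻¹ (alt cs t s k)⁻¹ := by
  rcases le_total k j with h | h
  · exact le_alt_inv_t_of_ge H hs ht hk h hj'
  · exact le_alt_inv_of_le cs (fun x => .single (arrow_refl φ _ x)) (fun _ _ _ => .trans)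
      (fun _ h h' => le_down_alt_inv_t H hs ht h h') hj h (show k ≤ 2 * m - 1 by omega)

/-- Among the elements with a given last letter one can move up and down in length. The exceptions
at the ends are w₀ and w₁, which cannot be the starting point y, and t, which cannot be the target
x. -/
theorem cellLE_left_core {x y : W} (hx1 : x ≠ 1) (hxt : x ≠ cs.simple t)
    (hy0 : y ≠ alt cs s t (2 * m)) (hy1 : y ≠ alt cs s t (2 * m - 1)) (hy : y ≠ 1)
    (hd : SameDescent cs s .L x y) : cellLE φ .L x y := by
  suffices key : ∀ x y : W, x ≠ 1 → x ≠ cs.simple t → y ≠ alt cs s t (2 * m) →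
      y ≠ alt cs s t (2 * m - 1) → y ≠ 1 → SameDescent cs s .L x y → cellLE φ .L x y from
    key x y hx1 hxt hy0 hy1 hy hd
  clear hx1 hxt hy0 hy1 hy hd
  refine alt_inv_cases cs H ?_ ?_ ?_
  · intro y h; exact absurd rfl h
  · intro j hj hj'
    have hf := alt_inv_facts cs H hj hj'
    refine alt_inv_cases cs H ?_ ?_ ?_
    · intro _ _ _ _ h; exact absurd rfl h
    · intro k hk hk' _ _ h1 h2 _ _
      have hg := alt_inv_facts cs H hk hk'
      rw [Ne, hg.2.1] at h1
      rw [Ne, hg.2.2.1] at h2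
      exact le_alt_inv_s H hs ht hj hj' hk (by omega)
    · intro k hk hk' _ _ _ _ _ hd
      exact absurd (hd.1 hf.2.2.2.2) (alt_inv_facts' cs H hk hk').2.2.2.2
  · intro j hj hj'
    have hf := alt_inv_facts' cs H hj hj'
    refine alt_inv_cases cs H ?_ ?_ ?_
    · intro _ _ _ _ h; exact absurd rfl h
    · intro k hk hk' _ _ _ _ _ hd
      exact absurd (hd.2 (alt_inv_facts cs H hk hk').2.2.2.2) hf.2.2.2.2
    · intro k hk hk' _ h _ _ _ _
      rw [Ne, hf.2.2.2.1] at h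
      exact le_alt_inv_t H hs ht (by omega) hj'.le hk hk'

theorem cellLE_left_iff_relA (ht0 : φ (cls cs t) ≠ 0) (x y : W) :
    cellLE φ .L x y ↔ RelA cs s t m .L x y := by
  have hm := H.two_le
  constructor
  · intro h
    refine cellLE_left_upper H hs ht (RelA.refl cs .L) (RelA.trans cs H .L) (fun x => Or.inl rfl)
      ?_ ?_ ?_ ?_ (fun h0 => absurd h0 ht0) h
    all_goals
      intro k hk hk'
      have h1 := alt_facts' cs H (j := k) (by omega) (by omega)
      have h2 := alt_facts cs H (j := k) (by omega) (by omega)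
    · have h3 := alt_facts cs H (j := k + 1) (by omega) (by omega)
      unfold RelA SameDescent
      simp only [h1, h3, ne_eq, not_false_eq_true, true_and, false_or, or_false, false_and, not_true_eq_false, and_true, or_true, and_self]; omega
    · rcases (show k + 1 ≤ 2 * m by omega).lt_or_eq with h | h
      · have h3 := alt_facts' cs H (j := k + 1) (by omega) h
        unfold RelA SameDescent
        simp only [h2, h3, ne_eq, not_false_eq_true, true_and, false_or, or_false, false_and, not_true_eq_false, and_true, or_true, and_self]; omega
      · right; left
        rw [h, alt_top cs H]
    · have h3 := alt_facts cs H (j := k - 1) (by omega) (by omega)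
      unfold RelA SameDescent
      simp only [h1, h3, ne_eq, not_false_eq_true, true_and, false_or, or_false, false_and, not_true_eq_false, and_true, or_true, and_self]; omega
    · have h3 := alt_facts cs H (j := k - 3) (by omega) (by omega)
      unfold RelA SameDescent
      simp only [h1, h3, ne_eq, not_false_eq_true, true_and, false_or, or_false, false_and, not_true_eq_false, and_true, or_true, and_self]; omega
  · intro h
    by_cases e1 : y = 1
    · rw [e1]; exact cellLE_left_one x
    by_cases e2 : x = alt cs s t (2 * m)
    · rw [e2]; exact alt_top_le H hs ht y
    obtain ⟨h1, h2, h3, h4⟩ := (h.resolve_left e1).resolve_left e2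
    by_cases e3 : x = cs.simple t
    · by_cases e4 : y = cs.simple t
      · rw [e3, e4]; exact .single (arrow_refl φ _ _)
      · have := special_ne cs H
        grind
    by_cases e4 : y = alt cs s t (2 * m - 1)
    · by_cases e5 : x = alt cs s t (2 * m - 1)
      · rw [e4, e5]; exact .single (arrow_refl φ _ _)
      · have := special_ne cs H
        grind
    exact cellLE_left_core H hs ht h1 e3 h2 e4 e1 h3

theorem cellLE_left_iff_relZ (ht0 : φ (cls cs t) = 0) (x y : W) :
    cellLE φ .L x y ↔ RelZ cs s t m .L x y := by
  have hm := H.two_le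
  constructor
  · intro h
    refine cellLE_left_upper H hs ht (RelZ.refl cs .L) (RelZ.trans cs H .L)
      (fun x => Or.inl (Or.inl rfl))
      ?_ ?_ ?_ ?_ (fun h0 => ⟨Or.inl (Or.inr rfl), Or.inr (Or.inl (Or.inr rfl))⟩) h
    all_goals
      intro k hk hk'
      have h1 := alt_facts' cs H (j := k) (by omega) (by omega)
      have h2 := alt_facts cs H (j := k) (by omega) (by omega)
    · have h3 := alt_facts cs H (j := k + 1) (by omega) (by omega)
      unfold RelZ SameDescent
      simp only [h1, h3, ne_eq, not_false_eq_true, true_and, false_or, or_false, false_and, not_true_eq_false, and_true, or_true, and_self]; omega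
    · rcases (show k + 1 ≤ 2 * m by omega).lt_or_eq with h | h
      · have h3 := alt_facts' cs H (j := k + 1) (by omega) h
        unfold RelZ SameDescent
        simp only [h2, h3, ne_eq, not_false_eq_true, true_and, false_or, or_false, false_and, not_true_eq_false, and_true, or_true, and_self]; omega
      · right; left; left
        rw [h, alt_top cs H]
    · have h3 := alt_facts cs H (j := k - 1) (by omega) (by omega)
      unfold RelZ SameDescent
      simp only [h1, h3, ne_eq, not_false_eq_true, true_and, false_or, or_false, false_and, not_true_eq_false, and_true, or_true, and_self]; omega
    · have h3 := alt_facts cs H (j := k - 3) (by omega) (by omega)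
      unfold RelZ SameDescent
      simp only [h1, h3, ne_eq, not_false_eq_true, true_and, false_or, or_false, false_and, not_true_eq_false, and_true, or_true, and_self]; omega
  · intro h
    by_cases e1 : y = 1
    · rw [e1]; exact cellLE_left_one x
    by_cases e1' : y = cs.simple t
    · rw [e1']
      have := le_down_of_zero H hs ht ht0 (k := 0) (by omega)
      rw [alt_zero, zero_add, alt_one] at this
      exact .trans (cellLE_left_one x) this
    by_cases e2 : x = alt cs s t (2 * m)
    · rw [e2]; exact alt_top_le H hs ht y
    by_cases e2' : x = alt cs s t (2 * m - 1)
    · rw [e2']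
      refine .trans ?_ (alt_top_le H hs ht y)
      -- For φ(t) = 0 the product T_t C_{w₀} is C_{w₁}, so w₁ lies below w₀ and hence below
      -- everything.
      have := le_down_of_zero H hs ht ht0 (k := 2 * m - 1) (by omega)
      rwa [Nat.sub_add_cancel (by omega), ← alt_top cs H] at this
    have := special_ne cs H
    unfold RelZ at h
    exact cellLE_left_core H hs ht (by tauto) (by tauto) (by tauto) (by tauto) e1 (by tauto)

end Unequal

/-! ### The left preorder for 0 < φ(s) = φ(t) -/

section Equal

variable (hs : 0 < φ (cls cs s)) (hst : φ (cls cs s) = φ (cls cs t))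
include hs hst

theorem le_up_of_eq {k : ℕ} (hk : 1 ≤ k) (hk' : k < 2 * m) :
    cellLE φ .L (alt cs s t (k + 1)) (alt cs t s k) := by
  refine .single ⟨Cgen φ s, ?_⟩
  rw [Cgen_mul_C_of_eq H hs hst hk hk', map_add, Finsupp.add_apply,
    repr_C_Calt H (by omega) (by omega) (by omega), ← Calt_of_pos (by omega),
    repr_C_Calt H (by omega) (by omega) (by omega), if_pos rfl, if_neg (by omega)]
  simp

theorem le_down_of_eq {k : ℕ} (hk : 2 ≤ k) (hk' : k < 2 * m) :
    cellLE φ .L (alt cs s t (k - 1)) (alt cs t s k) := by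
  refine .single ⟨Cgen φ s, ?_⟩
  rw [Cgen_mul_C_of_eq H hs hst (by omega) hk', map_add, Finsupp.add_apply,
    repr_C_Calt H (by omega) (by omega) (by omega), ← Calt_of_pos (by omega),
    repr_C_Calt H (by omega) (by omega) (by omega), if_pos rfl, if_neg (by omega)]
  simp

theorem le_down_alt_inv_of_eq {k : ℕ} (hk : 1 < k) (hk' : k ≤ 2 * m - 1) :
    cellLE φ .L (alt cs s t (k - 1))⁻¹ (alt cs s t k)⁻¹ := by
  have hm := H.two_le
  rcases Nat.even_or_odd k with h | h
  · rw [alt_inv_of_even cs s t h, alt_inv_of_odd cs s t (Nat.Even.sub_odd (by omega) h odd_one)]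
    exact le_down_of_eq H hs hst hk (by omega)
  · rw [alt_inv_of_odd cs s t h, alt_inv_of_even cs s t (Nat.Odd.sub_odd h odd_one)]
    exact le_down_of_eq H.symm (hst ▸ hs) hst.symm hk (by omega)

theorem le_alt_inv_of_eq {j k : ℕ} (hj : 1 ≤ j) (hj' : j ≤ 2 * m) (hk : 1 ≤ k)
    (hk' : k < 2 * m) : cellLE φ .L (alt cs s t j)⁻¹ (alt cs s t k)⁻¹ := by
  rcases le_total k j with h | h
  · exact le_alt_inv_of_ge cs H (fun x => .single (arrow_refl φ _ x)) (fun _ _ _ => .trans)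
      (fun _ h h' => le_up_of_eq H hs hst h h')
      (fun _ h h' => le_up_of_eq H.symm (hst ▸ hs) hst.symm h h') hk h hj'
  · exact le_alt_inv_of_le cs (fun x => .single (arrow_refl φ _ x)) (fun _ _ _ => .trans)
      (fun _ h h' => le_down_alt_inv_of_eq H hs hst h h') hj h (show k ≤ 2 * m - 1 by omega)

theorem cellLE_left_upper_of_eq {r : W → W → Prop} (hrefl : ∀ x, r x x)
    (htrans : ∀ x y z, r x y → r y z → r x z) (h1 : ∀ x, r x 1)
    (hst' : ∀ k, 1 ≤ k → k < 2 * m → r (alt cs s t (k + 1)) (alt cs t s k))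
    (hts' : ∀ k, 1 ≤ k → k < 2 * m → r (alt cs t s (k + 1)) (alt cs s t k))
    (hd : ∀ k, 2 ≤ k → k < 2 * m → r (alt cs s t (k - 1)) (alt cs t s k))
    (hd' : ∀ k, 2 ≤ k → k < 2 * m → r (alt cs t s (k - 1)) (alt cs s t k)) {x y : W}
    (h : cellLE φ .L x y) : r x y := by
  have hm := H.two_le
  -- Equal parameters make the situation symmetric, so one computation with an arbitrary ordered
  -- pair of generators serves for both C_s and C_t.
  have key : ∀ s t : B, IsDihedral M s t m → 0 < φ (cls cs s) → φ (cls cs s) = φ (cls cs t) →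
      (∀ k, 1 ≤ k → k < 2 * m → r (alt cs s t (k + 1)) (alt cs t s k)) →
      (∀ k, 2 ≤ k → k < 2 * m → r (alt cs s t (k - 1)) (alt cs t s k)) → ∀ y ≠ 1,
      Cgen φ s * C φ y ∈ Submodule.span (GrpRing Γ) (C φ '' {x | r x y}) := by
    intro s t H hs hst hst' hd
    refine alt_cases cs H ?_ ?_ ?_
    · intro h; exact absurd rfl h
    · intro k hk hk' _
      rw [(isEig_C_alt_eq H hs hst hk hk').Cgen_mul hs.ne']
      exact Submodule.smul_mem _ _ (Submodule.subset_span ⟨_, hrefl _, rfl⟩)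
    · intro k hk hk' _
      rw [Cgen_mul_C_of_eq H hs hst hk hk']
      refine add_mem (Submodule.subset_span ⟨_, hst' k hk hk', rfl⟩) ?_
      rw [Calt]
      split_ifs with h
      · exact zero_mem _
      · exact Submodule.subset_span ⟨_, hd k (by omega) hk', rfl⟩
  refine cellLE_left_of_Cgen hrefl htrans (fun i y => ?_) h
  by_cases hy : y = 1
  · have e : {x | r x 1} = Set.univ := Set.eq_univ_of_forall h1
    rw [hy, e, Set.image_univ]
    exact span_C φ trivial
  · rcases H.all i with rfl | rfl
    · exact key _ _ H hs hst hst' hd y hy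
    · exact key _ _ H.symm (hst ▸ hs) hst.symm hts' hd' y hy

theorem cellLE_left_iff_relE (x y : W) : cellLE φ .L x y ↔ RelE cs s t m .L x y := by
  have hm := H.two_le
  have hd := cellLE_left_upper_of_eq H hs hst (RelE.refl cs .L) (RelE.trans cs H .L)
    (fun x => Or.inl rfl) (x := x) (y := y)
  constructor
  · intro h
    refine hd ?_ ?_ ?_ ?_ h
    all_goals
      intro k hk hk'
      have h1 := alt_facts' cs H (j := k) (by omega) (by omega)
      have h2 := alt_facts cs H (j := k) (by omega) (by omega)
    · have h3 := alt_facts cs H (j := k + 1) (by omega) (by omega)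
      unfold RelE SameDescent
      simp only [h1, h3, ne_eq, not_false_eq_true, true_and, false_or, or_false, false_and, not_true_eq_false, and_true, or_true, and_self]; omega
    · rcases (show k + 1 ≤ 2 * m by omega).lt_or_eq with h | h
      · have h3 := alt_facts' cs H (j := k + 1) (by omega) h
        unfold RelE SameDescent
        simp only [h2, h3, ne_eq, not_false_eq_true, true_and, false_or, or_false, false_and, not_true_eq_false, and_true, or_true, and_self]; omega
      · right; left
        rw [h, alt_top cs H]
    · have h3 := alt_facts cs H (j := k - 1) (by omega) (by omega)
      unfold RelE SameDescent
      simp only [h1, h3, ne_eq, not_false_eq_true, true_and, false_or, or_false, false_and, not_true_eq_false, and_true, or_true, and_self]; omega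
    · have h3 := alt_facts' cs H (j := k - 1) (by omega) (by omega)
      unfold RelE SameDescent
      simp only [h2, h3, ne_eq, not_false_eq_true, true_and, false_or, or_false, false_and, not_true_eq_false, and_true, or_true, and_self]; omega
  · clear hd
    have htop : ∀ y, cellLE φ .L (alt cs s t (2 * m)) y := by
      refine alt_inv_cases cs H (cellLE_left_one _) ?_ ?_
      · intro k hk hk'
        rw [← alt_top_inv cs H]
        rcases hk'.lt_or_eq with h | rfl
        · exact le_alt_inv_of_eq H hs hst (by omega) le_rfl hk h
        · exact .single (arrow_refl φ _ _)
      · intro k hk hk'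
        rw [alt_top cs H, ← alt_top_inv cs H.symm]
        exact le_alt_inv_of_eq H.symm (hst ▸ hs) hst.symm (by omega) le_rfl hk hk'
    intro h
    by_cases e1 : y = 1
    · rw [e1]; exact cellLE_left_one x
    by_cases e2 : x = alt cs s t (2 * m)
    · rw [e2]; exact htop y
    obtain ⟨h1, h2, h3⟩ := (h.resolve_left e1).resolve_left e2
    clear h htop
    suffices key : ∀ x y : W, y ≠ 1 → x ≠ alt cs s t (2 * m) → x ≠ 1 → y ≠ alt cs s t (2 * m) →
        SameDescent cs s .L x y → cellLE φ .L x y from key x y e1 e2 h1 h2 h3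
    clear e1 e2 h1 h2 h3
    refine alt_inv_cases cs H ?_ ?_ ?_
    · intro y _ _ h; exact absurd rfl h
    · intro j hj hj'
      have hf := alt_inv_facts cs H hj hj'
      refine alt_inv_cases cs H ?_ ?_ ?_
      · intro h; exact absurd rfl h
      · intro k hk hk' _ _ _ h2 _
        have hg := alt_inv_facts cs H hk hk'
        rw [Ne, hg.2.1] at h2
        exact le_alt_inv_of_eq H hs hst hj hj' hk (by omega)
      · intro k hk hk' _ _ _ _ hd
        exact absurd (hd.1 hf.2.2.2.2) (alt_inv_facts' cs H hk hk').2.2.2.2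
    · intro j hj hj'
      have hf := alt_inv_facts' cs H hj hj'
      refine alt_inv_cases cs H ?_ ?_ ?_
      · intro h; exact absurd rfl h
      · intro k hk hk' _ _ _ _ hd
        exact absurd (hd.2 (alt_inv_facts cs H hk hk').2.2.2.2) hf.2.2.2.2
      · intro k hk hk' _ _ _ _ _
        exact le_alt_inv_of_eq H.symm (hst ▸ hs) hst.symm hj hj'.le hk hk'

end Equal

/-- With all parameters zero the T_w multiply as in the group and are fixed by `bar`, so C_w = T_w
and left multiplication reaches every element. -/
theorem cellLE_left_of_zero (hs : φ (cls cs s) = 0) (ht : φ (cls cs t) = 0) (x y : W) :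
    cellLE φ .L x y := by
  classical
  have h0 : ∀ i, φ (cls cs i) = 0 := fun i => by
    rcases H.all i with rfl | rfl
    · exact hs
    · exact ht
  have hq : ∀ i, qpar φ i = 0 := fun i => by rw [qpar, h0]; simp
  have hT : ∀ i x, T φ (cs.simple i) * T φ x = T φ (cs.simple i * x) := by
    intro i x
    rw [T_simple_mul_T, hq, zero_smul, add_zero, ite_self]
  have hbar : ∀ x, bar φ (T φ x) = T φ x := by
    intro x
    obtain ⟨n, hn⟩ : ∃ n, cs.length x = n := ⟨_, rfl⟩
    induction n generalizing x with
    | zero => rw [cs.length_eq_zero_iff.1 hn, T_one, bar_one]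
    | succ n ih =>
      have hx : x ≠ 1 := by rintro rfl; simp at hn
      obtain ⟨i, hi⟩ := cs.exists_leftDescent_of_ne_one hx
      have hi' := cs.isLeftDescent_iff.1 hi
      rw [T_eq_of_isLeftDescent φ i x hi, bar_T_simple_mul, ih _ (by omega), Tinv, hq, zero_smul,
        sub_zero]
  have hC : ∀ x, C φ x = T φ x := fun x =>
    (C_unique φ (hbar x) (by rw [sub_self]; exact zero_mem _)).symm
  have key : ∀ u : W, ∀ y, cellLE φ .L (u * y) y := by
    intro u
    refine cs.simple_induction_left (p := fun u => ∀ y, cellLE φ .L (u * y) y) u ?_ ?_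
    · intro y; rw [one_mul]; exact .single (arrow_refl φ _ _)
    · intro u i ih y
      refine .trans (.single ⟨T φ (cs.simple i), ?_⟩) (ih y)
      rw [hC, hT, ← hC, repr_C_C, mul_assoc, if_pos rfl]
      exact one_ne_zero
  have := key (x * y⁻¹) y
  rwa [inv_mul_cancel_right] at this

theorem cellLE_of_zero (hs : φ (cls cs s) = 0) (ht : φ (cls cs t) = 0) (side : Side) (x y : W) :
    cellLE φ side x y := by
  cases side
  · exact cellLE_left_of_zero H hs ht x y
  · exact (cellLE_right_iff φ _ _).2 (cellLE_left_of_zero H hs ht _ _)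
  · exact cellLE_two_sided_of_left φ (cellLE_left_of_zero H hs ht x y)

omit H in
-- Only the left preorder has to be computed. Inversion gives the right one, and `hfac` supplies
-- every two-sided comparison as a right one followed by a left one.
theorem cellLE_iff_of_left {R : Side → W → W → Prop}
    (hL : ∀ x y, cellLE φ .L x y ↔ R .L x y) (hinv : ∀ x y, R .L x⁻¹ y⁻¹ ↔ R .R x y)
    (htrans : ∀ x y z, R .LR x y → R .LR y z → R .LR x z)
    (htwo : ∀ side x y, R side x y → R .LR x y)
    (hfac : ∀ x y, R .LR x y → ∃ z, R .R x z ∧ R .L z y) (side : Side) (x y : W) :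
    cellLE φ side x y ↔ R side x y := by
  have hR : ∀ x y, cellLE φ .R x y ↔ R .R x y := fun x y => by
    rw [cellLE_right_iff, hL, hinv]
  cases side
  · exact hL x y
  · exact hR x y
  · refine ⟨cellLE_two_sided_of φ htrans (fun x y h => htwo .L x y ((hL x y).1 h))
      (fun x y h => htwo .R x y ((hR x y).1 h)), fun h => ?_⟩
    obtain ⟨z, h1, h2⟩ := hfac x y h
    exact .trans (cellLE_two_sided_of_right φ ((hR _ _).2 h1))
      (cellLE_two_sided_of_left φ ((hL _ _).2 h2))

theorem cellLE_iff_relA (ht : 0 < φ (cls cs t)) (hs : φ (cls cs t) < φ (cls cs s)) (side : Side)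
    (x y : W) : cellLE φ side x y ↔ RelA cs s t m side x y :=
  cellLE_iff_of_left (cellLE_left_iff_relA H hs ht.le ht.ne') (RelA.inv_iff cs H)
    (RelA.trans cs H .LR) (fun _ _ _ h => h.two_sided cs) (fun _ _ h => h.factor cs H) side x y

theorem cellLE_iff_relZ (ht : φ (cls cs t) = 0) (hs : 0 < φ (cls cs s)) (side : Side)
    (x y : W) : cellLE φ side x y ↔ RelZ cs s t m side x y :=
  cellLE_iff_of_left (cellLE_left_iff_relZ H (ht ▸ hs) ht.ge ht) (RelZ.inv_iff cs H)
    (RelZ.trans cs H .LR) (fun _ _ _ h => h.two_sided cs) (fun _ _ h => h.factor cs H) side x y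

theorem cellLE_iff_relE (hs : 0 < φ (cls cs s)) (hst : φ (cls cs s) = φ (cls cs t)) (side : Side)
    (x y : W) : cellLE φ side x y ↔ RelE cs s t m side x y :=
  cellLE_iff_of_left (cellLE_left_iff_relE H hs hst) (RelE.inv_iff cs H)
    (RelE.trans cs H .LR) (fun _ _ _ h => h.two_sided cs) (fun _ _ h => h.factor cs H) side x y

end Dihedral
end KLCell
end

noncomputable section
namespace KLCell
set_option linter.unusedSectionVars false

/-! ### The equivalence relations of dihedral groups -/

open Hecke

variable {B : Type u} {W : Type v} [Group W] {M : CoxeterMatrix B} {cs : CoxeterSystem M W}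
variable {Γ : Type w} [AddCommGroup Γ] [LinearOrder Γ] [IsOrderedAddMonoid Γ]
variable {s t : B} {m : ℕ} (H : IsDihedral M s t m)

section Symm

variable (cs s t m)

/-- The elements which are not extreme for the order in the case `0 < φ(t) < φ(s)`. -/
def IsCore (x : W) : Prop :=
  x ≠ 1 ∧ x ≠ cs.simple t ∧ x ≠ alt cs s t (2 * m) ∧ x ≠ alt cs s t (2 * m - 1)

end Symm

include H

theorem RelA.symm_iff (side : Side) (x y : W) :
    RelA cs s t m side x y ∧ RelA cs s t m side y x ↔
      x = y ∨ (IsCore cs s t m x ∧ IsCore cs s t m y ∧ SameDescent cs s side x y) := by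
  have hne := special_ne cs H
  have h1 := SameDescent.refl (cs := cs) s side x
  have h2 : SameDescent cs s side x y → SameDescent cs s side y x := fun h => h.symm
  unfold RelA IsCore
  grind (splits := 40)

theorem RelE.symm_iff (side : Side) (x y : W) :
    RelE cs s t m side x y ∧ RelE cs s t m side y x ↔
      x = y ∨ ((x ≠ 1 ∧ x ≠ alt cs s t (2 * m)) ∧ (y ≠ 1 ∧ y ≠ alt cs s t (2 * m)) ∧
        SameDescent cs s side x y) := by
  have hne := special_ne cs H
  have h1 := SameDescent.refl (cs := cs) s side x
  have h2 : SameDescent cs s side x y → SameDescent cs s side y x := fun h => h.symm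
  unfold RelE
  grind (splits := 40)

theorem RelZ.symm_iff (side : Side) (x y : W) :
    RelZ cs s t m side x y ∧ RelZ cs s t m side y x ↔
      ((x = 1 ∨ x = cs.simple t) ∧ (y = 1 ∨ y = cs.simple t)) ∨
      ((x = alt cs s t (2 * m) ∨ x = alt cs s t (2 * m - 1)) ∧
        (y = alt cs s t (2 * m) ∨ y = alt cs s t (2 * m - 1))) ∨
      (IsCore cs s t m x ∧ IsCore cs s t m y ∧ SameDescent cs s side x y) := by
  have hne := special_ne cs H
  have h2 : SameDescent cs s side x y → SameDescent cs s side y x := fun h => h.symm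
  unfold RelZ IsCore
  grind (splits := 40)

/-- Other than 1 and w₀, an element has a unique reduced word, hence exactly one descent on each
side. Exchanging s and t therefore only negates the descent conditions. -/
theorem descent_iff (x : W) (h1 : x ≠ 1) (h2 : x ≠ alt cs s t (2 * m)) :
    (cs.IsLeftDescent x t ↔ ¬ cs.IsLeftDescent x s) ∧
      (cs.IsRightDescent x t ↔ ¬ cs.IsRightDescent x s) := by
  revert h1 h2
  refine alt_cases cs H (P := fun x => x ≠ 1 → x ≠ alt cs s t (2 * m) →
    (cs.IsLeftDescent x t ↔ ¬ cs.IsLeftDescent x s) ∧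
      (cs.IsRightDescent x t ↔ ¬ cs.IsRightDescent x s)) ?_ ?_ ?_ x
  · intro h; exact absurd rfl h
  · intro k hk hk' _ h
    have hf := alt_facts cs H hk hk'
    rw [Ne, hf.2.1] at h
    have hg := alt_facts' cs H.symm hk (by omega)
    refine ⟨iff_of_false hg.2.2.2.2.1 (not_not.2 hf.2.2.2.2.1), ?_⟩
    rw [hf.2.2.2.2.2, hg.2.2.2.2.2]
    omega
  · intro k hk hk' _ h
    have hf := alt_facts cs H.symm hk hk'.le
    have hg := alt_facts' cs H hk hk'
    refine ⟨iff_of_true hf.2.2.2.2.1 hg.2.2.2.2.1, ?_⟩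
    rw [hf.2.2.2.2.2, hg.2.2.2.2.2]
    omega

theorem sameDescent_swap {x y : W} (h1 : x ≠ 1) (h2 : x ≠ alt cs s t (2 * m)) (h3 : y ≠ 1)
    (h4 : y ≠ alt cs s t (2 * m)) (side : Side) :
    SameDescent cs t side x y ↔ SameDescent cs s side x y := by
  have h := descent_iff H x h1 h2
  have h' := descent_iff H y h3 h4
  cases side
  · simp only [SameDescent, h, h']; exact not_iff_not
  · simp only [SameDescent, h, h']; exact not_iff_not
  · exact Iff.rfl

/-- The isolated elements besides 1 and w₀ are t and w₁ for the order (s, t), and s and w₀s for (t,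
s). As m ≥ 2, these two pairs are disjoint. -/
theorem isCore_or_isCore {x : W} (h1 : x ≠ 1) (h2 : x ≠ alt cs s t (2 * m)) :
    IsCore cs s t m x ∨ IsCore cs t s m x := by
  have hm := H.two_le
  have h3 := alt_facts' cs H.symm (j := 2 * m - 1) (by omega) (by omega)
  have h4 := alt_facts cs H.symm (j := 1) (by omega) (by omega)
  rw [alt_one] at h4
  have h5 := alt_top cs H
  unfold IsCore
  rw [← h5]
  have h6 := h3.2.2.2.1
  have : ¬ (2 * m - 1 = 1) := by omega
  have h7 : alt cs s t (2 * m - 1) ≠ cs.simple s := fun h => this (h6.1 h)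
  have h8 : cs.simple t ≠ alt cs t s (2 * m - 1) := fun h => by
    have := h4.2.2.1.1 h
    omega
  have h9 := h3.2.2.1
  have h10 : cs.simple t ≠ cs.simple s := h4.2.2.2.1
  grind (splits := 40)

/-- The words st and ts are core for both orders. They serve as meeting points when the relations of
two adjacent chambers are joined. -/
theorem exists_isCore_both (side : Side) (x : W) : ∃ z, IsCore cs s t m z ∧ IsCore cs t s m z ∧
    SameDescent cs s side x z := by
  have hm := H.two_le
  have h5 := alt_top cs H
  have core : ∀ s t, IsDihedral M s t m → IsCore cs s t m (alt cs s t 2) ∧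
      IsCore cs t s m (alt cs s t 2) := by
    intro s t H
    have h1 := alt_facts cs H (j := 2) (by omega) (by omega)
    have h2 := alt_facts' cs H.symm (j := 2) (by omega) (by omega)
    refine ⟨⟨h1.1, h1.2.2.2.1, ?_, ?_⟩, h2.1, ?_, h2.2.1, h2.2.2.1⟩
    · rw [Ne, h1.2.1]; omega
    · rw [Ne, h1.2.2.1]; omega
    · rw [Ne, h2.2.2.2.1]; omega
  have h1 := alt_facts cs H (j := 2) (by omega) (by omega)
  have h2 := alt_facts' cs H (j := 2) (by omega) (by omega)
  cases side
  · by_cases hx : cs.IsRightDescent x s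
    · refine ⟨_, (core t s H.symm).2, (core t s H.symm).1, ?_⟩
      simp only [SameDescent, hx, h2]
    · refine ⟨_, (core s t H).1, (core s t H).2, ?_⟩
      simp only [SameDescent, hx, false_iff, h1]
      omega
  · by_cases hx : cs.IsLeftDescent x s
    · refine ⟨_, (core s t H).1, (core s t H).2, ?_⟩
      simp only [SameDescent, hx, h1]
    · refine ⟨_, (core t s H.symm).2, (core t s H.symm).1, ?_⟩
      simp only [SameDescent, hx, h2]
  · exact ⟨_, (core s t H).1, (core s t H).2, trivial⟩

/-! #### Reduction to non-negative parameters -/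

theorem exists_sign_abs (φ : SBar cs → Γ) : ∃ ε : W →* ℤˣ, ∀ i,
    |φ (cls cs i)| = ((ε (cs.simple i) : ℤˣ) : ℤ) • φ (cls cs i) := by
  classical
  obtain ⟨ε, hε⟩ := exists_sign cs H (fun i => if 0 ≤ φ (cls cs i) then 1 else -1)
  refine ⟨ε, fun i => ?_⟩
  rw [hε]
  split_ifs with h
  · rw [abs_of_nonneg h]; simp
  · rw [abs_of_neg (not_le.1 h)]; simp

theorem cellLE_abs (φ : SBar cs → Γ) (side : Side) (x y : W) :
    cellLE (fun ω => |φ ω|) side x y ↔ cellLE φ side x y := by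
  obtain ⟨ε, hε⟩ := exists_sign_abs H φ
  exact cellLE_twist_iff hε side x y

variable {φ : SBar cs → Γ}

theorem cellLE_iff_relA_abs (ht : φ (cls cs t) ≠ 0) (hs : |φ (cls cs t)| < |φ (cls cs s)|)
    (side : Side) (x y : W) : cellLE φ side x y ↔ RelA cs s t m side x y := by
  rw [← cellLE_abs H]
  exact cellLE_iff_relA (φ := fun ω => |φ ω|) H (abs_pos.2 ht) hs side x y

theorem cellLE_iff_relZ_abs (ht : φ (cls cs t) = 0) (hs : φ (cls cs s) ≠ 0) (side : Side)
    (x y : W) : cellLE φ side x y ↔ RelZ cs s t m side x y := by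
  rw [← cellLE_abs H]
  exact cellLE_iff_relZ (φ := fun ω => |φ ω|) H (abs_eq_zero.2 ht) (abs_pos.2 hs) side x y

theorem cellLE_iff_relE_abs (hs : φ (cls cs s) ≠ 0) (hst : |φ (cls cs s)| = |φ (cls cs t)|)
    (side : Side) (x y : W) : cellLE φ side x y ↔ RelE cs s t m side x y := by
  rw [← cellLE_abs H]
  exact cellLE_iff_relE (φ := fun ω => |φ ω|) H (abs_pos.2 hs) hst side x y

theorem cellRel_iff_of_lt (ht : φ (cls cs t) ≠ 0) (hs : |φ (cls cs t)| < |φ (cls cs s)|)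
    (side : Side) (x y : W) : cellRel φ side x y ↔
      x = y ∨ (IsCore cs s t m x ∧ IsCore cs s t m y ∧ SameDescent cs s side x y) := by
  rw [← RelA.symm_iff H, ← cellLE_iff_relA_abs H ht hs, ← cellLE_iff_relA_abs H ht hs]
  exact Iff.rfl

theorem cellRel_iff_of_eq (hs : φ (cls cs s) ≠ 0) (hst : |φ (cls cs s)| = |φ (cls cs t)|)
    (side : Side) (x y : W) : cellRel φ side x y ↔
      x = y ∨ ((x ≠ 1 ∧ x ≠ alt cs s t (2 * m)) ∧ (y ≠ 1 ∧ y ≠ alt cs s t (2 * m)) ∧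
        SameDescent cs s side x y) := by
  rw [← RelE.symm_iff H, ← cellLE_iff_relE_abs H hs hst, ← cellLE_iff_relE_abs H hs hst]
  exact Iff.rfl

theorem cellRel_iff_of_zero (ht : φ (cls cs t) = 0) (hs : φ (cls cs s) ≠ 0) (side : Side)
    (x y : W) : cellRel φ side x y ↔
      ((x = 1 ∨ x = cs.simple t) ∧ (y = 1 ∨ y = cs.simple t)) ∨
      ((x = alt cs s t (2 * m) ∨ x = alt cs s t (2 * m - 1)) ∧
        (y = alt cs s t (2 * m) ∨ y = alt cs s t (2 * m - 1))) ∨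
      (IsCore cs s t m x ∧ IsCore cs s t m y ∧ SameDescent cs s side x y) := by
  rw [← RelZ.symm_iff H, ← cellLE_iff_relZ_abs H ht hs, ← cellLE_iff_relZ_abs H ht hs]
  exact Iff.rfl

variable {Γ' : Type*} [AddCommGroup Γ'] [LinearOrder Γ'] [IsOrderedAddMonoid Γ']
  {φ' : SBar cs → Γ'}
variable {Γ'' : Type*} [AddCommGroup Γ''] [LinearOrder Γ''] [IsOrderedAddMonoid Γ'']
  {φ'' : SBar cs → Γ''}

theorem cellRel_eq_of_lt (ht : φ (cls cs t) ≠ 0) (hs : |φ (cls cs t)| < |φ (cls cs s)|)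
    (ht' : φ' (cls cs t) ≠ 0) (hs' : |φ' (cls cs t)| < |φ' (cls cs s)|) (side : Side) :
    cellRel φ side = cellRel φ' side := by
  ext x y
  rw [cellRel_iff_of_lt H ht hs, cellRel_iff_of_lt H ht' hs']

/-- The wall |φ(s)| = |φ(t)| between two chambers. Any element other than 1 and w₀ is core on at
least one side, hence linked there to an element that is core on both sides with the same descent.
Conversely both chamber relations refine the relation on the wall. -/
theorem cellRel_eq_sup_of_eq (hs : φ (cls cs s) ≠ 0) (hst : |φ (cls cs s)| = |φ (cls cs t)|)
    (ht' : φ' (cls cs t) ≠ 0) (hs' : |φ' (cls cs t)| < |φ' (cls cs s)|)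
    (hs'' : φ'' (cls cs s) ≠ 0) (ht'' : |φ'' (cls cs s)| < |φ'' (cls cs t)|) (side : Side) :
    cellRel φ side = cellRel φ' side ⊔ cellRel φ'' side := by
  have htop := alt_top cs H
  refine le_antisymm ?_ (sup_le ?_ ?_)
  · have key : ∀ x z : W, x ≠ 1 → x ≠ alt cs s t (2 * m) → IsCore cs s t m z → IsCore cs t s m z →
        SameDescent cs s side x z → (cellRel φ' side ⊔ cellRel φ'' side) x z := by
      intro x z h1 h2 h3 h4 h5
      rcases isCore_or_isCore H h1 h2 with h | h
      · exact le_sup_left (a := cellRel φ' side)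
          ((cellRel_iff_of_lt H ht' hs' side x z).2 (Or.inr ⟨h, h3, h5⟩))
      · refine le_sup_right (a := cellRel φ' side)
          ((cellRel_iff_of_lt H.symm hs'' ht'' side x z).2 (Or.inr ⟨h, h4, ?_⟩))
        exact (sameDescent_swap H h1 h2 h3.1 h3.2.2.1 side).2 h5
    intro x y h
    rcases (cellRel_iff_of_eq H hs hst side x y).1 h with rfl | ⟨h1, h2, h3⟩
    · exact Setoid.refl' _ _
    · obtain ⟨z, hz, hz', hd⟩ := exists_isCore_both (cs := cs) H side x
      exact Setoid.trans' _ (key x z h1.1 h1.2 hz hz' hd)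
        (Setoid.symm' _ (key y z h2.1 h2.2 hz hz' (h3.symm.trans hd)))
  · intro x y h
    refine (cellRel_iff_of_eq H hs hst side x y).2 ?_
    rcases (cellRel_iff_of_lt H ht' hs' side x y).1 h with h | ⟨h1, h2, h3⟩
    · exact Or.inl h
    · exact Or.inr ⟨⟨h1.1, h1.2.2.1⟩, ⟨h2.1, h2.2.2.1⟩, h3⟩
  · intro x y h
    refine (cellRel_iff_of_eq H hs hst side x y).2 ?_
    rcases (cellRel_iff_of_lt H.symm hs'' ht'' side x y).1 h with h | ⟨h1, h2, h3⟩
    · exact Or.inl h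
    · rw [IsCore, ← htop] at h1 h2
      exact Or.inr ⟨⟨h1.1, h1.2.2.1⟩, ⟨h2.1, h2.2.2.1⟩,
        (sameDescent_swap H h1.1 h1.2.2.1 h2.1 h2.2.2.1 side).1 h3⟩

/-! #### Translations -/

/-- For φ(t) = 0, T_t permutes the Kazhdan–Lusztig basis by C_y ↦ C_{ty}: this is how translation by
t appears in the cells. -/
theorem cellLE_left_simple_mul (ht : φ (cls cs t) = 0) (hs : 0 < φ (cls cs s)) (y : W) :
    cellLE φ .L (cs.simple t * y) y := by
  have hm := H.two_le
  classical
  have hts : φ (cls cs t) < φ (cls cs s) := ht ▸ hs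
  have down : ∀ k, k < 2 * m →
      cellLE φ .L (cs.simple t * alt cs t s (k + 1)) (alt cs t s (k + 1)) := by
    intro k hk
    refine .single ⟨Cgen φ t, ?_⟩
    rw [Cgen_mul_C_of_zero H hts ht.ge ht hk, repr_C_C, simple_mul_alt_succ, if_pos rfl]
    exact one_ne_zero
  refine alt_cases cs H (P := fun y => cellLE φ .L (cs.simple t * y) y) (cellLE_left_one _)
    ?_ ?_ y
  · intro k hk hk'
    rcases hk'.lt_or_eq with h | rfl
    · refine .single ⟨Cgen φ t, ?_⟩
      rw [Cgen_mul_C_of_lt H hts ht.ge hk h, repr_C_C, simple_mul_alt, if_pos rfl]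
      exact one_ne_zero
    · rw [alt_top cs H]
      have := down (2 * m - 1) (by omega)
      rwa [show 2 * m - 1 + 1 = 2 * m by omega] at this
  · intro k hk hk'
    have := down (k - 1) (by omega)
    rwa [show k - 1 + 1 = k by omega] at this

theorem cellRel_left_simple_mul (ht : φ (cls cs t) = 0) (hs : φ (cls cs s) ≠ 0) (y : W) :
    cellRel φ .L y (cs.simple t * y) := by
  have key : ∀ y, cellLE φ .L (cs.simple t * y) y := fun y =>
    (cellLE_abs H φ .L _ _).1 (cellLE_left_simple_mul (φ := fun ω => |φ ω|) H (abs_eq_zero.2 ht) (abs_pos.2 hs) y)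
  refine ⟨?_, key y⟩
  simpa using key (cs.simple t * y)

omit H [LinearOrder Γ] [IsOrderedAddMonoid Γ] in
theorem closure_le_of_mul (r : Setoid W) {A : Set W}
    (h : ∀ a ∈ A, ∀ y, r y (a * y)) {g : W} (hg : g ∈ Subgroup.closure A) (y : W) :
    r y (g * y) := by
  induction hg using Subgroup.closure_induction generalizing y with
  | mem a ha => exact h a ha y
  | one => rw [one_mul]
  | mul a b _ _ h1 h2 => rw [mul_assoc]; exact Setoid.trans' _ (h2 y) (h1 _)
  | inv a _ h1 => simpa using Setoid.symm' _ (h1 (a⁻¹ * y))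

omit H [LinearOrder Γ] [IsOrderedAddMonoid Γ] in
theorem closure_le_of_mul_right (r : Setoid W) {A : Set W}
    (h : ∀ a ∈ A, ∀ y, r y (y * a)) {g : W} (hg : g ∈ Subgroup.closure A) (y : W) :
    r y (y * g) := by
  induction hg using Subgroup.closure_induction generalizing y with
  | mem a ha => exact h a ha y
  | one => rw [mul_one]
  | mul a b _ _ h1 h2 => rw [← mul_assoc]; exact Setoid.trans' _ (h1 y) (h2 _)
  | inv a _ h1 => simpa using Setoid.symm' _ (h1 (y * a⁻¹))

omit H in
theorem cellRel_le_two_sided (φ : SBar cs → Γ) (side : Side) :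
    cellRel φ side ≤ cellRel φ .LR := by
  intro x y h
  cases side
  · exact ⟨cellLE_two_sided_of_left φ h.1, cellLE_two_sided_of_left φ h.2⟩
  · exact ⟨cellLE_two_sided_of_right φ h.1, cellLE_two_sided_of_right φ h.2⟩
  · exact h

theorem cellRel_left_simple_mul_of_zero {i : B} (hi : φ (cls cs i) = 0) (y : W) :
    cellRel φ .L y (cs.simple i * y) := by
  rcases H.all i with rfl | rfl
  · by_cases ht : φ (cls cs t) = 0
    · exact ⟨cellLE_of_zero H hi ht _ _ _, cellLE_of_zero H hi ht _ _ _⟩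
    · exact cellRel_left_simple_mul H.symm hi ht y
  · by_cases hs : φ (cls cs s) = 0
    · exact ⟨cellLE_of_zero H hs hi _ _ _, cellLE_of_zero H hs hi _ _ _⟩
    · exact cellRel_left_simple_mul H hi hs y

theorem cellRel_right_mul_simple_of_zero {i : B} (hi : φ (cls cs i) = 0) (y : W) :
    cellRel φ .R y (y * cs.simple i) := by
  have h := cellRel_left_simple_mul_of_zero H hi y⁻¹
  constructor
  · rw [cellLE_right_iff]; simpa using h.1
  · rw [cellLE_right_iff]; simpa using h.2

/-- The set of generators is left as a predicate so that the result applies to `facetParabolic` and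
to `classParabolic` alike. -/
theorem transRel_closure_le_cellRel {P : B → Prop} (hP : ∀ i, P i → φ (cls cs i) = 0)
    (side : Side) :
    transRel side (Subgroup.closure {x | ∃ i, x = cs.simple i ∧ P i}) ≤ cellRel φ side := by
  have hL : ∀ g ∈ Subgroup.closure {x | ∃ i, x = cs.simple i ∧ P i}, ∀ y,
      cellRel φ .L y (g * y) := fun g hg y => closure_le_of_mul _ (by
    rintro _ ⟨i, rfl, hi⟩ y
    exact cellRel_left_simple_mul_of_zero H (hP i hi) y) hg y
  have hR : ∀ g ∈ Subgroup.closure {x | ∃ i, x = cs.simple i ∧ P i}, ∀ y,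
      cellRel φ .R y (y * g) := fun g hg y => closure_le_of_mul_right _ (by
    rintro _ ⟨i, rfl, hi⟩ y
    exact cellRel_right_mul_simple_of_zero H (hP i hi) y) hg y
  rintro x _ ⟨g, hg, rfl⟩
  cases side
  · rw [sideSub_snd rfl hg, inv_one, mul_one]
    exact hL _ (Subgroup.mem_prod.1 hg).1 x
  · rw [sideSub_fst rfl hg, one_mul]
    exact hR _ (inv_mem (Subgroup.mem_prod.1 hg).2) x
  · exact Setoid.trans' _ (cellRel_le_two_sided φ .L (hL _ (Subgroup.mem_prod.1 hg).1 x))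
      (cellRel_le_two_sided φ .R (hR _ (inv_mem (Subgroup.mem_prod.1 hg).2) _))

omit H [LinearOrder Γ] [IsOrderedAddMonoid Γ] in
theorem simple_mem_classParabolic (i : B) : cs.simple i ∈ classParabolic cs (cls cs i) :=
  Subgroup.subset_closure ⟨i, rfl, rfl⟩

omit H [LinearOrder Γ] [IsOrderedAddMonoid Γ] in
theorem transRel_left {K : Subgroup W} {side : Side} (hs : side ≠ .R) {g : W} (hg : g ∈ K)
    (x : W) : transRel side K x (g * x) := by
  refine ⟨(g, 1), ?_, by simp⟩
  cases side
  · exact Subgroup.mem_prod.2 ⟨hg, one_mem _⟩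
  · exact absurd rfl hs
  · exact Subgroup.mem_prod.2 ⟨hg, one_mem _⟩

omit H [LinearOrder Γ] [IsOrderedAddMonoid Γ] in
theorem transRel_right {K : Subgroup W} {side : Side} (hs : side ≠ .L) {g : W} (hg : g ∈ K)
    (x : W) : transRel side K x (x * g) := by
  refine ⟨(1, g⁻¹), ?_, by simp⟩
  cases side
  · exact absurd rfl hs
  · exact Subgroup.mem_prod.2 ⟨one_mem _, inv_mem hg⟩
  · exact Subgroup.mem_prod.2 ⟨one_mem _, inv_mem hg⟩

/-- On whichever side it acts, t exchanges 1 with t and w₀ with w₁. These are exactly the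
identifications missing from the adjacent chamber. -/
theorem transRel_extreme (side : Side) :
    transRel side (classParabolic cs (cls cs t)) 1 (cs.simple t) ∧
    transRel side (classParabolic cs (cls cs t)) (alt cs s t (2 * m))
      (alt cs s t (2 * m - 1)) := by
  have hm := H.two_le
  have hmem := simple_mem_classParabolic (cs := cs) t
  have h1 : cs.simple t * alt cs s t (2 * m) = alt cs s t (2 * m - 1) := by
    rw [alt_top cs H]
    have := simple_mul_alt_succ cs t s (2 * m - 1)
    rwa [show 2 * m - 1 + 1 = 2 * m by omega] at this
  have h2 : alt cs s t (2 * m) * cs.simple t = alt cs s t (2 * m - 1) := by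
    have := congrArg (·⁻¹) h1
    simpa only [mul_inv_rev, cs.inv_simple, alt_top_inv cs H,
      alt_pred_top_inv cs (by omega : 1 ≤ m)] using this
  by_cases hs : side = .R
  · subst hs
    have a := transRel_right (side := .R) (by simp) hmem 1
    have b := transRel_right (side := .R) (by simp) hmem (alt cs s t (2 * m))
    rw [one_mul] at a
    rw [h2] at b
    exact ⟨a, b⟩
  · have a := transRel_left hs hmem 1
    have b := transRel_left hs hmem (alt cs s t (2 * m))
    rw [mul_one] at a
    rw [h1] at b
    exact ⟨a, b⟩

/-- Compared with a chamber, the wall φ(t) = 0 only glues 1 to t and w₀ to w₁, and translations by t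
do this. All other translations by t already stay inside cells of the wall. -/
theorem cellRel_eq_sup_of_zero (ht : φ (cls cs t) = 0) (hs : φ (cls cs s) ≠ 0)
    (ht' : φ' (cls cs t) ≠ 0) (hs' : |φ' (cls cs t)| < |φ' (cls cs s)|) (side : Side) :
    cellRel φ side = cellRel φ' side ⊔ transRel side (classParabolic cs (cls cs t)) := by
  refine le_antisymm ?_ (sup_le ?_ (transRel_closure_le_cellRel H (fun i hi => hi ▸ ht) side))
  · intro x y h
    obtain ⟨h1, h2⟩ := transRel_extreme (cs := cs) H side
    have h1' := Setoid.symm' _ h1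
    have h2' := Setoid.symm' _ h2
    rcases (cellRel_iff_of_zero H ht hs side x y).1 h with h | h | h
    · refine le_sup_right (a := cellRel φ' side) ?_
      rcases h with ⟨rfl | rfl, rfl | rfl⟩ <;> first | assumption | exact Setoid.refl' _ _
    · refine le_sup_right (a := cellRel φ' side) ?_
      rcases h with ⟨rfl | rfl, rfl | rfl⟩ <;> first | assumption | exact Setoid.refl' _ _
    · exact le_sup_left (a := cellRel φ' side)
        ((cellRel_iff_of_lt H ht' hs' side x y).2 (Or.inr h))
  · intro x y h
    refine (cellRel_iff_of_zero H ht hs side x y).2 ?_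
    rcases (cellRel_iff_of_lt H ht' hs' side x y).1 h with rfl | h
    · by_cases h1 : x = 1 ∨ x = cs.simple t
      · exact Or.inl ⟨h1, h1⟩
      by_cases h2 : x = alt cs s t (2 * m) ∨ x = alt cs s t (2 * m - 1)
      · exact Or.inr (Or.inl ⟨h2, h2⟩)
      push Not at h1 h2
      have : IsCore cs s t m x := ⟨h1.1, h1.2, h2.1, h2.2⟩
      exact Or.inr (Or.inr ⟨this, this, SameDescent.refl _ _ _⟩)
    · exact Or.inr (Or.inr h)

theorem cellRel_eq_top (hs : φ (cls cs s) = 0) (ht : φ (cls cs t) = 0) (side : Side) :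
    cellRel φ side = ⊤ := by
  ext x y
  exact ⟨fun _ => trivial,
    fun _ => ⟨cellLE_of_zero H hs ht side x y, cellLE_of_zero H hs ht side y x⟩⟩

/-- Passing from a chamber to its closure only enlarges the preorder: `RelA` is contained in `RelZ`,
in `RelE` and in the full relation. Conjecture A uses this for the relations, Conjecture B for the
preorders themselves. -/
theorem cellLE_of_cellLE_of_lt (ht' : φ' (cls cs t) ≠ 0) (hs' : |φ' (cls cs t)| < |φ' (cls cs s)|)
    (h : |φ (cls cs t)| ≤ |φ (cls cs s)|) {side : Side} {x y : W} (hxy : cellLE φ' side x y) :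
    cellLE φ side x y := by
  have hne := special_ne cs H
  have hr := SameDescent.refl (cs := cs) s side x
  have hA := (cellLE_iff_relA_abs H ht' hs' side x y).1 hxy
  by_cases hs : φ (cls cs s) = 0
  · refine cellLE_of_zero H hs ?_ side x y
    rw [hs, abs_zero] at h
    exact abs_nonpos_iff.1 h
  by_cases ht : φ (cls cs t) = 0
  · refine (cellLE_iff_relZ_abs H ht hs side x y).2 ?_
    unfold RelA at hA
    unfold RelZ
    grind (splits := 40)
  rcases h.lt_or_eq with h | h
  · exact (cellLE_iff_relA_abs H ht h side x y).2 hA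
  · refine (cellLE_iff_relE_abs H hs h.symm side x y).2 ?_
    unfold RelA at hA
    unfold RelE
    tauto

/-- The element t is a two-sided cell by itself in the chamber, but lies in the big two-sided cell
on the wall. This is what makes the two diagonals essential. -/
theorem cellRel_ne_of_eq_of_lt (hs : φ (cls cs s) ≠ 0) (hst : |φ (cls cs s)| = |φ (cls cs t)|)
    (ht' : φ' (cls cs t) ≠ 0) (hs' : |φ' (cls cs t)| < |φ' (cls cs s)|) :
    cellRel φ .LR ≠ cellRel φ' .LR := by
  intro h
  have hne := special_ne cs H
  obtain ⟨z, h1, h2, -⟩ := exists_isCore_both (cs := cs) H .LR 1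
  have h3 : cellRel φ .LR (cs.simple t) z := (cellRel_iff_of_eq H hs hst _ _ _).2
    (Or.inr ⟨⟨hne.2.2.1, hne.2.2.2.1⟩, ⟨h1.1, h1.2.2.1⟩, trivial⟩)
  rw [h] at h3
  rcases (cellRel_iff_of_lt H ht' hs' _ _ _).1 h3 with h4 | h4
  · exact h1.2.1 h4.symm
  · exact h4.1.2.1 rfl

end KLCell
end

noncomputable section
namespace KLCell
set_option linter.unusedSectionVars false

/-! ### Positive subsets and signs -/

namespace PosSubset

variable {Λ : Type u} [AddCommGroup Λ] (X Y Z : PosSubset Λ)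

theorem can_eq_zero_iff {l : Λ} : X.can l = 0 ↔ l ∈ X.carrier ∧ -l ∈ X.carrier :=
  QuotientAddGroup.eq_zero_iff l

theorem can_nonneg_iff {l : Λ} : 0 ≤ X.can l ↔ l ∈ X.carrier := by
  rw [X.le_def, sub_zero]
  exact ⟨fun ⟨l', h, e⟩ => X.mem_of_can_eq e h, fun h => ⟨l, h, rfl⟩⟩

theorem mem_avoid_iff {l : Λ} : X ∈ avoid {l} ↔ X.can l < 0 := by
  rw [← not_le, X.can_nonneg_iff]
  simp [avoid]

theorem mem_hyp_iff {l : Λ} : X ∈ hyp l ↔ X.can l = 0 := by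
  rw [X.can_eq_zero_iff]
  simp [hyp]

/-- The sign of `l` with respect to a positive subset. -/
def sgn (l : Λ) : SignType := SignType.sign (X.can l)

theorem sgn_neg (l : Λ) : X.sgn (-l) = -X.sgn l := by
  rw [sgn, map_neg, Left.sign_neg, sgn]

theorem sgn_eq_neg_one_iff {X : PosSubset Λ} {l : Λ} : X.sgn l = -1 ↔ X.can l < 0 := sign_eq_neg_one_iff

theorem sgn_eq_one_iff {X : PosSubset Λ} {l : Λ} : X.sgn l = 1 ↔ 0 < X.can l := sign_eq_one_iff

theorem sgn_eq_zero_iff {X : PosSubset Λ} {l : Λ} : X.sgn l = 0 ↔ X.can l = 0 := sign_eq_zero_iff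

theorem sgn_eq_of_iff {X Y : PosSubset Λ} {l l' : Λ} (h1 : X.can l < 0 ↔ Y.can l' < 0)
    (h2 : X.can l = 0 ↔ Y.can l' = 0) : X.sgn l = Y.sgn l' := by
  rw [← sgn_eq_neg_one_iff, ← sgn_eq_neg_one_iff] at h1
  rw [← sgn_eq_zero_iff, ← sgn_eq_zero_iff] at h2
  generalize X.sgn l = a at *
  generalize Y.sgn l' = b at *
  revert a b
  decide

theorem can_eq_zero_of_zsmul {p : ℤ} (hp : p ≠ 0) {l : Λ} (h : X.can (p • l) = 0) :
    X.can l = 0 := by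
  rw [map_zsmul] at h
  exact (smul_eq_zero.1 h).resolve_left hp

theorem sgn_zsmul (p : ℤ) (l : Λ) : X.sgn (p • l) = SignType.sign p * X.sgn l := by
  have key : ∀ q : ℤ, 0 < q → ∀ x : X.GammaQuot,
      SignType.sign (q • x) = SignType.sign x := by
    intro q hq x
    rcases lt_trichotomy x 0 with h | rfl | h
    · have := zsmul_pos (neg_pos.2 h) hq
      rw [smul_neg] at this
      rw [sign_neg h, sign_neg (neg_pos.1 this)]
    · rw [smul_zero]
    · rw [sign_pos h, sign_pos (zsmul_pos h hq)]
  rw [sgn, map_zsmul, sgn]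
  rcases lt_trichotomy p 0 with h | rfl | h
  · have := key (-p) (neg_pos.2 h) (X.can l)
    rw [neg_smul, Left.sign_neg] at this
    rw [sign_neg h, ← this]
    simp
  · simp
  · rw [sign_pos h, one_mul, key p h]

section OfHom

variable {Γ : Type w} [AddCommGroup Γ] [LinearOrder Γ] [IsOrderedAddMonoid Γ] (f : Λ →+ Γ)

theorem ofHom_sgn (l : Λ) : (ofHom f).sgn l = SignType.sign (f l) := by
  have h : ∀ l, 0 ≤ (ofHom f).can l ↔ 0 ≤ f l := fun l => (ofHom f).can_nonneg_iff
  have h1 : (ofHom f).can l < 0 ↔ f l < 0 := by rw [← not_le, h, not_le]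
  have h2 : 0 < (ofHom f).can l ↔ 0 < f l := by
    have := h (-l)
    rw [map_neg, map_neg, neg_nonneg, neg_nonneg] at this
    rw [← not_le, this, not_le]
  rcases lt_trichotomy (f l) 0 with h' | h' | h'
  · rw [sign_neg h', sgn_eq_neg_one_iff, h1]; exact h'
  · rw [h', sign_zero, sgn_eq_zero_iff]
    exact le_antisymm (not_lt.1 fun h => (h2.1 h).ne' h') (not_lt.1 fun h => (h1.1 h).ne h')
  · rw [sign_pos h', sgn_eq_one_iff, h2]; exact h'

end OfHom

/-- The positive subset obtained from `X` by ordering lexicographically its kernel with `Z`. -/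
def lex : PosSubset Λ where
  carrier := {l | 0 < X.can l ∨ (X.can l = 0 ∧ l ∈ Z.carrier)}
  union_neg := by
    ext l
    simp only [Set.mem_union, Set.mem_neg, Set.mem_ofPred_eq, map_neg, neg_pos, neg_eq_zero,
      Set.mem_univ, iff_true]
    rcases lt_trichotomy (X.can l) 0 with h | h | h
    · exact Or.inr (Or.inl h)
    · rcases Z.mem_or_neg_mem l with h' | h'
      · exact Or.inl (Or.inr ⟨h, h'⟩)
      · exact Or.inr (Or.inr ⟨h, h'⟩)
    · exact Or.inl (Or.inl h)
  add_subset := by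
    rintro _ ⟨a, ha, b, hb, rfl⟩
    simp only [Set.mem_ofPred_eq, map_add]
    rcases ha with ha | ⟨ha, ha'⟩ <;> rcases hb with hb | ⟨hb, hb'⟩
    · exact Or.inl (add_pos ha hb)
    · rw [hb, add_zero]; exact Or.inl ha
    · rw [ha, zero_add]; exact Or.inl hb
    · exact Or.inr ⟨by rw [ha, hb, add_zero], Z.add_mem ha' hb'⟩
  exists_addSubgroup := by
    refine ⟨X.lin ⊓ Z.lin, ?_⟩
    ext l
    have h : l ∈ X.lin ↔ X.can l = 0 := (QuotientAddGroup.eq_zero_iff l).symm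
    simp only [Set.mem_inter_iff, Set.mem_neg, Set.mem_ofPred_eq, map_neg, neg_pos, neg_eq_zero,
      SetLike.mem_coe, AddSubgroup.mem_inf, h]
    have h' : l ∈ Z.lin ↔ l ∈ Z.carrier ∧ -l ∈ Z.carrier := Iff.rfl
    rw [h']
    constructor
    · rintro ⟨h1, h2, h3⟩
      exact ⟨Or.inr ⟨h1, h2⟩, Or.inr ⟨h1, h3⟩⟩
    · rintro ⟨h1 | h1, h2 | h2⟩
      · exact absurd (h1.trans h2) (lt_irrefl _)
      · exact absurd h2.1 h1.ne'
      · exact absurd h1.1 h2.ne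
      · exact ⟨h1.1, h1.2, h2.2⟩

theorem lex_can_nonneg_iff {l : Λ} :
    0 ≤ (lex X Z).can l ↔ 0 < X.can l ∨ (X.can l = 0 ∧ 0 ≤ Z.can l) := by
  rw [can_nonneg_iff, can_nonneg_iff]; rfl

theorem lex_sgn_of_eq_zero {l : Λ} (h : X.sgn l = 0) : (lex X Z).sgn l = Z.sgn l := by
  rw [sgn_eq_zero_iff] at h
  have h1 : 0 ≤ (lex X Z).can l ↔ 0 ≤ Z.can l := by
    rw [lex_can_nonneg_iff]; simp [h]
  have h2 : (lex X Z).can l ≤ 0 ↔ Z.can l ≤ 0 := by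
    have : 0 ≤ (lex X Z).can (-l) ↔ 0 ≤ Z.can (-l) := by rw [lex_can_nonneg_iff]; simp [h]
    simpa using this
  refine sgn_eq_of_iff ?_ ?_
  · rw [← not_le, h1, not_le]
  · rw [le_antisymm_iff, h1, h2, ← le_antisymm_iff]

theorem lex_sgn_of_ne_zero {l : Λ} (h : X.sgn l ≠ 0) : (lex X Z).sgn l = X.sgn l := by
  have key : ∀ l, 0 < X.can l → 0 < (lex X Z).can l := by
    intro l h
    rw [← not_le, ← neg_nonneg, ← map_neg, lex_can_nonneg_iff, map_neg, not_or]
    exact ⟨by simpa using h.le, fun h' => h.ne' (neg_eq_zero.1 h'.1)⟩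
  rw [Ne, sgn_eq_zero_iff] at h
  rcases lt_or_gt_of_ne h with h | h
  · have := key (-l) (by simpa using h)
    rw [map_neg, neg_pos] at this
    rw [sgn_eq_neg_one_iff.2 h, sgn_eq_neg_one_iff.2 this]
  · rw [sgn_eq_one_iff.2 h, sgn_eq_one_iff.2 (key l h)]

theorem isOpen_avoid {E : Set Λ} (hE : E.Finite) : IsOpen (avoid E) :=
  fun _ hX => ⟨E, hE, hX, subset_rfl⟩

/-- A strict sign is an open condition: X has l negative exactly when it avoids {l}, so some point
of K near X has the same sign. -/
theorem sgn_eq_of_mem_closure {K : Set (PosSubset Λ)} {X Y : PosSubset Λ} (hX : X ∈ closure K)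
    {l : Λ} (hK : ∀ Z ∈ K, Z.sgn l = Y.sgn l) (h : X.sgn l ≠ 0) : X.sgn l = Y.sgn l := by
  rw [mem_closure_iff] at hX
  rw [Ne, sgn_eq_zero_iff] at h
  rcases lt_or_gt_of_ne h with h | h
  · obtain ⟨Z, hZ, hZ'⟩ := hX _ (isOpen_avoid (Set.finite_singleton l)) (X.mem_avoid_iff.2 h)
    rw [← hK Z hZ', sgn_eq_neg_one_iff.2 h, sgn_eq_neg_one_iff.2 (Z.mem_avoid_iff.1 hZ)]
  · obtain ⟨Z, hZ, hZ'⟩ := hX _ (isOpen_avoid (Set.finite_singleton (-l)))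
      (X.mem_avoid_iff.2 (by simpa using h))
    have := Z.mem_avoid_iff.1 hZ
    rw [map_neg, neg_lt_zero] at this
    rw [← hK Z hZ', sgn_eq_one_iff.2 h, sgn_eq_one_iff.2 this]

/-- Whatever is non-negative for the lexicographic refinement is non-negative for X. Hence any set
avoided by X is avoided by the refinement, which lies in every neighbourhood of X. -/
theorem mem_closure_of_lex_mem {K : Set (PosSubset Λ)} (h : lex X Z ∈ K) : X ∈ closure K := by
  rw [mem_closure_iff]
  intro U hU hX
  obtain ⟨E, -, h1, h2⟩ := hU X hX
  refine ⟨lex X Z, h2 ?_, h⟩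
  simp only [avoid, Set.mem_ofPred_eq, Set.eq_empty_iff_forall_notMem, Set.mem_inter_iff,
    not_and] at h1 ⊢
  intro l hl
  refine h1 l ?_
  rcases hl with hl | hl
  · exact X.can_nonneg_iff.1 hl.le
  · exact (X.can_eq_zero_iff.1 hl.1).1

theorem SameSide.sgn_eq {X Y : PosSubset Λ} {l : Λ} (hl : l ≠ 0) (h : SameSide (hyp l) X Y) :
    X.sgn l = Y.sgn l := by
  obtain ⟨h1, h2, -⟩ := h l hl rfl
  rw [mem_avoid_iff, mem_avoid_iff] at h1
  rw [mem_hyp_iff, mem_hyp_iff] at h2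
  exact sgn_eq_of_iff h1 h2

/-- `SameSide` ranges over all vectors defining the same hyperplane, hence the hypothesis that they
are proportional. A common proportionality factor acts on the signs of X and Y in the same way. -/
theorem sameSide_of_sgn_eq {X Y : PosSubset Λ} {l : Λ}
    (hprop : ∀ l' : Λ, l' ≠ 0 → hyp l = hyp l' → ∃ p q : ℤ, p ≠ 0 ∧ p • l' = q • l)
    (h : X.sgn l = Y.sgn l) : SameSide (hyp l) X Y := by
  intro l' hl' e
  obtain ⟨p, q, hp, hpq⟩ := hprop l' hl' e
  have key : X.sgn l' = Y.sgn l' := by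
    have h1 := X.sgn_zsmul p l'
    have h2 := Y.sgn_zsmul p l'
    rw [hpq, sgn_zsmul] at h1 h2
    rw [h, h2] at h1
    have hp' : SignType.sign p ≠ 0 := sign_ne_zero.2 hp
    generalize SignType.sign q * Y.sgn l = d at *
    generalize SignType.sign p = a at *
    generalize X.sgn l' = b at *
    generalize Y.sgn l' = c at *
    revert a b c d
    decide
  have e1 := sgn_eq_neg_one_iff (X := X) (l := l')
  have e2 := sgn_eq_neg_one_iff (X := Y) (l := l')
  have e3 := sgn_eq_zero_iff (X := X) (l := l')
  have e4 := sgn_eq_zero_iff (X := Y) (l := l')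
  have e5 := sgn_eq_one_iff (X := X) (l := l')
  have e6 := sgn_eq_one_iff (X := Y) (l := l')
  simp only [mem_avoid_iff, mem_hyp_iff, map_neg, neg_lt_zero, ← e1, ← e2, ← e3, ← e4, ← e5, ← e6,
    key, and_self]

end PosSubset

/-! ### Hyperplanes, facets and chambers in rank two -/

section Rank2

open PosSubset

variable {B : Type u} {W : Type v} [Group W] {M : CoxeterMatrix B} {cs : CoxeterSystem M W}
variable {s t : B} {m : ℕ} (H : IsDihedral M s t m)
include H

variable (cs s t) in
omit H in
/-- The positive subset of the `λ s + μ t` such that `λ a + μ b ≥ 0`. -/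
def planePos (a b : ℤ) : PosSubset (Lam cs) :=
  ofHom
    { toFun := fun l => l (cls cs s) * a + l (cls cs t) * b
      map_zero' := by simp
      map_add' := fun l l' => by simp only [Finsupp.add_apply]; ring }

omit H in
theorem planePos_sgn (a b : ℤ) (l : Lam cs) :
    (planePos cs s t a b).sgn l = SignType.sign (l (cls cs s) * a + l (cls cs t) * b) :=
  ofHom_sgn _ _

theorem bas_apply_self_ne : (bas (cls cs s) : Lam cs) (cls cs s) = 1 ∧
    (bas (cls cs s) : Lam cs) (cls cs t) = 0 ∧ (bas (cls cs t) : Lam cs) (cls cs s) = 0 ∧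
    (bas (cls cs t) : Lam cs) (cls cs t) = 1 := by
  have h := cls_ne cs H
  simp [bas, h, h.symm]

theorem lam_ext {l l' : Lam cs} (h1 : l (cls cs s) = l' (cls cs s))
    (h2 : l (cls cs t) = l' (cls cs t)) : l = l' := by
  ext ω
  rcases cls_cases cs H ω with rfl | rfl <;> assumption

/-- Test the equality on the positive subset of the linear form that vanishes exactly on the line of
l. It lies on the hyperplane of l, so the form also kills l', which is therefore proportional to l.
A non-zero coordinate of l supplies the factor p. -/
theorem exists_smul_eq_of_hyp_eq {l l' : Lam cs} (hl : l ≠ 0)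
    (h : hyp l = hyp l') : ∃ p q : ℤ, p ≠ 0 ∧ p • l' = q • l := by
  have h1 : planePos cs s t (l (cls cs t)) (-l (cls cs s)) ∈ hyp l := by
    rw [mem_hyp_iff, ← sgn_eq_zero_iff, planePos_sgn, sign_eq_zero_iff]; ring
  rw [h, mem_hyp_iff, ← sgn_eq_zero_iff, planePos_sgn, sign_eq_zero_iff] at h1
  by_cases h2 : l (cls cs s) = 0
  · refine ⟨l (cls cs t), l' (cls cs t), fun h3 => hl (lam_ext H h2 h3), lam_ext H ?_ ?_⟩
    · simp only [Finsupp.smul_apply, smul_eq_mul]; linarith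
    · simp only [Finsupp.smul_apply, smul_eq_mul]; ring
  · refine ⟨l (cls cs s), l' (cls cs s), h2, lam_ext H ?_ ?_⟩
    · simp only [Finsupp.smul_apply, smul_eq_mul]; ring
    · simp only [Finsupp.smul_apply, smul_eq_mul]; linarith

theorem sameSide_iff {l : Lam cs} (hl : l ≠ 0) (X Y : PosSubset (Lam cs)) :
    SameSide (hyp l) X Y ↔ X.sgn l = Y.sgn l :=
  ⟨fun h => h.sgn_eq hl,
    fun h => sameSide_of_sgn_eq (fun _ _ e => exists_smul_eq_of_hyp_eq H hl e) h⟩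

variable (cs s t) in
omit H in
/-- The four hyperplanes `H_s`, `H_t`, `H_{s-t}` and `H_{s+t}`. -/
def fourHyp : Set (Set (PosSubset (Lam cs))) :=
  {hyp (bas (cls cs s)), hyp (bas (cls cs t)),
      hyp (bas (cls cs s) - bas (cls cs t)), hyp (bas (cls cs s) + bas (cls cs t))}

omit H in
/-- `X` and `Y` give the same signs to `s`, `t`, `s - t` and `s + t`. -/
def SameSigns (s t : B) (X Y : PosSubset (Lam cs)) : Prop :=
  X.sgn (bas (cls cs s)) = Y.sgn (bas (cls cs s)) ∧ X.sgn (bas (cls cs t)) = Y.sgn (bas (cls cs t)) ∧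
  X.sgn (bas (cls cs s) - bas (cls cs t)) = Y.sgn (bas (cls cs s) - bas (cls cs t)) ∧
  X.sgn (bas (cls cs s) + bas (cls cs t)) = Y.sgn (bas (cls cs s) + bas (cls cs t))

theorem four_ne_zero : (bas (cls cs s) : Lam cs) ≠ 0 ∧ (bas (cls cs t) : Lam cs) ≠ 0 ∧
    (bas (cls cs s) - bas (cls cs t) : Lam cs) ≠ 0 ∧
    (bas (cls cs s) + bas (cls cs t) : Lam cs) ≠ 0 := by
  obtain ⟨h1, h2, h3, h4⟩ := bas_apply_self_ne (cs := cs) H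
  refine ⟨fun h => ?_, fun h => ?_, fun h => ?_, fun h => ?_⟩
  · simpa [h1] using DFunLike.congr_fun h (cls cs s)
  · simpa [h4] using DFunLike.congr_fun h (cls cs t)
  · simpa [h1, h3] using DFunLike.congr_fun h (cls cs s)
  · simpa [h1, h3] using DFunLike.congr_fun h (cls cs s)

theorem isArrangement_fourHyp : IsArrangement (fourHyp cs s t) := by
  obtain ⟨h1, h2, h3, h4⟩ := four_ne_zero (cs := cs) H
  refine ⟨by simp [fourHyp], ?_⟩
  rintro _ (rfl | rfl | rfl | rfl)
  · exact ⟨_, h1, rfl⟩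
  · exact ⟨_, h2, rfl⟩
  · exact ⟨_, h3, rfl⟩
  · exact ⟨_, h4, rfl⟩

theorem isComplete_fourHyp : IsComplete cs (fourHyp cs s t) := by
  intro ω
  rcases cls_cases cs H ω with rfl | rfl
  · exact Or.inl rfl
  · exact Or.inr (Or.inl rfl)

theorem forall_sameSide_iff (X Y : PosSubset (Lam cs)) :
    (∀ P ∈ fourHyp cs s t, SameSide P X Y) ↔ SameSigns s t X Y := by
  obtain ⟨h1, h2, h3, h4⟩ := four_ne_zero (cs := cs) H
  simp only [fourHyp, Set.mem_insert_iff, Set.mem_singleton_iff, forall_eq_or_imp, forall_eq,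
    sameSide_iff H h1, sameSide_iff H h2, sameSide_iff H h3, sameSide_iff H h4, SameSigns]

theorem isFacet_fourHyp_iff {F : Set (PosSubset (Lam cs))} :
    IsFacet (fourHyp cs s t) F ↔ ∃ X, F = {Y | SameSigns s t X Y} := by
  simp only [IsFacet, forall_sameSide_iff H]

omit H in
/-- `X` lies on none of the four hyperplanes. -/
def IsGeneric (s t : B) (X : PosSubset (Lam cs)) : Prop :=
  X.sgn (bas (cls cs s)) ≠ 0 ∧ X.sgn (bas (cls cs t)) ≠ 0 ∧
  X.sgn (bas (cls cs s) - bas (cls cs t)) ≠ 0 ∧ X.sgn (bas (cls cs s) + bas (cls cs t)) ≠ 0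

omit H in
theorem SameSigns.refl (X : PosSubset (Lam cs)) : SameSigns s t X X := ⟨rfl, rfl, rfl, rfl⟩

theorem isChamber_fourHyp_iff {K : Set (PosSubset (Lam cs))} :
    IsChamber (fourHyp cs s t) K ↔ ∃ X, IsGeneric s t X ∧ K = {Y | SameSigns s t X Y} := by
  rw [IsChamber, isFacet_fourHyp_iff H]
  have key : ∀ l : Lam cs, ∀ Y, Y.sgn l ≠ 0 ↔ Y ∉ hyp l := fun l Y => by
    rw [mem_hyp_iff, Ne, sgn_eq_zero_iff]
  constructor
  · rintro ⟨⟨X, rfl⟩, h⟩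
    refine ⟨X, ?_, rfl⟩
    have h' : ∀ l : Lam cs, hyp l ∈ fourHyp cs s t → X.sgn l ≠ 0 := fun l hl => by
      rw [key]
      intro h''
      exact Set.notMem_empty X (h _ hl ▸ ⟨SameSigns.refl X, h''⟩)
    exact ⟨h' _ (by simp [fourHyp]), h' _ (by simp [fourHyp]), h' _ (by simp [fourHyp]),
      h' _ (by simp [fourHyp])⟩
  · rintro ⟨X, ⟨h1, h2, h3, h4⟩, rfl⟩
    refine ⟨⟨X, rfl⟩, ?_⟩
    intro P hP
    rw [Set.eq_empty_iff_forall_notMem]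
    rintro Y ⟨⟨e1, e2, e3, e4⟩, hY⟩
    rcases hP with rfl | rfl | rfl | rfl
    · exact (key _ _).1 (e1 ▸ h1) hY
    · exact (key _ _).1 (e2 ▸ h2) hY
    · exact (key _ _).1 (e3 ▸ h3) hY
    · exact (key _ _).1 (e4 ▸ h4) hY

omit H in
/-- The non-zero signs of `s`, `t`, `s - t` and `s + t` for `X` are also their signs for `Y`. -/
def SpecializesTo (s t : B) (X Y : PosSubset (Lam cs)) : Prop :=
  (X.sgn (bas (cls cs s)) ≠ 0 → X.sgn (bas (cls cs s)) = Y.sgn (bas (cls cs s))) ∧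
  (X.sgn (bas (cls cs t)) ≠ 0 → X.sgn (bas (cls cs t)) = Y.sgn (bas (cls cs t))) ∧
  (X.sgn (bas (cls cs s) - bas (cls cs t)) ≠ 0 →
    X.sgn (bas (cls cs s) - bas (cls cs t)) = Y.sgn (bas (cls cs s) - bas (cls cs t))) ∧
  (X.sgn (bas (cls cs s) + bas (cls cs t)) ≠ 0 →
    X.sgn (bas (cls cs s) + bas (cls cs t)) = Y.sgn (bas (cls cs s) + bas (cls cs t)))

omit H in
theorem specializes_of_mem_closure {X Y : PosSubset (Lam cs)}
    (h : X ∈ closure {Z | SameSigns s t Y Z}) : SpecializesTo s t X Y :=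
  ⟨sgn_eq_of_mem_closure h fun _ hZ => hZ.1.symm, sgn_eq_of_mem_closure h fun _ hZ => hZ.2.1.symm,
    sgn_eq_of_mem_closure h fun _ hZ => hZ.2.2.1.symm,
    sgn_eq_of_mem_closure h fun _ hZ => hZ.2.2.2.symm⟩

end Rank2

end KLCell
end

noncomputable section
namespace KLCell
set_option linter.unusedSectionVars false

/-! ### Conjecture A -/

open PosSubset

/-- The reason for the hyperplanes of s - t and s + t: the inequality means that the difference and
the sum have the same non-zero sign. -/
theorem abs_lt_abs_iff_sub_add {Γ : Type*} [AddCommGroup Γ] [LinearOrder Γ] [IsOrderedAddMonoid Γ]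
    (a b : Γ) : |b| < |a| ↔ (0 < a - b ∧ 0 < a + b) ∨ (a - b < 0 ∧ a + b < 0) := by
  rw [sub_pos, sub_neg, ← neg_lt_iff_pos_add, ← lt_neg_iff_add_neg]
  constructor
  · intro h
    rcases le_total 0 a with ha | ha
    · rw [abs_of_nonneg ha, abs_lt] at h
      exact Or.inl ⟨h.2, neg_lt.1 h.1⟩
    · rw [abs_of_nonpos ha, abs_lt, neg_neg] at h
      exact Or.inr ⟨h.1, lt_neg.1 h.2⟩
  · rintro (⟨h1, h2⟩ | ⟨h1, h2⟩)
    · exact (abs_lt.2 ⟨neg_lt.1 h2, h1⟩).trans_le (le_abs_self a)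
    · exact (abs_lt.2 ⟨by rwa [neg_neg], lt_neg.1 h2⟩).trans_le (neg_le_abs a)

/-! ### Unions of equivalence classes -/

section Saturated

variable {α : Type*}

/-- A set is saturated for an equivalence relation if it is a union of classes. -/
def IsSat (r : Setoid α) (E : Set α) : Prop := ∀ x y, r x y → x ∈ E → y ∈ E

theorem IsSat.mono {r r' : Setoid α} {E : Set α} (h : r ≤ r') (hE : IsSat r' E) : IsSat r E :=
  fun _ _ hxy => hE _ _ (h hxy)

theorem isSat_iff_le_ker {r : Setoid α} {E : Set α} : IsSat r E ↔ r ≤ Setoid.ker (· ∈ E) := by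
  constructor
  · intro h x y hxy
    exact propext ⟨h x y hxy, h y x (Setoid.symm' r hxy)⟩
  · intro h x y hxy hx
    have := h hxy
    rw [Setoid.ker_def] at this
    exact this ▸ hx

theorem IsSat.sup {r r' : Setoid α} {E : Set α} (h : IsSat r E) (h' : IsSat r' E) :
    IsSat (r ⊔ r') E := by
  rw [isSat_iff_le_ker] at *
  exact sup_le h h'

theorem isSat_class {r : Setoid α} {D : Set α} (hD : D ∈ r.classes) : IsSat r D := by
  obtain ⟨z, rfl⟩ := hD
  intro x y hxy hx
  exact Setoid.trans' r (Setoid.symm' r hxy) hx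

/-- Classes are the minimal non-empty saturated sets. Part (b) of Conjecture A thus becomes a
statement about which sets are saturated, and saturation behaves well under joins. -/
theorem mem_classes_iff_minimal {r : Setoid α} {D : Set α} :
    D ∈ r.classes ↔ Minimal (fun E : Set α => E.Nonempty ∧ IsSat r E) D := by
  constructor
  · intro hD
    refine ⟨⟨?_, isSat_class hD⟩, ?_⟩
    · obtain ⟨z, rfl⟩ := hD
      exact ⟨z, Setoid.refl' r z⟩
    · rintro E ⟨⟨x, hx⟩, hE⟩ hED y hy
      obtain ⟨z, rfl⟩ := hD
      exact hE x y (Setoid.trans' r (hED hx) (Setoid.symm' r hy)) hx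
  · rintro ⟨⟨⟨x, hx⟩, hD⟩, hmin⟩
    have h1 : {y | r y x} ⊆ D := fun y hy => hD x y (Setoid.symm' r hy) hx
    have h2 := hmin (y := {y | r y x}) ⟨⟨x, Setoid.refl' r x⟩,
      isSat_class (Setoid.mem_classes r x)⟩ h1
    rw [← h1.antisymm h2]
    exact Setoid.mem_classes r x

end Saturated

variable {B : Type u} {W : Type v} [Group W] {M : CoxeterMatrix B} {cs : CoxeterSystem M W}

theorem isTransStable_iff {side : Side} {K : Subgroup W} {D : Set W} :
    IsTransStable side K D ↔ IsSat (transRel side K) D := by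
  constructor
  · rintro h x _ ⟨g, hg, rfl⟩ hx
    exact h x hx g hg
  · intro h x hx g hg
    exact h x _ ⟨g, hg, rfl⟩ hx

theorem isUnionOfCells_iff {Γ : Type*} [AddCommGroup Γ] [LinearOrder Γ] [IsOrderedAddMonoid Γ]
    {φ : SBar cs → Γ} {side : Side} {D : Set W} :
    IsUnionOfCells φ side D ↔ IsSat (cellRel φ side) D := by
  constructor
  · rintro ⟨S, hS, rfl⟩ x y hxy ⟨E, hE, hx⟩
    exact ⟨E, hE, isSat_class (hS E hE) x y hxy hx⟩
  · intro h
    refine ⟨{E | IsCell φ side E ∧ E ⊆ D}, fun E hE => hE.1, ?_⟩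
    ext x
    refine ⟨fun hx => ⟨{y | cellRel φ side y x}, ⟨Setoid.mem_classes _ x, fun y hy => ?_⟩,
      Setoid.refl' (cellRel φ side) x⟩, ?_⟩
    · exact h x y (Setoid.symm' _ hy) hx
    · rintro ⟨E, hE, hx⟩
      exact hE.2 hx

variable {s t : B} {m : ℕ} (H : IsDihedral M s t m)

section Signs

theorem phi_eq_zero_iff (X : PosSubset (Lam cs)) (ω : SBar cs) :
    phi X ω = 0 ↔ X.sgn (bas ω) = 0 := sgn_eq_zero_iff.symm

theorem abs_phi_lt_iff (X : PosSubset (Lam cs)) : |phi X (cls cs t)| < |phi X (cls cs s)| ↔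
    X.sgn (bas (cls cs s) - bas (cls cs t)) = X.sgn (bas (cls cs s) + bas (cls cs t)) ∧
      X.sgn (bas (cls cs s) + bas (cls cs t)) ≠ 0 := by
  rw [abs_lt_abs_iff_sub_add, phi, phi, ← map_sub, ← map_add, ← sgn_eq_one_iff, ← sgn_eq_one_iff,
    ← sgn_eq_neg_one_iff, ← sgn_eq_neg_one_iff]
  generalize X.sgn (bas (cls cs s) - bas (cls cs t)) = a
  generalize X.sgn (bas (cls cs s) + bas (cls cs t)) = b
  revert a b
  decide

theorem abs_phi_lt_iff' (X : PosSubset (Lam cs)) : |phi X (cls cs s)| < |phi X (cls cs t)| ↔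
    X.sgn (bas (cls cs s) - bas (cls cs t)) = -X.sgn (bas (cls cs s) + bas (cls cs t)) ∧
      X.sgn (bas (cls cs s) + bas (cls cs t)) ≠ 0 := by
  rw [abs_phi_lt_iff, ← neg_sub, sgn_neg, add_comm (bas (cls cs t)), neg_eq_iff_eq_neg]

theorem SameSigns.symm {X Y : PosSubset (Lam cs)} (h : SameSigns s t X Y) : SameSigns s t Y X :=
  ⟨h.1.symm, h.2.1.symm, h.2.2.1.symm, h.2.2.2.symm⟩

theorem SameSigns.trans {X Y Z : PosSubset (Lam cs)} (h : SameSigns s t X Y)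
    (h' : SameSigns s t Y Z) : SameSigns s t X Z :=
  ⟨h.1.trans h'.1, h.2.1.trans h'.2.1, h.2.2.1.trans h'.2.2.1, h.2.2.2.trans h'.2.2.2⟩

theorem SameSigns.facts {X Y : PosSubset (Lam cs)} (h : SameSigns s t X Y) :
    (phi X (cls cs s) = 0 ↔ phi Y (cls cs s) = 0) ∧ (phi X (cls cs t) = 0 ↔ phi Y (cls cs t) = 0) ∧
    (|phi X (cls cs t)| < |phi X (cls cs s)| ↔ |phi Y (cls cs t)| < |phi Y (cls cs s)|) ∧
    (|phi X (cls cs s)| < |phi X (cls cs t)| ↔ |phi Y (cls cs s)| < |phi Y (cls cs t)|) := by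
  obtain ⟨h1, h2, h3, h4⟩ := h
  rw [phi_eq_zero_iff, phi_eq_zero_iff, phi_eq_zero_iff, phi_eq_zero_iff, abs_phi_lt_iff,
    abs_phi_lt_iff, abs_phi_lt_iff', abs_phi_lt_iff', h1, h2, h3, h4]
  simp

theorem IsGeneric.cases {Y : PosSubset (Lam cs)} (h : IsGeneric s t Y) :
    |phi Y (cls cs t)| < |phi Y (cls cs s)| ∨ |phi Y (cls cs s)| < |phi Y (cls cs t)| := by
  rw [abs_phi_lt_iff, abs_phi_lt_iff']
  obtain ⟨-, -, h3, h4⟩ := h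
  generalize Y.sgn (bas (cls cs s) - bas (cls cs t)) = a at *
  generalize Y.sgn (bas (cls cs s) + bas (cls cs t)) = b at *
  revert a b
  decide

theorem SpecializesTo.le_of_lt {X Y : PosSubset (Lam cs)} (h : SpecializesTo s t X Y)
    (hY : |phi Y (cls cs t)| < |phi Y (cls cs s)|) :
    |phi X (cls cs t)| ≤ |phi X (cls cs s)| := by
  rw [← not_lt, abs_phi_lt_iff']
  rw [abs_phi_lt_iff] at hY
  obtain ⟨-, -, h3, h4⟩ := h
  generalize Y.sgn (bas (cls cs s) - bas (cls cs t)) = a at *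
  generalize Y.sgn (bas (cls cs s) + bas (cls cs t)) = b at *
  generalize X.sgn (bas (cls cs s) - bas (cls cs t)) = c at *
  generalize X.sgn (bas (cls cs s) + bas (cls cs t)) = d at *
  revert a b c d
  decide

theorem SpecializesTo.le_of_lt' {X Y : PosSubset (Lam cs)} (h : SpecializesTo s t X Y)
    (hY : |phi Y (cls cs s)| < |phi Y (cls cs t)|) :
    |phi X (cls cs s)| ≤ |phi X (cls cs t)| := by
  rw [← not_lt, abs_phi_lt_iff]
  rw [abs_phi_lt_iff'] at hY
  obtain ⟨-, -, h3, h4⟩ := h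
  generalize Y.sgn (bas (cls cs s) - bas (cls cs t)) = a at *
  generalize Y.sgn (bas (cls cs s) + bas (cls cs t)) = b at *
  generalize X.sgn (bas (cls cs s) - bas (cls cs t)) = c at *
  generalize X.sgn (bas (cls cs s) + bas (cls cs t)) = d at *
  revert a b c d
  decide

end Signs

include H

theorem cellLE_of_specializesTo {X Y : PosSubset (Lam cs)} (hY : IsGeneric s t Y)
    (h : SpecializesTo s t X Y) {side : Side} {x y : W} (hxy : cellLE (phi Y) side x y) :
    cellLE (phi X) side x y := by
  have h1 := (phi_eq_zero_iff Y (cls cs s)).not.2 hY.1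
  have h2 := (phi_eq_zero_iff Y (cls cs t)).not.2 hY.2.1
  rcases hY.cases with h' | h'
  · exact cellLE_of_cellLE_of_lt H h2 h' (h.le_of_lt h') hxy
  · exact cellLE_of_cellLE_of_lt H.symm h1 h' (h.le_of_lt' h') hxy

/-- The cells depend only on which parameters vanish and on the comparison of their absolute values,
and the four signs determine these. -/
theorem SameSigns.cellRel_eq {X Y : PosSubset (Lam cs)} (h : SameSigns s t X Y) (side : Side) :
    cellRel (phi X) side = cellRel (phi Y) side := by
  obtain ⟨h1, h2, h3, h4⟩ := h.facts
  by_cases hs : phi X (cls cs s) = 0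
  · have hs' := h1.1 hs
    by_cases ht : phi X (cls cs t) = 0
    · rw [cellRel_eq_top H hs ht, cellRel_eq_top H hs' (h2.1 ht)]
    · ext x y
      rw [cellRel_iff_of_zero H.symm hs ht, cellRel_iff_of_zero H.symm hs' (h2.not.1 ht)]
  · have hs' := h1.not.1 hs
    by_cases ht : phi X (cls cs t) = 0
    · ext x y
      rw [cellRel_iff_of_zero H ht hs, cellRel_iff_of_zero H (h2.1 ht) hs']
    · have ht' := h2.not.1 ht
      rcases lt_trichotomy |phi X (cls cs t)| |phi X (cls cs s)| with h5 | h5 | h5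
      · exact cellRel_eq_of_lt H ht h5 ht' (h3.1 h5) side
      · have h6 : |phi Y (cls cs s)| = |phi Y (cls cs t)| :=
          le_antisymm (not_lt.1 (h3.not.1 h5.not_lt)) (not_lt.1 (h4.not.1 h5.not_gt))
        ext x y
        rw [cellRel_iff_of_eq H hs h5.symm, cellRel_iff_of_eq H hs' h6]
      · exact cellRel_eq_of_lt H.symm hs h5 hs' (h4.1 h5) side

omit H in
theorem transRel_top (side : Side) : transRel side (⊤ : Subgroup W) = ⊤ := by
  ext x y
  refine ⟨fun _ => trivial, fun _ => ?_⟩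
  by_cases hs : side = .R
  · have := transRel_right (side := side) (by rw [hs]; simp) (Subgroup.mem_top (x⁻¹ * y)) x
    rwa [mul_inv_cancel_left] at this
  · have := transRel_left (side := side) hs (Subgroup.mem_top (y * x⁻¹)) x
    rwa [inv_mul_cancel_right] at this

/-- Perturbation of `X` in the direction `(a, b)`. -/
theorem lex_planePos_spec {X : PosSubset (Lam cs)} {a b : ℤ} :
    SpecializesTo s t X (X.lex (planePos cs s t a b)) ∧
    (X.sgn (bas (cls cs s)) = 0 →
      (X.lex (planePos cs s t a b)).sgn (bas (cls cs s)) = SignType.sign a) ∧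
    (X.sgn (bas (cls cs t)) = 0 →
      (X.lex (planePos cs s t a b)).sgn (bas (cls cs t)) = SignType.sign b) ∧
    (X.sgn (bas (cls cs s) - bas (cls cs t)) = 0 → (X.lex (planePos cs s t a b)).sgn
      (bas (cls cs s) - bas (cls cs t)) = SignType.sign (a - b)) ∧
    (X.sgn (bas (cls cs s) + bas (cls cs t)) = 0 → (X.lex (planePos cs s t a b)).sgn
      (bas (cls cs s) + bas (cls cs t)) = SignType.sign (a + b)) := by
  obtain ⟨e1, e2, e3, e4⟩ := bas_apply_self_ne (cs := cs) H
  refine ⟨⟨fun h => (lex_sgn_of_ne_zero _ _ h).symm, fun h => (lex_sgn_of_ne_zero _ _ h).symm,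
    fun h => (lex_sgn_of_ne_zero _ _ h).symm, fun h => (lex_sgn_of_ne_zero _ _ h).symm⟩,
    fun h => ?_, fun h => ?_, fun h => ?_, fun h => ?_⟩
  all_goals rw [lex_sgn_of_eq_zero _ _ h, planePos_sgn]
  all_goals simp [e1, e2, e3, e4, sub_eq_add_neg]

/-- A direction perturbs X into a chamber as soon as it avoids those of the four hyperplanes that
contain X. The others keep their sign. -/
theorem exists_perturbation {X : PosSubset (Lam cs)} (a b : ℤ)
    (h1 : X.sgn (bas (cls cs s)) = 0 → a ≠ 0) (h2 : X.sgn (bas (cls cs t)) = 0 → b ≠ 0)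
    (h3 : X.sgn (bas (cls cs s) - bas (cls cs t)) = 0 → a ≠ b)
    (h4 : X.sgn (bas (cls cs s) + bas (cls cs t)) = 0 → a + b ≠ 0) :
    IsGeneric s t (X.lex (planePos cs s t a b)) ∧
      X ∈ closure {Y | SameSigns s t (X.lex (planePos cs s t a b)) Y} := by
  obtain ⟨⟨g1, g2, g3, g4⟩, k1, k2, k3, k4⟩ := lex_planePos_spec (cs := cs) H (X := X) (a := a)
    (b := b)
  refine ⟨⟨?_, ?_, ?_, ?_⟩, mem_closure_of_lex_mem _ _ (SameSigns.refl _)⟩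
  · by_cases h : X.sgn (bas (cls cs s)) = 0
    · rw [k1 h, sign_ne_zero]; exact h1 h
    · rw [← g1 h]; exact h
  · by_cases h : X.sgn (bas (cls cs t)) = 0
    · rw [k2 h, sign_ne_zero]; exact h2 h
    · rw [← g2 h]; exact h
  · by_cases h : X.sgn (bas (cls cs s) - bas (cls cs t)) = 0
    · rw [k3 h, sign_ne_zero, sub_ne_zero]; exact h3 h
    · rw [← g3 h]; exact h
  · by_cases h : X.sgn (bas (cls cs s) + bas (cls cs t)) = 0
    · rw [k4 h, sign_ne_zero]; exact h4 h
    · rw [← g4 h]; exact h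

omit H in
theorem abs_eq_abs_of_zero {X : PosSubset (Lam cs)}
    (h : X.sgn (bas (cls cs s) - bas (cls cs t)) = 0 ∨ X.sgn (bas (cls cs s) + bas (cls cs t)) = 0) :
    |phi X (cls cs s)| = |phi X (cls cs t)| := by
  rw [abs_eq_abs, ← sub_eq_zero, ← add_eq_zero_iff_eq_neg, phi, phi, ← map_sub, ← map_add,
    ← sgn_eq_zero_iff, ← sgn_eq_zero_iff]
  exact h

/-- Exactly one of s - t and s + t vanishes at X: if both did, twice s would vanish and so would s,
ordered groups being torsion-free. Moving the s-coordinate or the t-coordinate then leads to the two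
sides of the wall. -/
theorem exists_perturbation_of_abs_eq {X : PosSubset (Lam cs)} (hs : phi X (cls cs s) ≠ 0)
    (ht : phi X (cls cs t) ≠ 0) (h : |phi X (cls cs s)| = |phi X (cls cs t)|) :
    (∃ Y, IsGeneric s t Y ∧ X ∈ closure {Z | SameSigns s t Y Z} ∧
      |phi Y (cls cs t)| < |phi Y (cls cs s)|) ∧
    (∃ Y, IsGeneric s t Y ∧ X ∈ closure {Z | SameSigns s t Y Z} ∧
      |phi Y (cls cs s)| < |phi Y (cls cs t)|) := by
  rw [abs_eq_abs, ← sub_eq_zero, ← add_eq_zero_iff_eq_neg, phi, phi, ← map_sub, ← map_add,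
    ← sgn_eq_zero_iff, ← sgn_eq_zero_iff] at h
  rw [Ne, phi_eq_zero_iff] at hs ht
  have hne : ¬ (X.sgn (bas (cls cs s) - bas (cls cs t)) = 0 ∧
      X.sgn (bas (cls cs s) + bas (cls cs t)) = 0) := by
    intro h'
    rw [sgn_eq_zero_iff, sgn_eq_zero_iff] at h'
    apply hs
    rw [sgn_eq_zero_iff]
    have h2 : X.can ((2 : ℤ) • bas (cls cs s)) = 0 := by
      have := congrArg₂ (· + ·) h'.1 h'.2
      simp only [← map_add, add_zero] at this
      rw [← this]; congr 1; rw [two_smul]; abel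
    exact X.can_eq_zero_of_zsmul (by norm_num) h2
  -- The integer e will have the sign of the form that does not vanish. Moving the s-coordinate
  -- gives the vanishing form that same sign, so |φ(t)| < |φ(s)|; moving the t-coordinate gives it
  -- the opposite sign.
  have hsign : ∀ σ : SignType, ∃ e : ℤ, SignType.sign e = σ := fun σ =>
    ⟨σ, by cases σ <;> rfl⟩
  have main : ∀ a b : ℤ, (X.sgn (bas (cls cs s) - bas (cls cs t)) = 0 → a ≠ b) →
      (X.sgn (bas (cls cs s) + bas (cls cs t)) = 0 → a + b ≠ 0) →
      IsGeneric s t (X.lex (planePos cs s t a b)) ∧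
        X ∈ closure {Y | SameSigns s t (X.lex (planePos cs s t a b)) Y} := fun a b h1 h2 =>
    exists_perturbation H a b (fun h => absurd h hs) (fun h => absurd h ht) h1 h2
  rcases h with h | h
  · have h' : X.sgn (bas (cls cs s) + bas (cls cs t)) ≠ 0 := fun h' => hne ⟨h, h'⟩
    obtain ⟨e, he⟩ := hsign (X.sgn (bas (cls cs s) + bas (cls cs t)))
    have he0 : e ≠ 0 := fun h0 => h' (by rw [← he, h0, sign_zero])
    constructor
    · obtain ⟨h1, h2⟩ := main e 0 (fun _ => he0) (fun h0 => absurd h0 h')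
      obtain ⟨⟨g1, g2, g3, g4⟩, k1, k2, k3, k4⟩ := lex_planePos_spec (cs := cs) H (X := X) (a := e)
        (b := 0)
      refine ⟨_, h1, h2, (abs_phi_lt_iff _).2 ⟨?_, h1.2.2.2⟩⟩
      rw [k3 h, ← g4 h', ← he, sub_zero]
    · obtain ⟨h1, h2⟩ := main 0 e (fun _ => he0.symm) (fun h0 => absurd h0 h')
      obtain ⟨⟨g1, g2, g3, g4⟩, k1, k2, k3, k4⟩ := lex_planePos_spec (cs := cs) H (X := X) (a := 0)
        (b := e)
      refine ⟨_, h1, h2, (abs_phi_lt_iff' _).2 ⟨?_, h1.2.2.2⟩⟩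
      rw [k3 h, ← g4 h', ← he, zero_sub, Left.sign_neg]
  · have h' : X.sgn (bas (cls cs s) - bas (cls cs t)) ≠ 0 := fun h' => hne ⟨h', h⟩
    obtain ⟨e, he⟩ := hsign (X.sgn (bas (cls cs s) - bas (cls cs t)))
    have he0 : e ≠ 0 := fun h0 => h' (by rw [← he, h0, sign_zero])
    constructor
    · obtain ⟨h1, h2⟩ := main e 0 (fun _ => he0) (fun _ => by simpa using he0)
      obtain ⟨⟨g1, g2, g3, g4⟩, k1, k2, k3, k4⟩ := lex_planePos_spec (cs := cs) H (X := X) (a := e)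
        (b := 0)
      refine ⟨_, h1, h2, (abs_phi_lt_iff _).2 ⟨?_, h1.2.2.2⟩⟩
      rw [k4 h, ← g3 h', ← he, add_zero]
    · obtain ⟨h1, h2⟩ := main 0 (-e) (fun h0 => absurd h0 h') (fun _ => by simpa using he0)
      obtain ⟨⟨g1, g2, g3, g4⟩, k1, k2, k3, k4⟩ := lex_planePos_spec (cs := cs) H (X := X) (a := 0)
        (b := -e)
      refine ⟨_, h1, h2, (abs_phi_lt_iff' _).2 ⟨?_, h1.2.2.2⟩⟩
      rw [k4 h, ← g3 h', ← he, zero_add, Left.sign_neg, neg_neg]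

omit H in
theorem sgn_add_sub_of_zero {X : PosSubset (Lam cs)} (ht : phi X (cls cs t) = 0) :
    X.sgn (bas (cls cs s) - bas (cls cs t)) = X.sgn (bas (cls cs s)) ∧
    X.sgn (bas (cls cs s) + bas (cls cs t)) = X.sgn (bas (cls cs s)) := by
  rw [phi] at ht
  simp only [sgn, map_sub, map_add, ht, sub_zero, add_zero, and_self]

/-- When only t vanishes, s ± t have the sign of s, so the direction (0, 1) is transverse to the
only hyperplane through X. The reverse inequality at Y would force s to vanish at X as well. -/
theorem exists_perturbation_of_zero {X : PosSubset (Lam cs)} (ht : phi X (cls cs t) = 0)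
    (hs : phi X (cls cs s) ≠ 0) : ∃ Y, IsGeneric s t Y ∧ X ∈ closure {Z | SameSigns s t Y Z} ∧
      |phi Y (cls cs t)| < |phi Y (cls cs s)| := by
  obtain ⟨h1, h2⟩ := sgn_add_sub_of_zero (s := s) ht
  have hs' := (phi_eq_zero_iff _ _).not.1 hs
  obtain ⟨h3, h4⟩ := exists_perturbation (cs := cs) H (X := X) 0 1 (fun h => absurd h hs')
    (fun _ => one_ne_zero) (fun _ => zero_ne_one) (fun _ => by simp)
  refine ⟨_, h3, h4, h3.cases.resolve_right fun h => hs ?_⟩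
  have := (specializes_of_mem_closure h4).le_of_lt' h
  rw [ht, abs_zero] at this
  exact abs_nonpos_iff.1 this

theorem exists_perturbation_of_zero' {X : PosSubset (Lam cs)} (hs : phi X (cls cs s) = 0)
    (ht : phi X (cls cs t) ≠ 0) : ∃ Y, IsGeneric s t Y ∧ X ∈ closure {Z | SameSigns s t Y Z} ∧
      |phi Y (cls cs s)| < |phi Y (cls cs t)| := by
  have ht' := (phi_eq_zero_iff _ _).not.1 ht
  obtain ⟨h3, h4⟩ := exists_perturbation (cs := cs) H (X := X) 1 0 (fun _ => one_ne_zero)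
    (fun h => absurd h ht') (fun _ => one_ne_zero) (fun _ => by simp)
  refine ⟨_, h3, h4, h3.cases.resolve_left fun h => ht ?_⟩
  have := (specializes_of_mem_closure h4).le_of_lt h
  rw [hs, abs_zero] at this
  exact abs_nonpos_iff.1 this

omit H in
theorem IsGeneric.phi_ne {Y : PosSubset (Lam cs)} (h : IsGeneric s t Y) :
    phi Y (cls cs s) ≠ 0 ∧ phi Y (cls cs t) ≠ 0 :=
  ⟨(phi_eq_zero_iff _ _).not.2 h.1, (phi_eq_zero_iff _ _).not.2 h.2.1⟩

omit H in
theorem isGeneric_of_abs_ne {X : PosSubset (Lam cs)} (hs : phi X (cls cs s) ≠ 0)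
    (ht : phi X (cls cs t) ≠ 0) (h : |phi X (cls cs s)| ≠ |phi X (cls cs t)|) :
    IsGeneric s t X :=
  ⟨(phi_eq_zero_iff _ _).not.1 hs, (phi_eq_zero_iff _ _).not.1 ht,
    fun h' => h (abs_eq_abs_of_zero (Or.inl h')), fun h' => h (abs_eq_abs_of_zero (Or.inr h'))⟩

/-- A set is saturated for `X` if and only if it is saturated for the adjacent chambers, and under
translation by the parabolic subgroup of the facet. -/
theorem isSat_facet_iff {X : PosSubset (Lam cs)} {F : Set (PosSubset (Lam cs))}
    (hF : F = {Y | SameSigns s t X Y}) (side : Side) (E : Set W) :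
    IsSat (cellRel (phi X) side) E ↔
      (∀ K, IsChamber (fourHyp cs s t) K → F ⊆ closure K →
        ∀ Y ∈ K, IsSat (cellRel (phi Y) side) E) ∧
      IsSat (transRel side (facetParabolic cs F)) E := by
  have hXF : X ∈ F := hF ▸ SameSigns.refl X
  have hzero : ∀ i, F ⊆ hyp (bas (cls cs i)) ↔ phi X (cls cs i) = 0 := by
    intro i
    refine ⟨fun h => (X.mem_hyp_iff).1 (h hXF), fun h Y hY => ?_⟩
    rw [hF] at hY
    obtain ⟨h1, h2, -, -⟩ := SameSigns.facts hY
    rw [Y.mem_hyp_iff]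
    rcases H.all i with rfl | rfl
    · exact h1.1 h
    · exact h2.1 h
  constructor
  · intro h
    constructor
    · intro K hK hFK Y hY
      obtain ⟨Z, hZ, rfl⟩ := (isChamber_fourHyp_iff H).1 hK
      have hsp := specializes_of_mem_closure (hFK hXF)
      rw [← SameSigns.cellRel_eq H hY]
      have hle : cellRel (phi Z) side ≤ cellRel (phi X) side := fun x y hxy =>
        ⟨cellLE_of_specializesTo H hZ hsp hxy.1, cellLE_of_specializesTo H hZ hsp hxy.2⟩
      exact h.mono hle
    · exact h.mono (transRel_closure_le_cellRel H (fun i hi => (hzero i).1 hi) side)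
  · rintro ⟨h1, h2⟩
    have key : ∀ Y, IsGeneric s t Y → X ∈ closure {Z | SameSigns s t Y Z} →
        IsSat (cellRel (phi Y) side) E := by
      intro Y hY hX
      -- The closure must contain the whole facet and not just X. For any X' in the facet, the
      -- refinement of X' by Y has the signs of Y, so X' lies in the closure too.
      refine h1 _ ((isChamber_fourHyp_iff H).2 ⟨Y, hY, rfl⟩) ?_ Y (SameSigns.refl Y)
      rw [hF]
      intro X' hX'
      have hsp := specializes_of_mem_closure hX
      obtain ⟨e1, e2, e3, e4⟩ := hX'
      refine mem_closure_of_lex_mem X' Y ⟨?_, ?_, ?_, ?_⟩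
      · by_cases h : X'.sgn (bas (cls cs s)) = 0
        · rw [lex_sgn_of_eq_zero _ _ h]
        · rw [lex_sgn_of_ne_zero _ _ h, ← e1, hsp.1 (e1 ▸ h)]
      · by_cases h : X'.sgn (bas (cls cs t)) = 0
        · rw [lex_sgn_of_eq_zero _ _ h]
        · rw [lex_sgn_of_ne_zero _ _ h, ← e2, hsp.2.1 (e2 ▸ h)]
      · by_cases h : X'.sgn (bas (cls cs s) - bas (cls cs t)) = 0
        · rw [lex_sgn_of_eq_zero _ _ h]
        · rw [lex_sgn_of_ne_zero _ _ h, ← e3, hsp.2.2.1 (e3 ▸ h)]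
      · by_cases h : X'.sgn (bas (cls cs s) + bas (cls cs t)) = 0
        · rw [lex_sgn_of_eq_zero _ _ h]
        · rw [lex_sgn_of_ne_zero _ _ h, ← e4, hsp.2.2.2 (e4 ▸ h)]
    have hpar : ∀ i, phi X (cls cs i) = 0 →
        classParabolic cs (cls cs i) ≤ facetParabolic cs F := by
      intro i hi
      refine Subgroup.closure_mono ?_
      rintro _ ⟨j, rfl, hj⟩
      exact ⟨j, rfl, (hzero j).2 (hj ▸ hi)⟩
    have htrans : ∀ {K K' : Subgroup W}, K ≤ K' → transRel side K ≤ transRel side K' := by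
      rintro K K' hK x _ ⟨g, hg, rfl⟩
      refine ⟨g, ?_, rfl⟩
      cases side
      · exact ⟨hK (Subgroup.mem_prod.1 hg).1, (Subgroup.mem_prod.1 hg).2⟩
      · exact ⟨(Subgroup.mem_prod.1 hg).1, hK (Subgroup.mem_prod.1 hg).2⟩
      · exact ⟨hK (Subgroup.mem_prod.1 hg).1, hK (Subgroup.mem_prod.1 hg).2⟩
    -- The cases are the origin, the two axes, and the remaining points, either on a diagonal or in
    -- a chamber. In each one the relation at X is a join of relations under which E is known to be
    -- saturated.
    by_cases hs : phi X (cls cs s) = 0 <;> by_cases ht : phi X (cls cs t) = 0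
    · have htop : facetParabolic cs F = ⊤ := by
        rw [← top_le_iff, ← cs.subgroup_closure_range_simple]
        refine Subgroup.closure_mono ?_
        rintro _ ⟨i, rfl⟩
        refine ⟨i, rfl, (hzero i).2 ?_⟩
        rcases H.all i with rfl | rfl <;> assumption
      rw [htop, transRel_top] at h2
      exact h2.mono (le_top)
    · obtain ⟨Y, hY, hXY, hlt⟩ := exists_perturbation_of_zero' H hs ht
      rw [cellRel_eq_sup_of_zero H.symm hs ht hY.phi_ne.1 hlt]
      exact (key Y hY hXY).sup (h2.mono (htrans (hpar s hs)))
    · obtain ⟨Y, hY, hXY, hlt⟩ := exists_perturbation_of_zero H ht hs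
      rw [cellRel_eq_sup_of_zero H ht hs hY.phi_ne.2 hlt]
      exact (key Y hY hXY).sup (h2.mono (htrans (hpar t ht)))
    · by_cases h : |phi X (cls cs s)| = |phi X (cls cs t)|
      · obtain ⟨⟨Y, hY, hXY, hlt⟩, ⟨Z, hZ, hXZ, hlt'⟩⟩ := exists_perturbation_of_abs_eq H hs ht h
        rw [cellRel_eq_sup_of_eq H hs h hY.phi_ne.2 hlt hZ.phi_ne.1 hlt']
        exact (key Y hY hXY).sup (key Z hZ hXZ)
      · exact key X (isGeneric_of_abs_ne hs ht h) (subset_closure (SameSigns.refl X))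

theorem condA_fourHyp : CondA cs (fourHyp cs s t) := by
  intro side F hF
  obtain ⟨X₀, hF⟩ := (isFacet_fourHyp_iff H).1 hF
  refine ⟨fun X hX Y hY => ?_, fun X hX D => ?_⟩
  · rw [hF] at hX hY
    exact SameSigns.cellRel_eq H (hX.symm.trans hY) side
  · have hF' : F = {Y | SameSigns s t X Y} := by
      rw [hF] at hX ⊢
      ext Y
      exact ⟨fun h => hX.symm.trans h, fun h => hX.trans h⟩
    rw [IsCell, mem_classes_iff_minimal]
    simp only [isSat_facet_iff H hF', isUnionOfCells_iff, isTransStable_iff]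

theorem fourHyp_mem_arrangementsA : fourHyp cs s t ∈ arrangementsA cs :=
  ⟨isArrangement_fourHyp H, isComplete_fourHyp H, condA_fourHyp H⟩

/-! ### Minimality -/

/-- Take X on the diagonal and a perturbation Y of X off it. If the diagonal were missing, X and Y
would lie in the same facet, as every other hyperplane avoids X; but their two-sided cells differ.
The sign d = 1 treats s - t and d = -1 treats s + t. -/
theorem hyp_mem_of_mem_arrangementsA {𝔄 : Set (Set (PosSubset (Lam cs)))}
    (h𝔄 : 𝔄 ∈ arrangementsA cs) (d : ℤˣ) :
    hyp (bas (cls cs s) - (d : ℤ) • bas (cls cs t)) ∈ 𝔄 := by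
  obtain ⟨⟨-, h1⟩, -, h2⟩ := h𝔄
  by_contra hn
  obtain ⟨e1, e2, e3, e4⟩ := bas_apply_self_ne (cs := cs) H
  have hd : (d : ℤ) * d = 1 := by rw [← Units.val_mul, Int.units_mul_self]; rfl
  set X := planePos cs s t 1 d with hX
  set Y := X.lex (planePos cs s t 1 0) with hY
  have hXs : X.sgn (bas (cls cs s)) = 1 := by rw [hX, planePos_sgn, e1, e2]; simp
  have hXt : X.sgn (bas (cls cs t)) = SignType.sign (d : ℤ) := by
    rw [hX, planePos_sgn, e3, e4]; simp
  have hd0 : SignType.sign (d : ℤ) ≠ 0 := sign_ne_zero.2 d.ne_zero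
  have hXst : X.sgn (bas (cls cs s) - (d : ℤ) • bas (cls cs t)) = 0 := by
    rw [hX, planePos_sgn, sign_eq_zero_iff]
    simp [e1, e2, e3, e4, hd]
  have hsame : ∀ l, l ≠ 0 → hyp l ∈ 𝔄 → X.sgn l = Y.sgn l := by
    intro l hl hl'
    refine (lex_sgn_of_ne_zero _ _ fun h0 => hn ?_).symm
    rw [hX, planePos_sgn, sign_eq_zero_iff] at h0
    -- Only multiples of s - dt vanish at X = (1, d), since d² = 1. A non-zero multiple defines the
    -- same hyperplane.
    have hl2 : l = l (cls cs s) • (bas (cls cs s) - (d : ℤ) • bas (cls cs t)) := by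
      refine lam_ext H ?_ ?_
      · simp [e1, e3]
      · simp only [Finsupp.smul_apply, Finsupp.sub_apply, e2, e4, smul_eq_mul]
        linear_combination (d : ℤ) * h0 - l (cls cs t) * hd
    have hne : l (cls cs s) ≠ 0 := fun h => hl (by rw [hl2, h, zero_smul])
    convert hl' using 1
    ext Z
    rw [Z.mem_hyp_iff, Z.mem_hyp_iff]
    refine ⟨fun h => by rw [hl2, map_zsmul, h, smul_zero], fun h => ?_⟩
    rw [hl2] at h
    exact Z.can_eq_zero_of_zsmul hne h
  have hcell := (h2 .LR {Z | ∀ P ∈ 𝔄, SameSide P X Z} ⟨X, rfl⟩).1 X (fun P hP => by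
    obtain ⟨l, hl, rfl⟩ := h1 P hP
    exact (sameSide_iff H hl _ _).2 rfl) Y (fun P hP => by
    obtain ⟨l, hl, rfl⟩ := h1 P hP
    exact (sameSide_iff H hl _ _).2 (hsame l hl hP))
  have hXs0 : phi X (cls cs s) ≠ 0 := by rw [Ne, phi_eq_zero_iff, hXs]; decide
  have hYt : phi Y (cls cs t) ≠ 0 := by
    rw [Ne, phi_eq_zero_iff, hY, lex_sgn_of_ne_zero _ _ (by rwa [hXt]), hXt]; exact hd0
  refine cellRel_ne_of_eq_of_lt H hXs0 ?_ hYt ?_ hcell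
  · refine abs_eq_abs_of_zero ?_
    rcases Int.units_eq_one_or d with rfl | rfl
    · left; simpa using hXst
    · right; simpa using hXst
  · rw [abs_phi_lt_iff]
    rcases Int.units_eq_one_or d with rfl | rfl
    · have h3 : X.sgn (bas (cls cs s) - bas (cls cs t)) = 0 := by simpa using hXst
      have h4 : X.sgn (bas (cls cs s) + bas (cls cs t)) = 1 := by
        rw [hX, planePos_sgn]; simp [e1, e2, e3, e4]
      rw [hY, lex_sgn_of_eq_zero _ _ h3, lex_sgn_of_ne_zero _ _ (by rw [h4]; decide), h4,
        planePos_sgn]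
      simp [e1, e2, e3, e4]
    · have h3 : X.sgn (bas (cls cs s) + bas (cls cs t)) = 0 := by simpa using hXst
      have h4 : X.sgn (bas (cls cs s) - bas (cls cs t)) = 1 := by
        rw [hX, planePos_sgn]; simp [e1, e2, e3, e4]
      rw [hY, lex_sgn_of_eq_zero _ _ h3, lex_sgn_of_ne_zero _ _ (by rw [h4]; decide), h4,
        planePos_sgn]
      simp [e1, e2, e3, e4]

theorem isEssential_fourHyp : IsEssential cs (fourHyp cs s t) := by
  refine ⟨fourHyp_mem_arrangementsA H, fun 𝔄 h𝔄 => ?_⟩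
  rintro _ (rfl | rfl | rfl | rfl)
  · exact h𝔄.2.1 _
  · exact h𝔄.2.1 _
  · simpa using hyp_mem_of_mem_arrangementsA H h𝔄 1
  · simpa using hyp_mem_of_mem_arrangementsA H h𝔄 (-1)

end KLCell
end

noncomputable section
namespace KLCell
set_option linter.unusedSectionVars false

/-! ### The concrete form of Conjecture A -/

open PosSubset

variable {B : Type u} {W : Type v} [Group W] {M : CoxeterMatrix B} {cs : CoxeterSystem M W}
variable {Γ : Type w} [AddCommGroup Γ] [LinearOrder Γ] [IsOrderedAddMonoid Γ]

theorem PosOf_sgn (φ : SBar cs → Γ) (l : Lam cs) :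
    (PosOf φ).sgn l = SignType.sign (extHom φ l) := ofHom_sgn _ _

theorem phi_PosOf_pos_iff (φ : SBar cs → Γ) (ω : SBar cs) :
    0 < phi (PosOf φ) ω ↔ 0 < φ ω := by
  rw [phi, ← sgn_eq_one_iff, PosOf_sgn, sign_eq_one_iff]
  simp [extHom, bas]

theorem phi_PosOf_lt_iff (φ : SBar cs → Γ) (ω ω' : SBar cs) :
    phi (PosOf φ) ω < phi (PosOf φ) ω' ↔ φ ω < φ ω' := by
  rw [phi, phi, ← sub_neg, ← map_sub, ← sgn_eq_neg_one_iff, PosOf_sgn, sign_eq_neg_one_iff]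
  simp [extHom, bas]

theorem mem_chamberC_zero_iff (φ : SBar cs → Γ) (ω₁ ω₂ : SBar cs) :
    PosOf φ ∈ chamberC ω₁ ω₂ (fun _ : Fin 1 => 1) 0 ↔ 0 < φ ω₂ ∧ φ ω₂ < φ ω₁ := by
  have h0 : ratio (fun _ : Fin 1 => (1 : ℚ)) 0 = ((0 : ℚ) : WithTop ℚ) := by simp [ratio]
  have h1 : ratio (fun _ : Fin 1 => (1 : ℚ)) (0 + 1) = ((1 : ℚ) : WithTop ℚ) := by simp [ratio]
  rw [chamberC, Set.mem_ofPred_eq, h0, h1]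
  simp only [WithTop.coe_inj, forall_eq', Rat.num_zero, Rat.den_zero, Rat.num_one, Rat.den_one,
    zero_smul, one_smul, phi_PosOf_pos_iff, phi_PosOf_lt_iff]
  exact ⟨fun h => h.2, fun h => ⟨h.1.trans h.2, h⟩⟩

theorem mem_chamberC_one_iff (φ : SBar cs → Γ) (ω₁ ω₂ : SBar cs) :
    PosOf φ ∈ chamberC ω₁ ω₂ (fun _ : Fin 1 => 1) 1 ↔ 0 < φ ω₁ ∧ φ ω₁ < φ ω₂ := by
  have h1 : ratio (fun _ : Fin 1 => (1 : ℚ)) 1 = ((1 : ℚ) : WithTop ℚ) := by simp [ratio]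
  have h2 : ratio (fun _ : Fin 1 => (1 : ℚ)) (1 + 1) = ⊤ := by simp [ratio]
  rw [chamberC, Set.mem_ofPred_eq, h1, h2]
  simp only [WithTop.coe_inj, forall_eq', Rat.num_one, Rat.den_one, one_smul, phi_PosOf_pos_iff,
    phi_PosOf_lt_iff, WithTop.top_ne_coe, false_imp_iff, implies_true, and_true]

theorem abs_lt_abs_of_pos {a b : Γ} (ha : 0 < a) (h : a < b) : |a| < |b| := by
  rwa [abs_of_pos ha, abs_of_pos (ha.trans h)]

variable {s t : B} {m : ℕ} (H : IsDihedral M s t m)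
include H

theorem Xplus_sgn (q : ℚ) :
    (Xplus (cls cs s) (cls cs t) q).sgn (bas (cls cs s)) = 1 ∧
    (Xplus (cls cs s) (cls cs t) q).sgn (bas (cls cs t)) = SignType.sign q ∧
    (Xplus (cls cs s) (cls cs t) q).sgn (bas (cls cs s) - bas (cls cs t)) =
      SignType.sign (1 - q) := by
  obtain ⟨e1, e2, e3, e4⟩ := bas_apply_self_ne (cs := cs) H
  refine ⟨?_, ?_, ?_⟩ <;> rw [Xplus, ofHom_sgn] <;> simp [e1, e2, e3, e4, sub_eq_add_neg]

theorem XplusTop_sgn :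
    (XplusTop (cls cs t)).sgn (bas (cls cs s)) = 0 ∧
    (XplusTop (cls cs t)).sgn (bas (cls cs t)) = 1 := by
  obtain ⟨e1, e2, e3, e4⟩ := bas_apply_self_ne (cs := cs) H
  refine ⟨?_, ?_⟩ <;> rw [XplusTop, ofHom_sgn] <;> simp [e2, e4]

/-- With r₁ = 1 the chambers are 0 < φ(t) < φ(s) and 0 < φ(s) < φ(t), and the clauses are the join
formulas on the diagonal and on the two axes. -/
theorem conjectureA'' :
    ConjectureA''.{u, v, w} cs (cls cs s) (cls cs t) 1 (fun _ => 1) := by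
  refine ⟨⟨cls_ne cs H, cls_cases cs H⟩, Subsingleton.strictMono _, fun _ => one_pos, ?_⟩
  intro side Γ _ _ _ Γ' _ _ _ φ φ'
  refine ⟨fun i hi h h' => ?_, fun i h h' => ?_, fun h => ?_, fun h => ?_⟩
  · rcases Nat.le_one_iff_eq_zero_or_eq_one.1 hi with rfl | rfl
    · rw [mem_chamberC_zero_iff] at h h'
      exact cellRel_eq_of_lt H h.1.ne' (abs_lt_abs_of_pos h.1 h.2) h'.1.ne'
        (abs_lt_abs_of_pos h'.1 h'.2) side
    · rw [mem_chamberC_one_iff] at h h'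
      exact cellRel_eq_of_lt H.symm h.1.ne' (abs_lt_abs_of_pos h.1 h.2) h'.1.ne'
        (abs_lt_abs_of_pos h'.1 h'.2) side
  · obtain rfl := Subsingleton.elim i 0
    have h := (mem_chamberC_zero_iff _ _ _).1 h
    have h' := (mem_chamberC_one_iff _ _ _).1 h'
    obtain ⟨g1, g2, g3⟩ := Xplus_sgn (cs := cs) H 1
    refine cellRel_eq_sup_of_eq H ?_ (abs_eq_abs_of_zero (Or.inl (by rw [g3]; simp))) h.1.ne'
      (abs_lt_abs_of_pos h.1 h.2) h'.1.ne' (abs_lt_abs_of_pos h'.1 h'.2) side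
    rw [Ne, phi_eq_zero_iff, g1]; decide
  · rw [mem_chamberC_zero_iff] at h
    obtain ⟨g1, g2, g3⟩ := Xplus_sgn (cs := cs) H 0
    refine cellRel_eq_sup_of_zero H ?_ ?_ h.1.ne' (abs_lt_abs_of_pos h.1 h.2) side
    · rw [phi_eq_zero_iff, g2, sign_zero]
    · rw [Ne, phi_eq_zero_iff, g1]; decide
  · rw [mem_chamberC_one_iff] at h
    obtain ⟨g1, g2⟩ := XplusTop_sgn (cs := cs) H
    refine cellRel_eq_sup_of_zero H.symm ?_ ?_ h.1.ne' (abs_lt_abs_of_pos h.1 h.2) side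
    · rw [phi_eq_zero_iff, g1]
    · rw [Ne, phi_eq_zero_iff, g2]; decide

end KLCell
end

noncomputable section
namespace KLCell
set_option linter.unusedSectionVars false

/-! ### Specialization of Hecke algebras to the group ring -/

open Hecke

variable {B : Type u} {W : Type v} [Group W] {M : CoxeterMatrix B} {cs : CoxeterSystem M W}
variable {Γ : Type w} [AddCommGroup Γ]

/-- The specialization `T_w ↦ w`, `e^γ ↦ 1`. -/
def spec (φ : SBar cs → Γ) : Hecke cs φ →ₛₗ[aug Γ] MonoidAlgebra ℤ W where
  toFun h := .ofCoeff (((Tbasis φ).repr h).mapRange (aug Γ) (map_zero _))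
  map_add' a b := by
    ext x
    simp
  map_smul' a b := by
    ext x
    rw [MonoidAlgebra.coeff_smul, Finsupp.smul_apply]
    simp only [map_smul, Finsupp.mapRange_apply, Finsupp.smul_apply,
      smul_eq_mul, map_mul]

theorem spec_coeff (φ : SBar cs → Γ) (h : Hecke cs φ) (x : W) :
    (spec φ h).coeff x = aug Γ ((Tbasis φ).repr h x) := rfl

theorem spec_T (φ : SBar cs → Γ) (x : W) : spec φ (T φ x) = MonoidAlgebra.single x 1 := by
  classical
  ext y
  rw [spec_coeff, repr_T, MonoidAlgebra.coeff_single, Finsupp.single_apply]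
  split_ifs <;> simp

theorem spec_one (φ : SBar cs → Γ) : spec φ 1 = 1 := by
  rw [← T_one, spec_T]; rfl

theorem aug_qpar (φ : SBar cs → Γ) (i : B) : aug Γ (qpar φ i) = 0 := by
  rw [qpar, map_sub, aug_expo, aug_expo, sub_self]

theorem spec_T_simple_mul (φ : SBar cs → Γ) (i : B) (h : Hecke cs φ) :
    spec φ (T φ (cs.simple i) * h) = MonoidAlgebra.single (cs.simple i) 1 * spec φ h := by
  ext y
  rw [spec_coeff, repr_T_simple_mul, map_add, MonoidAlgebra.coeff_single_mul_apply, one_mul,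
    cs.inv_simple, spec_coeff]
  split_ifs
  · rw [map_mul (aug Γ) (qpar φ i), aug_qpar, zero_mul, add_zero]
  · rw [map_zero, add_zero]

theorem spec_mul (φ : SBar cs → Γ) (a b : Hecke cs φ) : spec φ (a * b) = spec φ a * spec φ b := by
  refine Hecke.induction φ (P := fun a => spec φ (a * b) = spec φ a * spec φ b) ?_ ?_ ?_ ?_ a
  · rw [one_mul, spec_one, one_mul]
  · intro a a' h h'
    rw [add_mul, map_add, map_add, h, h', add_mul]
  · intro r a h
    rw [smul_mul_assoc, map_smulₛₗ, map_smulₛₗ, h, smul_mul_assoc]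
  · intro i a h
    rw [mul_assoc, spec_T_simple_mul, h, spec_T_simple_mul, mul_assoc]

section Basis

variable [LinearOrder Γ] [IsOrderedAddMonoid Γ] (φ : SBar cs → Γ)

/-- The specialization of `C_w`. -/
def cel (x : W) : MonoidAlgebra ℤ W := spec φ (C φ x)

theorem spec_mem_span {P : Set W} {h : Hecke cs φ}
    (hh : h ∈ Submodule.span (GrpRing Γ) (C φ '' P)) :
    spec φ h ∈ Submodule.span ℤ (cel φ '' P) := by
  induction hh using Submodule.span_induction with
  | mem z hz =>
    obtain ⟨x, hx, rfl⟩ := hz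
    exact Submodule.subset_span ⟨x, hx, rfl⟩
  | zero => rw [map_zero]; exact zero_mem _
  | add a b _ _ ha hb => rw [map_add]; exact add_mem ha hb
  | smul a b _ hb => rw [map_smulₛₗ]; exact Submodule.smul_mem _ _ hb

theorem exists_spec_eq {P : Set W} {v : MonoidAlgebra ℤ W}
    (hv : v ∈ Submodule.span ℤ (cel φ '' P)) :
    ∃ h ∈ Submodule.span (GrpRing Γ) (C φ '' P), spec φ h = v := by
  induction hv using Submodule.span_induction with
  | mem z hz =>
    obtain ⟨x, hx, rfl⟩ := hz
    exact ⟨C φ x, Submodule.subset_span ⟨x, hx, rfl⟩, rfl⟩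
  | zero => exact ⟨0, zero_mem _, map_zero _⟩
  | add a b _ _ ha hb =>
    obtain ⟨h, hh, rfl⟩ := ha
    obtain ⟨k, hk, rfl⟩ := hb
    exact ⟨h + k, add_mem hh hk, map_add _ _ _⟩
  | smul n b _ hb =>
    obtain ⟨h, hh, rfl⟩ := hb
    exact ⟨n • h, zsmul_mem hh n, map_zsmul _ _ _⟩

theorem span_cel_univ : Submodule.span ℤ (cel φ '' Set.univ) = ⊤ := by
  rw [eq_top_iff]
  intro v _
  induction v using MonoidAlgebra.induction_linear with
  | zero => exact zero_mem _
  | add a b ha hb => exact add_mem (ha trivial) (hb trivial)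
  | single x n =>
    have : MonoidAlgebra.single x n = n • spec φ (T φ x) := by
      rw [spec_T, MonoidAlgebra.smul_single]; simp
    rw [this]
    refine Submodule.smul_mem _ _ (spec_mem_span φ ?_)
    rw [Set.image_univ]
    have := (Cbasis φ).span_eq
    rw [show (⇑(Cbasis φ) : W → Hecke cs φ) = C φ from funext (Cbasis_apply φ)] at this
    rw [this]
    trivial

variable [Finite W]

/-- A spanning family indexed by W in a free ℤ-module of rank |W|: it defines a surjective
endomorphism of a finitely generated module, and such a map is injective. -/
theorem linearIndependent_cel : LinearIndependent ℤ (cel φ) := by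
  let e : MonoidAlgebra ℤ W ≃ₗ[ℤ] (W →₀ ℤ) := MonoidAlgebra.coeffLinearEquiv ℤ
  have hs : Function.Surjective (e.toLinearMap ∘ₗ Finsupp.linearCombination ℤ (cel φ)) := by
    rw [LinearMap.coe_comp]
    refine e.surjective.comp ?_
    rw [← LinearMap.range_eq_top, Finsupp.range_linearCombination, ← Set.image_univ,
      span_cel_univ]
  have := OrzechProperty.injective_of_surjective_endomorphism _ hs
  rw [LinearMap.coe_comp] at this
  exact this.of_comp

/-- The basis `(c_w)` of the group ring. -/
def celBasis : Module.Basis W ℤ (MonoidAlgebra ℤ W) :=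
  .mk (linearIndependent_cel φ) (by rw [← Set.image_univ, span_cel_univ])

theorem celBasis_apply (x : W) : celBasis φ x = cel φ x := Module.Basis.mk_apply _ _ x

theorem coe_celBasis : ⇑(celBasis φ) = cel φ := funext (celBasis_apply φ)

end Basis

end KLCell
end

noncomputable section
namespace KLCell
set_option linter.unusedSectionVars false

/-! ### Cell modules as quotients of submodules of the group ring -/

open Hecke

variable {B : Type u} {W : Type v} [Group W] {M : CoxeterMatrix B} {cs : CoxeterSystem M W}

/-- The group ring, as a left, right or two-sided module over itself. -/
def regRep (W : Type v) [Group W] (side : Side) :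
    Representation ℤ (SideGroup W side) (MonoidAlgebra ℤ W) where
  toFun g := LinearMap.mulRight ℤ (.single g.1.2⁻¹ 1) ∘ₗ LinearMap.mulLeft ℤ (.single g.1.1 1)
  map_one' := by
    ext x
    simp [MonoidAlgebra.single_mul_single]
  map_mul' g k := by
    ext x
    simp [MonoidAlgebra.single_mul_single, mul_assoc]

theorem regRep_apply (side : Side) (g : SideGroup W side) (v : MonoidAlgebra ℤ W) :
    regRep W side g v = .single g.1.1 1 * v * .single g.1.2⁻¹ 1 := rfl

variable {Γ : Type w} [AddCommGroup Γ]

theorem spec_actH (φ : SBar cs → Γ) (side : Side) (g : SideGroup W side) (h : Hecke cs φ) :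
    spec φ (actH φ g.1 h) = regRep W side g (spec φ h) := by
  rw [actH_apply, spec_mul, spec_mul, spec_T, spec_T, regRep_apply]

variable [LinearOrder Γ] [IsOrderedAddMonoid Γ] (φ : SBar cs → Γ)

/-- A set of elements of `W` is closed if it contains the elements which are smaller than one of its
elements. -/
def IsClosedSet (side : Side) (P : Set W) : Prop := ∀ x y, cellLE φ side x y → y ∈ P → x ∈ P

/-- The elements which are below `D`. -/
def leSet (side : Side) (D : Set W) : Set W := {x | ∃ c ∈ D, cellLE φ side x c}

/-- The elements which are strictly below `D`. -/
def ltSet (side : Side) (D : Set W) : Set W :=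
  {x | ∃ c ∈ D, cellLE φ side x c ∧ ¬ cellLE φ side c x}

theorem isClosedSet_leSet (side : Side) (D : Set W) : IsClosedSet φ side (leSet φ side D) :=
  fun _ _ h ⟨c, hc, hy⟩ => ⟨c, hc, .trans h hy⟩

theorem isClosedSet_ltSet (side : Side) (D : Set W) : IsClosedSet φ side (ltSet φ side D) :=
  fun _ _ h ⟨c, hc, hy, hn⟩ => ⟨c, hc, .trans h hy, fun h' => hn (.trans h' h)⟩

/-- The span of the `c_w`, `w ∈ P`. -/
def celSpan (P : Set W) : Submodule ℤ (MonoidAlgebra ℤ W) := Submodule.span ℤ (cel φ '' P)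

variable {φ}

theorem regRep_mem_celSpan {side : Side} {P : Set W} (hP : IsClosedSet φ side P)
    (g : SideGroup W side) {v : MonoidAlgebra ℤ W} (hv : v ∈ celSpan φ P) :
    regRep W side g v ∈ celSpan φ P := by
  obtain ⟨h, hh, rfl⟩ := exists_spec_eq φ hv
  rw [← spec_actH]
  exact spec_mem_span φ (actH_mem_span φ (fun x y hxy hy => hP x y (.single hxy) hy) g hh)

/-- The module spanned by the `c_w`, `w ∈ P`, for a closed set `P`. -/
def celModule {side : Side} {P : Set W} (hP : IsClosedSet φ side P) :
    Submodule (MonoidAlgebra ℤ (SideGroup W side)) (regRep W side).asModule :=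
  Subrepresentation.asSubmodule ⟨celSpan φ P, fun g _ hv => regRep_mem_celSpan hP g hv⟩

variable (φ) [Finite W]

open Classical in
/-- The map from the group ring to `ℤ M_D`. -/
def toZCell (side : Side) (D : Set W) : MonoidAlgebra ℤ W →ₗ[ℤ] ZCell φ side D :=
  -- The value 0 outside `leSet` is a filler; the map is only used on the span of the c_x with x in
  -- `leSet`.
  (celBasis φ).constr ℤ fun x => if hx : x ∈ leSet φ side D then
    ztmul φ side D 1 ⟨C φ x, Submodule.subset_span ⟨x, hx, rfl⟩⟩ else 0

omit [Finite W] in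
theorem ztmul_add (side : Side) (D : Set W) (n : ℤ) (x y : leIdeal φ side D) :
    ztmul φ side D n (x + y) = ztmul φ side D n x + ztmul φ side D n y :=
  TensorProduct.tmul_add (R := GrpRing Γ) (M := AugInt Γ) _ (Submodule.Quotient.mk x)
    (Submodule.Quotient.mk y)

omit [Finite W] in
theorem ztmul_zsmul (side : Side) (D : Set W) (n : ℤ) (x : leIdeal φ side D) :
    ztmul φ side D n x = n • ztmul φ side D 1 x := by
  have h : ∀ a b : ℤ, ztmul φ side D (a + b) x = ztmul φ side D a x + ztmul φ side D b x :=
    fun a b => TensorProduct.add_tmul (R := GrpRing Γ) (M := AugInt Γ) (show AugInt Γ from a)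
      (show AugInt Γ from b) (Submodule.Quotient.mk x : CellMod φ side D)
  let f : ℤ →+ ZCell φ side D := AddMonoidHom.mk' (fun n => ztmul φ side D n x) h
  have := map_zsmul f n 1
  simpa [f] using this

omit [Finite W] in
theorem ztmul_smul (side : Side) (D : Set W) (a : GrpRing Γ) (x : leIdeal φ side D) :
    ztmul φ side D 1 (a • x) = aug Γ a • ztmul φ side D 1 x := by
  rw [← ztmul_zsmul]
  change TensorProduct.tmul (GrpRing Γ) (show AugInt Γ from (1 : ℤ))
    (a • (Submodule.Quotient.mk x : CellMod φ side D)) = _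
  rw [← TensorProduct.smul_tmul, smul_augInt, mul_one]
  rfl

/-- On that span the map is compatible with the specialization from the Hecke algebra, so
equivariance and surjectivity can be checked on lifts. -/
theorem toZCell_spec (side : Side) (D : Set W) (h : leIdeal φ side D) :
    toZCell φ side D (spec φ h.1) = ztmul φ side D 1 h := by
  obtain ⟨h, hh⟩ := h
  dsimp only
  induction hh using Submodule.span_induction with
  | mem z hz =>
    obtain ⟨x, hx, rfl⟩ := hz
    change toZCell φ side D (cel φ x) = _
    rw [← celBasis_apply, toZCell, Module.Basis.constr_basis]
    exact dif_pos hx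
  | zero =>
    rw [map_zero, map_zero]
    have := ztmul_sub φ side D 1 0 0
    rw [sub_self, sub_self] at this
    exact this.symm
  | add a b ha hb iha ihb =>
    rw [map_add, map_add, iha, ihb, ← ztmul_add]; rfl
  | smul a b hb ihb =>
    rw [map_smulₛₗ, map_smul, ihb, ← ztmul_smul]; rfl

theorem toZCell_regRep (side : Side) (D : Set W) (g : SideGroup W side) {v : MonoidAlgebra ℤ W}
    (hv : v ∈ celSpan φ (leSet φ side D)) :
    toZCell φ side D (regRep W side g v) = cellRep φ side D g (toZCell φ side D v) := by
  obtain ⟨h, hh, rfl⟩ := exists_spec_eq φ hv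
  rw [← spec_actH, toZCell_spec φ side D ⟨h, hh⟩]
  exact (toZCell_spec φ side D ⟨actH φ g.1 h, actH_mem_leIdeal φ side D g hh⟩).trans
    (actZ_ztmul φ side D g 1 ⟨h, hh⟩).symm

omit [Finite W] in
/-- The map from `ℤ M_D` to a quotient of the group ring. -/
def ofZCell (side : Side) (D : Set W) :
    ZCell φ side D →+ MonoidAlgebra ℤ W ⧸ celSpan φ (ltSet φ side D) :=
  let g : CellMod φ side D →ₛₗ[aug Γ] MonoidAlgebra ℤ W ⧸ celSpan φ (ltSet φ side D) :=
    Submodule.liftQ _ ((celSpan φ (ltSet φ side D)).mkQ.comp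
      ((spec φ).comp (leIdeal φ side D).subtype)) fun x hx => by
        refine (Submodule.Quotient.mk_eq_zero _).2 ?_
        exact spec_mem_span φ hx
  TensorProduct.liftAddHom (R := GrpRing Γ) (M := AugInt Γ) (N := CellMod φ side D)
    (AddMonoidHom.mk' (fun n : AugInt Γ => (show ℤ from n) • g.toAddMonoidHom)
      fun a b => add_smul (show ℤ from a) (show ℤ from b) g.toAddMonoidHom)
    fun r n x => by
      change (aug Γ r * (show ℤ from n)) • g x = (show ℤ from n) • g (r • x)
      rw [map_smulₛₗ, mul_comm, mul_smul]

omit [Finite W] in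
theorem ofZCell_ztmul (side : Side) (D : Set W) (n : ℤ) (h : leIdeal φ side D) :
    ofZCell φ side D (ztmul φ side D n h) = n • Submodule.Quotient.mk (spec φ h.1) := rfl

/-- That the kernel is no larger is seen by composing with `ofZCell`, which recovers v modulo the
span of `ltSet`. The other inclusion lifts v to the Hecke algebra, where it dies in the quotient. -/
theorem toZCell_eq_zero_iff (side : Side) (D : Set W) {v : MonoidAlgebra ℤ W}
    (hv : v ∈ celSpan φ (leSet φ side D)) :
    toZCell φ side D v = 0 ↔ v ∈ celSpan φ (ltSet φ side D) := by
  constructor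
  · intro h0
    obtain ⟨h, hh, rfl⟩ := exists_spec_eq φ hv
    rw [toZCell_spec φ side D ⟨h, hh⟩] at h0
    have := ofZCell_ztmul φ side D 1 ⟨h, hh⟩
    rw [h0, map_zero, one_smul, eq_comm, Submodule.Quotient.mk_eq_zero] at this
    exact this
  · intro hl
    obtain ⟨h, hh, rfl⟩ := exists_spec_eq φ hl
    have hle : ltSet φ side D ⊆ leSet φ side D := fun x ⟨c, hc, h1, _⟩ => ⟨c, hc, h1⟩
    have hh' : h ∈ leIdeal φ side D := Submodule.span_mono (Set.image_mono hle) hh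
    rw [toZCell_spec φ side D ⟨h, hh'⟩]
    have : (Submodule.Quotient.mk ⟨h, hh'⟩ : CellMod φ side D) = 0 :=
      (Submodule.Quotient.mk_eq_zero _).2 hh
    rw [ztmul, this]
    exact TensorProduct.tmul_zero _ _

theorem toZCell_surjective (side : Side) (D : Set W) (z : ZCell φ side D) :
    ∃ v ∈ celSpan φ (leSet φ side D), toZCell φ side D v = z := by
  refine TensorProduct.induction_on (R := GrpRing Γ) (M := AugInt Γ) (N := CellMod φ side D)
    (motive := fun z => ∃ v ∈ celSpan φ (leSet φ side D), toZCell φ side D v = z) z ?_ ?_ ?_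
  · exact ⟨0, zero_mem _, map_zero _⟩
  · intro n x
    obtain ⟨x, rfl⟩ := Submodule.Quotient.mk_surjective _ x
    refine ⟨(show ℤ from n) • spec φ x.1, Submodule.smul_mem _ _ (spec_mem_span φ x.2), ?_⟩
    rw [map_smul, toZCell_spec, ← ztmul_zsmul]
    rfl
  · rintro a b ⟨v, hv, rfl⟩ ⟨v', hv', rfl⟩
    exact ⟨v + v', add_mem hv hv', map_add _ _ _⟩

/-- A linear map between modules attached to representations. -/
def linearMapOfEquivariant {G : Type*} [Monoid G] {A A' : Type*} [AddCommGroup A] [AddCommGroup A']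
    [Module (MonoidAlgebra ℤ G) A] [Module (MonoidAlgebra ℤ G) A'] (f : A →+ A')
    (h : ∀ (g : G) (x : A), f (MonoidAlgebra.single g (1 : ℤ) • x) = MonoidAlgebra.single g (1 : ℤ) • f x) :
    A →ₗ[MonoidAlgebra ℤ G] A' where
  toFun := f
  map_add' := map_add f
  map_smul' r x := by
    induction r using MonoidAlgebra.induction_linear with
    | zero => simp
    | add a b ha hb => rw [add_smul, map_add, ha, hb, ← add_smul, ← map_add]
    | single g n =>
      have : MonoidAlgebra.single g n = n • MonoidAlgebra.single g (1 : ℤ) := by simp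
      rw [this, smul_assoc, map_zsmul, h, RingHom.id_apply, smul_assoc]

/-- The surjection from the span of the `c_w`, `w ≤ D`, to the cell module of `D`. -/
def toCellModule (side : Side) (D : Set W) :
    celModule (isClosedSet_leSet φ side D) →ₗ[MonoidAlgebra ℤ (SideGroup W side)]
      CellModule φ side D :=
  linearMapOfEquivariant
    ((cellRep φ side D).asModuleEquiv.symm.toAddEquiv.toAddMonoidHom.comp
      ((toZCell φ side D).toAddMonoidHom.comp
        ((regRep W side).asModuleEquiv.toAddEquiv.toAddMonoidHom.comp
          (celModule (isClosedSet_leSet φ side D)).subtype.toAddMonoidHom)))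
    fun g x => by
      have := toZCell_regRep φ side D g x.2
      rw [Representation.single_smul, one_smul]
      refine Eq.trans ?_ this
      change toZCell φ side D ((regRep W side).asModuleEquiv
        (MonoidAlgebra.single g (1 : ℤ) • x.1)) = _
      rw [Representation.single_smul, one_smul]
      rfl

theorem toCellModule_surjective (side : Side) (D : Set W) :
    Function.Surjective (toCellModule φ side D) := fun z => by
  obtain ⟨v, hv, h⟩ := toZCell_surjective φ side D z
  exact ⟨⟨v, hv⟩, h⟩

theorem toCellModule_eq_zero_iff (side : Side) (D : Set W)
    (x : celModule (isClosedSet_leSet φ side D)) :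
    toCellModule φ side D x = 0 ↔ x.1 ∈ celModule (isClosedSet_ltSet φ side D) :=
  toZCell_eq_zero_iff φ side D x.2

end KLCell
end

noncomputable section
namespace KLCell
set_option linter.unusedSectionVars false

/-! ### Filtrations of cell modules -/

section Abstract

variable {R A A' C E : Type*} [Ring R] [AddCommGroup A] [AddCommGroup A'] [AddCommGroup C]
  [AddCommGroup E] [Module R A] [Module R A'] [Module R C] [Module R E]

/-- Two quotients of a module by the same submodule are isomorphic. -/
def equivOfSurjective (f : A →ₗ[R] C) (g : A →ₗ[R] E) (hf : Function.Surjective f)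
    (hg : Function.Surjective g) (h : ∀ x, f x = 0 ↔ g x = 0) : C ≃ₗ[R] E :=
  (f.quotKerEquivOfSurjective hf).symm ≪≫ₗ
    Submodule.quotEquivOfEq _ _ (by ext x; exact h x) ≪≫ₗ g.quotKerEquivOfSurjective hg

variable {S : Submodule R A} (π : S →ₗ[R] C) (ψ : A →ₗ[R] A')

/-- The image under `π` of the elements whose image under `ψ` belongs to `P`. -/
def imageOfComap (P : Submodule R A') : Submodule R C :=
  ((P.comap ψ).comap S.subtype).map π

theorem imageOfComap_mono {P Q : Submodule R A'} (h : P ≤ Q) :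
    imageOfComap π ψ P ≤ imageOfComap π ψ Q := by
  rintro _ ⟨x, hx, rfl⟩
  exact ⟨x, h hx, rfl⟩

variable {π ψ}

theorem apply_mem_imageOfComap_iff {P₀ P : Submodule R A'} (hP : P₀ ≤ P)
    (h0 : ∀ x : S, π x = 0 → ψ x.1 ∈ P₀) (x : S) : π x ∈ imageOfComap π ψ P ↔ ψ x.1 ∈ P := by
  constructor
  · rintro ⟨y, hy, hxy⟩
    have h1 := h0 (x - y) (by rw [map_sub, hxy, sub_self])
    have h2 : ψ x.1 = ψ (x - y : S).1 + ψ y.1 := by simp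
    rw [h2]
    exact add_mem (hP h1) hy
  · exact fun h => ⟨x, h, rfl⟩

/-- The subquotients of the filtration given by `imageOfComap`. -/
theorem nonempty_subquotient_equiv {P₀ P Q U : Submodule R A'} (hP : P₀ ≤ P) (hPQ : P ≤ Q)
    (h0 : ∀ x : S, π x = 0 → ψ x.1 ∈ P₀) (hQ : Q ≤ S.map ψ ⊔ P₀) (hUQ : U ≤ Q) (hU : Q ≤ U ⊔ P)
    (q : U →ₗ[R] E) (hq : Function.Surjective q) (hqk : ∀ x, q x = 0 ↔ x.1 ∈ P) :
    Nonempty ((imageOfComap π ψ Q ⧸ (imageOfComap π ψ P).submoduleOf (imageOfComap π ψ Q)) ≃ₗ[R]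
      E) := by
  -- Both modules are identified with Q/P: the subquotient of C through T and ψ, and E through U,
  -- since `hU` makes U surject onto Q/P with U ∩ P as kernel.
  let T : Submodule R S := (Q.comap ψ).comap S.subtype
  let f : T →ₗ[R] imageOfComap π ψ Q ⧸ (imageOfComap π ψ P).submoduleOf (imageOfComap π ψ Q) :=
    Submodule.mkQ _ ∘ₗ (π.restrict (p := T) (q := imageOfComap π ψ Q) fun x hx => ⟨x, hx, rfl⟩)
  let g : T →ₗ[R] Q ⧸ P.submoduleOf Q :=
    Submodule.mkQ _ ∘ₗ ((ψ ∘ₗ S.subtype).restrict (p := T) (q := Q) fun x hx => hx)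
  let k : U →ₗ[R] Q ⧸ P.submoduleOf Q := Submodule.mkQ _ ∘ₗ Submodule.inclusion hUQ
  have hf : Function.Surjective f := by
    refine (Submodule.mkQ_surjective _).comp ?_
    rintro ⟨_, x, hx, rfl⟩
    exact ⟨⟨x, hx⟩, rfl⟩
  have hg : Function.Surjective g := by
    intro y
    obtain ⟨⟨y, hy⟩, rfl⟩ := Submodule.mkQ_surjective _ y
    obtain ⟨_, ⟨x, hx, rfl⟩, z, hz, hxz⟩ := Submodule.mem_sup.1 (hQ hy)
    have hx' : ψ x ∈ Q := by
      rw [eq_sub_of_add_eq hxz]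
      exact sub_mem hy (hPQ (hP hz))
    refine ⟨⟨⟨x, hx⟩, hx'⟩, (Submodule.Quotient.eq _).2 ?_⟩
    change ψ x - y ∈ P
    rw [← hxz, sub_add_cancel_left]
    exact neg_mem (hP hz)
  have hk : Function.Surjective k := by
    intro y
    obtain ⟨⟨y, hy⟩, rfl⟩ := Submodule.mkQ_surjective _ y
    obtain ⟨x, hx, z, hz, hxz⟩ := Submodule.mem_sup.1 (hU hy)
    refine ⟨⟨x, hx⟩, (Submodule.Quotient.eq _).2 ?_⟩
    change x - y ∈ P
    rw [← hxz, sub_add_cancel_left]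
    exact neg_mem hz
  have hfg : ∀ x, f x = 0 ↔ g x = 0 := fun x =>
    (Submodule.Quotient.mk_eq_zero _).trans <|
      (apply_mem_imageOfComap_iff hP h0 x.1).trans
        (Submodule.Quotient.mk_eq_zero (P.submoduleOf Q) (x := ⟨ψ x.1.1, x.2⟩)).symm
  have hkq : ∀ x, k x = 0 ↔ q x = 0 := fun x =>
    (Submodule.Quotient.mk_eq_zero _).trans (hqk x).symm
  exact ⟨(equivOfSurjective f g hf hg hfg).trans (equivOfSurjective k q hk hq hkq)⟩

/-- Each block of the partition will contain a single cell, so the direct sum required in Conjecture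
B has only one summand. -/
theorem nonempty_equiv_directSum {ι : Type*} [Unique ι] (F : ι → Type*)
    [∀ i, AddCommGroup (F i)] [∀ i, Module R (F i)] :
    Nonempty (F default ≃ₗ[R] DirectSum ι F) := by
  classical
  exact ⟨((DirectSum.linearEquivFunOnFintype R ι F).trans (LinearEquiv.piUnique R F)).symm⟩

end Abstract

/-- A finite partially ordered set has a monotone numbering. -/
theorem exists_monotone_numbering {α : Type*} [Finite α] (r : α → α → Prop) (hr : ∀ a, r a a)
    (ht : ∀ a b c, r a b → r b c → r a c) (ha : ∀ a b, r a b → r b a → a = b) :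
    ∃ (d : ℕ) (κ : α → Fin d), Function.Bijective κ ∧ ∀ i j, r i j → κ i ≤ κ j := by
  let _ : PartialOrder α := { le := r, le_refl := hr, le_trans := ht, le_antisymm := ha }
  have : Fintype (LinearExtension α) :=
    @Fintype.ofFinite _ (inferInstanceAs (Finite α))
  let e := (Fintype.orderIsoFinOfCardEq (LinearExtension α) rfl).symm
  refine ⟨_, fun i => e (toLinearExtension i), ?_, fun i j h => ?_⟩
  · exact e.bijective.comp Function.bijective_id
  · exact e.monotone (toLinearExtension.monotone (show i ≤ j from h))

variable {B : Type u} {W : Type v} [Group W] {M : CoxeterMatrix B} {cs : CoxeterSystem M W}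
variable {Γ : Type*} [AddCommGroup Γ] [LinearOrder Γ] [IsOrderedAddMonoid Γ]
variable {Γ' : Type*} [AddCommGroup Γ'] [LinearOrder Γ'] [IsOrderedAddMonoid Γ']

/-- There is an equivariant map identifying the cell module of `D` for `φ` with the subquotient of
the group ring spanned by the `c_w` attached to `φ'`, for `w ∈ D`. -/
def IsComparable (φ : SBar cs → Γ) (φ' : SBar cs → Γ') (side : Side) (D : Set W) : Prop :=
  ∃ (J J' : Set W) (ψ : MonoidAlgebra ℤ W →ₗ[ℤ] MonoidAlgebra ℤ W),
    IsClosedSet φ' side J ∧ IsClosedSet φ' side J' ∧ J = J' ∪ D ∧ Disjoint J' D ∧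
    (∀ g v, ψ (regRep W side g v) = regRep W side g (ψ v)) ∧
    (∀ v ∈ celSpan φ (leSet φ side D), ψ v ∈ celSpan φ' J) ∧
    (∀ v ∈ celSpan φ (leSet φ side D), ψ v ∈ celSpan φ' J' ↔ v ∈ celSpan φ (ltSet φ side D)) ∧
    celSpan φ' J ≤ (celSpan φ (leSet φ side D)).map ψ ⊔ celSpan φ' J'

theorem celSpan_mono (φ : SBar cs → Γ) {P Q : Set W} (h : P ⊆ Q) : celSpan φ P ≤ celSpan φ Q :=
  Submodule.span_mono (Set.image_mono h)

theorem celSpan_union (φ : SBar cs → Γ) (P Q : Set W) :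
    celSpan φ (P ∪ Q) = celSpan φ P ⊔ celSpan φ Q := by
  rw [celSpan, Set.image_union, Submodule.span_union]; rfl

theorem cel_mem_celSpan (φ : SBar cs → Γ) {P : Set W} {x : W} (h : x ∈ P) :
    cel φ x ∈ celSpan φ P := Submodule.subset_span ⟨x, h, rfl⟩

theorem mem_celSpan_inter [Finite W] (φ : SBar cs → Γ) {P Q : Set W} {v : MonoidAlgebra ℤ W}
    (hP : v ∈ celSpan φ P) (hQ : v ∈ celSpan φ Q) : v ∈ celSpan φ (P ∩ Q) := by
  rw [celSpan, ← coe_celBasis, Module.Basis.mem_span_image] at *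
  exact Set.subset_inter hP hQ

/-- An equivariant endomorphism of the group ring. -/
def equivariantMap {side : Side} (ψ : MonoidAlgebra ℤ W →ₗ[ℤ] MonoidAlgebra ℤ W)
    (h : ∀ g v, ψ (regRep W side g v) = regRep W side g (ψ v)) :
    (regRep W side).asModule →ₗ[MonoidAlgebra ℤ (SideGroup W side)] (regRep W side).asModule :=
  linearMapOfEquivariant ((regRep W side).asModuleEquiv.symm.toAddEquiv.toAddMonoidHom.comp
      (ψ.toAddMonoidHom.comp (regRep W side).asModuleEquiv.toAddEquiv.toAddMonoidHom))
    fun g x => by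
      have e (y : (regRep W side).asModule) : MonoidAlgebra.single g (1 : ℤ) • y =
          (regRep W side).asModuleEquiv.symm
            (regRep W side g ((regRep W side).asModuleEquiv y)) := by
        rw [Representation.single_smul, one_smul]; rfl
      rw [e, e]
      exact h g _

theorem celModule_mono {φ : SBar cs → Γ} {side : Side} {P Q : Set W} (hP : IsClosedSet φ side P)
    (hQ : IsClosedSet φ side Q) (h : P ⊆ Q) : celModule hP ≤ celModule hQ :=
  fun _ hx => celSpan_mono φ h hx

theorem eq_of_mem_of_cellLE {φ : SBar cs → Γ} {side : Side} {E E' : Set W} (hE : IsCell φ side E)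
    (hE' : IsCell φ side E') {x y x' y' : W} (hx : x ∈ E) (hy : y ∈ E') (h : cellLE φ side x y)
    (hx' : x' ∈ E') (hy' : y' ∈ E) (h' : cellLE φ side x' y') : E = E' := by
  obtain ⟨a, rfl⟩ := hE
  obtain ⟨b, rfl⟩ := hE'
  have hx : cellRel φ side x a := hx
  have hy : cellRel φ side y b := hy
  have hx' : cellRel φ side x' b := hx'
  have hy' : cellRel φ side y' a := hy'
  have hab : cellRel φ side a b := ⟨(hx.2.trans h).trans hy.1, (hx'.2.trans h').trans hy'.1⟩
  ext z
  exact ⟨fun hz => (cellRel φ side).trans hz hab,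
    fun hz => (cellRel φ side).trans hz ((cellRel φ side).symm hab)⟩

theorem isCell_class (φ : SBar cs → Γ) (side : Side) (x : W) :
    IsCell φ side {y | cellRel φ side y x} := ⟨x, rfl⟩

section

variable [Finite W] {X Y : PosSubset (Lam cs)} {side : Side} {D : Set W}

/-- The Y-cells inside D are numbered along a linear extension of the preorder. Adding the first k
of them to J' gives a set closed for Y. The elements that ψ sends into its span, pushed to the cell
module of D, form the k-th step. The k-th quotient is then the span of one Y-cell modulo what lies
below it. -/
theorem exists_filtration (hD : IsCell (phi X) side D)
    (hle : ∀ x y, cellLE (phi Y) side x y → cellLE (phi X) side x y)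
    (h : IsComparable (phi X) (phi Y) side D) :
    ∃ (d : ℕ) (κ : Subcells side Y D → Fin d), Function.Surjective κ ∧
      (∀ i j, (∃ x ∈ i.1, ∃ y ∈ j.1, cellLE (phi Y) side x y) → κ i ≤ κ j) ∧
      ∃ N : Fin (d + 1) →
          Submodule (MonoidAlgebra ℤ (SideGroup W side)) (CellModule (phi X) side D),
        Monotone N ∧ N 0 = ⊥ ∧ N (Fin.last d) = ⊤ ∧
        ∀ k : Fin d, Nonempty
          ((N k.succ ⧸ (N k.castSucc).submoduleOf (N k.succ))
            ≃ₗ[MonoidAlgebra ℤ (SideGroup W side)]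
            (DirectSum {i : Subcells side Y D // κ i = k}
              fun i => CellModule (phi Y) side i.1.1)) := by
  obtain ⟨J, J', ψ, hJ, hJ', hJD, hdisj, heq, h1, h2, h3⟩ := h
  have : Finite (Subcells side Y D) := Subtype.finite
  obtain ⟨d, κ, hκ, hmono⟩ := exists_monotone_numbering
    (fun i j : Subcells side Y D => ∃ x ∈ i.1, ∃ y ∈ j.1, cellLE (phi Y) side x y)
    (fun i => by
      obtain ⟨x, hx⟩ := i.2.1
      have : x ∈ i.1 := by rw [hx]; exact (cellRel (phi Y) side).refl x
      exact ⟨x, this, x, this, ((cellRel (phi Y) side).refl x).1⟩)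
    (fun i j k ⟨x, hx, y, hy, h⟩ ⟨y', hy', z, hz, h'⟩ => by
      obtain ⟨a, ha⟩ := j.2.1
      rw [ha] at hy hy'
      exact ⟨x, hx, z, hz, (h.trans (hy.1.trans hy'.2)).trans h'⟩)
    (fun i j ⟨x, hx, y, hy, h⟩ ⟨x', hx', y', hy', h'⟩ =>
      Subtype.ext (eq_of_mem_of_cellLE i.2.1 j.2.1 hx hy h hx' hy' h'))
  -- D is a union of Y-cells, because the preorder of Y is finer than that of X.
  have hcell : ∀ x ∈ D, ∃ i : Subcells side Y D, x ∈ i.1 := fun x hx => by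
    refine ⟨⟨_, isCell_class (phi Y) side x, fun y hy => ?_⟩, (cellRel (phi Y) side).refl x⟩
    obtain ⟨c, rfl⟩ := hD
    exact (cellRel (phi X) side).trans ⟨hle _ _ hy.1, hle _ _ hy.2⟩ hx
  have hcle : ∀ i : Subcells side Y D, ∀ x ∈ i.1, ∀ y ∈ i.1, cellLE (phi Y) side x y := by
    intro i x hx y hy
    obtain ⟨a, ha⟩ := i.2.1
    rw [ha] at hx hy
    exact hx.1.trans hy.2
  let Jk : ℕ → Set W := fun k => {x | x ∈ J' ∨ ∃ i : Subcells side Y D, (κ i : ℕ) < k ∧ x ∈ i.1}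
  -- Something below one of the first k cells lies in J; if it is not in J', its own Y-cell in D has
  -- a number that is no larger.
  have hJk : ∀ k, IsClosedSet (phi Y) side (Jk k) := by
    rintro k x y hxy (hy | ⟨i, hi, hy⟩)
    · exact .inl (hJ' x y hxy hy)
    · have hx : x ∈ J := hJ x y hxy (by rw [hJD]; exact .inr (i.2.2 hy))
      rw [hJD] at hx
      rcases hx with hx | hx
      · exact .inl hx
      · obtain ⟨j, hj⟩ := hcell x hx
        exact .inr ⟨j, lt_of_le_of_lt (hmono j i ⟨x, hj, y, hy, hxy⟩) hi, hj⟩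
  have hJkm : ∀ k l, k ≤ l → Jk k ⊆ Jk l := by
    rintro k l hkl x (hx | ⟨i, hi, hx⟩)
    · exact .inl hx
    · exact .inr ⟨i, hi.trans_le hkl, hx⟩
  have hJJk : ∀ k, J' ⊆ Jk k := fun k x hx => .inl hx
  have hJkJ : ∀ k, Jk k ⊆ J := by
    rintro k x (hx | ⟨i, -, hx⟩) <;> rw [hJD]
    exacts [.inl hx, .inr (i.2.2 hx)]
  have hJk0 : Jk 0 = J' := by
    ext x
    exact ⟨fun h => h.resolve_right fun ⟨i, hi, _⟩ => absurd hi (Nat.not_lt_zero _), fun h => .inl h⟩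
  have hJkd : Jk d = J := by
    refine (hJkJ d).antisymm fun x hx => ?_
    rw [hJD] at hx
    rcases hx with hx | hx
    · exact .inl hx
    · obtain ⟨i, hi⟩ := hcell x hx
      exact .inr ⟨i, (κ i).2, hi⟩
  let π := toCellModule (phi X) side D
  let Ψ := equivariantMap (side := side) ψ heq
  have h0 : ∀ x, π x = 0 → Ψ x.1 ∈ celModule hJ' := fun x hx =>
    (h2 _ x.2).2 ((toCellModule_eq_zero_iff (phi X) side D x).1 hx)
  have hN0 : celModule hJ' ≤ celModule (hJk 0) := celModule_mono _ _ (hJJk 0)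
  refine ⟨d, κ, hκ.2, hmono, fun k => imageOfComap π Ψ (celModule (hJk k)), ?_, ?_, ?_, ?_⟩
  · intro k l hkl
    exact imageOfComap_mono _ _ (celModule_mono _ _ (hJkm _ _ hkl))
  · refine eq_bot_iff.2 ?_
    rintro _ ⟨x, hx, rfl⟩
    have hx : ψ x.1 ∈ celSpan (phi Y) (Jk 0) := hx
    rw [hJk0] at hx
    exact (toCellModule_eq_zero_iff (phi X) side D x).2 ((h2 _ x.2).1 hx)
  · refine eq_top_iff.2 fun z _ => ?_
    obtain ⟨x, rfl⟩ := toCellModule_surjective (phi X) side D z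
    refine ⟨x, ?_, rfl⟩
    change ψ x.1 ∈ celSpan (phi Y) (Jk d)
    rw [hJkd]
    exact h1 _ x.2
  · intro k
    obtain ⟨i, rfl⟩ := hκ.2 k
    let _ : Unique {j : Subcells side Y D // κ j = κ i} :=
      ⟨⟨⟨i, rfl⟩⟩, fun j => Subtype.ext (hκ.1 j.2)⟩
    obtain ⟨e⟩ := nonempty_equiv_directSum (R := MonoidAlgebra ℤ (SideGroup W side))
      (fun j : {j : Subcells side Y D // κ j = κ i} => CellModule (phi Y) side j.1.1)
    obtain ⟨a, ha⟩ := i.2.1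
    have hai : a ∈ i.1 := by rw [ha]; exact (cellRel (phi Y) side).refl a
    have hleJ : leSet (phi Y) side i.1 ⊆ Jk (κ i + 1) := fun x ⟨c, hc, hxc⟩ =>
      hJk _ x c hxc (.inr ⟨i, Nat.lt_succ_self _, hc⟩)
    -- What lies weakly below the i-th cell and is already present is exactly what lies strictly
    -- below it, so the new subquotient is the cell module of that cell.
    have hlt : leSet (phi Y) side i.1 ∩ Jk (κ i) = ltSet (phi Y) side i.1 := by
      ext x
      constructor
      · rintro ⟨⟨c, hc, hxc⟩, hx⟩
        refine ⟨c, hc, hxc, fun hcx => ?_⟩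
        have hxi : x ∈ i.1 := by
          rw [ha] at hc ⊢
          exact (cellRel (phi Y) side).trans ⟨hxc, hcx⟩ hc
        rcases hx with hx | ⟨j, hj, hx⟩
        · exact hdisj.le_bot ⟨hx, i.2.2 hxi⟩
        · have := hmono i j ⟨x, hxi, x, hx, ((cellRel (phi Y) side).refl x).1⟩
          exact absurd hj (not_lt.2 this)
      · rintro ⟨c, hc, hxc, hcx⟩
        refine ⟨⟨c, hc, hxc⟩, ?_⟩
        rcases hleJ ⟨c, hc, hxc⟩ with hx | ⟨j, hj, hx⟩
        · exact .inl hx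
        · refine .inr ⟨j, lt_of_le_of_ne (Nat.lt_succ_iff.1 hj) fun hji => hcx ?_, hx⟩
          have : j = i := hκ.1 (Fin.ext hji)
          subst this
          exact hcle j c hc x hx
    obtain ⟨f⟩ := nonempty_subquotient_equiv (π := π) (ψ := Ψ) (P₀ := celModule hJ')
      (P := celModule (hJk (κ i))) (Q := celModule (hJk (κ i + 1)))
      (celModule_mono _ _ (hJJk _)) (celModule_mono _ _ (hJkm _ _ (Nat.le_succ _))) h0
      (fun y hy => by
        obtain ⟨_, ⟨x, hx, rfl⟩, z, hz, hxz⟩ :=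
          Submodule.mem_sup.1 (h3 (celSpan_mono (phi Y) (hJkJ _) hy))
        exact Submodule.mem_sup.2 ⟨_, ⟨x, hx, rfl⟩, z, hz, hxz⟩)
      (celModule_mono (isClosedSet_leSet (phi Y) side i.1) _ hleJ)
      (fun y hy => by
        have hsub : Jk (κ i + 1) ⊆ leSet (phi Y) side i.1 ∪ Jk (κ i) := by
          rintro x (hx | ⟨j, hj, hx⟩)
          · exact .inr (.inl hx)
          · rcases (Nat.lt_succ_iff.1 hj).lt_or_eq with hji | hji
            · exact .inr (.inr ⟨j, hji, hx⟩)
            · have : j = i := hκ.1 (Fin.ext hji)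
              subst this
              exact .inl ⟨x, hx, ((cellRel (phi Y) side).refl x).1⟩
        have hy' : (regRep W side).asModuleEquiv y ∈ celSpan (phi Y) (leSet (phi Y) side i.1 ∪ Jk (κ i)) :=
          celSpan_mono (phi Y) hsub hy
        rw [celSpan_union] at hy'
        obtain ⟨x, hx, z, hz, hxz⟩ := Submodule.mem_sup.1 hy'
        exact Submodule.mem_sup.2 ⟨x, hx, z, hz, hxz⟩)
      (toCellModule (phi Y) side i.1) (toCellModule_surjective (phi Y) side i.1)
      (fun x => by
        rw [toCellModule_eq_zero_iff]
        constructor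
        · exact fun hx => celSpan_mono (phi Y) (hlt ▸ Set.inter_subset_right) hx
        · intro hx
          have := mem_celSpan_inter (phi Y) x.2 hx
          rwa [hlt] at this)
    exact ⟨f.trans e⟩

end

end KLCell
end

noncomputable section
namespace KLCell
set_option linter.unusedSectionVars false

/-! ### Transport of comparisons -/

open Hecke

variable {B : Type u} {W : Type v} [Group W] {M : CoxeterMatrix B} {cs : CoxeterSystem M W}
variable {Γ : Type*} [AddCommGroup Γ] [LinearOrder Γ] [IsOrderedAddMonoid Γ]
variable {Γ' : Type*} [AddCommGroup Γ'] [LinearOrder Γ'] [IsOrderedAddMonoid Γ']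

theorem leSet_eq_union {φ : SBar cs → Γ} {side : Side} {D : Set W} (hD : IsCell φ side D) :
    leSet φ side D = ltSet φ side D ∪ D ∧ Disjoint (ltSet φ side D) D := by
  obtain ⟨a, rfl⟩ := hD
  have key : ∀ x, cellRel φ side x a → x ∉ ltSet φ side {x | cellRel φ side x a} :=
    fun x hx ⟨c, hc, _, hn⟩ => hn (hc.1.trans hx.2)
  refine ⟨?_, Set.disjoint_right.2 fun x hx => key x hx⟩
  ext x
  constructor
  · rintro ⟨c, hc, hxc⟩
    by_cases h : cellLE φ side c x
    · exact .inr ((cellRel φ side).trans ⟨hxc, h⟩ hc)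
    · exact .inl ⟨c, hc, hxc, h⟩
  · rintro (⟨c, hc, hxc, -⟩ | hx)
    · exact ⟨c, hc, hxc⟩
    · exact ⟨x, hx, ((cellRel φ side).refl x).1⟩

/-- When the spans of the `c_w` coincide, the identity is a comparison. -/
theorem isComparable_of_celSpan_eq {φ : SBar cs → Γ} {φ' : SBar cs → Γ'} {side : Side} {D : Set W}
    (hD : IsCell φ side D) (hle : ∀ x y, cellLE φ' side x y → cellLE φ side x y)
    (h1 : celSpan φ (leSet φ side D) = celSpan φ' (leSet φ side D))
    (h2 : celSpan φ (ltSet φ side D) = celSpan φ' (ltSet φ side D)) :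
    IsComparable φ φ' side D := by
  refine ⟨leSet φ side D, ltSet φ side D, LinearMap.id,
    fun x y h => isClosedSet_leSet φ side D x y (hle x y h),
    fun x y h => isClosedSet_ltSet φ side D x y (hle x y h), (leSet_eq_union hD).1,
    (leSet_eq_union hD).2, fun _ _ => rfl, fun v hv => ?_, fun v _ => ?_, ?_⟩
  · rw [← h1]; exact hv
  · rw [← h2]; rfl
  · rw [Submodule.map_id, h1]; exact le_sup_left

/-- Conjugating ψ by σ gives the comparison. A scalar c is allowed in the equivariance because sign
twists commute with the group action only up to sign; it occurs on both sides and cancels. -/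
theorem isComparable_transport {φ₁ φ : SBar cs → Γ} {φ₁' φ' : SBar cs → Γ'} {side' side : Side}
    (τ : W ≃ W) (σ : MonoidAlgebra ℤ W ≃ₗ[ℤ] MonoidAlgebra ℤ W)
    (hσ : ∀ P v, σ v ∈ celSpan φ₁ P ↔ v ∈ celSpan φ (τ ⁻¹' P))
    (hσ' : ∀ P v, σ v ∈ celSpan φ₁' P ↔ v ∈ celSpan φ' (τ ⁻¹' P))
    (hle : ∀ x y, cellLE φ₁ side' (τ x) (τ y) ↔ cellLE φ side x y)
    (hle' : ∀ x y, cellLE φ₁' side' (τ x) (τ y) ↔ cellLE φ' side x y)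
    (hg : ∀ g : SideGroup W side, ∃ (g' : SideGroup W side') (c : ℤ), ∀ v,
      σ (regRep W side g v) = c • regRep W side' g' (σ v))
    {E : Set W} (h : IsComparable φ₁ φ₁' side' E) : IsComparable φ φ' side (τ ⁻¹' E) := by
  obtain ⟨J, J', ψ, hJ, hJ', hJE, hdisj, heq, h1, h2, h3⟩ := h
  have e1 : τ ⁻¹' leSet φ₁ side' E = leSet φ side (τ ⁻¹' E) := by
    ext x
    constructor
    · rintro ⟨c, hc, hx⟩
      refine ⟨τ.symm c, by simpa using hc, (hle _ _).1 (by simpa using hx)⟩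
    · rintro ⟨c, hc, hx⟩
      exact ⟨τ c, hc, (hle _ _).2 hx⟩
  have e2 : τ ⁻¹' ltSet φ₁ side' E = ltSet φ side (τ ⁻¹' E) := by
    ext x
    constructor
    · rintro ⟨c, hc, hx, hn⟩
      refine ⟨τ.symm c, by simpa using hc, (hle _ _).1 (by simpa using hx), fun h => hn ?_⟩
      simpa using (hle _ _).2 h
    · rintro ⟨c, hc, hx, hn⟩
      exact ⟨τ c, hc, (hle _ _).2 hx, fun h => hn ((hle _ _).1 h)⟩
  have m1 : ∀ v, v ∈ celSpan φ (leSet φ side (τ ⁻¹' E)) ↔ σ v ∈ celSpan φ₁ (leSet φ₁ side' E) :=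
    fun v => by rw [hσ, e1]
  have m2 : ∀ v, v ∈ celSpan φ (ltSet φ side (τ ⁻¹' E)) ↔ σ v ∈ celSpan φ₁ (ltSet φ₁ side' E) :=
    fun v => by rw [hσ, e2]
  refine ⟨τ ⁻¹' J, τ ⁻¹' J', σ.symm.toLinearMap ∘ₗ ψ ∘ₗ σ.toLinearMap,
    fun x y h hy => hJ _ _ ((hle' x y).2 h) hy, fun x y h hy => hJ' _ _ ((hle' x y).2 h) hy,
    by rw [hJE]; rfl, hdisj.preimage τ, fun g v => ?_, fun v hv => ?_, fun v hv => ?_,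
    fun v hv => ?_⟩
  · obtain ⟨g', c, hgc⟩ := hg g
    apply σ.injective
    change σ (σ.symm (ψ (σ _))) = σ (regRep W side g (σ.symm (ψ (σ v))))
    rw [hgc, hgc, σ.apply_symm_apply, σ.apply_symm_apply, map_zsmul, heq]
  · rw [← hσ']
    simpa using h1 _ ((m1 v).1 hv)
  · rw [← hσ', m2, ← h2 _ ((m1 v).1 hv)]
    simp
  · obtain ⟨_, ⟨x, hx, rfl⟩, z, hz, hxz⟩ := Submodule.mem_sup.1 (h3 ((hσ' _ _).2 hv))
    refine Submodule.mem_sup.2 ⟨_, ⟨σ.symm x, (m1 _).2 (by simpa using hx), rfl⟩, σ.symm z,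
      (hσ' _ _).1 (by simpa using hz), ?_⟩
    apply σ.injective
    simpa using hxz

/-- A linear automorphism permuting the bases `c_w` up to signs maps spans to spans. -/
theorem mem_celSpan_iff_of_cel {φ₁ φ : SBar cs → Γ} (τ : W ≃ W)
    (σ : MonoidAlgebra ℤ W ≃ₗ[ℤ] MonoidAlgebra ℤ W) (ε : W → ℤˣ)
    (h : ∀ x, σ (cel φ x) = (ε x : ℤ) • cel φ₁ (τ x)) (P : Set W) (v : MonoidAlgebra ℤ W) :
    σ v ∈ celSpan φ₁ P ↔ v ∈ celSpan φ (τ ⁻¹' P) := by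
  have key : (celSpan φ (τ ⁻¹' P)).map σ.toLinearMap = celSpan φ₁ P := by
    apply le_antisymm
    · rw [celSpan, Submodule.map_span_le]
      rintro _ ⟨x, hx, rfl⟩
      change σ (cel φ x) ∈ _
      rw [h]
      exact Submodule.smul_mem _ _ (cel_mem_celSpan φ₁ hx)
    · refine Submodule.span_le.2 ?_
      rintro _ ⟨y, hy, rfl⟩
      obtain ⟨x, rfl⟩ := τ.surjective y
      refine ⟨(ε x : ℤ) • cel φ x, Submodule.smul_mem _ _ (cel_mem_celSpan φ hy), ?_⟩
      change σ _ = _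
      rw [map_smul, h, smul_smul, ← Units.val_mul, Int.units_mul_self, Units.val_one, one_smul]
  rw [← key]
  exact (Submodule.mem_map_equiv (e := σ) (p := celSpan φ (τ ⁻¹' P)) (x := σ v)).trans
    (by rw [σ.symm_apply_apply])

/-! #### Twisting by a sign character -/

/-- The automorphism of the group ring attached to a sign character. -/
def signHom (ε : W →* ℤˣ) : MonoidAlgebra ℤ W →ₐ[ℤ] MonoidAlgebra ℤ W :=
  MonoidAlgebra.lift ℤ _ W
    { toFun := fun w => ((ε w : ℤˣ) : ℤ) • MonoidAlgebra.single w 1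
      map_one' := by simp [MonoidAlgebra.one_def]
      map_mul' := fun a b => by
        rw [smul_mul_smul_comm, MonoidAlgebra.single_mul_single, map_mul, Units.val_mul, one_mul] }

theorem signHom_single (ε : W →* ℤˣ) (x : W) :
    signHom ε (.single x 1) = ((ε x : ℤˣ) : ℤ) • MonoidAlgebra.single x 1 := by
  simp [signHom]

theorem signHom_signHom (ε : W →* ℤˣ) (v : MonoidAlgebra ℤ W) : signHom ε (signHom ε v) = v := by
  induction v using MonoidAlgebra.induction_linear with
  | zero => simp
  | add a b ha hb => rw [map_add, map_add, ha, hb]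
  | single x n =>
    have : MonoidAlgebra.single x n = n • MonoidAlgebra.single x (1 : ℤ) := by simp
    rw [this, map_smul, map_smul, signHom_single, map_smul, signHom_single]
    congr 1
    rw [smul_smul, ← Units.val_mul, Int.units_mul_self, Units.val_one, one_smul]

theorem spec_twist (φ φ₁ : SBar cs → Γ) (ε : W →* ℤˣ) (h : Hecke cs φ) :
    spec φ₁ (twist φ φ₁ ε h) = signHom ε (spec φ h) := by
  have key : ∀ (v : MonoidAlgebra ℤ W) (y : W),
      (signHom ε v).coeff y = ((ε y : ℤˣ) : ℤ) • v.coeff y := by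
    classical
    intro v y
    induction v using MonoidAlgebra.induction_linear with
    | zero => simp
    | add a b ha hb => rw [map_add, MonoidAlgebra.coeff_add, Finsupp.add_apply, ha, hb]; simp [mul_add]
    | single x n =>
      have : MonoidAlgebra.single x n = n • MonoidAlgebra.single x (1 : ℤ) := by simp
      rw [this, map_smul, signHom_single]
      simp only [MonoidAlgebra.coeff_smul, MonoidAlgebra.coeff_single, Finsupp.smul_apply,
        Finsupp.single_apply]
      split_ifs with hxy
      · subst hxy; simp [mul_comm]
      · simp
  ext y
  rw [key, spec_coeff, spec_coeff, repr_twist, map_zsmul]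

/-- One character must correct the signs of both parameter functions, as the same σ has to respect
both bases. -/
theorem IsComparable.of_twist [Finite W] {φ₁ φ : SBar cs → Γ} {φ₁' φ' : SBar cs → Γ'} {ε : W →* ℤˣ}
    (hε : ∀ i, φ₁ (cls cs i) = ((ε (cs.simple i) : ℤˣ) : ℤ) • φ (cls cs i))
    (hε' : ∀ i, φ₁' (cls cs i) = ((ε (cs.simple i) : ℤˣ) : ℤ) • φ' (cls cs i)) {side : Side}
    {D : Set W} (h : IsComparable φ₁ φ₁' side D) : IsComparable φ φ' side D := by
  let σ : MonoidAlgebra ℤ W ≃ₗ[ℤ] MonoidAlgebra ℤ W :=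
    LinearEquiv.ofInvolutive (signHom ε).toLinearMap (signHom_signHom ε)
  refine isComparable_transport (Equiv.refl W) σ
    (mem_celSpan_iff_of_cel (Equiv.refl W) σ ε fun x => ?_)
    (mem_celSpan_iff_of_cel (Equiv.refl W) σ ε fun x => ?_)
    (cellLE_twist_iff hε side) (cellLE_twist_iff hε' side) (fun g => ?_) h
  · change signHom ε (cel φ x) = _
    rw [cel, ← spec_twist φ φ₁ ε, twist_C hε, map_zsmul]; rfl
  · change signHom ε (cel φ' x) = _
    rw [cel, ← spec_twist φ' φ₁' ε, twist_C hε', map_zsmul]; rfl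
  · refine ⟨g, ((ε g.1.1 : ℤˣ) : ℤ) * ((ε g.1.2⁻¹ : ℤˣ) : ℤ), fun v => ?_⟩
    change signHom ε _ = _ • regRep W side g (signHom ε v)
    rw [regRep_apply, regRep_apply, map_mul, map_mul, signHom_single, signHom_single,
      smul_mul_assoc, smul_mul_assoc, mul_smul_comm, smul_smul]

/-! #### Exchanging left and right -/

/-- The antiautomorphism of the group ring inverting the elements of the group. -/
def invMap (W : Type v) [Group W] : MonoidAlgebra ℤ W →ₗ[ℤ] MonoidAlgebra ℤ W :=
  (MonoidAlgebra.coeffLinearEquiv ℤ).symm.toLinearMap ∘ₗ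
    (Finsupp.domLCongr (R := ℤ) (M := ℤ) (Equiv.inv W)).toLinearMap ∘ₗ
      (MonoidAlgebra.coeffLinearEquiv ℤ).toLinearMap

theorem coeff_invMap (v : MonoidAlgebra ℤ W) (y : W) : (invMap W v).coeff y = v.coeff y⁻¹ := rfl

theorem invMap_single (x : W) : invMap W (.single x 1) = .single x⁻¹ 1 := by
  classical
  ext y
  rw [coeff_invMap, MonoidAlgebra.coeff_single, MonoidAlgebra.coeff_single, Finsupp.single_apply,
    Finsupp.single_apply]
  simp only [eq_inv_iff_mul_eq_one, inv_eq_iff_mul_eq_one]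

theorem monoidAlgebra_hom_ext {A : Type*} [AddCommGroup A] {f g : MonoidAlgebra ℤ W →ₗ[ℤ] A}
    (h : ∀ x, f (.single x 1) = g (.single x 1)) : f = g := by
  ext x
  exact h x

theorem invMap_invMap (v : MonoidAlgebra ℤ W) : invMap W (invMap W v) = v := by
  have : invMap W ∘ₗ invMap W = LinearMap.id := monoidAlgebra_hom_ext fun x => by
    simp [invMap_single]
  exact LinearMap.congr_fun this v

theorem invMap_mul_single (v : MonoidAlgebra ℤ W) (x : W) :
    invMap W (v * .single x 1) = .single x⁻¹ 1 * invMap W v := by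
  have : invMap W ∘ₗ LinearMap.mulRight ℤ (.single x 1) =
      LinearMap.mulLeft ℤ (.single x⁻¹ 1) ∘ₗ invMap W := monoidAlgebra_hom_ext fun y => by
    simp [invMap_single, MonoidAlgebra.single_mul_single]
  exact LinearMap.congr_fun this v

theorem spec_flip (φ : SBar cs → Γ) (h : Hecke cs φ) :
    spec φ (flip φ h) = invMap W (spec φ h) := by
  ext y
  rw [coeff_invMap, spec_coeff, spec_coeff, repr_flip]

theorem invMap_cel (φ : SBar cs → Γ) (x : W) : invMap W (cel φ x) = cel φ x⁻¹ := by
  rw [cel, ← spec_flip, flip_C]; rfl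

theorem IsComparable.flip [Finite W] {φ : SBar cs → Γ} {φ' : SBar cs → Γ'} {D : Set W}
    (h : IsComparable φ φ' .L ((Equiv.inv W) ⁻¹' D)) : IsComparable φ φ' .R D := by
  let σ : MonoidAlgebra ℤ W ≃ₗ[ℤ] MonoidAlgebra ℤ W :=
    LinearEquiv.ofInvolutive (invMap W) invMap_invMap
  have e : D = Equiv.inv W ⁻¹' (Equiv.inv W ⁻¹' D) := by ext; simp
  rw [e]
  refine isComparable_transport (Equiv.inv W) σ
    (mem_celSpan_iff_of_cel (Equiv.inv W) σ 1 fun x => ?_)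
    (mem_celSpan_iff_of_cel (Equiv.inv W) σ 1 fun x => ?_)
    (fun x y => (cellLE_right_iff φ x y).symm) (fun x y => (cellLE_right_iff φ' x y).symm)
    (fun g => ?_) h
  · change invMap W (cel φ x) = _
    rw [invMap_cel]; simp
  · change invMap W (cel φ' x) = _
    rw [invMap_cel]; simp
  · have h1 : g.1.1 = 1 := sideSub_fst rfl g.2
    refine ⟨⟨(g.1.2, 1), Subgroup.mem_prod.2 ⟨trivial, rfl⟩⟩, 1, fun v => ?_⟩
    change invMap W _ = (1 : ℤ) • regRep W .L _ (invMap W v)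
    rw [regRep_apply, regRep_apply, h1, invMap_mul_single]
    simp [← MonoidAlgebra.one_def]

end KLCell
end

noncomputable section
namespace KLCell
set_option linter.unusedSectionVars false

/-! ### Comparison of the specialized Kazhdan-Lusztig bases -/

open Hecke

variable {B : Type u} {W : Type v} [Group W] {M : CoxeterMatrix B} {cs : CoxeterSystem M W}
variable {Γ : Type*} [AddCommGroup Γ] [LinearOrder Γ] [IsOrderedAddMonoid Γ]
variable {Γ' : Type*} [AddCommGroup Γ'] [LinearOrder Γ'] [IsOrderedAddMonoid Γ']
variable {s t : B} {m : ℕ}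

theorem spec_Cgen_of_zero {φ : SBar cs → Γ} {i : B} (h : φ (cls cs i) = 0) :
    spec φ (Cgen φ i) = .single (cs.simple i) 1 := by
  rw [Cgen_eq_T h, spec_T]

theorem spec_Cgen_of_ne {φ : SBar cs → Γ} {i : B} (h : φ (cls cs i) ≠ 0) :
    spec φ (Cgen φ i) = .single (cs.simple i) 1 + 1 := by
  rw [Cgen, dpar, if_neg h, map_add, spec_T, map_smulₛₗ, aug_expo, one_smul, spec_one]

theorem cel_simple {φ : SBar cs → Γ} {i : B} (h : 0 ≤ φ (cls cs i)) :
    cel φ (cs.simple i) = spec φ (Cgen φ i) := by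
  rw [cel, C_simple h]

theorem cel_one (φ : SBar cs → Γ) : cel φ 1 = 1 := by
  rw [cel, C_one, spec_one]

/-- The element `c_w` attached to the alternating word of length `k`, or `0` if `k = 0`. -/
def celAlt (φ : SBar cs → Γ) (s t : B) (k : ℕ) : MonoidAlgebra ℤ W := spec φ (Calt φ s t k)

theorem celAlt_zero (φ : SBar cs → Γ) (s t : B) : celAlt φ s t 0 = 0 := by
  rw [celAlt, Calt, if_pos rfl, map_zero]

theorem celAlt_of_pos (φ : SBar cs → Γ) (s t : B) {k : ℕ} (hk : 1 ≤ k) :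
    celAlt φ s t k = cel φ (alt cs s t k) := by
  rw [celAlt, Calt_of_pos hk]; rfl

theorem celAlt_one {φ : SBar cs → Γ} (h : 0 ≤ φ (cls cs s)) (t : B) :
    celAlt φ s t 1 = spec φ (Cgen φ s) := by
  rw [celAlt_of_pos φ s t le_rfl, alt_one, cel_simple h]

variable (H : IsDihedral M s t m)
include H

theorem gen_mul_celAlt_of_lt {φ : SBar cs → Γ} (hs : φ (cls cs t) < φ (cls cs s))
    (ht : 0 ≤ φ (cls cs t)) {k : ℕ} (hk : 1 ≤ k) (hk' : k < 2 * m) :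
    spec φ (Cgen φ t) * celAlt φ s t k = celAlt φ t s (k + 1) := by
  rw [celAlt_of_pos φ s t hk, celAlt_of_pos φ t s (by omega), cel, ← spec_mul,
    Cgen_mul_C_of_lt H hs ht hk hk']; rfl

theorem gen_mul_celAlt_of_gt {φ : SBar cs → Γ} (hs : φ (cls cs t) < φ (cls cs s))
    (ht : 0 ≤ φ (cls cs t)) {k : ℕ} (hk : 1 ≤ k) (hk' : k < 2 * m) :
    spec φ (Cgen φ s) * celAlt φ t s k = celAlt φ s t (k + 1) +
      (if φ (cls cs t) = 0 then (0 : ℤ) else 2) • celAlt φ s t (k - 1) + celAlt φ s t (k - 3) := by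
  rw [celAlt_of_pos φ t s hk, celAlt_of_pos φ s t (k := k + 1) (by omega), cel, ← spec_mul,
    Cgen_mul_C_of_gt H hs ht hk hk', map_add, map_add, map_smulₛₗ, zeta, apply_ite (aug Γ),
    map_zero, map_add, aug_expo, aug_expo]
  rfl

theorem gen_mul_celAlt_of_eq {φ : SBar cs → Γ} (hs : 0 < φ (cls cs s))
    (hst : φ (cls cs s) = φ (cls cs t)) {k : ℕ} (hk : 1 ≤ k) (hk' : k < 2 * m) :
    spec φ (Cgen φ s) * celAlt φ t s k = celAlt φ s t (k + 1) + celAlt φ s t (k - 1) := by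
  rw [celAlt_of_pos φ t s hk, celAlt_of_pos φ s t (k := k + 1) (by omega), cel, ← spec_mul,
    Cgen_mul_C_of_eq H hs hst hk hk', map_add]
  rfl

theorem cel_eq_cel {φ : SBar cs → Γ} {φ' : SBar cs → Γ'}
    (h1 : ∀ k ≤ 2 * m, celAlt φ s t k = celAlt φ' s t k)
    (h2 : ∀ k ≤ 2 * m, celAlt φ t s k = celAlt φ' t s k) (x : W) : cel φ x = cel φ' x := by
  refine alt_cases cs H (P := fun x => cel φ x = cel φ' x) ?_ ?_ ?_ x
  · rw [cel_one, cel_one]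
  · intro k hk hk'
    rw [← celAlt_of_pos φ s t hk, ← celAlt_of_pos φ' s t hk, h1 k hk']
  · intro k hk hk'
    rw [← celAlt_of_pos φ t s hk, ← celAlt_of_pos φ' t s hk, h2 k hk'.le]

/-- At e^γ = 1 the multiplication formulas for 0 < φ(t) < φ(s) have constant coefficients 1, 2, 1,
so they no longer see the actual parameters. -/
theorem cel_eq_of_lt {φ : SBar cs → Γ} {φ' : SBar cs → Γ'} (ht : 0 < φ (cls cs t))
    (hs : φ (cls cs t) < φ (cls cs s)) (ht' : 0 < φ' (cls cs t))
    (hs' : φ' (cls cs t) < φ' (cls cs s)) : cel φ = cel φ' := by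
  have key : ∀ k ≤ 2 * m, celAlt φ s t k = celAlt φ' s t k ∧ celAlt φ t s k = celAlt φ' t s k := by
    intro k
    induction k using Nat.strong_induction_on with
    | _ k ih =>
      intro hk
      rcases (by omega : k = 0 ∨ k = 1 ∨ 2 ≤ k) with rfl | rfl | h2
      · simp [celAlt_zero]
      · rw [celAlt_one (ht.trans hs).le, celAlt_one (ht'.trans hs').le, celAlt_one ht.le,
          celAlt_one ht'.le, spec_Cgen_of_ne (ht.trans hs).ne', spec_Cgen_of_ne (ht'.trans hs').ne',
          spec_Cgen_of_ne ht.ne', spec_Cgen_of_ne ht'.ne']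
        exact ⟨rfl, rfl⟩
      · obtain ⟨k, rfl⟩ : ∃ j, k = j + 1 := ⟨k - 1, by omega⟩
        have e1 := gen_mul_celAlt_of_gt H hs ht.le (k := k) (by omega) (by omega)
        have e2 := gen_mul_celAlt_of_gt H hs' ht'.le (k := k) (by omega) (by omega)
        have e3 := gen_mul_celAlt_of_lt H hs ht.le (k := k) (by omega) (by omega)
        have e4 := gen_mul_celAlt_of_lt H hs' ht'.le (k := k) (by omega) (by omega)
        rw [if_neg ht.ne', spec_Cgen_of_ne (ht.trans hs).ne', (ih k (by omega) (by omega)).2,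
          (ih (k - 1) (by omega) (by omega)).1, (ih (k - 3) (by omega) (by omega)).1] at e1
        rw [if_neg ht'.ne', spec_Cgen_of_ne (ht'.trans hs').ne', e1] at e2
        rw [spec_Cgen_of_ne ht.ne', (ih k (by omega) (by omega)).1] at e3
        rw [spec_Cgen_of_ne ht'.ne', e3] at e4
        exact ⟨add_right_cancel (add_right_cancel e2), e4⟩
  exact funext (cel_eq_cel H (fun k hk => (key k hk).1) fun k hk => (key k hk).2)

/-- The bases `c_w` for equal parameters and for `0 < φ'(t) < φ'(s)`. -/
theorem celAlt_of_eq_of_lt {φ : SBar cs → Γ} {φ' : SBar cs → Γ'} (hs : 0 < φ (cls cs s))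
    (hst : φ (cls cs s) = φ (cls cs t)) (ht' : 0 < φ' (cls cs t))
    (hs' : φ' (cls cs t) < φ' (cls cs s)) {k : ℕ} (hk : k ≤ 2 * m) :
    (k % 2 = 0 → celAlt φ' s t k = celAlt φ s t k ∧ celAlt φ' t s k = celAlt φ t s k) ∧
    (k % 2 = 1 → celAlt φ s t k = celAlt φ' s t k + celAlt φ' s t (k - 2) ∧
      celAlt φ' t s k = celAlt φ t s k + celAlt φ t s (k - 2)) := by
  have ht : 0 < φ (cls cs t) := hst ▸ hs
  revert hk
  induction k using Nat.strong_induction_on with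
  | _ k ih =>
    intro hk
    rcases (by omega : k = 0 ∨ k = 1 ∨ 2 ≤ k) with rfl | rfl | h2
    · simp [celAlt_zero]
    · rw [celAlt_one hs.le, celAlt_one (ht'.trans hs').le, celAlt_one ht.le,
        celAlt_one ht'.le, spec_Cgen_of_ne hs.ne', spec_Cgen_of_ne (ht'.trans hs').ne',
        spec_Cgen_of_ne ht.ne', spec_Cgen_of_ne ht'.ne']
      simp [celAlt_zero]
    · obtain ⟨k, rfl⟩ : ∃ j, k = j + 1 := ⟨k - 1, by omega⟩
      have a1 := gen_mul_celAlt_of_eq H hs hst (k := k) (by omega) (by omega)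
      have a2 := gen_mul_celAlt_of_eq H.symm ht hst.symm (k := k) (by omega) (by omega)
      have b1 := gen_mul_celAlt_of_gt H hs' ht'.le (k := k) (by omega) (by omega)
      have b2 := gen_mul_celAlt_of_lt H hs' ht'.le (k := k) (by omega) (by omega)
      rw [spec_Cgen_of_ne hs.ne'] at a1
      rw [spec_Cgen_of_ne ht.ne'] at a2
      rw [spec_Cgen_of_ne (ht'.trans hs').ne', if_neg ht'.ne', two_smul] at b1
      rw [spec_Cgen_of_ne ht'.ne'] at b2
      have i0 := ih k (by omega) (by omega)
      have i1 := ih (k - 1) (by omega) (by omega)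
      constructor
      · intro hp
        obtain ⟨i01, i02⟩ := i0.2 (by omega)
        obtain ⟨i11, i12⟩ := i1.1 (by omega)
        -- For k = 1 the terms of index k - 2 and k - 3 are absent. Otherwise the coefficient 2 of
        -- the unequal formula arises from two equal-parameter products, at k and k - 2, each
        -- contributing the term of index k - 1.
        rcases (by omega : k = 1 ∨ 3 ≤ k) with rfl | h3
        · simp only [Nat.sub_self, Nat.reduceSub, celAlt_zero, add_zero] at *
          rw [i02] at b1
          rw [i01] at a2
          exact ⟨by rw [← a1, ← b1], by rw [← a2, ← b2]⟩
        · have a1' := gen_mul_celAlt_of_eq H hs hst (k := k - 2) (by omega) (by omega)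
          have b2' := gen_mul_celAlt_of_lt H hs' ht'.le (k := k - 2) (by omega) (by omega)
          have i3 := (ih (k - 3) (by omega) (by omega)).1 (by omega)
          rw [spec_Cgen_of_ne hs.ne'] at a1'
          rw [spec_Cgen_of_ne ht'.ne'] at b2'
          have e1 : k - 2 + 1 = k - 1 := by omega
          have e2 : k - 2 - 1 = k - 3 := by omega
          rw [e1] at b2'
          rw [e1, e2] at a1'
          rw [i02, mul_add, a1, a1', i11, i3.1] at b1
          rw [i01, mul_add, b2, b2', i12] at a2
          refine ⟨sub_eq_zero.1 ?_, sub_eq_zero.1 ?_⟩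
          · rw [← sub_eq_zero.2 b1.symm]; abel
          · rw [← sub_eq_zero.2 a2]; abel
      · intro hp
        obtain ⟨i01, i02⟩ := i0.1 (by omega)
        obtain ⟨i11, i12⟩ := i1.2 (by omega)
        have e3 : k - 1 - 2 = k - 3 := by omega
        have e4 : k + 1 - 2 = k - 1 := by omega
        rw [e3] at i11 i12
        rw [e4]
        rw [i02, a1, i11] at b1
        rw [← i01, b2] at a2
        refine ⟨sub_eq_zero.1 ?_, a2⟩
        rw [← sub_eq_zero.2 b1]; abel

end KLCell
end

noncomputable section
namespace KLCell
set_option linter.unusedSectionVars false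

/-! ### Comparison of cell modules -/

open Hecke

variable {B : Type u} {W : Type v} [Group W] {M : CoxeterMatrix B} {cs : CoxeterSystem M W}
variable {Γ : Type*} [AddCommGroup Γ] [LinearOrder Γ] [IsOrderedAddMonoid Γ]
variable {Γ' : Type*} [AddCommGroup Γ'] [LinearOrder Γ'] [IsOrderedAddMonoid Γ']
variable {s t : B} {m : ℕ} {side : Side} {D : Set W}

theorem celSpan_le_iff {φ : SBar cs → Γ} {P : Set W} {S : Submodule ℤ (MonoidAlgebra ℤ W)} :
    celSpan φ P ≤ S ↔ ∀ x ∈ P, cel φ x ∈ S := by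
  rw [celSpan, Submodule.span_le, Set.image_subset_iff]; rfl

theorem isComparable_of_cel_eq {φ : SBar cs → Γ} {φ' : SBar cs → Γ'} (hD : IsCell φ side D)
    (hle : ∀ x y, cellLE φ' side x y → cellLE φ side x y) (h : cel φ = cel φ') :
    IsComparable φ φ' side D :=
  isComparable_of_celSpan_eq hD hle (by rw [celSpan, celSpan, h]) (by rw [celSpan, celSpan, h])

section

variable {A : Type*} [AddCommGroup A] {f g : ℕ → A} {p : ℕ → Prop} {n : ℕ} {F : Submodule ℤ A}

/-- The base change f(k) = g(k) + g(k - 2) is unitriangular on odd indices. Over an index set stable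
under k ↦ k - 2, both families therefore lie in the same submodules; the companion lemma is the easy
direction. -/
theorem mem_of_add_sub_two (h : ∀ k < n, k % 2 = 1 → f k = g k + g (k - 2)) (h0 : g 0 = 0)
    (hp : ∀ k, 3 ≤ k → k < n → k % 2 = 1 → p k → p (k - 2))
    (hF : ∀ k < n, k % 2 = 1 → p k → f k ∈ F) : ∀ k < n, k % 2 = 1 → p k → g k ∈ F := by
  intro k
  induction k using Nat.strong_induction_on with
  | _ k ih =>
    intro h1 h2 h3
    rw [eq_sub_of_add_eq (h k h1 h2).symm]
    refine sub_mem (hF k h1 h2 h3) ?_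
    rcases (by omega : k = 1 ∨ 3 ≤ k) with rfl | h4
    · rw [h0]; exact zero_mem _
    · exact ih _ (by omega) (by omega) (by omega) (hp k h4 h1 h2 h3)

theorem mem_of_add_sub_two' (h : ∀ k < n, k % 2 = 1 → f k = g k + g (k - 2)) (h0 : g 0 = 0)
    (hp : ∀ k, 3 ≤ k → k < n → k % 2 = 1 → p k → p (k - 2))
    (hF : ∀ k < n, k % 2 = 1 → p k → g k ∈ F) : ∀ k < n, k % 2 = 1 → p k → f k ∈ F := by
  intro k h1 h2 h3
  rw [h k h1 h2]
  refine add_mem (hF k h1 h2 h3) ?_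
  rcases (by omega : k = 1 ∨ 3 ≤ k) with rfl | h4
  · rw [h0]; exact zero_mem _
  · exact hF _ (by omega) (by omega) (hp k h4 h1 h2 h3)

end

variable (H : IsDihedral M s t m)
include H

/-- There is a single cell, namely W, with nothing strictly below it, so both spans are the whole
group ring or zero. -/
theorem isComparable_of_zero_of_zero {φ : SBar cs → Γ} {φ' : SBar cs → Γ'}
    (hD : IsCell φ side D) (hs : φ (cls cs s) = 0) (ht : φ (cls cs t) = 0) :
    IsComparable φ φ' side D := by
  have := finite_of_isDihedral cs H
  have hall := cellLE_of_zero H hs ht side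
  have h1 : leSet φ side D = Set.univ := by
    obtain ⟨a, rfl⟩ := hD
    exact Set.eq_univ_of_forall fun x => ⟨a, (cellRel φ side).refl a, hall x a⟩
  have h2 : ltSet φ side D = ∅ :=
    Set.eq_empty_of_forall_notMem fun x ⟨c, _, _, hn⟩ => hn (hall c x)
  refine isComparable_of_celSpan_eq hD (fun x y _ => hall x y) ?_ ?_
  · rw [h1, celSpan, celSpan, span_cel_univ, span_cel_univ]
  · rw [h2, celSpan, celSpan, Set.image_empty, Set.image_empty]

theorem cellLE_alt_sub_two {φ : SBar cs → Γ} (hs : 0 < φ (cls cs s))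
    (hst : φ (cls cs s) = φ (cls cs t)) (side : Side) {k : ℕ} (hk : 3 ≤ k) (hk' : k < 2 * m)
    (hp : k % 2 = 1) : cellLE φ side (alt cs s t (k - 2)) (alt cs s t k) := by
  have h1 := alt_facts cs H (j := k - 2) (by omega) (by omega)
  have h2 := alt_facts cs H (j := k) (by omega) (by omega)
  refine (cellLE_iff_relE_abs H hs.ne' (by rw [hst]) side _ _).2 (.inr (.inr ⟨h1.1, ?_, ?_⟩))
  · rw [ne_eq, h2.2.1]; omega
  · cases side
    · exact iff_of_true (h1.2.2.2.2.2.mpr (by omega)) (h2.2.2.2.2.2.mpr (by omega))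
    · exact iff_of_true h1.2.2.2.2.1 h2.2.2.2.2.1
    · trivial

/-- The two bases agree at even lengths and differ by the term of index k - 2 at odd length k. The
words of odd lengths k - 2 and k have the same descents, so a set closed for equal parameters that
contains the longer word contains the shorter one. -/
theorem celSpan_eq_of_eq_of_lt {φ : SBar cs → Γ} {φ' : SBar cs → Γ'} (hs : 0 < φ (cls cs s))
    (hst : φ (cls cs s) = φ (cls cs t)) (ht' : 0 < φ' (cls cs t))
    (hs' : φ' (cls cs t) < φ' (cls cs s)) {P : Set W} (hP : IsClosedSet φ side P) :
    celSpan φ P = celSpan φ' P := by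
  have ht : 0 < φ (cls cs t) := hst ▸ hs
  have key := fun k hk => celAlt_of_eq_of_lt H hs hst ht' hs' (k := k) hk
  have p1 : ∀ k, 3 ≤ k → k < 2 * m → k % 2 = 1 → alt cs s t k ∈ P → alt cs s t (k - 2) ∈ P :=
    fun k h1 h2 h3 => hP _ _ (cellLE_alt_sub_two H hs hst side h1 h2 h3)
  have p2 : ∀ k, 3 ≤ k → k < 2 * m → k % 2 = 1 → alt cs t s k ∈ P → alt cs t s (k - 2) ∈ P :=
    fun k h1 h2 h3 => hP _ _ (cellLE_alt_sub_two H.symm ht hst.symm side h1 h2 h3)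
  have e1 := fun k (hk : k < 2 * m) hk' => ((key k hk.le).2 hk').1
  have e2 := fun k (hk : k < 2 * m) hk' => ((key k hk.le).2 hk').2
  apply le_antisymm
  · have q2 := mem_of_add_sub_two e2 (celAlt_zero φ t s) p2 (F := celSpan φ' P) fun k h1 h2 h3 => by
      rw [celAlt_of_pos _ _ _ (by omega)]; exact cel_mem_celSpan φ' h3
    have q1 := mem_of_add_sub_two' e1 (celAlt_zero φ' s t) p1 (F := celSpan φ' P)
      fun k h1 h2 h3 => by
        rw [celAlt_of_pos _ _ _ (by omega)]; exact cel_mem_celSpan φ' h3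
    refine celSpan_le_iff.2 (alt_cases cs H (fun h => ?_) (fun k hk hk' h => ?_) fun k hk hk' h => ?_)
    · rw [cel_one, ← cel_one φ']; exact cel_mem_celSpan φ' h
    · rw [← celAlt_of_pos φ s t hk]
      rcases Nat.mod_two_eq_zero_or_one k with hp | hp
      · rw [← ((key k hk').1 hp).1, celAlt_of_pos φ' s t hk]; exact cel_mem_celSpan φ' h
      · exact q1 k (by omega) hp h
    · rw [← celAlt_of_pos φ t s hk]
      rcases Nat.mod_two_eq_zero_or_one k with hp | hp
      · rw [← ((key k hk'.le).1 hp).2, celAlt_of_pos φ' t s hk]; exact cel_mem_celSpan φ' h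
      · exact q2 k hk' hp h
  · have q1 := mem_of_add_sub_two e1 (celAlt_zero φ' s t) p1 (F := celSpan φ P) fun k h1 h2 h3 => by
      rw [celAlt_of_pos _ _ _ (by omega)]; exact cel_mem_celSpan φ h3
    have q2 := mem_of_add_sub_two' e2 (celAlt_zero φ t s) p2 (F := celSpan φ P)
      fun k h1 h2 h3 => by
        rw [celAlt_of_pos _ _ _ (by omega)]; exact cel_mem_celSpan φ h3
    refine celSpan_le_iff.2 (alt_cases cs H (fun h => ?_) (fun k hk hk' h => ?_) fun k hk hk' h => ?_)
    · rw [cel_one, ← cel_one φ]; exact cel_mem_celSpan φ h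
    · rw [← celAlt_of_pos φ' s t hk]
      rcases Nat.mod_two_eq_zero_or_one k with hp | hp
      · rw [((key k hk').1 hp).1, celAlt_of_pos φ s t hk]; exact cel_mem_celSpan φ h
      · exact q1 k (by omega) hp h
    · rw [← celAlt_of_pos φ' t s hk]
      rcases Nat.mod_two_eq_zero_or_one k with hp | hp
      · rw [((key k hk'.le).1 hp).2, celAlt_of_pos φ t s hk]; exact cel_mem_celSpan φ h
      · exact q2 k hk' hp h

end KLCell
end

noncomputable section
namespace KLCell
set_option linter.unusedSectionVars false

/-! ### Comparison of cell modules when one parameter is zero -/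

open Hecke

variable {B : Type u} {W : Type v} [Group W] {M : CoxeterMatrix B} {cs : CoxeterSystem M W}
variable {Γ : Type*} [AddCommGroup Γ] [LinearOrder Γ] [IsOrderedAddMonoid Γ]
variable {Γ' : Type*} [AddCommGroup Γ'] [LinearOrder Γ'] [IsOrderedAddMonoid Γ']
variable {s t : B} {m : ℕ} {side : Side} {D : Set W}

theorem invMap_single_mul (v : MonoidAlgebra ℤ W) (x : W) :
    invMap W (.single x 1 * v) = invMap W v * .single x⁻¹ 1 := by
  have := invMap_mul_single (invMap W v) x⁻¹
  rw [inv_inv, invMap_invMap] at this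
  rw [← this, invMap_invMap]

theorem not_isLeftDescent_simple_mul {x : W} {i : B} (h : cs.IsLeftDescent x i) :
    ¬ cs.IsLeftDescent (cs.simple i * x) i := by
  rw [CoxeterSystem.IsLeftDescent, cs.simple_mul_simple_cancel_left]
  exact not_lt.2 h.le

theorem not_isRightDescent_mul_simple {x : W} {i : B} (h : cs.IsRightDescent x i) :
    ¬ cs.IsRightDescent (x * cs.simple i) i := by
  rw [CoxeterSystem.IsRightDescent, cs.simple_mul_simple_cancel_right]
  exact not_lt.2 h.le

theorem not_isLeftDescent_mul_simple {x : W} {i j : B} (h : ¬ cs.IsLeftDescent x i)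
    (h' : cs.IsRightDescent x j) : ¬ cs.IsLeftDescent (x * cs.simple j) i := by
  unfold CoxeterSystem.IsLeftDescent CoxeterSystem.IsRightDescent at *
  have h1 := cs.length_simple_mul x i
  have h2 := cs.length_mul_simple x j
  have h3 := cs.length_mul_simple (cs.simple i * x) j
  rw [mul_assoc] at h3
  omega

variable (H : IsDihedral M s t m)
include H

section Zero

variable {φ : SBar cs → Γ} {φ' : SBar cs → Γ'} (ht : φ (cls cs t) = 0) (hs : 0 < φ (cls cs s))

include ht hs in
theorem cel_simple_mul_of_zero (x : W) :
    cel φ (cs.simple t * x) = .single (cs.simple t) 1 * cel φ x := by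
  have hm := H.two_le
  have key : ∀ k < 2 * m, cel φ (alt cs t s (k + 1)) =
      .single (cs.simple t) 1 * cel φ (alt cs s t k) := by
    intro k hk
    rcases Nat.eq_zero_or_pos k with rfl | h
    · rw [zero_add, alt_one, cel_simple ht.ge, spec_Cgen_of_zero ht, alt_zero, cel_one, mul_one]
    · rw [← celAlt_of_pos φ t s (by omega), ← celAlt_of_pos φ s t h, ← spec_Cgen_of_zero ht,
        gen_mul_celAlt_of_lt H (ht ▸ hs) ht.ge h hk]
  have key' : ∀ k < 2 * m, cel φ (cs.simple t * alt cs t s (k + 1)) =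
      .single (cs.simple t) 1 * cel φ (alt cs t s (k + 1)) := by
    intro k hk
    rw [simple_mul_alt_succ, key k hk, ← mul_assoc, MonoidAlgebra.single_mul_single]
    simp [← MonoidAlgebra.one_def]
  refine alt_cases cs H (P := fun x => cel φ (cs.simple t * x) =
    .single (cs.simple t) 1 * cel φ x) ?_ (fun k hk hk' => ?_) (fun k hk hk' => ?_) x
  · simpa using key 0 (by omega)
  · rcases hk'.lt_or_eq with h | rfl
    · rw [simple_mul_alt, key k h]
    · rw [alt_top cs H]
      simpa [Nat.sub_add_cancel hk] using key' (2 * m - 1) (by omega)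
  · simpa [Nat.sub_add_cancel hk] using key' (k - 1) (by omega)

include ht hs in
theorem cel_mul_simple_of_zero (x : W) :
    cel φ (x * cs.simple t) = cel φ x * .single (cs.simple t) 1 := by
  have h := congrArg (invMap W) (cel_simple_mul_of_zero H ht hs x⁻¹)
  rw [invMap_cel, invMap_single_mul, invMap_cel] at h
  simpa using h

variable (ht' : 0 < φ' (cls cs t)) (hs' : φ' (cls cs t) < φ' (cls cs s))

include ht' hs' in
theorem cel_simple_mul_of_lt {x : W} (hx : ¬ cs.IsLeftDescent x t) :
    cel φ' (cs.simple t * x) = (.single (cs.simple t) 1 + 1) * cel φ' x := by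
  revert hx
  refine alt_cases cs H (P := fun x => ¬ cs.IsLeftDescent x t → cel φ' (cs.simple t * x) =
    (.single (cs.simple t) 1 + 1) * cel φ' x) (fun _ => ?_) (fun k hk hk' hx => ?_)
    (fun k hk hk' hx => ?_) x
  · rw [mul_one, cel_simple ht'.le, spec_Cgen_of_ne ht'.ne', cel_one, mul_one]
  · rcases hk'.lt_or_eq with h | rfl
    · rw [simple_mul_alt, ← celAlt_of_pos φ' t s (by omega), ← celAlt_of_pos φ' s t hk,
        ← spec_Cgen_of_ne ht'.ne', gen_mul_celAlt_of_lt H hs' ht'.le hk h]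
    · rw [alt_top cs H] at hx
      exact absurd (isLeftDescent_alt cs H.symm hk le_rfl) hx
  · exact absurd (isLeftDescent_alt cs H.symm hk hk'.le) hx

include ht' hs' in
theorem cel_mul_simple_of_lt {x : W} (hx : ¬ cs.IsRightDescent x t) :
    cel φ' (x * cs.simple t) = cel φ' x * (.single (cs.simple t) 1 + 1) := by
  have hx' : ¬ cs.IsLeftDescent x⁻¹ t := by rwa [cs.isLeftDescent_inv_iff]
  have h := congrArg (invMap W) (cel_simple_mul_of_lt H ht' hs' hx')
  rw [add_mul, one_mul, map_add, invMap_cel, invMap_single_mul, invMap_cel] at h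
  rw [mul_add, mul_one]
  simpa using h

theorem single_mul_celAlt {φ : SBar cs → Γ} (hs : φ (cls cs t) < φ (cls cs s))
    (ht : 0 ≤ φ (cls cs t)) {k : ℕ} (hk : 1 ≤ k) (hk' : k ≤ 2 * m) :
    .single (cs.simple s) 1 * celAlt φ s t k = celAlt φ s t k := by
  have h := congrArg (spec φ) (isEig_C_alt H hs ht hk hk')
  rw [spec_mul, spec_T, map_smulₛₗ, aug_expo, one_smul] at h
  rw [celAlt_of_pos φ s t hk]
  exact h

include ht hs ht' hs' in
-- Advance by two letters at a time. The two recursions differ by replacing t with t + 1 inside (s +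
-- 1)t c_k. As s fixes c_k, this adds 2c_k, which is exactly the specialized `zeta` term missing
-- when φ(t) = 0.
theorem celAlt_odd_of_zero {k : ℕ} (hk : k < 2 * m) (hp : k % 2 = 1) :
    celAlt φ s t k = celAlt φ' s t k := by
  induction k using Nat.strong_induction_on with
  | _ k ih =>
    rcases (by omega : k = 1 ∨ 3 ≤ k) with rfl | h3
    · rw [celAlt_one hs.le, celAlt_one (ht'.trans hs').le, spec_Cgen_of_ne hs.ne',
        spec_Cgen_of_ne (ht'.trans hs').ne']
    · have hts : φ (cls cs t) < φ (cls cs s) := ht ▸ hs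
      obtain ⟨k, rfl⟩ : ∃ j, k = j + 2 := ⟨k - 2, by omega⟩
      have a1 := gen_mul_celAlt_of_gt H hts ht.ge (k := k + 1) (by omega) (by omega)
      have a2 := gen_mul_celAlt_of_gt H hs' ht'.le (k := k + 1) (by omega) (by omega)
      rw [if_pos ht, zero_smul, add_zero, ← gen_mul_celAlt_of_lt H hts ht.ge (k := k) (by omega)
        (by omega), spec_Cgen_of_zero ht, spec_Cgen_of_ne hs.ne',
        ih k (by omega) (by omega) (by omega)] at a1
      have e1 : celAlt φ s t (k + 1 - 3) = celAlt φ' s t (k + 1 - 3) := by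
        rcases (by omega : k = 1 ∨ 3 ≤ k) with rfl | h
        · simp [celAlt_zero]
        · exact ih _ (by omega) (by omega) (by omega)
      have e2 := single_mul_celAlt H hs' ht'.le (k := k) (by omega) (by omega)
      rw [e1] at a1
      rw [if_neg ht'.ne', two_smul, ← gen_mul_celAlt_of_lt H hs' ht'.le (k := k) (by omega)
        (by omega), spec_Cgen_of_ne ht'.ne', spec_Cgen_of_ne (ht'.trans hs').ne',
        add_mul _ _ (celAlt φ' s t k), one_mul, mul_add, a1, add_mul _ _ (celAlt φ' s t k), e2,
        one_mul, Nat.add_sub_cancel] at a2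
      refine sub_eq_zero.1 ?_
      rw [← sub_eq_zero.2 a2]
      abel

include ht hs ht' hs' in
-- The elements without t as a descent on either side are 1 and the words s⋯s of odd length below
-- 2m.
theorem cel_eq_of_not_isDescent {x : W} (h1 : ¬ cs.IsLeftDescent x t)
    (h2 : ¬ cs.IsRightDescent x t) : cel φ x = cel φ' x := by
  revert h1 h2
  refine alt_cases cs H (P := fun x => ¬ cs.IsLeftDescent x t → ¬ cs.IsRightDescent x t →
    cel φ x = cel φ' x) (fun _ _ => ?_) (fun k hk hk' h1 h2 => ?_) (fun k hk hk' h1 _ => ?_) x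
  · rw [cel_one, cel_one]
  · have hk2 : k < 2 * m := by
      refine hk'.lt_of_ne fun h => h1 ?_
      rw [h, alt_top cs H]
      exact isLeftDescent_alt cs H.symm (by omega) le_rfl
    have h3 := (alt_facts' cs H.symm hk hk2).2.2.2.2.2
    rw [← celAlt_of_pos φ s t hk, ← celAlt_of_pos φ' s t hk,
      celAlt_odd_of_zero H ht hs ht' hs' hk2 (by rw [h3] at h2; omega)]
  · exact absurd (isLeftDescent_alt cs H.symm hk hk'.le) h1

end Zero

end KLCell
end

noncomputable section
namespace KLCell
set_option linter.unusedSectionVars false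

/-! ### Comparison of cell modules when one parameter is zero, continued -/

open Hecke

variable {B : Type u} {W : Type v} [Group W] {M : CoxeterMatrix B} {cs : CoxeterSystem M W}
variable {Γ : Type*} [AddCommGroup Γ] [LinearOrder Γ] [IsOrderedAddMonoid Γ]
variable {Γ' : Type*} [AddCommGroup Γ'] [LinearOrder Γ'] [IsOrderedAddMonoid Γ']
variable {s t : B} {m : ℕ} {side : Side} {D : Set W}
variable (H : IsDihedral M s t m)
include H

theorem single_mul_mem_celSpan {φ : SBar cs → Γ} (hside : side ≠ .R) {P : Set W}
    (hP : IsClosedSet φ side P) (w : W) {v : MonoidAlgebra ℤ W} (hv : v ∈ celSpan φ P) :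
    .single w 1 * v ∈ celSpan φ P := by
  have hg : (w, (1 : W)) ∈ sideSub side (⊤ : Subgroup W) := by
    cases side
    · exact Subgroup.mem_prod.2 ⟨trivial, rfl⟩
    · exact absurd rfl hside
    · exact Subgroup.mem_prod.2 ⟨trivial, trivial⟩
  have := regRep_mem_celSpan hP ⟨(w, 1), hg⟩ hv
  rw [regRep_apply] at this
  simpa [← MonoidAlgebra.one_def] using this

theorem alt_top_mul_simple :
    alt cs s t (2 * m) * cs.simple t = alt cs s t (2 * m - 1) := by
  have hm := H.two_le
  rw [← inv_inj, mul_inv_rev, alt_top_inv cs H, cs.inv_simple, alt_pred_top_inv cs (by omega),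
    alt_top cs H]
  obtain ⟨k, hk⟩ : ∃ k, 2 * m = k + 1 := ⟨2 * m - 1, by omega⟩
  rw [hk, simple_mul_alt_succ]; rfl

section Zero

variable {φ : SBar cs → Γ} {φ' : SBar cs → Γ'} (ht : φ (cls cs t) = 0) (hs : 0 < φ (cls cs s))
  (ht' : 0 < φ' (cls cs t)) (hs' : φ' (cls cs t) < φ' (cls cs s))
include ht hs ht' hs'

/-- Removing a t from the left and from the right leads to elements where the two bases agree.
Removing it on the left is harmless, since P is stable under translation by t and both spans are
left submodules. On the right one has to know that the shortened element is still in P, which is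
`hR`. -/
theorem celSpan_eq_of_zero_of_lt (hside : side ≠ .R) {P : Set W} (hP : IsClosedSet φ side P)
    (hP' : IsClosedSet φ' side P)
    (hR : ∀ u ∈ P, cs.IsRightDescent u t → u * cs.simple t ∈ P) :
    celSpan φ P = celSpan φ' P := by
  have hL : ∀ u ∈ P, cs.simple t * u ∈ P := fun u hu => by
    refine hP _ u ?_ hu
    have := cellRel_left_simple_mul_of_zero (φ := φ) H ht u
    cases side
    · exact this.2
    · exact absurd rfl hside
    · exact (cellRel_le_two_sided φ .L this).2
  -- With v = ut the bases satisfy c_u = c_v t and c'_u = c_v(t + 1), so c'_u = c_v + c_u with c_v =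
  -- c'_v.
  have dec : ∀ u ∈ P, ¬ cs.IsLeftDescent u t → cs.IsRightDescent u t →
      u * cs.simple t ∈ P ∧ cel φ (u * cs.simple t) = cel φ' (u * cs.simple t) ∧
      cel φ' u = cel φ (u * cs.simple t) + cel φ u := by
    intro u hu h1 h2
    have e := cel_eq_of_not_isDescent H ht hs ht' hs' (not_isLeftDescent_mul_simple h1 h2)
      (not_isRightDescent_mul_simple h2)
    refine ⟨hR u hu h2, e, ?_⟩
    have e1 := cel_mul_simple_of_lt H ht' hs' (not_isRightDescent_mul_simple h2)
    have e2 := cel_mul_simple_of_zero H ht hs (u * cs.simple t)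
    rw [cs.simple_mul_simple_cancel_right] at e1 e2
    rw [e1, ← e, mul_add, mul_one, ← e2, add_comm]
  have dec' : ∀ x, cs.IsLeftDescent x t → cel φ' x = .single (cs.simple t) 1 *
      cel φ' (cs.simple t * x) + cel φ' (cs.simple t * x) ∧
      cel φ x = .single (cs.simple t) 1 * cel φ (cs.simple t * x) := by
    intro x hx
    have e1 := cel_simple_mul_of_lt H ht' hs' (not_isLeftDescent_simple_mul hx)
    have e2 := cel_simple_mul_of_zero H ht hs (cs.simple t * x)
    rw [cs.simple_mul_simple_cancel_left] at e1 e2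
    exact ⟨by rw [e1, add_mul, one_mul], e2⟩
  have k1 : ∀ u ∈ P, ¬ cs.IsLeftDescent u t → cel φ u ∈ celSpan φ' P ∧ cel φ' u ∈ celSpan φ P := by
    intro u hu h1
    by_cases h2 : cs.IsRightDescent u t
    · obtain ⟨h3, h4, h5⟩ := dec u hu h1 h2
      refine ⟨?_, ?_⟩
      · rw [← sub_eq_of_eq_add' h5, h4]
        exact sub_mem (cel_mem_celSpan φ' hu) (cel_mem_celSpan φ' h3)
      · rw [h5]
        exact add_mem (cel_mem_celSpan φ h3) (cel_mem_celSpan φ hu)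
    · have e := cel_eq_of_not_isDescent H ht hs ht' hs' h1 h2
      refine ⟨?_, ?_⟩
      · rw [e]; exact cel_mem_celSpan φ' hu
      · rw [← e]; exact cel_mem_celSpan φ hu
  have k2 : ∀ x ∈ P, cel φ x ∈ celSpan φ' P ∧ cel φ' x ∈ celSpan φ P := by
    intro x hx
    by_cases h : cs.IsLeftDescent x t
    · obtain ⟨h1, h2⟩ := k1 _ (hL x hx) (not_isLeftDescent_simple_mul h)
      obtain ⟨e1, e2⟩ := dec' x h
      rw [e1, e2]
      exact ⟨single_mul_mem_celSpan H hside hP' _ h1,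
        add_mem (single_mul_mem_celSpan H hside hP _ h2) h2⟩
    · exact k1 x hx h
  exact le_antisymm (celSpan_le_iff.2 fun x hx => (k2 x hx).1)
    (celSpan_le_iff.2 fun x hx => (k2 x hx).2)

omit hs ht' hs' in
-- In the two-sided case closed sets are also stable under right translation by t, so `hR` is
-- automatic.
theorem isComparable_two_sided_of_zero (hs : 0 < φ (cls cs s)) (ht' : 0 < φ' (cls cs t))
    (hs' : φ' (cls cs t) < φ' (cls cs s)) (hD : IsCell φ .LR D)
    (hle : ∀ x y, cellLE φ' .LR x y → cellLE φ .LR x y) : IsComparable φ φ' .LR D := by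
  have hR : ∀ P, IsClosedSet φ .LR P → celSpan φ P = celSpan φ' P := fun P hP =>
    celSpan_eq_of_zero_of_lt H ht hs ht' hs' (by simp) hP (fun x y h => hP x y (hle x y h))
      fun u hu _ => hP _ u (cellRel_le_two_sided φ .R
        (cellRel_right_mul_simple_of_zero (φ := φ) H ht u)).2 hu
  exact isComparable_of_celSpan_eq hD hle (hR _ (isClosedSet_leSet φ _ _))
    (hR _ (isClosedSet_ltSet φ _ _))

/-- Below a left cell of this kind other than {1, t}, the only element ending with t is w₀, and its
translate w₀t = w₁ is also below. Below {1, t} lies the whole group. Hence `hR` holds and the spans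
coincide. -/
theorem isComparable_left_of_zero {a : W} (ha : ¬ (IsCore cs s t m a ∧ cs.IsRightDescent a t))
    (hle : ∀ x y, cellLE φ' .L x y → cellLE φ .L x y) :
    IsComparable φ φ' .L {x | cellRel φ .L x a} := by
  have hm := H.two_le
  have hne := special_ne cs H
  have hrel := cellLE_iff_relZ_abs (φ := φ) H ht hs.ne' .L
  have htop := alt_top_mul_simple (cs := cs) H
  have hfac := (alt_facts cs H (j := 2 * m - 1) (by omega) (by omega))
  have h1 : ∀ u, cellLE φ .L u a → cs.IsRightDescent u t → (a = 1 ∨ a = cs.simple t) ∨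
      cellLE φ .L (u * cs.simple t) u := by
    intro u hu hut
    by_cases h0 : u = alt cs s t (2 * m)
    · right
      rw [hrel, h0, htop]
      exact .inr (.inl (.inr rfl))
    by_cases h2 : u = 1
    · rw [h2] at hut
      simp [CoxeterSystem.IsRightDescent] at hut
    have hus := (descent_iff H u h2 h0).2.1 hut
    rcases (hrel u a).1 hu with h | (h | h) | ⟨h3, h4, h5⟩
    · exact .inl h
    · exact absurd h h0
    · rw [h] at hus
      exact absurd (hfac.2.2.2.2.2.2 (by omega)) hus
    · by_cases ha1 : a = 1 ∨ a = cs.simple t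
      · exact .inl ha1
      · rw [not_or] at ha1
        have hac : IsCore cs s t m a := ⟨ha1.1, ha1.2, h4.1, h4.2⟩
        have h6 := (descent_iff H a ha1.1 h4.1).2
        have h7 : ¬ cs.IsRightDescent a s := fun h => hus (h5.2 h)
        exact absurd ⟨hac, h6.2 h7⟩ ha
  have hcl : IsCell φ .L {x | cellRel φ .L x a} := isCell_class φ .L a
  have hspan : ∀ P, IsClosedSet φ .L P → (∀ u ∈ P, cellLE φ .L u a) →
      ((a = 1 ∨ a = cs.simple t) → ∀ u ∈ P, cs.IsRightDescent u t → u * cs.simple t ∈ P) →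
      celSpan φ P = celSpan φ' P := fun P hP hPa hP1 => by
    refine celSpan_eq_of_zero_of_lt H ht hs ht' hs' (by simp) hP
      (fun x y h => hP x y (hle x y h)) fun u hu hut => ?_
    rcases h1 u (hPa u hu) hut with h | h
    · exact hP1 h u hu hut
    · exact hP _ u h hu
  have hall : (a = 1 ∨ a = cs.simple t) → ∀ x, cellLE φ .L x a := fun h x => (hrel x a).2 (.inl h)
  refine isComparable_of_celSpan_eq hcl hle (hspan _ (isClosedSet_leSet φ _ _) ?_ ?_)
    (hspan _ (isClosedSet_ltSet φ _ _) ?_ ?_)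
  · rintro u ⟨c, hc, huc⟩
    exact huc.trans hc.1
  · exact fun h u _ _ => ⟨a, (cellRel φ .L).refl a, hall h _⟩
  · rintro u ⟨c, hc, huc, -⟩
    exact huc.trans hc.1
  -- Were a below ut, then ut would be 1 or t, and so would u, contradicting that u is strictly
  -- below the cell.
  · rintro h u ⟨c, hc, huc, hcu⟩ hut
    refine ⟨a, (cellRel φ .L).refl a, hall h _, fun h' => hcu (hc.1.trans ?_)⟩
    refine (hrel _ _).2 ?_
    rcases (hrel _ _).1 h' with h' | h' | h'
    · refine .inl ?_
      rcases h' with h' | h'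
      · right
        rw [mul_eq_one_iff_eq_inv, cs.inv_simple] at h'
        exact h'
      · left
        simpa using h'
    · rcases h with rfl | rfl <;> rcases h' with h' | h' <;> simp_all
    · tauto

/-- The exceptional left cell D: the core elements ending with t. For φ both w₀ and w₁ lie below D,
whereas for φ' the set D ∪ {w₀} is closed without w₁, so the identity cannot compare the spans.
Right multiplication by 1 + t commutes with the left action. It sends c_x to c'_x up to a triangular
change, for x in D, and both c_{w₀} and c_{w₁} to c'_{w₀}. -/
theorem isComparable_left_of_zero_of_isCore {a : W} (ha : IsCore cs s t m a)
    (hat : cs.IsRightDescent a t) : IsComparable φ φ' .L {x | cellRel φ .L x a} := by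
  have := finite_of_isDihedral cs H
  have hm := H.two_le
  have hne := special_ne cs H
  have hrel := cellLE_iff_relZ_abs (φ := φ) H ht hs.ne' .L
  have hrel' : ∀ x y, cellLE φ' .L x y ↔ RelA cs s t m .L x y :=
    cellLE_iff_relA H ht' hs' .L
  have htop := alt_top_mul_simple (cs := cs) H
  have hw1 := (alt_facts cs H (j := 2 * m - 1) (by omega) (by omega))
  have hw1s : cs.IsRightDescent (alt cs s t (2 * m - 1)) s := hw1.2.2.2.2.2.2 (by omega)
  set D := {x | cellRel φ .L x a} with hD
  set w0 := alt cs s t (2 * m) with hw0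
  set w1 := alt cs s t (2 * m - 1) with hw1'
  have hdes := fun x (hx : IsCore cs s t m x) => (descent_iff H x hx.1 hx.2.2.1).2
  have hDiff : ∀ x, x ∈ D ↔ IsCore cs s t m x ∧ cs.IsRightDescent x t := by
    intro x
    have e := cellRel_iff_of_zero (φ := φ) H ht hs.ne' .L x a
    have h2 := hdes a ha
    refine e.trans ⟨?_, ?_⟩
    · rintro (h | h | ⟨h1, -, h3⟩)
      · exact absurd h.2 (by rintro (h | h); exacts [ha.1 h, ha.2.1 h])
      · exact absurd h.2 (by rintro (h | h); exacts [ha.2.2.1 h, ha.2.2.2 h])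
      · exact ⟨h1, (hdes x h1).2 fun h => h2.1 hat (h3.1 h)⟩
    · rintro ⟨h1, h3⟩
      exact .inr (.inr ⟨h1, ha, iff_of_false ((hdes x h1).1 h3) (h2.1 hat)⟩)
  have hle : leSet φ .L D = D ∪ {w0, w1} := by
    ext x
    constructor
    · rintro ⟨c, hc, hxc⟩
      have hxa := hxc.trans hc.1
      rcases (hrel x a).1 hxa with (h | h) | (h | h) | ⟨h1, h2, h3⟩
      · exact absurd h ha.1
      · exact absurd h ha.2.1
      · exact .inr (.inl h)
      · exact .inr (.inr h)
      · by_cases h4 : x = w0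
        · exact .inr (.inl h4)
        by_cases h5 : x = w1
        · exact .inr (.inr h5)
        exact .inl ⟨hxa, (hrel a x).2 (.inr (.inr ⟨⟨ha.1, ha.2.1⟩, ⟨h4, h5⟩, h3.symm⟩))⟩
    · rintro (h | h)
      · exact ⟨x, h, ((cellRel φ .L).refl x).1⟩
      · exact ⟨a, (cellRel φ .L).refl a, (hrel x a).2 (.inr (.inl h))⟩
  have hcl : IsCell φ .L D := isCell_class φ .L a
  have hw0D : w0 ∉ D := fun h => ((hDiff _).1 h).1.2.2.1 rfl
  have hw1D : w1 ∉ D := fun h => ((hDiff _).1 h).1.2.2.2 rfl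
  have hlt : ltSet φ .L D = {w0, w1} := by
    obtain ⟨e1, e2⟩ := leSet_eq_union hcl
    ext x
    constructor
    · intro hx
      have : x ∈ leSet φ .L D := by rw [e1]; exact .inl hx
      rw [hle] at this
      exact this.resolve_left (Set.disjoint_left.1 e2 hx)
    · intro hx
      have : x ∈ leSet φ .L D := by rw [hle]; exact .inr hx
      rw [e1] at this
      refine this.resolve_right ?_
      rcases hx with rfl | rfl
      exacts [hw0D, hw1D]
  have hw1t : w1 * cs.simple t = w0 := by rw [← htop, cs.simple_mul_simple_cancel_right]
  have hw0t : cs.IsRightDescent w0 t := by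
    rw [CoxeterSystem.IsRightDescent, htop, hw0, hw1', length_alt cs H le_rfl,
      length_alt cs H (by omega)]
    omega
  have hw0L : cs.IsLeftDescent w0 t := by
    rw [hw0, alt_top cs H]
    exact isLeftDescent_alt cs H.symm (by omega) le_rfl
  -- Here c_x(1 + t) = c_{xt}(1 + t), and c_{xt} = c'_{xt} because xt has no descent t on either
  -- side; the product is then c'_x.
  have e1 : ∀ x, cs.IsRightDescent x t → ¬ cs.IsLeftDescent (x * cs.simple t) t →
      cel φ x * (.single (cs.simple t) 1 + 1) = cel φ' x := by
    intro x h1 h2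
    have h3 := not_isRightDescent_mul_simple h1
    have h4 := cel_eq_of_not_isDescent H ht hs ht' hs' h2 h3
    have h5 := cel_mul_simple_of_zero H ht hs (x * cs.simple t)
    have h6 := cel_mul_simple_of_lt H ht' hs' h3
    rw [cs.simple_mul_simple_cancel_right] at h5 h6
    rw [h6, h5, ← h4, mul_assoc, mul_add, MonoidAlgebra.single_mul_single,
      cs.simple_mul_simple_self, mul_one, mul_one, ← MonoidAlgebra.one_def, add_comm]
  have hw1L : ¬ cs.IsLeftDescent w1 t := fun h =>
    ((descent_iff H w1 hw1.1 hne.2.2.2.2.2.symm).1.1 h) hw1.2.2.2.2.1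
  have f0 : cel φ w0 * (.single (cs.simple t) 1 + 1) = cel φ' w0 := e1 w0 hw0t (by rwa [htop])
  have f1 : cel φ w1 * (.single (cs.simple t) 1 + 1) = cel φ' w0 := by
    have h1 := cel_mul_simple_of_zero H ht hs w1
    have h2 := cel_mul_simple_of_zero H ht hs w0
    rw [hw1t] at h1
    rw [htop] at h2
    rw [← f0, mul_add, mul_add, ← h1, ← h2, mul_one, mul_one, add_comm]
  have f2 : ∀ x ∈ D, ¬ cs.IsLeftDescent x t →
      cel φ x * (.single (cs.simple t) 1 + 1) = cel φ' x := fun x hx h =>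
    e1 x ((hDiff x).1 hx).2 (not_isLeftDescent_mul_simple h ((hDiff x).1 hx).2)
  -- For x starting with t, c_x = t c_{tx}, so the image is t c'_{tx} = c'_x - c'_{tx}: still in the
  -- span, and triangular.
  have f3 : ∀ x ∈ D, cs.IsLeftDescent x t → cs.simple t * x ∈ D ∧
      cel φ x * (.single (cs.simple t) 1 + 1) = cel φ' x - cel φ' (cs.simple t * x) := by
    intro x hx h
    have h1 := not_isLeftDescent_simple_mul h
    have h2 : cs.simple t * x ∈ D := (cellRel φ .L).trans ((cellRel φ .L).symm
      (cellRel_left_simple_mul_of_zero (φ := φ) H ht x)) hx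
    have h3 := cel_simple_mul_of_zero H ht hs (cs.simple t * x)
    have h4 := cel_simple_mul_of_lt H ht' hs' h1
    rw [cs.simple_mul_simple_cancel_left] at h3 h4
    refine ⟨h2, ?_⟩
    rw [h3, mul_assoc, f2 _ h2 h1, h4, add_mul, one_mul, add_sub_cancel_right]
  let ψ : MonoidAlgebra ℤ W →ₗ[ℤ] MonoidAlgebra ℤ W :=
    LinearMap.mulRight ℤ (.single (cs.simple t) 1 + 1)
  have hψlt : ∀ v ∈ celSpan φ {w0, w1}, ψ v ∈ celSpan φ' {w0} := by
    intro v hv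
    have : celSpan φ {w0, w1} ≤ (celSpan φ' {w0}).comap ψ := celSpan_le_iff.2 fun x hx => by
      change cel φ x * (MonoidAlgebra.single (cs.simple t) 1 + 1) ∈ celSpan φ' {w0}
      rcases hx with rfl | rfl
      · rw [f0]; exact cel_mem_celSpan φ' rfl
      · rw [f1]; exact cel_mem_celSpan φ' rfl
    exact this hv
  refine ⟨{w0} ∪ D, {w0}, ψ, ?_, ?_, rfl, Set.disjoint_singleton_left.2 hw0D, ?_, ?_, ?_, ?_⟩
  · rintro x y hxy hy
    rcases (hrel' x y).1 hxy with h | h | ⟨h1, h2, h3, h4⟩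
    · rw [h] at hy
      rcases hy with hy | hy
      · exact absurd hy hne.1
      · exact absurd rfl ((hDiff _).1 hy).1.1
    · exact .inl h
    · have hyD := hy.resolve_left h2
      obtain ⟨hyc, hyt⟩ := (hDiff y).1 hyD
      have hys := (hdes y hyc).1 hyt
      have hxs : ¬ cs.IsRightDescent x s := fun h => hys (h3.1 h)
      rcases h4 with h4 | h4 | ⟨h4, -⟩
      · exact absurd h4 hyc.2.1
      · rw [h4] at hxs
        exact absurd hw1s hxs
      · by_cases h5 : x = w0
        · exact .inl h5
        · have hxc : IsCore cs s t m x := ⟨h1, h4, h5, fun h => hxs (by rw [h]; exact hw1s)⟩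
          exact .inr ((hDiff x).2 ⟨hxc, (hdes x hxc).2 hxs⟩)
  · rintro x y hxy rfl
    rcases (hrel' x _).1 hxy with h | h | ⟨-, h, -⟩
    · exact absurd h.symm hne.1
    · exact h
    · exact absurd rfl h
  · intro g v
    have hg : g.1.2 = 1 := sideSub_snd rfl g.2
    change regRep W .L g v * _ = regRep W .L g (v * _)
    simp [regRep_apply, hg, ← MonoidAlgebra.one_def, mul_assoc]
  · intro v hv
    have : celSpan φ (leSet φ .L D) ≤ (celSpan φ' ({w0} ∪ D)).comap ψ := celSpan_le_iff.2 fun x hx => by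
      rw [hle] at hx
      rcases hx with hx | hx
      · change cel φ x * (MonoidAlgebra.single (cs.simple t) 1 + 1) ∈ celSpan φ' ({w0} ∪ D)
        by_cases h : cs.IsLeftDescent x t
        · obtain ⟨h1, h2⟩ := f3 x hx h
          rw [h2]
          exact sub_mem (cel_mem_celSpan φ' (.inr hx)) (cel_mem_celSpan φ' (.inr h1))
        · rw [f2 x hx h]
          exact cel_mem_celSpan φ' (.inr hx)
      · exact celSpan_mono φ' Set.subset_union_left (hψlt _ (cel_mem_celSpan φ hx))
    exact this hv
  · intro v hv
    rw [hlt]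
    -- If the image is n c'_{w₀}, subtracting n c_{w₁} leaves u with u(1 + t) = 0. Then u = -ut, so
    -- the support of u is stable under right translation by t.
    refine ⟨fun h => ?_, hψlt v⟩
    rw [celSpan, Set.image_singleton] at h
    obtain ⟨n, hn⟩ := Submodule.mem_span_singleton.1 h
    have hw1m : cel φ w1 ∈ celSpan φ {w0, w1} := cel_mem_celSpan φ (.inr rfl)
    have hu : v - n • cel φ w1 ∈ celSpan φ (leSet φ .L D) := by
      refine sub_mem hv (Submodule.smul_mem _ _ (celSpan_mono φ ?_ hw1m))
      rw [hle]; exact Set.subset_union_right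
    set u := v - n • cel φ w1 with hudef
    have h0 : u * (.single (cs.simple t) 1 + 1) = 0 := by
      rw [hudef, sub_mul, smul_mul_assoc, f1, hn]
      exact sub_self _
    have h1 : u = -(u * .single (cs.simple t) 1) := by
      rw [mul_add, mul_one] at h0
      exact eq_neg_of_add_eq_zero_right h0
    have h2 : celSpan φ (leSet φ .L D) ≤
        (celSpan φ {x | x * cs.simple t ∈ leSet φ .L D}).comap
          (LinearMap.mulRight ℤ (.single (cs.simple t) 1)) := celSpan_le_iff.2 fun x hx => by
      change cel φ x * MonoidAlgebra.single (cs.simple t) 1 ∈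
        celSpan φ {x | x * cs.simple t ∈ leSet φ .L D}
      rw [← cel_mul_simple_of_zero H ht hs]
      refine cel_mem_celSpan φ ?_
      change x * cs.simple t * cs.simple t ∈ leSet φ .L D
      rwa [cs.simple_mul_simple_cancel_right]
    have h3 : u ∈ celSpan φ {x | x * cs.simple t ∈ leSet φ .L D} := by
      rw [h1]
      exact neg_mem (h2 hu)
    have h4 := celSpan_mono φ (Q := {w0, w1}) ?_ (mem_celSpan_inter φ hu h3)
    · have : v = u + n • cel φ w1 := by rw [hudef, sub_add_cancel]
      rw [this]
      exact add_mem h4 (Submodule.smul_mem _ _ hw1m)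
    -- For x in D the element xt does not end with t, hence is not in D; nor is it w₀ or w₁, since x
    -- would be the other of the two. So u is supported on {w₀, w₁}.
    · rintro x ⟨hx, hxt⟩
      have hxt : x * cs.simple t ∈ leSet φ .L D := hxt
      rw [hle] at hx hxt
      refine hx.resolve_left fun hxD => ?_
      have hxr := ((hDiff x).1 hxD).2
      rcases hxt with h | h | h
      · exact not_isRightDescent_mul_simple hxr ((hDiff _).1 h).2
      · rw [← hw1t] at h
        exact hw1D (mul_right_cancel h ▸ hxD)
      · have h : x * cs.simple t = w1 := h
        rw [← htop] at h
        exact hw0D (mul_right_cancel h ▸ hxD)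
  · refine celSpan_le_iff.2 fun x hx => ?_
    rcases hx with hx | hx
    · exact Submodule.mem_sup_right (cel_mem_celSpan φ' hx)
    · refine Submodule.mem_sup_left ?_
      have hsub : ∀ y ∈ D, cel φ y ∈ celSpan φ (leSet φ .L D) := fun y hy =>
        cel_mem_celSpan φ (by rw [hle]; exact .inl hy)
      by_cases h : cs.IsLeftDescent x t
      · obtain ⟨h1, h2⟩ := f3 x hx h
        -- Adding c_{tx} cancels the error term -c'_{tx} in the image of c_x.
        refine ⟨cel φ x + cel φ (cs.simple t * x), add_mem (hsub _ hx) (hsub _ h1), ?_⟩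
        change (cel φ x + cel φ (cs.simple t * x)) * (MonoidAlgebra.single (cs.simple t) 1 + 1) = _
        rw [add_mul, h2, f2 _ h1 (not_isLeftDescent_simple_mul h), sub_add_cancel]
      · exact ⟨cel φ x, hsub x hx, f2 x hx h⟩

end Zero

end KLCell
end

noncomputable section
namespace KLCell
set_option linter.unusedSectionVars false

/-! ### Conjecture B for dihedral groups -/

open PosSubset

variable {B : Type u} {W : Type v} [Group W] {M : CoxeterMatrix B} {cs : CoxeterSystem M W}
variable {Γ : Type*} [AddCommGroup Γ] [LinearOrder Γ] [IsOrderedAddMonoid Γ]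
variable {Γ' : Type*} [AddCommGroup Γ'] [LinearOrder Γ'] [IsOrderedAddMonoid Γ']
variable {s t : B} {m : ℕ} {side : Side} {D : Set W}
variable (H : IsDihedral M s t m)
include H

theorem isComparable_of_nonneg {φ : SBar cs → Γ} {φ' : SBar cs → Γ'} (ht : 0 ≤ φ (cls cs t))
    (hs : φ (cls cs t) ≤ φ (cls cs s)) (ht' : 0 < φ' (cls cs t))
    (hs' : φ' (cls cs t) < φ' (cls cs s)) (hD : IsCell φ side D)
    (hle : ∀ side x y, cellLE φ' side x y → cellLE φ side x y) : IsComparable φ φ' side D := by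
  have := finite_of_isDihedral cs H
  rcases ht.eq_or_lt with ht0 | ht0
  · rcases (ht.trans hs).eq_or_lt with hs0 | hs0
    · exact isComparable_of_zero_of_zero H hD hs0.symm ht0.symm
    · have left : ∀ a, IsComparable φ φ' .L {x | cellRel φ .L x a} := fun a => by
        by_cases ha : IsCore cs s t m a ∧ cs.IsRightDescent a t
        · exact isComparable_left_of_zero_of_isCore H ht0.symm hs0 ht' hs' ha.1 ha.2
        · exact isComparable_left_of_zero H ht0.symm hs0 ht' hs' ha (hle .L)
      cases side
      · obtain ⟨a, rfl⟩ := hD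
        exact left a
      · obtain ⟨a, rfl⟩ := hD
        -- Right cells reduce to left cells, since inversion carries the right cell of a to the left
        -- cell of its inverse.
        refine IsComparable.flip ?_
        convert left a⁻¹ using 1
        ext x
        refine (and_congr (cellLE_right_iff φ _ _) (cellLE_right_iff φ _ _)).trans ?_
        simp only [Equiv.inv_apply, inv_inv]
        exact Iff.rfl
      · exact isComparable_two_sided_of_zero H ht0.symm hs0 ht' hs' hD (hle .LR)
  · rcases hs.eq_or_lt with hs0 | hs0
    · have key := fun P hP => celSpan_eq_of_eq_of_lt (side := side) (P := P) H (ht0.trans_le hs)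
        hs0.symm ht' hs' hP
      exact isComparable_of_celSpan_eq hD (hle side) (key _ (isClosedSet_leSet φ _ _))
        (key _ (isClosedSet_ltSet φ _ _))
    · exact isComparable_of_cel_eq hD (hle side) (cel_eq_of_lt H ht0 hs0 ht' hs')

omit H in
-- The sign is taken from b. It also corrects a when a ≠ 0, by hypothesis, and is irrelevant when a
-- = 0, so one character makes the parameters of both X and Y non-negative.
theorem abs_eq_sign_smul (a : Γ) (b : Γ') (h : SignType.sign a ≠ 0 → SignType.sign a = SignType.sign b) :
    |a| = (((if 0 ≤ b then 1 else -1 : ℤˣ)) : ℤ) • a := by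
  rcases lt_trichotomy a 0 with ha | ha | ha
  · have hb : b < 0 := by
      rw [sign_neg ha] at h
      exact sign_eq_neg_one_iff.1 (h (by decide)).symm
    rw [if_neg (not_le.2 hb), abs_of_neg ha]; simp
  · simp [ha]
  · have hb : 0 < b := by
      rw [sign_pos ha] at h
      exact sign_eq_one_iff.1 (h (by decide)).symm
    rw [if_pos hb.le, abs_of_pos ha]; simp

theorem isComparable_of_abs_lt {φ : SBar cs → Γ} {φ' : SBar cs → Γ'}
    (hsgn : ∀ i, SignType.sign (φ (cls cs i)) ≠ 0 →
      SignType.sign (φ (cls cs i)) = SignType.sign (φ' (cls cs i)))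
    (hφ : |φ (cls cs t)| ≤ |φ (cls cs s)|) (ht' : φ' (cls cs t) ≠ 0)
    (hs' : |φ' (cls cs t)| < |φ' (cls cs s)|)
    (hle : ∀ side x y, cellLE φ' side x y → cellLE φ side x y)
    (hD : IsCell φ side D) : IsComparable φ φ' side D := by
  classical
  have := finite_of_isDihedral cs H
  obtain ⟨ε, hε⟩ := exists_sign cs H (fun i => if 0 ≤ φ' (cls cs i) then 1 else -1)
  refine IsComparable.of_twist (φ₁ := fun ω => |φ ω|) (φ₁' := fun ω => |φ' ω|) (ε := ε)
    (fun i => ?_) (fun i => ?_) ?_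
  · rw [hε]; exact abs_eq_sign_smul _ _ (hsgn i)
  · rw [hε]; exact abs_eq_sign_smul _ _ fun _ => rfl
  refine isComparable_of_nonneg H (abs_nonneg _) hφ (abs_pos.2 ht') hs' ?_ fun side x y hxy => ?_
  · obtain ⟨a, rfl⟩ := hD
    refine ⟨a, ?_⟩
    ext x
    exact and_congr (cellLE_abs H φ side x a).symm (cellLE_abs H φ side a x).symm
  · rw [cellLE_abs H] at hxy ⊢
    exact hle side x y hxy

/-- In a chamber one of the two absolute values is strictly larger. The symmetry of s and t reduces
to the case where it is that of s, and X, in the closure, satisfies the corresponding weak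
inequality. -/
theorem conjectureB : ConjectureB cs := by
  have := finite_of_isDihedral cs H
  refine ⟨fourHyp cs s t, isEssential_fourHyp H, ?_⟩
  intro side X D hD K hK hX Y hYK
  obtain ⟨Z, hZ, rfl⟩ := (isChamber_fourHyp_iff H).1 hK
  have hYK : SameSigns s t Z Y := hYK
  have hXZ := specializes_of_mem_closure hX
  have hY : IsGeneric s t Y := by
    obtain ⟨h1, h2, h3, h4⟩ := hYK
    unfold IsGeneric
    rw [← h1, ← h2, ← h3, ← h4]
    exact hZ
  have hXY : SpecializesTo s t X Y := by
    obtain ⟨h1, h2, h3, h4⟩ := hYK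
    unfold SpecializesTo
    rw [← h1, ← h2, ← h3, ← h4]
    exact hXZ
  have hle := fun side x y => cellLE_of_specializesTo H hY hXY (side := side) (x := x) (y := y)
  refine exists_filtration hD (hle side) ?_
  have hsgn : ∀ i, SignType.sign (phi X (cls cs i)) ≠ 0 →
      SignType.sign (phi X (cls cs i)) = SignType.sign (phi Y (cls cs i)) := fun i => by
    rcases H.all i with rfl | rfl
    exacts [hXY.1, hXY.2.1]
  rcases hY.cases with h | h
  · exact isComparable_of_abs_lt H hsgn (hXY.le_of_lt h) hY.phi_ne.2 h hle hD
  · exact isComparable_of_abs_lt H.symm hsgn (hXY.le_of_lt' h) hY.phi_ne.1 h hle hD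

end KLCell
end

theorem mainTheorem1 {B : Type u} {W : Type v} [Group W] {M : CoxeterMatrix B}
    (cs : CoxeterSystem M W) (s t : B) (hst : s ≠ t) (hB : ∀ i : B, i = s ∨ i = t)
    (m : ℕ) (hm : 2 ≤ m) (hM : M s t = 2 * m) :
    ConjectureA cs ∧
    IsEssential cs {hyp (bas (cls cs s)), hyp (bas (cls cs t)),
      hyp (bas (cls cs s) - bas (cls cs t)), hyp (bas (cls cs s) + bas (cls cs t))} ∧
    ConjectureB cs ∧
    ConjectureA''.{u, v, w} cs (cls cs s) (cls cs t) 1 (fun _ => 1) := by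
  have H : IsDihedral M s t m := ⟨hst, hB, hm, hM⟩
  exact ⟨⟨_, fourHyp_mem_arrangementsA H⟩, isEssential_fourHyp H, conjectureB H, conjectureA'' H⟩
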